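/- Let $T>0$, $0<k<1$, $\sigma>0$, $\alpha_k(t)=1+kt$, $\beta_k(y,t)=\frac{1-k^2y^2}{\alpha_k(t)}$, $\gamma_k(y)=-2ky$, $\Omega=(0,1)$, $Q=\Omega\times(0,T)$, and let $$Lv=-\Big[\frac{\beta_k}{\alpha_k}v_y\Big]_y+\frac{\gamma_k}{\alpha_k}v'_y ,\qquad {}'=\partial_t,$$ with formal adjoint $L^*$. Put $\Sigma_0=\{0\}\times(0,T)$, $\Sigma=\Sigma_0\cup(\{1\}\times(0,T))$, and let $\Sigma_0=\Sigma_1\cup\Sigma_2$ with $\Sigma_1,\Sigma_2$ measurable (for instance disjoint; on $\Sigma_1\cap\Sigma_2$ the boundary value below is understood as the sum of the two prescribed values). Let $v_2\in L^2(Q)$ be given. For $f\in L^2(Q)$, a solution of $p''+L^*p=f$ in $Q$, $p=0$ on $\Sigma$, $p(T)=p'(T)=0$ is a function $p\in C([0,T];H^1_0(\Omega))\cap C^1([0,T];L^2(\Omega))$ with these final data which satisfies the equation in the sense of distributions; $p_y(0,\cdot)$ denotes the limit of $p(h,\cdot)/h$ in $L^2(0,T)$ as $h\to0^+$, and $\frac{\partial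 p}{\partial\nu}=-p_y$ is the exterior normal derivative on $\Sigma_0$. For $w_1\in L^2(\Sigma_1)$, $w_2\in L^2(\Sigma_2)$, let $v=v(w_1,w_2)$ be the solution of $$v''+Lv=0\ \text{in }Q,\quad v=w_1\ \text{on }\Sigma_1,\quad v=w_2\ \text{on }\Sigma_2,\quad v=0\ \text{on }\Sigma\setminus\Sigma_0,\quad v(0)=v'(0)=0$$ in the sense of transposition: $v\in C([0,T];L^2(\Omega))\cap C^1([0,T];H^{-1}(\Omega))$ has these initial data and, with $w$ denoting the boundary value on $\Sigma_0$, $\iint_Q v f\,dy\,dt=\int_0^T\alpha_k(t)^{-2}\,\theta_y(0,t)\,w(t)\,dt$ for every $f\in L^2(Q)$, where $\theta''+L^*\theta=f$ in $Q$, $\theta=0$ on $\Sigma$, $\theta(T)=\theta'(T)=0$. This solution exists and is unique, so that $$J_2(w_1,w_2)=\frac12\int_0^T\!\!\int_\Omega\alpha_k(t)\,[v(w_1,w_2)-v_2]^2\,dy\,dt+\frac\sigma2\int_{\Sigma_2}w_2^2\,d\Sigma$$ is well defined. **Theorem.** For each $w_1\in L^2(\Sigma_1)$ there exists a unique Nash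 equilibrium $w_2\in L^2(\Sigma_2)$, that is, a unique $w_2$ with $J_2(w_1,w_2)=\inf_{\widehat w_2\in L^2(\Sigma_2)}J_2(w_1,\widehat w_2)$. Moreover, $$w_2=\frac{1}{\sigma\alpha_k^2(t)}\,\frac{\partial p}{\partial\nu}=-\frac{1}{\sigma\alpha_k^2(t)}\,p_y\quad\text{on }\Sigma_2,$$ where $\{v,p\}$ is the unique solution of the optimality system $$v''+Lv=0\ \text{in }Q,\qquad p''+L^*p=\alpha_k(t)(v-v_2)\ \text{in }Q,$$ $$v=w_1\ \text{on }\Sigma_1,\quad v=\frac{1}{\sigma\alpha_k^2(t)}\,\frac{\partial p}{\partial\nu}\ \text{on }\Sigma_2,\quad v=0\ \text{on }\Sigma\setminus\Sigma_0,$$ $$p=0\ \text{on }\Sigma,\quad v(0)=v'(0)=0,\quad p(T)=p'(T)=0\ \text{in }\Omega .$$ -/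

import Mathlib

open MeasureTheory Set Filter Topology
open scoped ContDiff

noncomputable section

namespace WaveCylinder

/-! ### Function spaces on `Ω = (0,1)` -/

/-- `L²(Ω)`, `Ω = (0,1)`. -/
abbrev L2 : Type := Lp ℝ 2 (volume.restrict (Ioo (0 : ℝ) 1))

/-- The pairs `(φ, φ_y)`, `φ ∈ C_c^∞(Ω)`, in `L²(Ω) × L²(Ω)`. -/
def testPairs : Set (L2 × L2) :=
  {z | ∃ φ : ℝ → ℝ, ContDiff ℝ ∞ φ ∧ HasCompactSupport φ ∧ tsupport φ ⊆ Ioo 0 1 ∧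
    z.1 =ᵐ[volume.restrict (Ioo (0 : ℝ) 1)] φ ∧
    z.2 =ᵐ[volume.restrict (Ioo (0 : ℝ) 1)] deriv φ}

/-- `H¹₀(Ω)`, the closure of `C_c^∞(Ω)` in the `H¹` norm. An element is stored as the pair
(function, weak derivative), with the norm `max ‖f‖ ‖f_y‖`, equivalent to the usual `H¹` norm. -/
def H10Submodule : Submodule ℝ (L2 × L2) :=
  (Submodule.span ℝ testPairs).topologicalClosure

/-- `H¹₀(Ω)`. -/
abbrev H10 : Type := H10Submodule

/-- The inclusion `H¹₀(Ω) → L²(Ω)`. -/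
def toL2 : H10 →L[ℝ] L2 :=
  (ContinuousLinearMap.fst ℝ L2 L2).comp H10Submodule.subtypeL

/-- The derivative `∂_y : H¹₀(Ω) → L²(Ω)`. -/
def dy : H10 →L[ℝ] L2 :=
  (ContinuousLinearMap.snd ℝ L2 L2).comp H10Submodule.subtypeL

/-- `H⁻¹(Ω)`, the dual of `H¹₀(Ω)`. -/
abbrev Hneg1 : Type := StrongDual ℝ H10

/-- The embedding `L²(Ω) → H⁻¹(Ω)`, `f ↦ (φ ↦ ∫_Ω f φ)`. -/
def toHneg1 (f : L2) : Hneg1 := (innerSL ℝ f).comp toL2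

/-! ### The operator `L` -/

/-- `α_k(t) = 1 + k t`. -/
def alpha (k t : ℝ) : ℝ := 1 + k * t

/-- `β_k(y,t) = (1 - k² y²) / α_k(t)`. -/
def beta (k y t : ℝ) : ℝ := (1 - k ^ 2 * y ^ 2) / alpha k t

/-- `γ_k(y) = -2 k y`. -/
def gamma (k y : ℝ) : ℝ := -2 * k * y

/-- `Lφ = -[(β_k/α_k) φ_y]_y + (γ_k/α_k) (φ')_y`, where `'` is the derivative in `t`. -/
def opL (k : ℝ) (φ : ℝ → ℝ → ℝ) (y t : ℝ) : ℝ :=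
  - deriv (fun x => beta k x t / alpha k t * deriv (fun z => φ z t) x) y
    + gamma k y / alpha k t * deriv (fun x => deriv (fun s => φ x s) t) y

/-- `φ'' + Lφ`. -/
def waveOp (k : ℝ) (φ : ℝ → ℝ → ℝ) (y t : ℝ) : ℝ :=
  deriv (fun s => deriv (fun r => φ y r) s) t + opL k φ y t

/-! ### The adjoint problem -/

/-- `p` is the finite energy solution of
`p'' + L* p = f` in `Q = Ω × (0,T)`, `p = 0` on `Σ`, `p(T) = p'(T) = 0`:
`p ∈ C([0,T]; H¹₀(Ω)) ∩ C¹([0,T]; L²(Ω))`, and the equation holds in the sense of distributions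
on `Q`, that is, `∫∫_Q p (φ'' + Lφ) = ∫∫_Q f φ` for all `φ ∈ C_c^∞(Q)`
(`L*` is the formal adjoint of `L`). -/
structure IsAdjointSolution (T k : ℝ) (f : ℝ → ℝ → ℝ) (p : ℝ → H10) : Prop where
  continuousOn : ContinuousOn p (Icc 0 T)
  final : p T = 0
  final_deriv : ∃ p' : ℝ → L2, ContinuousOn p' (Icc 0 T) ∧ p' T = 0 ∧
    ∀ t ∈ Icc 0 T, HasDerivWithinAt (fun s => toL2 (p s)) (p' t) (Icc 0 T) t
  equation : ∀ φ : ℝ → ℝ → ℝ, ContDiff ℝ ∞ (Function.uncurry φ) →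
    HasCompactSupport (Function.uncurry φ) →
    tsupport (Function.uncurry φ) ⊆ Ioo 0 1 ×ˢ Ioo 0 T →
    ∫ t in Ioo 0 T, ∫ y in Ioo (0 : ℝ) 1, toL2 (p t) y * waveOp k φ y t =
      ∫ t in Ioo 0 T, ∫ y in Ioo (0 : ℝ) 1, f y t * φ y t

/-- `g = p_y(0,·)` in `L²(0,T)`: the difference quotients
`p(h,t)/h = (1/h) ∫_0^h p_y(y,t) dy` converge to `g` in `L²(0,T)` as `h → 0+`
(recall `p(0,t) = 0`). -/
def HasDyTrace (T : ℝ) (p : ℝ → H10) (g : ℝ → ℝ) : Prop :=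
  MemLp g 2 (volume.restrict (Ioo 0 T)) ∧
  Tendsto (fun h : ℝ => eLpNorm (fun t => h⁻¹ * (∫ y in Ioo 0 h, dy (p t) y) - g t) 2
    (volume.restrict (Ioo 0 T))) (𝓝[>] 0) (𝓝 0)

/-! ### The state equation -/

/-- `v` is the solution, in the sense of transposition, of
`v'' + Lv = 0` in `Q`, `v(0,t) = w(t)`, `v(1,t) = 0` for `0 < t < T`, `v(0) = v'(0) = 0`:
`v ∈ C([0,T]; L²(Ω)) ∩ C¹([0,T]; H⁻¹(Ω))` with zero initial data, and for each `f ∈ L²(Q)`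
`∫∫_Q v f = ∫_0^T α_k(t)⁻² θ_y(0,t) w(t) dt`, where `θ` solves the adjoint problem
`θ'' + L* θ = f` in `Q`, `θ = 0` on `Σ`, `θ(T) = θ'(T) = 0`. -/
structure IsState (T k : ℝ) (w : ℝ → ℝ) (v : ℝ → L2) : Prop where
  continuousOn : ContinuousOn v (Icc 0 T)
  initial : v 0 = 0
  initial_deriv : ∃ v' : ℝ → Hneg1, ContinuousOn v' (Icc 0 T) ∧ v' 0 = 0 ∧
    ∀ t ∈ Icc 0 T, HasDerivWithinAt (fun s => toHneg1 (v s)) (v' t) (Icc 0 T) t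
  transposition : ∀ f : ℝ → ℝ → ℝ,
    MemLp (Function.uncurry f) 2 (volume.restrict (Ioo 0 1 ×ˢ Ioo 0 T)) →
    ∀ (θ : ℝ → H10) (g : ℝ → ℝ), IsAdjointSolution T k f θ → HasDyTrace T θ g →
    ∫ t in Ioo 0 T, ∫ y in Ioo (0 : ℝ) 1, v t y * f y t =
      ∫ t in Ioo 0 T, 1 / alpha k t ^ 2 * g t * w t

/-- The solution of the state equation with boundary datum `w` at `y = 0`. -/
def state (T k : ℝ) (w : ℝ → ℝ) : ℝ → L2 := Classical.epsilon (IsState T k w)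

/-- The boundary datum on `Σ₀ = Σ₁ ∪ Σ₂`: the controls `w₁` on `Σ₁` and `w₂` on `Σ₂`
(where `Σ₁` and `Σ₂` overlap, if they do, their sum). -/
def boundaryDatum (S₁ S₂ : Set ℝ) (w₁ w₂ : ℝ → ℝ) (t : ℝ) : ℝ :=
  S₁.indicator w₁ t + S₂.indicator w₂ t

/-! ### The cost functional, Nash equilibria, the optimality system -/

/-- `J₂(w₁,w₂) = ½ ∫_0^T ∫_Ω α_k (v(w₁,w₂) - v₂)² dy dt + (σ/2) ∫_{Σ₂} w₂²`. -/
def costJ₂ (T k σ : ℝ) (S₁ S₂ : Set ℝ) (v₂ : ℝ → ℝ → ℝ)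
    (w₁ : Lp ℝ 2 (volume.restrict S₁)) (w₂ : Lp ℝ 2 (volume.restrict S₂)) : ℝ :=
  1 / 2 * (∫ t in Ioo 0 T, ∫ y in Ioo (0 : ℝ) 1,
      alpha k t * (state T k (boundaryDatum S₁ S₂ w₁ w₂) t y - v₂ y t) ^ 2)
    + σ / 2 * ∫ t in S₂, w₂ t ^ 2

/-- `w₂` is a Nash equilibrium for the leader `w₁`: `J₂(w₁,w₂) = inf_{ŵ₂} J₂(w₁,ŵ₂)`. -/
def IsNashEquilibrium (T k σ : ℝ) (S₁ S₂ : Set ℝ) (v₂ : ℝ → ℝ → ℝ)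
    (w₁ : Lp ℝ 2 (volume.restrict S₁)) (w₂ : Lp ℝ 2 (volume.restrict S₂)) : Prop :=
  costJ₂ T k σ S₁ S₂ v₂ w₁ w₂ =
    ⨅ u : Lp ℝ 2 (volume.restrict S₂), costJ₂ T k σ S₁ S₂ v₂ w₁ u

/-- The follower `(1/(σ α_k²)) ∂p/∂ν` given by the trace `g = p_y(0,·)`; the exterior normal
derivative at `y = 0` is `∂p/∂ν = -p_y`. -/
def followerOfTrace (k σ : ℝ) (g : ℝ → ℝ) (t : ℝ) : ℝ :=
  1 / (σ * alpha k t ^ 2) * (- g t)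

/-- `{v,p}` solves the optimality system, with `g = p_y(0,·)`. -/
structure IsOptimalitySolution (T k σ : ℝ) (S₁ S₂ : Set ℝ) (v₂ : ℝ → ℝ → ℝ)
    (w₁ : ℝ → ℝ) (v : ℝ → L2) (p : ℝ → H10) (g : ℝ → ℝ) : Prop where
  adjoint : IsAdjointSolution T k (fun y t => alpha k t * (v t y - v₂ y t)) p
  trace : HasDyTrace T p g
  state : IsState T k (boundaryDatum S₁ S₂ w₁ (followerOfTrace k σ g)) v

end WaveCylinder

end

noncomputable section

namespace WaveCylinder

/-! ### Extension by density and quadratic minimization -/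

/-! In the characteristic coordinates a = α(1 + ky), b = α(1 - ky) the operator ∂_t² + L becomes 4k²
∂_a∂_b (`waveOp_comp_char`), and Q becomes a piece of the wedge b < a < r b, r = (1 + k)/(1 - k),
whose two sides are the lateral boundaries y = 0 and y = 1. The Jacobian is 2k²α, so the adjoint
equation is again the equation for ∂_a∂_b, with unknown p/α. Both problems are therefore solved by
explicit formulas of d'Alembert type.

Adjoint problem. Let Ψ vanish in the future and let Ψ_ab be supported in the image of Q. The
alternating sum `img` of Ψ over the reflections in the two sides vanishes on both of them, finitely
many images being enough up to time T, and inside the wedge only the original contributes to the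
mixed derivative (`pd2_pd1_img_eq`). Hence α times this sum solves the adjoint problem with source
4k²αΨ_ab. Its characteristic derivatives are dominated by functions of one characteristic variable
(`sq_pd1_img_le`), so their squares can be integrated along every line t = const and every line y =
const at the price of the L² norm of the source. The first kind of line gives the energy estimate;
the second gives the bound on the difference quotients p(h,·)/h up to h = 0, that is, the hidden
regularity p_y(0,·) ∈ L²(0,T). Sources of product form h₁(a)h₂(b), up to the factor α, span a dense
subspace (`LQ_eq_zero`), so the solution operator, its trace included, is obtained by closing its
graph (`exists_adjOp`). Uniqueness is by duality: a homogeneous solution is orthogonal to the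
sources of all forward image solutions, and these are dense as well (`IsHomAdj.eq_zero`).

State equation. The datum w emits a wave along the characteristics that is reflected back and forth;
the state is the signed sum of these waves. Each depends continuously on w, from L²(0,T) to C([0,T];
L²) ∩ C¹([0,T]; H⁻¹). Pairing a wave with a source is one integration along characteristics, and the
resulting weights add up to the derivative of the image sum on the diagonal (`sum_rayWeight`), which
is the trace of the adjoint state up to the factor in `quot_zero`. This is the transposition
identity. The state is unique because the adjoint problem is solvable for every f ∈ L²(Q).

Minimization. The state depends affinely and continuously on the follower, so J₂(w₁, w₂) = ½‖B w₂ +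
c‖² + (σ/2)‖w₂‖². Such a functional has exactly one minimizer, its critical point
(`exists_tikhonov_critical`, `tikhonov_expand`). Transposition with the source α(v - v₂) rewrites
the critical equation as w₂ = -p_y/(σα²). Conversely, every solution of the optimality system yields
a critical point, so the system has one solution only. -/

theorem exists_clm_of_dense {E F : Type*} [NormedAddCommGroup E] [NormedSpace ℝ E]
    [NormedAddCommGroup F] [NormedSpace ℝ F] [CompleteSpace F] (S : Submodule ℝ (E × F)) (C : ℝ)
    (hb : ∀ z ∈ S, ‖z.2‖ ≤ C * ‖z.1‖) (hd : Dense (Prod.fst '' (S : Set (E × F)))) :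
    ∃ G : E →L[ℝ] F, ∀ x, (x, G x) ∈ S.topologicalClosure := by
  -- The estimate passes to the closure, which is therefore still the graph of a bounded map.
  have hb' : ∀ z ∈ S.topologicalClosure, ‖z.2‖ ≤ C * ‖z.1‖ := by
    intro z hz
    have hcl : IsClosed {z : E × F | ‖z.2‖ ≤ C * ‖z.1‖} :=
      isClosed_le (by fun_prop) (by fun_prop)
    exact closure_minimal (fun z hz => hb z hz) hcl hz
  have hex : ∀ x, ∃ y, (x, y) ∈ S.topologicalClosure := by
    intro x
    obtain ⟨u, hu, hux⟩ := mem_closure_iff_seq_limit.1 (hd x)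
    choose z hzS hzu using hu
    have hcau : CauchySeq fun n => (z n).2 := by
      have h1 : CauchySeq u := hux.cauchySeq
      rw [Metric.cauchySeq_iff'] at h1 ⊢
      intro ε hε
      obtain ⟨N, hN⟩ := h1 (ε / (|C| + 1)) (by positivity)
      refine ⟨N, fun n hn => ?_⟩
      have h2 := hb _ (S.sub_mem (hzS n) (hzS N))
      have h3 := hN n hn
      rw [dist_eq_norm] at h3 ⊢
      rw [lt_div_iff₀ (by positivity)] at h3
      simp only [Prod.fst_sub, Prod.snd_sub, hzu] at h2
      calc _ ≤ C * ‖u n - u N‖ := h2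
        _ ≤ (|C| + 1) * ‖u n - u N‖ := by
          gcongr; linarith [le_abs_self C]
        _ < ε := by linarith
    obtain ⟨y, hy⟩ := cauchySeq_tendsto_of_complete hcau
    refine ⟨y, mem_closure_iff_seq_limit.2 ⟨z, hzS, ?_⟩⟩
    refine Prod.tendsto_iff _ _ |>.2 ⟨?_, hy⟩
    simpa [hzu] using hux
  choose g hg using hex
  have huniq : ∀ x y, (x, y) ∈ S.topologicalClosure → y = g x := by
    intro x y hy
    have := hb' _ (S.topologicalClosure.sub_mem hy (hg x))
    simp only [Prod.fst_sub, Prod.snd_sub, sub_self, norm_zero, mul_zero] at this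
    exact sub_eq_zero.1 (norm_le_zero_iff.1 this)
  let G : E →ₗ[ℝ] F :=
    { toFun := g
      map_add' := fun x y => (huniq _ _ (S.topologicalClosure.add_mem (hg x) (hg y))).symm
      map_smul' := fun c x => (huniq _ _ (S.topologicalClosure.smul_mem c (hg x))).symm }
  exact ⟨G.mkContinuous C fun x => hb' _ (hg x), hg⟩

/-- The Tikhonov functional `½‖Bw + c‖² + (σ/2)‖w‖²` and its critical point. -/
theorem exists_tikhonov_critical {H K : Type*} [NormedAddCommGroup H] [InnerProductSpace ℝ H]
    [CompleteSpace H] [NormedAddCommGroup K] [InnerProductSpace ℝ K] [CompleteSpace K]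
    (B : H →L[ℝ] K) (c : K) {σ : ℝ} (hσ : 0 < σ) :
    ∃ w : H, ∀ d, inner ℝ (B w + c) (B d) + σ * inner ℝ w d = 0 := by
  -- Lax–Milgram for the form of the critical equation; its coercivity constant is σ.
  let a : H →L[ℝ] H →L[ℝ] ℝ := (innerSL ℝ).comp
    ((ContinuousLinearMap.adjoint B).comp B + σ • ContinuousLinearMap.id ℝ H)
  have ha : ∀ u v, a u v = inner ℝ (B u) (B v) + σ * inner ℝ u v := by
    intro u v
    simp only [a, ContinuousLinearMap.comp_apply, add_apply,
      smul_apply, ContinuousLinearMap.id_apply, innerSL_apply_apply,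
      inner_add_left, ContinuousLinearMap.adjoint_inner_left, real_inner_smul_left]
  have hco : IsCoercive a := by
    refine ⟨σ, hσ, fun u => ?_⟩
    rw [ha, real_inner_self_eq_norm_mul_norm, real_inner_self_eq_norm_mul_norm]
    nlinarith [mul_self_nonneg ‖B u‖]
  obtain ⟨w, hw⟩ := hco.continuousLinearEquivOfBilin.surjective
    (-(ContinuousLinearMap.adjoint B c))
  refine ⟨w, fun d => ?_⟩
  have h := hco.continuousLinearEquivOfBilin_apply w d
  rw [hw, ha, inner_neg_left, ContinuousLinearMap.adjoint_inner_left] at h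
  rw [inner_add_left]; linarith

/-- Completing the square at a critical point: the term linear in u - w is the critical equation in
that direction. For σ > 0 the remainder is positive unless u = w, which gives minimality and
uniqueness together. -/
theorem tikhonov_expand {H K : Type*} [NormedAddCommGroup H] [InnerProductSpace ℝ H]
    [NormedAddCommGroup K] [InnerProductSpace ℝ K]
    (B : H →L[ℝ] K) (c : K) {σ : ℝ} {w : H}
    (hw : ∀ d, inner ℝ (B w + c) (B d) + σ * inner ℝ w d = 0) (u : H) :
    1 / 2 * ‖B u + c‖ ^ 2 + σ / 2 * ‖u‖ ^ 2 =
      1 / 2 * ‖B w + c‖ ^ 2 + σ / 2 * ‖w‖ ^ 2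
        + (1 / 2 * ‖B (u - w)‖ ^ 2 + σ / 2 * ‖u - w‖ ^ 2) := by
  have h1 : B u + c = (B w + c) + B (u - w) := by rw [map_sub]; abel
  have h2 : ‖u‖ ^ 2 = ‖w + (u - w)‖ ^ 2 := by simp
  rw [h1, h2, norm_add_sq_real (B w + c), norm_add_sq_real w]
  linarith [hw (u - w)]

/-! ### One-dimensional preliminaries -/

theorem contDiff_primitive {f : ℝ → ℝ} (hf : ContDiff ℝ ∞ f) (c : ℝ) :
    ContDiff ℝ ∞ fun t => ∫ s in c..t, f s := by
  rw [contDiff_infty_iff_deriv]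
  have hd : ∀ t, HasDerivAt (fun t => ∫ s in c..t, f s) (f t) t := fun t =>
    intervalIntegral.integral_hasDerivAt_right (hf.continuous.intervalIntegrable _ _)
      (hf.continuous.stronglyMeasurableAtFilter _ _) hf.continuous.continuousAt
  refine ⟨fun t => (hd t).differentiableAt, ?_⟩
  rwa [show deriv (fun t => ∫ s in c..t, f s) = f from funext fun t => (hd t).deriv]

theorem deriv_primitive {f : ℝ → ℝ} (hf : Continuous f) (c : ℝ) :
    deriv (fun t => ∫ s in c..t, f s) = f :=
  funext fun _ => (intervalIntegral.integral_hasDerivAt_right (hf.intervalIntegrable _ _)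
    (hf.stronglyMeasurableAtFilter _ _) hf.continuousAt).deriv

theorem tsupport_subset_Icc {f : ℝ → ℝ} {a b : ℝ} (h : ∀ x, x ∉ Icc a b → f x = 0) :
    tsupport f ⊆ Icc a b :=
  closure_minimal (fun x hx => by by_contra h'; exact hx (h x h')) isClosed_Icc

theorem exists_Icc_of_tsupport {f : ℝ → ℝ} {a b : ℝ} (hab : a < b) (hc : HasCompactSupport f)
    (hs : tsupport f ⊆ Ioo a b) :
    ∃ c d, a < c ∧ c ≤ d ∧ d < b ∧ ∀ x, x ∉ Icc c d → f x = 0 := by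
  rcases (tsupport f).eq_empty_or_nonempty with h | h
  · refine ⟨(a + b) / 2, (a + b) / 2, by linarith, le_rfl, by linarith, fun x _ => ?_⟩
    exact image_eq_zero_of_notMem_tsupport (by simp [h])
  · have hK : IsCompact (tsupport f) := hc
    refine ⟨sInf (tsupport f), sSup (tsupport f), (hs (hK.sInf_mem h)).1,
      csInf_le_csSup h hK.bddBelow hK.bddAbove, (hs (hK.sSup_mem h)).2, fun x hx => ?_⟩
    refine image_eq_zero_of_notMem_tsupport fun hx' => hx ⟨csInf_le hK.bddBelow hx',
      le_csSup hK.bddAbove hx'⟩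

theorem exists_bump_Ioo {a b : ℝ} (hab : a < b) :
    ∃ ρ : ℝ → ℝ, ContDiff ℝ ∞ ρ ∧ HasCompactSupport ρ ∧ tsupport ρ ⊆ Ioo a b ∧ ∫ x, ρ x = 1 := by
  let B : ContDiffBump ((a + b) / 2 : ℝ) := ⟨(b - a) / 8, (b - a) / 4, by linarith, by linarith⟩
  refine ⟨B.normed volume, B.contDiff_normed, B.hasCompactSupport_normed, ?_, B.integral_normed⟩
  rw [B.tsupport_normed_eq, Real.closedBall_eq_Icc]
  exact Icc_subset_Ioo (by simp only [B]; linarith) (by simp only [B]; linarith)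

theorem setIntegral_Ioo_eq_intervalIntegral {a b : ℝ} (hab : a ≤ b) (f : ℝ → ℝ) :
    ∫ x in Ioo a b, f x = ∫ x in a..b, f x := by
  rw [intervalIntegral.integral_of_le hab, integral_Ioc_eq_integral_Ioo]

/-- The lemma of du Bois-Reymond. -/
theorem ae_eq_const_of_integral_deriv_mul {a b : ℝ} (hab : a < b) {m : ℝ → ℝ}
    (hm : IntegrableOn m (Ioo a b))
    (h : ∀ η : ℝ → ℝ, ContDiff ℝ ∞ η → HasCompactSupport η → tsupport η ⊆ Ioo a b →
      ∫ t in Ioo a b, deriv η t * m t = 0) :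
    ∃ c, ∀ᵐ t ∂volume.restrict (Ioo a b), m t = c := by
  obtain ⟨ρ, hρ, hρc, hρs, hρ1⟩ := exists_bump_Ioo hab
  set c := ∫ t in Ioo a b, ρ t * m t with hc
  have hmul : ∀ g : ℝ → ℝ, ContDiff ℝ ∞ g → HasCompactSupport g →
      IntegrableOn (fun t => g t * m t) (Ioo a b) := by
    intro g hg hgc
    obtain ⟨M, hM⟩ := hgc.exists_bound_of_continuous hg.continuous
    exact hm.bdd_mul hg.continuous.aestronglyMeasurable (ae_of_all _ hM)
  have key : ∀ g : ℝ → ℝ, ContDiff ℝ ∞ g → HasCompactSupport g → tsupport g ⊆ Ioo a b →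
      ∫ t, g t • (m t - c) ∂volume.restrict (Ioo a b) = 0 := by
    intro g hg hgc hgs
    set I := ∫ x, g x with hI
    have hgI : ∫ t in Ioo a b, g t = I :=
      setIntegral_eq_integral_of_forall_compl_eq_zero fun x hx =>
        image_eq_zero_of_notMem_tsupport fun h' => hx (hgs h')
    -- Subtracting the multiple of ρ with the same integral makes the mean zero, so the primitive
    -- has compact support and is admissible in `h`.
    have hζ : ContDiff ℝ ∞ fun t => g t - I * ρ t := hg.sub (contDiff_const.mul hρ)
    obtain ⟨c1, d1, h1, h2, h3, h4⟩ := exists_Icc_of_tsupport hab hgc hgs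
    obtain ⟨c2, d2, k1, k2, k3, k4⟩ := exists_Icc_of_tsupport hab hρc hρs
    have hz : ∀ x, x ∉ Icc (min c1 c2) (max d1 d2) → g x - I * ρ x = 0 := by
      intro x hx
      rw [h4 x fun h' => hx ⟨(min_le_left _ _).trans h'.1, h'.2.trans (le_max_left _ _)⟩,
        k4 x fun h' => hx ⟨(min_le_right _ _).trans h'.1, h'.2.trans (le_max_right _ _)⟩]
      simp
    have hint : ∫ x, (g x - I * ρ x) = 0 := by
      rw [integral_sub (hg.continuous.integrable_of_hasCompactSupport hgc)
        ((hρ.continuous.integrable_of_hasCompactSupport hρc).const_mul I), integral_const_mul, hρ1]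
      simp [hI]
    have hη0 : ∀ x, x ∉ Icc (min c1 c2) (max d1 d2) → ∫ s in a..x, (g s - I * ρ s) = 0 := by
      intro x hx
      rcases lt_or_ge x (min c1 c2) with hlt | hge
      · refine intervalIntegral.integral_zero_ae (ae_of_all _ fun s hs => hz s fun h' => ?_)
        have : s ≤ max a x := hs.2
        have : max a x < min c1 c2 := max_lt (lt_min h1 k1) hlt
        linarith [h'.1]
      · have hgt : max d1 d2 < x := by
          by_contra h'; exact hx ⟨hge, not_lt.1 h'⟩
        have hax : a ≤ x := by
          have : a < min c1 c2 := lt_min h1 k1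
          linarith
        rw [intervalIntegral.integral_of_le hax, ← hint]
        refine setIntegral_eq_integral_of_forall_compl_eq_zero fun s hs => hz s fun h' => hs ?_
        exact ⟨lt_of_lt_of_le (lt_min h1 k1) h'.1, h'.2.trans hgt.le⟩
    have hts := tsupport_subset_Icc hη0
    have h0 := h _ (contDiff_primitive hζ a)
      (IsCompact.of_isClosed_subset isCompact_Icc (isClosed_tsupport _) hts)
      (hts.trans (Icc_subset_Ioo (lt_min h1 k1) (max_lt h3 k3)))
    rw [deriv_primitive hζ.continuous] at h0
    have e1 : ∀ t, (g t - I * ρ t) * m t = g t * m t - I * (ρ t * m t) := fun t => by ring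
    simp only [e1] at h0
    rw [integral_sub (hmul g hg hgc) ((hmul ρ hρ hρc).const_mul I), integral_const_mul, ← hc] at h0
    have e2 : ∀ t, g t • (m t - c) = g t * m t - g t * c := fun t => by
      rw [smul_eq_mul]; ring
    simp only [e2]
    rw [integral_sub (hmul g hg hgc)
      ((hg.continuous.integrable_of_hasCompactSupport hgc).restrict.mul_const c), integral_mul_const,
      hgI]
    linarith
  refine ⟨c, ?_⟩
  have hloc : LocallyIntegrableOn (fun t => m t - c) (Ioo a b) (volume.restrict (Ioo a b)) := by
    refine Integrable.locallyIntegrable ?_ |>.locallyIntegrableOn _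
    exact hm.sub (integrable_const c)
  have := isOpen_Ioo.ae_eq_zero_of_integral_contDiff_smul_eq_zero hloc key
  filter_upwards [this, ae_restrict_mem measurableSet_Ioo] with t ht hmem
  exact sub_eq_zero.1 (ht hmem)

/-! ### Functions on `(0,c)` as elements of `L²` -/

/-- The class of `u` in `L²(0,c)` (`0` if `u` is not square integrable). -/
def bL (c : ℝ) (u : ℝ → ℝ) : Lp ℝ 2 (volume.restrict (Ioo (0 : ℝ) c)) :=
  open Classical in if h : MemLp u 2 (volume.restrict (Ioo (0 : ℝ) c)) then h.toLp u else 0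

theorem bL_coe {c : ℝ} {u : ℝ → ℝ} (h : MemLp u 2 (volume.restrict (Ioo (0 : ℝ) c))) :
    bL c u =ᵐ[volume.restrict (Ioo (0 : ℝ) c)] u := by
  rw [bL, dif_pos h]; exact h.coeFn_toLp

theorem memLp_of_bound_Ioo {c : ℝ} {u : ℝ → ℝ} (hu : Measurable u) {C : ℝ}
    (h : ∀ x ∈ Ioo (0 : ℝ) c, |u x| ≤ C) : MemLp u 2 (volume.restrict (Ioo (0 : ℝ) c)) :=
  MemLp.of_bound hu.aestronglyMeasurable C
    ((ae_restrict_iff' measurableSet_Ioo).2 (ae_of_all _ fun x hx => h x hx))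

theorem memLp_Ioo_of_continuous {c : ℝ} {u : ℝ → ℝ} (hu : Continuous u) :
    MemLp u 2 (volume.restrict (Ioo (0 : ℝ) c)) := by
  obtain ⟨C, hC⟩ := (isCompact_Icc (a := (0 : ℝ)) (b := c)).exists_bound_of_continuousOn
    hu.continuousOn
  exact memLp_of_bound_Ioo hu.measurable fun x hx => hC x (Ioo_subset_Icc_self hx)

theorem bL_eq {c : ℝ} {u : ℝ → ℝ} {f : Lp ℝ 2 (volume.restrict (Ioo (0 : ℝ) c))}
    (h : f =ᵐ[volume.restrict (Ioo (0 : ℝ) c)] u) : bL c u = f := by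
  have hm : MemLp u 2 (volume.restrict (Ioo (0 : ℝ) c)) := (memLp_congr_ae h).1 (Lp.memLp f)
  exact Lp.ext ((bL_coe hm).trans h.symm)

theorem inner_Lp_eq {c : ℝ} (f g : Lp ℝ 2 (volume.restrict (Ioo (0 : ℝ) c))) :
    inner ℝ f g = ∫ x in Ioo (0 : ℝ) c, f x * g x := by
  rw [L2.inner_def]
  exact integral_congr_ae (ae_of_all _ fun x => by simp [mul_comm])

theorem inner_bL_left {c : ℝ} {u : ℝ → ℝ} (hu : MemLp u 2 (volume.restrict (Ioo (0 : ℝ) c)))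
    (g : Lp ℝ 2 (volume.restrict (Ioo (0 : ℝ) c))) :
    inner ℝ (bL c u) g = ∫ x in Ioo (0 : ℝ) c, u x * g x := by
  rw [inner_Lp_eq]
  exact integral_congr_ae ((bL_coe hu).mono fun x hx => by simp only [hx])

theorem inner_bL_bL {c : ℝ} {u v : ℝ → ℝ} (hu : MemLp u 2 (volume.restrict (Ioo (0 : ℝ) c)))
    (hv : MemLp v 2 (volume.restrict (Ioo (0 : ℝ) c))) :
    inner ℝ (bL c u) (bL c v) = ∫ x in Ioo (0 : ℝ) c, u x * v x := by
  rw [inner_bL_left hu]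
  exact integral_congr_ae ((bL_coe hv).mono fun x hx => by simp only [hx])

theorem norm_bL_sq {c : ℝ} {u : ℝ → ℝ} (hu : MemLp u 2 (volume.restrict (Ioo (0 : ℝ) c))) :
    ‖bL c u‖ ^ 2 = ∫ x in Ioo (0 : ℝ) c, u x ^ 2 := by
  rw [← real_inner_self_eq_norm_sq, inner_bL_bL hu hu]
  simp only [pow_two]

theorem bL_add {c : ℝ} {u v : ℝ → ℝ} (hu : MemLp u 2 (volume.restrict (Ioo (0 : ℝ) c)))
    (hv : MemLp v 2 (volume.restrict (Ioo (0 : ℝ) c))) :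
    bL c (fun x => u x + v x) = bL c u + bL c v := by
  apply bL_eq
  filter_upwards [bL_coe hu, bL_coe hv, Lp.coeFn_add (bL c u) (bL c v)] with x h1 h2 h3
  rw [h3, Pi.add_apply, h1, h2]

theorem bL_sub {c : ℝ} {u v : ℝ → ℝ} (hu : MemLp u 2 (volume.restrict (Ioo (0 : ℝ) c)))
    (hv : MemLp v 2 (volume.restrict (Ioo (0 : ℝ) c))) :
    bL c (fun x => u x - v x) = bL c u - bL c v := by
  apply bL_eq
  filter_upwards [bL_coe hu, bL_coe hv, Lp.coeFn_sub (bL c u) (bL c v)] with x h1 h2 h3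
  rw [h3, Pi.sub_apply, h1, h2]

theorem bL_const_mul {c : ℝ} (s : ℝ) {u : ℝ → ℝ}
    (hu : MemLp u 2 (volume.restrict (Ioo (0 : ℝ) c))) :
    bL c (fun x => s * u x) = s • bL c u := by
  apply bL_eq
  filter_upwards [bL_coe hu, Lp.coeFn_smul s (bL c u)] with x h1 h3
  rw [h3, Pi.smul_apply, h1, smul_eq_mul]

theorem bL_congr {c : ℝ} {u v : ℝ → ℝ} (h : ∀ x ∈ Ioo (0 : ℝ) c, u x = v x) :
    bL c u = bL c v := by
  have hae : u =ᵐ[volume.restrict (Ioo (0 : ℝ) c)] v :=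
    (ae_restrict_iff' measurableSet_Ioo).2 (ae_of_all _ h)
  by_cases hv : MemLp v 2 (volume.restrict (Ioo (0 : ℝ) c))
  · exact bL_eq ((bL_coe hv).trans hae.symm)
  · rw [bL, bL, dif_neg hv, dif_neg fun hu => hv ((memLp_congr_ae hae).1 hu)]

theorem norm_bL_le {c : ℝ} {u : ℝ → ℝ} (hu : MemLp u 2 (volume.restrict (Ioo (0 : ℝ) c)))
    {C : ℝ} (hC : 0 ≤ C) (h : ∀ x ∈ Ioo (0 : ℝ) c, |u x| ≤ C) :
    ‖bL c u‖ ≤ Real.sqrt |c| * C := by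
  refine abs_le_of_sq_le_sq' ?_ (by positivity) |>.2
  rw [norm_bL_sq hu, mul_pow, Real.sq_sqrt (abs_nonneg c)]
  have h2 : IntegrableOn (fun x => u x ^ 2) (Ioo 0 c) := hu.integrable_sq
  calc ∫ x in Ioo (0 : ℝ) c, u x ^ 2 ≤ ∫ x in Ioo (0 : ℝ) c, C ^ 2 := by
        refine setIntegral_mono_on h2 (by simp) measurableSet_Ioo fun x hx => ?_
        exact sq_le_sq' (by linarith [neg_le_of_abs_le (h x hx)]) ((le_abs_self _).trans (h x hx))
    _ ≤ |c| * C ^ 2 := by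
        simp only [integral_const, MeasurableSet.univ, measureReal_restrict_apply, univ_inter,
          Real.volume_real_Ioo, sub_zero, smul_eq_mul]
        gcongr
        exact max_le (le_abs_self c) (abs_nonneg c)

/-! ### The space `H¹₀(Ω)` -/

/-- `g ↦ ∫_0^y g` on `L²(Ω)`. -/
def ev (y : ℝ) : L2 →L[ℝ] ℝ := innerSL ℝ (bL 1 (indicator (Iio y) 1))

theorem memLp_indicator_one (y : ℝ) :
    MemLp (indicator (Iio y) (1 : ℝ → ℝ)) 2 (volume.restrict (Ioo (0 : ℝ) 1)) :=
  memLp_of_bound_Ioo (measurable_one.indicator measurableSet_Iio) (C := 1) fun x _ => by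
    by_cases h : x ∈ Iio y <;> simp [h]

theorem Lp_integrableOn {c : ℝ} (g : Lp ℝ 2 (volume.restrict (Ioo (0 : ℝ) c))) :
    IntegrableOn g (Ioo 0 c) :=
  (Lp.memLp g).integrable (by norm_num)

theorem ev_apply (y : ℝ) (g : L2) :
    ev y g = ∫ x in (0 : ℝ)..y, indicator (Ioo 0 1) g x := by
  rw [ev, innerSL_apply_apply, inner_bL_left (memLp_indicator_one y)]
  have h1 : ∀ x, indicator (Iio y) (1 : ℝ → ℝ) x * g x = indicator (Iio y) g x := fun x => by
    by_cases h : x ∈ Iio y <;> simp [h]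
  simp only [h1]
  rw [setIntegral_indicator measurableSet_Iio]
  rcases le_total 0 y with hy | hy
  · rw [← setIntegral_Ioo_eq_intervalIntegral hy, setIntegral_indicator measurableSet_Ioo]
    congr 2; ext x; simp only [mem_inter_iff, mem_Ioo, mem_Iio]; tauto
  · rw [intervalIntegral.integral_symm, ← setIntegral_Ioo_eq_intervalIntegral hy,
      setIntegral_indicator measurableSet_Ioo]
    have e1 : Ioo (0 : ℝ) 1 ∩ Iio y = ∅ := by
      ext x; simp only [mem_inter_iff, mem_Ioo, mem_Iio, mem_empty_iff_false, iff_false]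
      intro h; linarith [h.1.1, h.2]
    have e2 : Ioo y 0 ∩ Ioo (0 : ℝ) 1 = ∅ := by
      ext x; simp only [mem_inter_iff, mem_Ioo, mem_empty_iff_false, iff_false]
      intro h; linarith [h.1.2, h.2.1]
    simp [e1, e2]

theorem ev_eq_setIntegral {y : ℝ} (hy : y ∈ Icc (0 : ℝ) 1) (g : L2) :
    ev y g = ∫ x in Ioo 0 y, g x := by
  rw [ev_apply, ← setIntegral_Ioo_eq_intervalIntegral hy.1, setIntegral_indicator measurableSet_Ioo]
  congr 2; ext x; simp only [mem_inter_iff, mem_Ioo]; constructor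
  · tauto
  · exact fun h => ⟨h, h.1, h.2.trans_le hy.2⟩

theorem norm_ev_le (y : ℝ) (g : L2) : |ev y g| ≤ ‖g‖ := by
  have h1 : ‖bL 1 (indicator (Iio y) 1)‖ ≤ 1 := by
    refine (norm_bL_le (memLp_indicator_one y) zero_le_one fun x _ => ?_).trans (by simp)
    by_cases h : x ∈ Iio y <;> simp [h]
  rw [ev, innerSL_apply_apply]
  exact (abs_real_inner_le_norm _ _).trans (mul_le_of_le_one_left (norm_nonneg _) h1)

theorem continuous_ev (g : L2) : Continuous fun y => ev y g := by
  simp only [ev_apply]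
  have h : Integrable (indicator (Ioo 0 1) g) :=
    (integrable_indicator_iff measurableSet_Ioo).2 (Lp_integrableOn g)
  exact intervalIntegral.continuous_primitive (fun a b => h.intervalIntegrable) 0

/-- The primitive `g ↦ (y ↦ ∫_0^y g)` on `L²(Ω)`. -/
def prim : L2 →L[ℝ] L2 :=
  LinearMap.mkContinuous
    { toFun := fun g => bL 1 fun y => ev y g
      map_add' := fun f g => by
        rw [← bL_add (memLp_Ioo_of_continuous (continuous_ev f))
          (memLp_Ioo_of_continuous (continuous_ev g))]
        simp only [map_add]
      map_smul' := fun c g => by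
        simp only [map_smul, RingHom.id_apply, smul_eq_mul]
        exact bL_const_mul c (memLp_Ioo_of_continuous (continuous_ev g)) } 1 fun g => by
    simpa using norm_bL_le (c := 1) (memLp_Ioo_of_continuous (continuous_ev g)) (norm_nonneg g)
      fun x _ => norm_ev_le x g

theorem prim_apply (g : L2) : prim g = bL 1 fun y => ev y g := rfl

theorem norm_prim_le (g : L2) : ‖prim g‖ ≤ ‖g‖ := by
  rw [prim_apply]
  simpa using norm_bL_le (c := 1) (memLp_Ioo_of_continuous (continuous_ev g)) (norm_nonneg g)
      fun x _ => norm_ev_le x g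

theorem testPair_mem {φ : ℝ → ℝ} (h1 : ContDiff ℝ ∞ φ) (h2 : HasCompactSupport φ)
    (h3 : tsupport φ ⊆ Ioo 0 1) : (bL 1 φ, bL 1 (deriv φ)) ∈ testPairs :=
  ⟨φ, h1, h2, h3, bL_coe (memLp_Ioo_of_continuous h1.continuous),
    bL_coe (memLp_Ioo_of_continuous (h1.continuous_deriv (by simp)))⟩

theorem testPairs_eq {z : L2 × L2} (hz : z ∈ testPairs) :
    ∃ φ : ℝ → ℝ, ContDiff ℝ ∞ φ ∧ HasCompactSupport φ ∧ tsupport φ ⊆ Ioo 0 1 ∧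
      z = (bL 1 φ, bL 1 (deriv φ)) := by
  obtain ⟨φ, h1, h2, h3, h4, h5⟩ := hz
  exact ⟨φ, h1, h2, h3, Prod.ext (bL_eq h4).symm (bL_eq h5).symm⟩

/-- A continuous linear map that vanishes on test functions vanishes on `H¹₀(Ω)`. -/
theorem H10_ker {F : Type*} [NormedAddCommGroup F] [NormedSpace ℝ F] (l : L2 × L2 →L[ℝ] F)
    (h : ∀ φ : ℝ → ℝ, ContDiff ℝ ∞ φ → HasCompactSupport φ → tsupport φ ⊆ Ioo 0 1 →
      l (bL 1 φ, bL 1 (deriv φ)) = 0) {z : L2 × L2} (hz : z ∈ H10Submodule) : l z = 0 := by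
  have h1 : H10Submodule ≤ l.ker := by
    refine Submodule.topologicalClosure_minimal _ (Submodule.span_le.2 fun z hz => ?_)
      l.isClosed_ker
    obtain ⟨φ, h1, h2, h3, rfl⟩ := testPairs_eq hz
    exact h φ h1 h2 h3
  exact h1 hz

theorem ev_deriv {u : ℝ → ℝ} (hu : ContDiff ℝ 1 u) {y : ℝ} (hy : y ∈ Icc (0 : ℝ) 1) :
    ev y (bL 1 (deriv u)) = u y - u 0 := by
  have hc : Continuous (deriv u) := hu.continuous_deriv le_rfl
  rw [ev_eq_setIntegral hy]
  have h1 : ∫ x in Ioo 0 y, (bL 1 (deriv u)) x = ∫ x in Ioo 0 y, deriv u x :=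
    integral_congr_ae (ae_mono (Measure.restrict_mono (Ioo_subset_Ioo_right hy.2) le_rfl)
      (bL_coe (memLp_Ioo_of_continuous hc)))
  rw [h1, setIntegral_Ioo_eq_intervalIntegral hy.1]
  exact intervalIntegral.integral_deriv_eq_sub
    (fun x _ => (hu.differentiable one_ne_zero).differentiableAt) (hc.intervalIntegrable _ _)

theorem prim_deriv {u : ℝ → ℝ} (hu : ContDiff ℝ 1 u) (h0 : u 0 = 0) :
    prim (bL 1 (deriv u)) = bL 1 u := by
  rw [prim_apply]
  refine bL_congr fun y hy => ?_
  rw [ev_deriv hu (Ioo_subset_Icc_self hy), h0, sub_zero]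

theorem H10_rep {z : L2 × L2} (hz : z ∈ H10Submodule) : z.1 = prim z.2 ∧ ev 1 z.2 = 0 := by
  have hd : ∀ {φ : ℝ → ℝ} {x : ℝ}, tsupport φ ⊆ Ioo 0 1 → x ∉ Ioo (0 : ℝ) 1 → φ x = 0 :=
    fun h3 hx => image_eq_zero_of_notMem_tsupport fun h => hx (h3 h)
  constructor
  · refine sub_eq_zero.1 (H10_ker (ContinuousLinearMap.fst ℝ L2 L2
      - prim.comp (ContinuousLinearMap.snd ℝ L2 L2)) (fun φ h1 h2 h3 => ?_) hz)
    simp [prim_deriv (h1.of_le (by simp)) (hd h3 (by simp))]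
  · refine H10_ker ((ev 1).comp (ContinuousLinearMap.snd ℝ L2 L2)) (fun φ h1 h2 h3 => ?_) hz
    simp [ev_deriv (h1.of_le (by simp)) (show (1 : ℝ) ∈ Icc (0 : ℝ) 1 by simp),
      hd h3 (show (1 : ℝ) ∉ Ioo (0 : ℝ) 1 by simp), hd h3 (show (0 : ℝ) ∉ Ioo (0 : ℝ) 1 by simp)]

theorem toL2_eq_prim (χ : H10) : toL2 χ = prim (dy χ) := (H10_rep χ.2).1

theorem norm_toL2_le (χ : H10) : ‖toL2 χ‖ ≤ ‖dy χ‖ := by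
  rw [toL2_eq_prim]; exact norm_prim_le _

theorem norm_H10_le (χ : H10) : ‖χ‖ ≤ ‖dy χ‖ := max_le (norm_toL2_le χ) le_rfl

theorem H10_ext {χ ξ : H10} (h : dy χ = dy ξ) : χ = ξ := by
  have := norm_H10_le (χ - ξ)
  rw [map_sub, h, sub_self, norm_zero] at this
  exact sub_eq_zero.1 (norm_le_zero_iff.1 this)

instance : CompleteSpace H10 :=
  (Submodule.isClosed_topologicalClosure (Submodule.span ℝ testPairs)).completeSpace_coe

/-- The range of `dy` is closed by the Poincaré inequality, and by du Bois-Reymond only constants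
are orthogonal to it, so it contains every function of mean zero. This is how explicit smooth
functions with zero boundary values are recognised as elements of H¹₀ without approximating them. -/
theorem exists_H10_of_ev_one {g : L2} (hg : ev 1 g = 0) : ∃ χ : H10, dy χ = g := by
  have hanti : AntilipschitzWith 1 dy :=
    ContinuousLinearMap.antilipschitz_of_bound dy (K := 1) fun χ => by simpa using norm_H10_le χ
  have hclosed : IsClosed (dy.range : Set L2) :=
    (hanti.isClosed_range dy.uniformContinuous)
  have : CompleteSpace dy.range := hclosed.completeSpace_coe
  suffices h : g ∈ dy.range from h
  rw [← Submodule.orthogonal_orthogonal dy.range, Submodule.mem_orthogonal]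
  intro u hu
  obtain ⟨c, hc⟩ := ae_eq_const_of_integral_deriv_mul (zero_lt_one (α := ℝ)) (Lp_integrableOn u)
    fun η h1 h2 h3 => by
      have hm : (bL 1 η, bL 1 (deriv η)) ∈ H10Submodule :=
        Submodule.le_topologicalClosure _ (Submodule.subset_span (testPair_mem h1 h2 h3))
      have := (Submodule.mem_orthogonal _ _).1 hu (dy ⟨_, hm⟩) ⟨_, rfl⟩
      rwa [show dy ⟨_, hm⟩ = bL 1 (deriv η) from rfl,
        inner_bL_left (memLp_Ioo_of_continuous (h1.continuous_deriv (by simp)))] at this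
  have h2 := ev_eq_setIntegral (show (1 : ℝ) ∈ Icc (0 : ℝ) 1 by simp) g
  rw [hg] at h2
  rw [inner_Lp_eq, integral_congr_ae (hc.mono fun x hx => by simp only [hx] :
    (fun x => u x * g x) =ᵐ[_] fun x => c * g x), integral_const_mul, ← h2, mul_zero]

theorem mem_H10_of_contDiff {u : ℝ → ℝ} (hu : ContDiff ℝ 1 u) (h0 : u 0 = 0) (h1 : u 1 = 0) :
    (bL 1 u, bL 1 (deriv u)) ∈ H10Submodule := by
  obtain ⟨χ, hχ⟩ := exists_H10_of_ev_one (g := bL 1 (deriv u))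
    (by rw [ev_deriv hu (by simp), h0, h1, sub_zero])
  have : (bL 1 u, bL 1 (deriv u)) = (χ : L2 × L2) :=
    Prod.ext (by change _ = toL2 χ; rw [toL2_eq_prim, hχ, prim_deriv hu h0]) hχ.symm
  rw [this]; exact χ.2

/-- Integration by parts against `H¹₀(Ω)`. -/
theorem inner_deriv_toL2 {u : ℝ → ℝ} (hu : ContDiff ℝ 1 u) {z : L2 × L2}
    (hz : z ∈ H10Submodule) :
    inner ℝ (bL 1 (deriv u)) z.1 = - inner ℝ (bL 1 u) z.2 := by
  have hc : Continuous (deriv u) := hu.continuous_deriv le_rfl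
  have := H10_ker ((innerSL ℝ (bL 1 (deriv u))).comp (ContinuousLinearMap.fst ℝ L2 L2)
    + (innerSL ℝ (bL 1 u)).comp (ContinuousLinearMap.snd ℝ L2 L2)) (fun φ h1 h2 h3 => ?_) hz
  · simpa [add_eq_zero_iff_eq_neg] using this
  have hcφ : Continuous (deriv φ) := h1.continuous_deriv (by simp)
  have i1 : IntervalIntegrable (fun x => deriv u x * φ x) volume 0 1 :=
    (hc.mul h1.continuous).intervalIntegrable _ _
  have i2 : IntervalIntegrable (fun x => u x * deriv φ x) volume 0 1 :=
    (hu.continuous.mul hcφ).intervalIntegrable _ _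
  simp only [add_apply, ContinuousLinearMap.comp_apply, ContinuousLinearMap.coe_fst',
    ContinuousLinearMap.coe_snd', innerSL_apply_apply]
  rw [inner_bL_bL (memLp_Ioo_of_continuous hc) (memLp_Ioo_of_continuous h1.continuous),
    inner_bL_bL (memLp_Ioo_of_continuous hu.continuous) (memLp_Ioo_of_continuous hcφ),
    setIntegral_Ioo_eq_intervalIntegral zero_le_one, setIntegral_Ioo_eq_intervalIntegral zero_le_one,
    ← intervalIntegral.integral_add i1 i2]
  rw [intervalIntegral.integral_eq_sub_of_hasDerivAt (f := fun x => u x * φ x)]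
  · have e0 : φ 0 = 0 := image_eq_zero_of_notMem_tsupport fun h => by simpa using h3 h
    have e1 : φ 1 = 0 := image_eq_zero_of_notMem_tsupport fun h => by simpa using h3 h
    simp [e0, e1]
  · intro x _
    exact ((hu.differentiable one_ne_zero).differentiableAt.hasDerivAt).mul
      ((h1.differentiable (by simp)).differentiableAt.hasDerivAt)
  · exact i1.add i2

/-! ### Curves in `L²(Ω)` as elements of `L²(Q)` -/

/-- `L²(Q)`, `Q = (0,1) × (0,T)`. -/
abbrev LQ (T : ℝ) : Type := Lp ℝ 2 (volume.restrict (Ioo (0 : ℝ) 1 ×ˢ Ioo (0 : ℝ) T))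

theorem restrict_Q (T : ℝ) : (volume : Measure (ℝ × ℝ)).restrict (Ioo (0 : ℝ) 1 ×ˢ Ioo (0 : ℝ) T) =
    (volume.restrict (Ioo (0 : ℝ) 1)).prod (volume.restrict (Ioo (0 : ℝ) T)) := by
  rw [Measure.prod_restrict, Measure.volume_eq_prod]

/-- Every continuous curve in `L²(Ω)` has a jointly measurable representative. -/
theorem exists_measurable_rep {v : ℝ → L2} (hv : Continuous v) :
    ∃ V : ℝ × ℝ → ℝ, Measurable V ∧
      ∀ t, v t =ᵐ[volume.restrict (Ioo (0 : ℝ) 1)] fun y => V (y, t) := by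
  -- The primitive in y is continuous in y and measurable in t, hence jointly measurable. Lebesgue
  -- differentiation recovers v t from its difference quotients; `limsup` keeps measurability where
  -- they do not converge.
  have hE : Measurable fun z : ℝ × ℝ => ev z.1 (v z.2) := by
    have h1 : ∀ y, Measurable fun t => ev y (v t) := fun y =>
      ((ev y).continuous.comp hv).measurable
    have h2 : ∀ t, Continuous fun y => ev y (v t) := fun t => continuous_ev (v t)
    generalize hF : (fun y t => ev y (v t)) = F at *
    have h3 : Measurable (Function.uncurry F) := by
      subst hF; exact measurable_uncurry_of_continuous_of_measurable h2 h1
    subst hF; exact h3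
  let δ : ℕ → ℝ := fun n => ((n : ℝ) + 1)⁻¹
  let S : ℕ → ℝ × ℝ → ℝ := fun n z => (δ n)⁻¹ * (ev (z.1 + δ n) (v z.2) - ev z.1 (v z.2))
  have hS' : ∀ (F : ℝ × ℝ → ℝ), Measurable F → ∀ n,
      Measurable fun z => (δ n)⁻¹ * (F (z.1 + δ n, z.2) - F z) := fun F hF n => by fun_prop
  have hS : ∀ n, Measurable (S n) := hS' _ hE
  refine ⟨fun z => limsup (fun n => S n z) atTop, Measurable.limsup hS, fun t => ?_⟩
  have hint : Integrable (indicator (Ioo (0 : ℝ) 1) (v t)) :=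
    (integrable_indicator_iff measurableSet_Ioo).2 (Lp_integrableOn (v t))
  filter_upwards [ae_restrict_of_ae (LocallyIntegrable.ae_hasDerivAt_integral
      hint.locallyIntegrable),
    ae_restrict_mem measurableSet_Ioo] with y hy hmem
  have hd : HasDerivAt (fun x => ev x (v t)) (v t y) y := by
    have h := hy 0
    rw [indicator_of_mem hmem] at h
    simpa only [ev_apply] using h
  have hδ : Tendsto δ atTop (𝓝[≠] 0) := by
    refine tendsto_nhdsWithin_iff.2 ⟨?_, Eventually.of_forall fun n => ?_⟩
    · simpa [δ] using tendsto_one_div_add_atTop_nhds_zero_nat (𝕜 := ℝ)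
    · simp only [δ, mem_compl_iff, mem_singleton_iff, inv_eq_zero]; positivity
  have := (hd.tendsto_slope_zero).comp hδ
  exact this.limsup_eq.symm

/-- `V ∈ L²(Q)` represents the curve `v` in `L²(Ω)`. -/
def IsRep (T : ℝ) (v : ℝ → L2) (V : LQ T) : Prop :=
  ∀ᵐ t ∂volume.restrict (Ioo (0 : ℝ) T), v t =ᵐ[volume.restrict (Ioo (0 : ℝ) 1)] fun y => V (y, t)

theorem ae_Q_iff {T : ℝ} {p : ℝ × ℝ → Prop} (hp : MeasurableSet {z | p z}) :
    (∀ᵐ z ∂(volume.restrict (Ioo (0 : ℝ) 1 ×ˢ Ioo (0 : ℝ) T)), p z) ↔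
      ∀ᵐ t ∂volume.restrict (Ioo (0 : ℝ) T), ∀ᵐ y ∂volume.restrict (Ioo (0 : ℝ) 1), p (y, t) := by
  rw [restrict_Q, Measure.ae_prod_iff_ae_ae hp, Measure.ae_ae_comm hp]

theorem ae_ae_of_ae_Q {T : ℝ} {p : ℝ × ℝ → Prop}
    (h : ∀ᵐ z ∂(volume.restrict (Ioo (0 : ℝ) 1 ×ˢ Ioo (0 : ℝ) T)), p z) :
    ∀ᵐ t ∂volume.restrict (Ioo (0 : ℝ) T), ∀ᵐ y ∂volume.restrict (Ioo (0 : ℝ) 1), p (y, t) := by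
  rw [restrict_Q, ← Measure.prod_swap] at h
  have := Measure.ae_ae_of_ae_prod (ae_of_ae_map measurable_swap.aemeasurable h)
  simpa using this

theorem LQ_ext {T : ℝ} {F G : LQ T} (h : ∀ᵐ t ∂volume.restrict (Ioo (0 : ℝ) T),
    ∀ᵐ y ∂volume.restrict (Ioo (0 : ℝ) 1), F (y, t) = G (y, t)) : F = G :=
  Lp.ext ((ae_Q_iff (measurableSet_eq_fun (Lp.stronglyMeasurable F).measurable
    (Lp.stronglyMeasurable G).measurable)).2 h)

theorem IsRep.unique {T : ℝ} {v : ℝ → L2} {V W : LQ T} (hV : IsRep T v V) (hW : IsRep T v W) :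
    V = W :=
  LQ_ext (by filter_upwards [hV, hW] with t h1 h2 using h1.symm.trans h2)

theorem IsRep.add {T : ℝ} {v w : ℝ → L2} {V W : LQ T} (hV : IsRep T v V) (hW : IsRep T w W) :
    IsRep T (v + w) (V + W) := by
  filter_upwards [hV, hW, ae_ae_of_ae_Q (Lp.coeFn_add V W)] with t h1 h2 h3
  filter_upwards [h1, h2, h3, Lp.coeFn_add (v t) (w t)] with y k1 k2 k3 k4
  rw [k3, Pi.add_apply, Pi.add_apply, k4, Pi.add_apply, k1, k2]

theorem IsRep.smul {T : ℝ} {v : ℝ → L2} {V : LQ T} (c : ℝ) (hV : IsRep T v V) :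
    IsRep T (c • v) (c • V) := by
  filter_upwards [hV, ae_ae_of_ae_Q (Lp.coeFn_smul c V)] with t h1 h3
  filter_upwards [h1, h3, Lp.coeFn_smul c (v t)] with y k1 k3 k4
  rw [k3, Pi.smul_apply, Pi.smul_apply, k4, Pi.smul_apply, k1]

theorem IsRep.congr {T : ℝ} {v w : ℝ → L2} {V : LQ T} (hV : IsRep T v V)
    (h : EqOn v w (Ioo 0 T)) : IsRep T w V := by
  filter_upwards [hV, ae_restrict_mem measurableSet_Ioo] with t h1 h2
  rw [← h h2]; exact h1

/-- Iterated integrals against a square integrable function. -/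
theorem IsRep.integral_mul {T : ℝ} {v : ℝ → L2} {V : LQ T} (hV : IsRep T v V) {G : ℝ × ℝ → ℝ}
    (hG : MemLp G 2 (volume.restrict (Ioo (0 : ℝ) 1 ×ˢ Ioo (0 : ℝ) T))) :
    ∫ t in Ioo 0 T, ∫ y in Ioo (0 : ℝ) 1, v t y * G (y, t) = inner ℝ V (hG.toLp G) := by
  have h1 : inner ℝ V (hG.toLp G) = ∫ z in Ioo (0 : ℝ) 1 ×ˢ Ioo (0 : ℝ) T, V z * G z := by
    rw [L2.inner_def]
    refine integral_congr_ae (hG.coeFn_toLp.mono fun z hz => ?_)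
    simp [hz, mul_comm]
  have hi : Integrable (fun z => V z * G z)
      (volume.restrict (Ioo (0 : ℝ) 1 ×ˢ Ioo (0 : ℝ) T)) := (Lp.memLp V).integrable_mul hG
  have h2 : ∫ z in Ioo (0 : ℝ) 1 ×ˢ Ioo (0 : ℝ) T, V z * G z =
      ∫ t in Ioo 0 T, ∫ y in Ioo (0 : ℝ) 1, V (y, t) * G (y, t) := by
    generalize (V : ℝ × ℝ → ℝ) = W at hi ⊢
    rw [restrict_Q] at hi ⊢
    exact integral_prod_symm _ hi
  rw [h1, h2]
  refine integral_congr_ae (hV.mono fun t ht => integral_congr_ae (ht.mono fun y hy => ?_))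
  simp only [hy]

theorem IsRep.inner_eq {T : ℝ} {v : ℝ → L2} {V : LQ T} (hV : IsRep T v V) (G : LQ T) :
    inner ℝ V G = ∫ t in Ioo 0 T, ∫ y in Ioo (0 : ℝ) 1, v t y * G (y, t) := by
  rw [hV.integral_mul (Lp.memLp G), Lp.toLp_coeFn]

theorem IsRep.norm_sq {T : ℝ} {v : ℝ → L2} {V : LQ T} (hV : IsRep T v V) :
    ‖V‖ ^ 2 = ∫ t in Ioo 0 T, ‖v t‖ ^ 2 := by
  rw [← real_inner_self_eq_norm_sq, hV.inner_eq]
  refine integral_congr_ae (hV.mono fun t ht => ?_)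
  simp only
  rw [← real_inner_self_eq_norm_sq, inner_Lp_eq]
  exact integral_congr_ae (ht.mono fun y hy => by simp only [hy])

theorem exists_isRep (T : ℝ) {v : ℝ → L2} (hv : Continuous v) : ∃ V : LQ T, IsRep T v V := by
  obtain ⟨V, hVm, hV⟩ := exists_measurable_rep hv
  have hsq : ∀ t, ∫ y in Ioo (0 : ℝ) 1, V (y, t) ^ 2 = ‖v t‖ ^ 2 := fun t => by
    rw [← real_inner_self_eq_norm_sq, inner_Lp_eq]
    exact integral_congr_ae ((hV t).mono fun y hy => by simp only [hy, pow_two])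
  have hmem : MemLp V 2 (volume.restrict (Ioo (0 : ℝ) 1 ×ˢ Ioo (0 : ℝ) T)) := by
    rw [memLp_two_iff_integrable_sq hVm.aestronglyMeasurable, restrict_Q,
      integrable_prod_iff' (hVm.pow_const 2).aestronglyMeasurable]
    constructor
    · refine ae_of_all _ fun t => ?_
      exact (Lp.memLp (v t)).integrable_sq.congr ((hV t).mono fun y hy => by simp only [hy])
    · simp only [norm_pow, Real.norm_eq_abs, sq_abs, hsq]
      have hc : Continuous fun t => ‖v t‖ ^ 2 := by fun_prop
      exact (hc.integrableOn_Icc (a := 0) (b := T)).mono_set Ioo_subset_Icc_self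
  refine ⟨hmem.toLp V, ?_⟩
  filter_upwards [ae_ae_of_ae_Q hmem.coeFn_toLp] with t ht
  exact (hV t).trans (ht.mono fun y hy => hy.symm)

/-- The embedding `C([0,T]; L²(Ω)) → L²(Q)`. -/
theorem exists_iota {T : ℝ} (hT : 0 ≤ T) : ∃ ι : C(Icc (0 : ℝ) T, L2) →L[ℝ] LQ T,
    ∀ f : C(Icc (0 : ℝ) T, L2), IsRep T (IccExtend hT f) (ι f) := by
  have hex : ∀ f : C(Icc (0 : ℝ) T, L2), ∃ V : LQ T, IsRep T (IccExtend hT f) V := fun f =>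
    exists_isRep T (f.continuous.Icc_extend')
  choose g hg using hex
  let ι : C(Icc (0 : ℝ) T, L2) →ₗ[ℝ] LQ T :=
    { toFun := g
      map_add' := fun f h => (hg (f + h)).unique ((hg f).add (hg h))
      map_smul' := fun c f => (hg (c • f)).unique ((hg f).smul c) }
  refine ⟨ι.mkContinuous (Real.sqrt T) fun f => ?_, fun f => hg f⟩
  refine abs_le_of_sq_le_sq' ?_ (by positivity) |>.2
  change ‖g f‖ ^ 2 ≤ _
  rw [(hg f).norm_sq, mul_pow, Real.sq_sqrt hT]
  have hc : Continuous fun t => ‖IccExtend hT f t‖ ^ 2 :=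
    (f.continuous.Icc_extend').norm.pow 2
  calc ∫ t in Ioo 0 T, ‖IccExtend hT f t‖ ^ 2 ≤ ∫ t in Ioo 0 T, ‖f‖ ^ 2 := by
        refine setIntegral_mono_on ((hc.integrableOn_Icc (a := 0) (b := T)).mono_set
          Ioo_subset_Icc_self) (by simp) measurableSet_Ioo fun t _ => ?_
        gcongr
        exact f.norm_coe_le_norm _
    _ = T * ‖f‖ ^ 2 := by simp [hT]

/-! ### Smooth functions as curves in `L²` -/

theorem continuous_bL {c : ℝ} {X : Type*} [TopologicalSpace X] [FirstCountableTopology X]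
    [LocallyCompactSpace X] {G : X → ℝ → ℝ} (hG : Continuous (Function.uncurry G)) :
    Continuous fun s => bL c (G s) := by
  have hm : ∀ s, MemLp (G s) 2 (volume.restrict (Ioo (0 : ℝ) c)) := fun s =>
    memLp_Ioo_of_continuous (hG.comp (by fun_prop : Continuous fun x => (s, x)))
  rw [continuous_iff_continuousAt]
  intro s
  rw [ContinuousAt, tendsto_iff_norm_sub_tendsto_zero, Metric.tendsto_nhds]
  intro ε hε
  have hU := (isCompact_Icc (a := (0 : ℝ)) (b := c)).mem_uniformity_of_prod
    (f := fun s x => G s x) (q := s) (s := univ) hG.continuousOn (mem_univ _)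
    (Metric.dist_mem_uniformity (show 0 < ε / (Real.sqrt |c| + 1) by positivity))
  obtain ⟨v, hv, hvs⟩ := hU
  rw [nhdsWithin_univ] at hv
  filter_upwards [hv] with s' hs'
  rw [dist_zero_right, norm_norm, ← bL_sub (hm s') (hm s)]
  refine (norm_bL_le (C := ε / (Real.sqrt |c| + 1)) ((hm s').sub (hm s)) (by positivity)
    fun x hx => (hvs s' hs' x (Ioo_subset_Icc_self hx)).le).trans_lt ?_
  rw [mul_div_assoc', div_lt_iff₀ (by positivity)]
  nlinarith [Real.sqrt_nonneg |c|]

/-- A smooth function of `(x,t)` is a differentiable curve in `L²(0,c)`. -/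
theorem hasDerivAt_bL {c : ℝ} {G G' : ℝ → ℝ → ℝ} (hG : Continuous (Function.uncurry G))
    (hG' : Continuous (Function.uncurry G')) (hd : ∀ s x, HasDerivAt (fun s => G s x) (G' s x) s)
    (s : ℝ) : HasDerivAt (fun s => bL c (G s)) (bL c (G' s)) s := by
  have hm : ∀ s, MemLp (G s) 2 (volume.restrict (Ioo (0 : ℝ) c)) := fun s =>
    memLp_Ioo_of_continuous (hG.comp (by fun_prop : Continuous fun x => (s, x)))
  have hm' : ∀ s, MemLp (G' s) 2 (volume.restrict (Ioo (0 : ℝ) c)) := fun s =>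
    memLp_Ioo_of_continuous (hG'.comp (by fun_prop : Continuous fun x => (s, x)))
  rw [hasDerivAt_iff_isLittleO, Asymptotics.isLittleO_iff]
  intro ε hε
  set ε' := ε / (Real.sqrt |c| + 1) with hε'
  have hε'0 : 0 < ε' := by positivity
  obtain ⟨v, hv, hvs⟩ := (isCompact_Icc (a := (0 : ℝ)) (b := c)).mem_uniformity_of_prod
    (f := fun s x => G' s x) (q := s) (s := univ) hG'.continuousOn (mem_univ _)
    (Metric.dist_mem_uniformity hε'0)
  rw [nhdsWithin_univ] at hv
  obtain ⟨d, hd0, hball⟩ := Metric.mem_nhds_iff.1 hv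
  filter_upwards [Metric.ball_mem_nhds s hd0] with s' hs'
  have hm1 : MemLp (fun x => G s' x - G s x) 2 (volume.restrict (Ioo (0 : ℝ) c)) :=
    (hm s').sub (hm s)
  rw [← bL_sub (hm s') (hm s), ← bL_const_mul _ (hm' s), ← bL_sub hm1 ((hm' s).const_mul _)]
  have hpt : ∀ x ∈ Ioo 0 c, |G s' x - G s x - (s' - s) * G' s x| ≤ ε' * ‖s' - s‖ := by
    intro x hx
    have h := (convex_ball s d).norm_image_sub_le_of_norm_hasDerivWithin_le
      (f := fun r => G r x - r * G' s x) (f' := fun r => G' r x - G' s x) (C := ε')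
      (fun r _ => by
        have h := (hd r x).fun_sub ((hasDerivAt_id r).mul_const (G' s x))
        simp only [id, one_mul] at h
        exact h.hasDerivWithinAt)
      (fun r hr => (hvs r (hball hr) x (Ioo_subset_Icc_self hx)).le)
      (Metric.mem_ball_self hd0) hs'
    rw [Real.norm_eq_abs] at h
    convert h using 2; ring
  refine (norm_bL_le (hm1.sub ((hm' s).const_mul _)) (by positivity) hpt).trans ?_
  have h2 : Real.sqrt |c| * ε' ≤ ε := by
    rw [hε', mul_div_assoc', div_le_iff₀ (by positivity)]
    nlinarith [Real.sqrt_nonneg |c|]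
  calc _ = (Real.sqrt |c| * ε') * ‖s' - s‖ := by ring
    _ ≤ _ := by gcongr

/-! ### Partial derivatives -/

/-- The partial derivative in the first variable. -/
def pd1 (F : ℝ × ℝ → ℝ) (z : ℝ × ℝ) : ℝ := fderiv ℝ F z (1, 0)

/-- The partial derivative in the second variable. -/
def pd2 (F : ℝ × ℝ → ℝ) (z : ℝ × ℝ) : ℝ := fderiv ℝ F z (0, 1)

theorem contDiff_pd1 {F : ℝ × ℝ → ℝ} (hF : ContDiff ℝ ∞ F) : ContDiff ℝ ∞ (pd1 F) :=
  (hF.fderiv_right (m := ∞) (by simp)).clm_apply contDiff_const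

theorem contDiff_pd2 {F : ℝ × ℝ → ℝ} (hF : ContDiff ℝ ∞ F) : ContDiff ℝ ∞ (pd2 F) :=
  (hF.fderiv_right (m := ∞) (by simp)).clm_apply contDiff_const

theorem pd1_pd2_comm {F : ℝ × ℝ → ℝ} (hF : ContDiff ℝ ∞ F) : pd1 (pd2 F) = pd2 (pd1 F) := by
  funext z
  have hd : DifferentiableAt ℝ (fderiv ℝ F) z :=
    (hF.fderiv_right (m := ∞) (by simp)).differentiable (by simp) z
  have h1 : ∀ v w : ℝ × ℝ, fderiv ℝ (fun z => fderiv ℝ F z v) z w = fderiv ℝ (fderiv ℝ F) z w v :=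
    fun v w => by
      rw [fderiv_clm_apply hd (differentiableAt_const v)]
      simp
  have hs : IsSymmSndFDerivAt ℝ F z := (contDiff_infty.1 hF 2).contDiffAt.isSymmSndFDerivAt (by simp)
  change fderiv ℝ (fun z => fderiv ℝ F z (0, 1)) z (1, 0)
    = fderiv ℝ (fun z => fderiv ℝ F z (1, 0)) z (0, 1)
  rw [h1, h1]
  exact hs (1, 0) (0, 1)

theorem hasDerivAt_comp2 {F : ℝ × ℝ → ℝ} (hF : ContDiff ℝ ∞ F) {a b : ℝ → ℝ} {a' b' s : ℝ}
    (ha : HasDerivAt a a' s) (hb : HasDerivAt b b' s) :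
    HasDerivAt (fun s => F (a s, b s)) (a' * pd1 F (a s, b s) + b' * pd2 F (a s, b s)) s := by
  have h1 : HasFDerivAt F (fderiv ℝ F (a s, b s)) (a s, b s) :=
    ((hF.differentiable (by simp)) _).hasFDerivAt
  have h2 := h1.comp_hasDerivAt s (ha.prodMk hb)
  have e : ((a', b') : ℝ × ℝ) = a' • (1, 0) + b' • (0, 1) := by simp
  rw [e, map_add, map_smul, map_smul] at h2
  exact h2

theorem hasDerivAt_fst {F : ℝ × ℝ → ℝ} (hF : ContDiff ℝ ∞ F) (x t : ℝ) :
    HasDerivAt (fun x => F (x, t)) (pd1 F (x, t)) x := by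
  simpa using hasDerivAt_comp2 hF (hasDerivAt_id x) (hasDerivAt_const x t)

theorem hasDerivAt_snd {F : ℝ × ℝ → ℝ} (hF : ContDiff ℝ ∞ F) (x t : ℝ) :
    HasDerivAt (fun t => F (x, t)) (pd2 F (x, t)) t := by
  simpa using hasDerivAt_comp2 hF (hasDerivAt_const t x) (hasDerivAt_id t)

/-! ### Characteristic coordinates -/

theorem hasDerivAt_alpha (k t : ℝ) : HasDerivAt (alpha k) k t := by
  have h := ((hasDerivAt_id t).const_mul k).const_add 1
  simp only [mul_one] at h
  exact h

theorem alpha_pos {k t : ℝ} (hk : 0 < k) (ht : 0 ≤ t) : 0 < alpha k t := by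
  unfold alpha; positivity

theorem one_le_alpha {k t : ℝ} (hk : 0 < k) (ht : 0 ≤ t) : 1 ≤ alpha k t := by
  unfold alpha; nlinarith

theorem contDiff_alpha (k : ℝ) : ContDiff ℝ ∞ (alpha k) := by unfold alpha; fun_prop

/-- The characteristic coordinates `(a,b) = (α_k(t)(1 + ky), α_k(t)(1 - ky))`. -/
def char (k : ℝ) (z : ℝ × ℝ) : ℝ × ℝ := (alpha k z.2 * (1 + k * z.1), alpha k z.2 * (1 - k * z.1))

theorem contDiff_char (k : ℝ) : ContDiff ℝ ∞ (char k) := by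
  unfold char alpha; fun_prop

theorem waveOp_eq (k : ℝ) {φ : ℝ → ℝ → ℝ} (hφ : ContDiff ℝ ∞ (Function.uncurry φ)) (y t : ℝ) :
    waveOp k φ y t = pd2 (pd2 (Function.uncurry φ)) (y, t)
      - ((1 - k ^ 2 * y ^ 2) / alpha k t / alpha k t * pd1 (pd1 (Function.uncurry φ)) (y, t)
        - 2 * k ^ 2 * y / alpha k t / alpha k t * pd1 (Function.uncurry φ) (y, t))
      - 2 * k * y / alpha k t * pd1 (pd2 (Function.uncurry φ)) (y, t) := by
  have e1 : ∀ x s, deriv (fun r => φ x r) s = pd2 (Function.uncurry φ) (x, s) := fun x s =>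
    (hasDerivAt_snd hφ x s).deriv
  have e2 : ∀ x s, deriv (fun z => φ z s) x = pd1 (Function.uncurry φ) (x, s) := fun x s =>
    (hasDerivAt_fst hφ x s).deriv
  simp only [waveOp, opL, e1, e2]
  have e3 := (hasDerivAt_snd (contDiff_pd2 hφ) y t).deriv
  have e4 := (hasDerivAt_fst (contDiff_pd2 hφ) y t).deriv
  have h5 : HasDerivAt (fun x => beta k x t / alpha k t) (-(2 * k ^ 2 * y) / alpha k t / alpha k t)
      y := by
    unfold beta
    have := ((((hasDerivAt_id y).pow 2).const_mul (k ^ 2)).const_sub 1).div_const (alpha k t)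
      |>.div_const (alpha k t)
    refine this.congr_deriv ?_
    simp; ring
  have e5 := (h5.mul (hasDerivAt_fst (contDiff_pd1 hφ) y t)).deriv
  have e6 : deriv (fun x => beta k x t / alpha k t * pd1 (Function.uncurry φ) (x, t)) y = _ := e5
  rw [e3, e4, e6]
  unfold beta gamma
  ring

theorem hasDerivAt_char_fst {k : ℝ} {ψ : ℝ × ℝ → ℝ} (hψ : ContDiff ℝ ∞ ψ) (y t : ℝ) : HasDerivAt (fun y => ψ (char k (y, t)))
    (k * alpha k t * (pd1 ψ (char k (y, t)) - pd2 ψ (char k (y, t)))) y := by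
  have h1 : HasDerivAt (fun y => alpha k t * (1 + k * y)) (alpha k t * k) y := by
    simpa using (((hasDerivAt_id y).const_mul k).const_add 1).const_mul (alpha k t)
  have h2 : HasDerivAt (fun y => alpha k t * (1 - k * y)) (alpha k t * (-k)) y := by
    simpa using (((hasDerivAt_id y).const_mul k).const_sub 1).const_mul (alpha k t)
  refine (hasDerivAt_comp2 hψ h1 h2).congr_deriv ?_
  simp only [char]; ring

theorem hasDerivAt_char_snd {k : ℝ} {ψ : ℝ × ℝ → ℝ} (hψ : ContDiff ℝ ∞ ψ) (y t : ℝ) : HasDerivAt (fun t => ψ (char k (y, t)))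
    (k * ((1 + k * y) * pd1 ψ (char k (y, t)) + (1 - k * y) * pd2 ψ (char k (y, t)))) t := by
  refine (hasDerivAt_comp2 hψ ((hasDerivAt_alpha k t).mul_const (1 + k * y))
    ((hasDerivAt_alpha k t).mul_const (1 - k * y))).congr_deriv ?_
  simp only [char]; ring

theorem pd1_comp_char {k : ℝ} {ψ : ℝ × ℝ → ℝ} (hψ : ContDiff ℝ ∞ ψ) (y t : ℝ) : pd1 (fun z => ψ (char k z)) (y, t) =
    k * alpha k t * (pd1 ψ (char k (y, t)) - pd2 ψ (char k (y, t))) :=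
  (hasDerivAt_fst (hψ.comp (contDiff_char k)) y t).unique (hasDerivAt_char_fst hψ y t)

theorem pd2_comp_char {k : ℝ} {ψ : ℝ × ℝ → ℝ} (hψ : ContDiff ℝ ∞ ψ) (y t : ℝ) : pd2 (fun z => ψ (char k z)) (y, t) =
    k * ((1 + k * y) * pd1 ψ (char k (y, t)) + (1 - k * y) * pd2 ψ (char k (y, t))) :=
  (hasDerivAt_snd (hψ.comp (contDiff_char k)) y t).unique (hasDerivAt_char_snd hψ y t)

/-- In characteristic coordinates the wave operator is `4k² ∂_a ∂_b`. -/
theorem waveOp_comp_char {k : ℝ} {ψ : ℝ × ℝ → ℝ} (hψ : ContDiff ℝ ∞ ψ) {y t : ℝ} (ht : alpha k t ≠ 0) :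
    waveOp k (fun y t => ψ (char k (y, t))) y t = 4 * k ^ 2 * pd2 (pd1 ψ) (char k (y, t)) := by
  have hΦ : ContDiff ℝ ∞ fun z => ψ (char k z) := hψ.comp (contDiff_char k)
  have hu : Function.uncurry (fun y t => ψ (char k (y, t))) = fun z => ψ (char k z) := by
    funext ⟨y, t⟩; rfl
  rw [waveOp_eq k (by rw [hu]; exact hΦ), hu]
  have f1 : ∀ y t, pd1 (fun z => ψ (char k z)) (y, t) = _ := pd1_comp_char hψ
  have f2 : ∀ y t, pd2 (fun z => ψ (char k z)) (y, t) = _ := pd2_comp_char hψ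
  have a1 := hasDerivAt_char_fst (k := k) (contDiff_pd1 hψ) y t
  have a2 := hasDerivAt_char_fst (k := k) (contDiff_pd2 hψ) y t
  have b1 := hasDerivAt_char_snd (k := k) (contDiff_pd1 hψ) y t
  have b2 := hasDerivAt_char_snd (k := k) (contDiff_pd2 hψ) y t
  have g11 : pd1 (pd1 fun z => ψ (char k z)) (y, t) = _ :=
    (hasDerivAt_fst (contDiff_pd1 hΦ) y t).unique
      (((a1.sub a2).const_mul (k * alpha k t)).congr_of_eventuallyEq
        (Eventually.of_forall fun y => f1 y t))
  have c1 : HasDerivAt (fun y : ℝ => 1 + k * y) k y := by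
    simpa using ((hasDerivAt_id y).const_mul k).const_add 1
  have c2 : HasDerivAt (fun y : ℝ => 1 - k * y) (-k) y := by
    simpa using ((hasDerivAt_id y).const_mul k).const_sub 1
  have g12 : pd1 (pd2 fun z => ψ (char k z)) (y, t) = _ :=
    (hasDerivAt_fst (contDiff_pd2 hΦ) y t).unique
      ((((c1.mul a1).add (c2.mul a2)).const_mul k).congr_of_eventuallyEq
        (Eventually.of_forall fun y => f2 y t))
  have g22 : pd2 (pd2 fun z => ψ (char k z)) (y, t) = _ :=
    (hasDerivAt_snd (contDiff_pd2 hΦ) y t).unique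
      ((((b1.const_mul (1 + k * y)).add (b2.const_mul (1 - k * y))).const_mul k
        ).congr_of_eventuallyEq (Eventually.of_forall fun t => f2 y t))
  rw [g11, g12, g22, f1, pd1_pd2_comm hψ]
  field_simp
  ring

/-- The image of `Q` in characteristic coordinates. -/
def charRegion (k T : ℝ) : Set (ℝ × ℝ) :=
  {z | z.2 < z.1 ∧ (1 - k) * z.1 < (1 + k) * z.2 ∧ 2 < z.1 + z.2 ∧ z.1 + z.2 < 2 * alpha k T}

/-- The inverse of `char k`. -/
def charInv (k : ℝ) (z : ℝ × ℝ) : ℝ × ℝ :=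
  ((z.1 - z.2) / (k * (z.1 + z.2)), ((z.1 + z.2) / 2 - 1) / k)

theorem charInv_char {k : ℝ} (hk : 0 < k) {z : ℝ × ℝ} (hz : alpha k z.2 ≠ 0) :
    charInv k (char k z) = z := by
  have h1 : alpha k z.2 * (1 + k * z.1) + alpha k z.2 * (1 - k * z.1) = 2 * alpha k z.2 := by ring
  have h2 : alpha k z.2 * (1 + k * z.1) - alpha k z.2 * (1 - k * z.1) = 2 * alpha k z.2 * k * z.1 := by
    ring
  ext
  · simp only [charInv, char, h1, h2]; field_simp
  · simp only [charInv, char, h1]; unfold alpha; field_simp; ring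

theorem alpha_charInv {k : ℝ} (hk : 0 < k) (z : ℝ × ℝ) :
    alpha k (charInv k z).2 = (z.1 + z.2) / 2 := by
  simp only [charInv, alpha]; field_simp; ring

theorem char_charInv {k : ℝ} (hk : 0 < k) {z : ℝ × ℝ} (hz : z.1 + z.2 ≠ 0) :
    char k (charInv k z) = z := by
  ext
  · simp only [char, alpha_charInv hk]; simp only [charInv]; field_simp; ring
  · simp only [char, alpha_charInv hk]; simp only [charInv]; field_simp; ring

/-- The four inequalities of `charRegion` are, in this order, y > 0, y < 1, t > 0 and t < T. -/
theorem char_mem_iff {k T : ℝ} (hk : 0 < k) {z : ℝ × ℝ} (hz : 0 < alpha k z.2) :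
    char k z ∈ charRegion k T ↔ z ∈ Ioo (0 : ℝ) 1 ×ˢ Ioo 0 T := by
  simp only [char, charRegion, mem_ofPred_eq, mem_prod, mem_Ioo]
  have e1 : alpha k z.2 * (1 - k * z.1) < alpha k z.2 * (1 + k * z.1) ↔ 0 < z.1 := by
    rw [mul_lt_mul_iff_right₀ hz]
    constructor
    · intro h; nlinarith
    · intro h; nlinarith
  have e2 : (1 - k) * (alpha k z.2 * (1 + k * z.1)) < (1 + k) * (alpha k z.2 * (1 - k * z.1)) ↔
      z.1 < 1 := by
    have : (1 + k) * (alpha k z.2 * (1 - k * z.1)) - (1 - k) * (alpha k z.2 * (1 + k * z.1))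
      = 2 * k * alpha k z.2 * (1 - z.1) := by ring
    rw [← sub_pos, this, mul_pos_iff_of_pos_left (by positivity), sub_pos]
  have e3 : alpha k z.2 * (1 + k * z.1) + alpha k z.2 * (1 - k * z.1) = 2 * alpha k z.2 := by ring
  rw [e1, e2, e3]
  have e4 : 2 < 2 * alpha k z.2 ↔ 0 < z.2 := by
    unfold alpha
    constructor
    · intro h; by_contra h'; nlinarith
    · intro h; nlinarith
  have e5 : 2 * alpha k z.2 < 2 * alpha k T ↔ z.2 < T := by
    unfold alpha
    constructor
    · intro h; by_contra h'; nlinarith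
    · intro h; nlinarith
  rw [e4, e5]; tauto

theorem char_image {k : ℝ} (hk : 0 < k) (T : ℝ) :
    char k '' (Ioo (0 : ℝ) 1 ×ˢ Ioo 0 T) = charRegion k T := by
  ext z
  constructor
  · rintro ⟨w, hw, rfl⟩
    exact (char_mem_iff hk (alpha_pos hk hw.2.1.le)).2 hw
  · intro hz
    have hs : 2 < z.1 + z.2 := hz.2.2.1
    have h1 : char k (charInv k z) = z := char_charInv hk (by linarith)
    refine ⟨charInv k z, (char_mem_iff (T := T) hk ?_).1 (by rwa [h1]), h1⟩
    rw [alpha_charInv hk]; linarith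

theorem isOpen_charRegion (k T : ℝ) : IsOpen (charRegion k T) := by
  have h1 : IsOpen {z : ℝ × ℝ | z.2 < z.1} := isOpen_lt (by fun_prop) (by fun_prop)
  have h2 : IsOpen {z : ℝ × ℝ | (1 - k) * z.1 < (1 + k) * z.2} :=
    isOpen_lt (by fun_prop) (by fun_prop)
  have h3 : IsOpen {z : ℝ × ℝ | 2 < z.1 + z.2} := isOpen_lt (by fun_prop) (by fun_prop)
  have h4 : IsOpen {z : ℝ × ℝ | z.1 + z.2 < 2 * alpha k T} := isOpen_lt (by fun_prop) (by fun_prop)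
  exact h1.inter (h2.inter (h3.inter h4))

/-- The derivative of `char k`. -/
def charDeriv (k : ℝ) (z : ℝ × ℝ) : ℝ × ℝ →L[ℝ] ℝ × ℝ :=
  ((k * alpha k z.2) • ContinuousLinearMap.fst ℝ ℝ ℝ
      + (k * (1 + k * z.1)) • ContinuousLinearMap.snd ℝ ℝ ℝ).prod
    ((-(k * alpha k z.2)) • ContinuousLinearMap.fst ℝ ℝ ℝ
      + (k * (1 - k * z.1)) • ContinuousLinearMap.snd ℝ ℝ ℝ)

theorem hasFDerivAt_char (k : ℝ) (z : ℝ × ℝ) : HasFDerivAt (char k) (charDeriv k z) z := by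
  have h2 : HasFDerivAt (fun z : ℝ × ℝ => alpha k z.2) (k • ContinuousLinearMap.snd ℝ ℝ ℝ) z := by
    have := (hasDerivAt_alpha k z.2).comp_hasFDerivAt z (hasFDerivAt_snd (𝕜 := ℝ) (p := z))
    exact this
  have h1 : HasFDerivAt (fun z : ℝ × ℝ => k * z.1) (k • ContinuousLinearMap.fst ℝ ℝ ℝ) z :=
    (hasFDerivAt_fst (𝕜 := ℝ) (p := z)).const_mul k
  refine ((h2.mul (h1.const_add 1)).prodMk (h2.mul (h1.const_sub 1))).congr_fderiv ?_
  ext <;> simp [charDeriv] <;> ring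

theorem det_charDeriv (k : ℝ) (z : ℝ × ℝ) :
    (charDeriv k z).det = 2 * k ^ 2 * alpha k z.2 := by
  let b := Module.Basis.finTwoProd ℝ
  have : (charDeriv k z).det = LinearMap.det (charDeriv k z : ℝ × ℝ →ₗ[ℝ] ℝ × ℝ) := rfl
  rw [this, ← LinearMap.det_toMatrix b, Matrix.det_fin_two]
  simp [b, LinearMap.toMatrix_apply, charDeriv]
  ring

theorem injOn_char {k : ℝ} (hk : 0 < k) (T : ℝ) : InjOn (char k) (Ioo (0 : ℝ) 1 ×ˢ Ioo 0 T) := by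
  intro z hz w hw h
  rw [← charInv_char hk (alpha_pos hk hz.2.1.le).ne', h, charInv_char hk (alpha_pos hk hw.2.1.le).ne']

/-- Change of variables to characteristic coordinates. -/
theorem integral_charRegion {k : ℝ} (hk : 0 < k) (T : ℝ) (g : ℝ × ℝ → ℝ) :
    ∫ z in charRegion k T, g z =
      ∫ z in Ioo (0 : ℝ) 1 ×ˢ Ioo 0 T, 2 * k ^ 2 * alpha k z.2 * g (char k z) := by
  have hQ : MeasurableSet (Ioo (0 : ℝ) 1 ×ˢ Ioo 0 T) := measurableSet_Ioo.prod measurableSet_Ioo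
  rw [← char_image hk, integral_image_eq_integral_abs_det_fderiv_smul volume hQ
    (fun z _ => (hasFDerivAt_char k z).hasFDerivWithinAt) (injOn_char hk T)]
  refine setIntegral_congr_fun hQ fun z hz => ?_
  have := alpha_pos hk hz.2.1.le
  simp only [det_charDeriv, smul_eq_mul]
  rw [abs_of_pos (by positivity)]

theorem integrableOn_charRegion {k : ℝ} (hk : 0 < k) (T : ℝ) (g : ℝ × ℝ → ℝ) :
    IntegrableOn g (charRegion k T) ↔
      IntegrableOn (fun z => 2 * k ^ 2 * alpha k z.2 * g (char k z)) (Ioo (0 : ℝ) 1 ×ˢ Ioo 0 T) := by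
  have hQ : MeasurableSet (Ioo (0 : ℝ) 1 ×ˢ Ioo 0 T) := measurableSet_Ioo.prod measurableSet_Ioo
  rw [← char_image hk, integrableOn_image_iff_integrableOn_abs_det_fderiv_smul volume hQ
    (fun z _ => (hasFDerivAt_char k z).hasFDerivWithinAt) (injOn_char hk T)]
  refine integrableOn_congr_fun (fun z hz => ?_) hQ
  have := alpha_pos hk hz.2.1.le
  simp only [det_charDeriv, smul_eq_mul]
  rw [abs_of_pos (by positivity)]

/-! ### Density of products of functions of the characteristic coordinates -/

/-- Bumps equal to one on the inner interval, with outer radius shrinking to ε. The limit is the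
indicator at every point, so dominated convergence reaches integrals over boxes. -/
theorem exists_smooth_approx_Icc (x : ℝ) {ε δ : ℝ} (hε : 0 < ε) (hεδ : ε < δ) :
    ∃ h : ℕ → ℝ → ℝ, (∀ n, ContDiff ℝ ∞ (h n)) ∧ (∀ n y, |h n y| ≤ 1) ∧
      (∀ n y, y ∉ Icc (x - δ) (x + δ) → h n y = 0) ∧
      ∀ y, Tendsto (fun n => h n y) atTop (𝓝 (indicator (Icc (x - ε) (x + ε)) 1 y)) := by
  let c : ℕ → ℝ := fun n => (δ - ε) / ((n : ℝ) + 1)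
  have hc0 : ∀ n, 0 < c n := fun n => div_pos (by linarith) (by positivity)
  have hc1 : ∀ n, c n ≤ δ - ε := fun n => div_le_self (by linarith) (by linarith [n.cast_nonneg (α := ℝ)])
  have hct : Tendsto c atTop (𝓝 0) := by
    have := (tendsto_one_div_add_atTop_nhds_zero_nat (𝕜 := ℝ)).const_mul (δ - ε)
    simpa [c, div_eq_mul_inv] using this
  let B : ∀ _ : ℕ, ContDiffBump (x : ℝ) := fun n => ⟨ε, ε + c n, hε, by linarith [hc0 n]⟩
  refine ⟨fun n => B n, fun n => (B n).contDiff, fun n y => ?_, fun n y hy => ?_, fun y => ?_⟩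
  · rw [abs_of_nonneg (B n).nonneg]; exact (B n).le_one
  · refine (B n).zero_of_le_dist ?_
    rw [← Real.closedBall_eq_Icc, Metric.mem_closedBall, not_le] at hy
    change ε + c n ≤ _
    linarith [hc1 n]
  · by_cases hy : y ∈ Icc (x - ε) (x + ε)
    · rw [indicator_of_mem hy]
      refine tendsto_const_nhds.congr fun n => ?_
      rw [← Real.closedBall_eq_Icc] at hy
      exact ((B n).one_of_mem_closedBall hy).symm
    · rw [indicator_of_notMem hy]
      rw [← Real.closedBall_eq_Icc, Metric.mem_closedBall, not_le] at hy
      refine tendsto_const_nhds.congr' ?_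
      filter_upwards [hct.eventually_lt_const (sub_pos.2 hy)] with n hn
      refine ((B n).zero_of_le_dist ?_).symm
      change ε + c n ≤ _
      linarith

/-- A function on an open subset of the plane that is orthogonal to all products of smooth
functions supported in small squares vanishes. -/
theorem ae_eq_zero_of_integral_prod {U : Set (ℝ × ℝ)} (hU : IsOpen U) {g : ℝ × ℝ → ℝ}
    (hg : IntegrableOn g U)
    (h : ∀ (a₁ a₂ b₁ b₂ : ℝ) (h₁ h₂ : ℝ → ℝ), Icc a₁ a₂ ×ˢ Icc b₁ b₂ ⊆ U → a₁ < a₂ → b₁ < b₂ →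
      ContDiff ℝ ∞ h₁ → ContDiff ℝ ∞ h₂ → (∀ x, x ∉ Icc a₁ a₂ → h₁ x = 0) →
      (∀ x, x ∉ Icc b₁ b₂ → h₂ x = 0) → ∫ z in U, g z * (h₁ z.1 * h₂ z.2) = 0) :
    ∀ᵐ z ∂volume.restrict U, g z = 0 := by
  -- Balls of the product metric are squares, so their indicators are bounded limits of admissible
  -- products.
  have hball : ∀ (z : ℝ × ℝ) (ε δ : ℝ), 0 < ε → ε < δ → Metric.closedBall z δ ⊆ U →
      ∫ w in Metric.closedBall z ε, indicator U g w = 0 := by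
    intro z ε δ hε hεδ hsub
    obtain ⟨f₁, s₁, m₁, z₁, t₁⟩ := exists_smooth_approx_Icc z.1 hε hεδ
    obtain ⟨f₂, s₂, m₂, z₂, t₂⟩ := exists_smooth_approx_Icc z.2 hε hεδ
    have hbox : ∀ ρ, Metric.closedBall z ρ = Icc (z.1 - ρ) (z.1 + ρ) ×ˢ Icc (z.2 - ρ) (z.2 + ρ) := by
      intro ρ
      rw [← closedBall_prod_same, Real.closedBall_eq_Icc, Real.closedBall_eq_Icc]
    have hlim : Tendsto (fun n => ∫ w in U, g w * (f₁ n w.1 * f₂ n w.2)) atTop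
        (𝓝 (∫ w in U, indicator (Metric.closedBall z ε) g w)) := by
      refine tendsto_integral_of_dominated_convergence (fun w => |g w|) (fun n => ?_) hg.norm
        (fun n => ae_of_all _ fun w => ?_) (ae_of_all _ fun w => ?_)
      · refine hg.aestronglyMeasurable.mul ?_
        exact ((((s₁ n).continuous.comp continuous_fst).mul
          ((s₂ n).continuous.comp continuous_snd)).aestronglyMeasurable)
      · rw [norm_mul, Real.norm_eq_abs, Real.norm_eq_abs, abs_mul]
        exact mul_le_of_le_one_right (abs_nonneg _)
          (mul_le_one₀ (m₁ n _) (abs_nonneg _) (m₂ n _))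
      · have := ((t₁ w.1).mul (t₂ w.2)).const_mul (g w)
        convert this using 2
        rw [hbox]
        by_cases h1 : w.1 ∈ Icc (z.1 - ε) (z.1 + ε) <;> by_cases h2 : w.2 ∈ Icc (z.2 - ε) (z.2 + ε)
        all_goals simp only [indicator, mem_prod, h1, h2]; simp
    have hzero : ∀ n, ∫ w in U, g w * (f₁ n w.1 * f₂ n w.2) = 0 := fun n =>
      h _ _ _ _ _ _ (by rw [← hbox]; exact hsub) (by linarith) (by linarith) (s₁ n) (s₂ n)
        (z₁ n) (z₂ n)
    simp only [hzero] at hlim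
    have h0 := tendsto_nhds_unique hlim tendsto_const_nhds
    rw [← h0, setIntegral_indicator measurableSet_closedBall, setIntegral_indicator hU.measurableSet,
      inter_comm]
  have hint : Integrable (indicator U g) := (integrable_indicator_iff hU.measurableSet).2 hg
  -- Lebesgue differentiation: the averages over small squares vanish, and they converge to g almost
  -- everywhere.
  have hae := IsUnifLocDoublingMeasure.ae_tendsto_average (μ := (volume : Measure (ℝ × ℝ)))
    hint.locallyIntegrable 1
  filter_upwards [ae_restrict_of_ae hae, ae_restrict_mem hU.measurableSet] with z hz hzU
  obtain ⟨δ, hδ, hsub⟩ := Metric.nhds_basis_closedBall.mem_iff.1 (hU.mem_nhds hzU)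
  have hlim : Tendsto (fun n : ℕ => (1 : ℝ) / ((n : ℝ) + 1)) atTop (𝓝[>] 0) :=
    tendsto_nhdsWithin_iff.2 ⟨tendsto_one_div_add_atTop_nhds_zero_nat,
      Eventually.of_forall fun n => by simp only [mem_Ioi]; positivity⟩
  have ht := hz (fun _ : ℕ => z) (fun n : ℕ => (1 : ℝ) / ((n : ℝ) + 1)) hlim
    (Eventually.of_forall fun n => Metric.mem_closedBall_self (by positivity))
  have ht0 : Tendsto (fun n : ℕ => ⨍ y in Metric.closedBall z (1 / ((n : ℝ) + 1)), indicator U g y)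
      atTop (𝓝 0) := by
    refine tendsto_const_nhds.congr' ?_
    filter_upwards [(tendsto_nhdsWithin_iff.1 hlim).1.eventually_lt_const hδ] with n hn
    rw [setAverage_eq, hball z _ δ (by positivity) hn hsub, smul_zero]
  have := tendsto_nhds_unique ht ht0
  rwa [indicator_of_mem hzU] at this

/-- The density statement behind both halves of the adjoint theory: it makes the sources of backward
solutions dense for existence and those of forward solutions dense for uniqueness. -/
theorem LQ_eq_zero {k T : ℝ} (hk : 0 < k) {G : LQ T}
    (h : ∀ (a₁ a₂ b₁ b₂ : ℝ) (h₁ h₂ : ℝ → ℝ), Icc a₁ a₂ ×ˢ Icc b₁ b₂ ⊆ charRegion k T →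
      a₁ < a₂ → b₁ < b₂ → ContDiff ℝ ∞ h₁ → ContDiff ℝ ∞ h₂ → (∀ x, x ∉ Icc a₁ a₂ → h₁ x = 0) →
      (∀ x, x ∉ Icc b₁ b₂ → h₂ x = 0) →
      ∫ z in Ioo (0 : ℝ) 1 ×ˢ Ioo 0 T, G z * (h₁ (char k z).1 * h₂ (char k z).2) = 0) : G = 0 := by
  have hQ : MeasurableSet (Ioo (0 : ℝ) 1 ×ˢ Ioo 0 T) := measurableSet_Ioo.prod measurableSet_Ioo
  -- Division by the Jacobian 2k²α, so that integrals of g over the region are integrals of G over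
  -- Q.
  let g : ℝ × ℝ → ℝ := fun z => G (charInv k z) / (2 * k ^ 2 * alpha k (charInv k z).2)
  have hgG : ∀ z ∈ Ioo (0 : ℝ) 1 ×ˢ Ioo 0 T, 2 * k ^ 2 * alpha k z.2 * g (char k z) = G z := by
    intro z hz
    have ha := alpha_pos hk hz.2.1.le
    simp only [g, charInv_char hk ha.ne']
    field_simp
  have hG : IntegrableOn G (Ioo (0 : ℝ) 1 ×ˢ Ioo 0 T) := by
    have : IsFiniteMeasure ((volume : Measure (ℝ × ℝ)).restrict (Ioo (0 : ℝ) 1 ×ˢ Ioo 0 T)) := by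
      rw [restrict_Q]; infer_instance
    exact (Lp.memLp G).integrable (by norm_num)
  have hgi : IntegrableOn g (charRegion k T) := by
    rw [integrableOn_charRegion hk]
    exact hG.congr_fun (fun z hz => (hgG z hz).symm) hQ
  have hg0 := ae_eq_zero_of_integral_prod (isOpen_charRegion k T) hgi
    fun a₁ a₂ b₁ b₂ h₁ h₂ k1 k2 k3 k4 k5 k6 k7 => by
      refine Eq.trans ?_ (h a₁ a₂ b₁ b₂ h₁ h₂ k1 k2 k3 k4 k5 k6 k7)
      rw [integral_charRegion hk]
      refine setIntegral_congr_fun hQ fun z hz => ?_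
      simp only [← hgG z hz]; ring
  have h1 : ∫ z in Ioo (0 : ℝ) 1 ×ˢ Ioo 0 T, |G z| = 0 := by
    have h2 : ∫ z in charRegion k T, |g z| = 0 := by
      exact integral_eq_zero_of_ae (hg0.mono fun z hz => by simp [hz])
    refine Eq.trans ?_ h2
    rw [integral_charRegion hk]
    refine setIntegral_congr_fun hQ fun z hz => ?_
    have ha := alpha_pos hk hz.2.1.le
    simp only [← hgG z hz, abs_mul]
    rw [abs_of_pos ha, abs_of_pos (by positivity : (2 : ℝ) > 0), abs_of_pos (by positivity : k ^ 2 > 0)]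
  rw [integral_eq_zero_iff_of_nonneg (fun z => abs_nonneg _) hG.abs] at h1
  refine Lp.eq_zero_iff_ae_eq_zero.2 (h1.mono fun z hz => ?_)
  exact abs_eq_zero.1 hz

/-! ### The method of images -/

/-- The ratio `(1+k)/(1-k)` of the characteristic coordinates on the moving boundary. -/
def ratio (k : ℝ) : ℝ := (1 + k) / (1 - k)

theorem one_lt_ratio {k : ℝ} (hk₀ : 0 < k) (hk₁ : k < 1) : 1 < ratio k := by
  rw [ratio, one_lt_div (by linarith)]; linarith

theorem ratio_pos {k : ℝ} (hk₀ : 0 < k) (hk₁ : k < 1) : 0 < ratio k :=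
  zero_lt_one.trans (one_lt_ratio hk₀ hk₁)

theorem ratio_mul {k : ℝ} (hk₁ : k < 1) : (1 - k) * ratio k = 1 + k := by
  rw [ratio, mul_div_cancel₀]; linarith

/-- The sum over the images of a potential under the reflections in the boundaries `a = b` and
`a = ratio k * b`. -/
def img (k : ℝ) (N : ℕ) (Ψ : ℝ × ℝ → ℝ) (z : ℝ × ℝ) : ℝ :=
  ∑ n ∈ Finset.Icc (-(N : ℤ)) N,
    (Ψ (ratio k ^ n * z.1, ratio k ^ (-n) * z.2) - Ψ (ratio k ^ n * z.2, ratio k ^ (-n) * z.1))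

theorem contDiff_img (k : ℝ) (N : ℕ) {Ψ : ℝ × ℝ → ℝ} (hΨ : ContDiff ℝ ∞ Ψ) :
    ContDiff ℝ ∞ (img k N Ψ) := by
  unfold img
  refine ContDiff.sum fun n _ => ContDiff.sub (hΨ.comp ?_) (hΨ.comp ?_) <;> fun_prop

theorem img_swap (k : ℝ) (N : ℕ) (Ψ : ℝ × ℝ → ℝ) (a b : ℝ) : img k N Ψ (a, b) = -img k N Ψ (b, a) := by
  simp only [img, ← Finset.sum_neg_distrib, neg_sub]

theorem img_diag (k : ℝ) (N : ℕ) (Ψ : ℝ × ℝ → ℝ) (b : ℝ) : img k N Ψ (b, b) = 0 := by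
  simp [img]

/-- On the side a = r b the reflected image of index n equals the direct image of index n - 1, so
the sum telescopes to its two outermost terms. For large N these lie beyond the reach of Ψ. -/
theorem img_ratio {k : ℝ} (hk₀ : 0 < k) (hk₁ : k < 1) (N : ℕ) (Ψ : ℝ × ℝ → ℝ) (b : ℝ) :
    img k N Ψ (ratio k * b, b) = Ψ (ratio k ^ (N + 1) * b, (ratio k ^ N)⁻¹ * b)
      - Ψ ((ratio k ^ N)⁻¹ * b, ratio k ^ (N + 1) * b) := by
  have hr : ratio k ≠ 0 := (ratio_pos hk₀ hk₁).ne'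
  let X : ℤ → ℝ := fun n => Ψ (ratio k ^ (n + 1) * b, ratio k ^ (-n) * b)
  have h1 : img k N Ψ (ratio k * b, b) = ∑ n ∈ Finset.Icc (-(N : ℤ)) N, (X n - X (n - 1)) := by
    refine Finset.sum_congr rfl fun n _ => ?_
    have e1 : ratio k ^ n * (ratio k * b) = ratio k ^ (n + 1) * b := by
      rw [zpow_add_one₀ hr]; ring
    have e2 : ratio k ^ (-n) * (ratio k * b) = ratio k ^ (-(n - 1)) * b := by
      rw [show -(n - 1) = -n + 1 by ring, zpow_add_one₀ hr]; ring
    simp only [X, e1, e2, sub_add_cancel]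
  have h2 : ∀ M : ℕ, ∑ n ∈ Finset.Icc (-(M : ℤ)) M, (X n - X (n - 1)) = X M - X (-(M : ℤ) - 1) := by
    intro M
    induction M with
    | zero => simp
    | succ M ih =>
      have e : Finset.Icc (-((M + 1 : ℕ) : ℤ)) ((M + 1 : ℕ) : ℤ) =
          insert (-((M + 1 : ℕ) : ℤ)) (insert ((M + 1 : ℕ) : ℤ) (Finset.Icc (-(M : ℤ)) M)) := by
        ext n; simp only [Finset.mem_Icc, Finset.mem_insert]; omega
      rw [e, Finset.sum_insert (by simp; omega), Finset.sum_insert (by simp), ih]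
      push_cast
      rw [show (M : ℤ) + 1 - 1 = M by ring, show -((M : ℤ) + 1) = -(M : ℤ) - 1 by ring]
      ring
  rw [h1, h2]
  simp only [X]
  congr 3
  · rw [zpow_neg, zpow_natCast]
  · rw [show -(N : ℤ) - 1 + 1 = -(N : ℤ) by ring, zpow_neg, zpow_natCast]
  · rw [show -(-(N : ℤ) - 1) = ((N + 1 : ℕ) : ℤ) by push_cast; ring, zpow_natCast]

theorem pd1_img (k : ℝ) (N : ℕ) {Ψ : ℝ × ℝ → ℝ} (hΨ : ContDiff ℝ ∞ Ψ) (a b : ℝ) :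
    pd1 (img k N Ψ) (a, b) = ∑ n ∈ Finset.Icc (-(N : ℤ)) N,
      (ratio k ^ n * pd1 Ψ (ratio k ^ n * a, ratio k ^ (-n) * b)
        - ratio k ^ (-n) * pd2 Ψ (ratio k ^ n * b, ratio k ^ (-n) * a)) := by
  refine (hasDerivAt_fst (contDiff_img k N hΨ) a b).unique ?_
  refine HasDerivAt.fun_sum fun n _ => HasDerivAt.fun_sub ?_ ?_
  · have := hasDerivAt_comp2 hΨ ((hasDerivAt_id a).const_mul (ratio k ^ n))
      (hasDerivAt_const a (ratio k ^ (-n) * b))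
    simpa using this
  · have := hasDerivAt_comp2 hΨ (hasDerivAt_const a (ratio k ^ n * b))
      ((hasDerivAt_id a).const_mul (ratio k ^ (-n)))
    simpa using this

theorem pd2_img (k : ℝ) (N : ℕ) {Ψ : ℝ × ℝ → ℝ} (hΨ : ContDiff ℝ ∞ Ψ) (a b : ℝ) :
    pd2 (img k N Ψ) (a, b) = -pd1 (img k N Ψ) (b, a) := by
  refine (hasDerivAt_snd (contDiff_img k N hΨ) a b).unique ?_
  have := (hasDerivAt_fst (contDiff_img k N hΨ) b a).fun_neg
  simpa only [← img_swap] using this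

/-- The maps (a, b) ↦ (rⁿa, r⁻ⁿb) preserve mixed derivatives, because the two factors cancel. -/
theorem pd2_pd1_img {k : ℝ} (hk₀ : 0 < k) (hk₁ : k < 1) (N : ℕ) {Ψ : ℝ × ℝ → ℝ}
    (hΨ : ContDiff ℝ ∞ Ψ) (a b : ℝ) :
    pd2 (pd1 (img k N Ψ)) (a, b) = ∑ n ∈ Finset.Icc (-(N : ℤ)) N,
      (pd2 (pd1 Ψ) (ratio k ^ n * a, ratio k ^ (-n) * b)
        - pd2 (pd1 Ψ) (ratio k ^ n * b, ratio k ^ (-n) * a)) := by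
  have hr : ratio k ≠ 0 := (ratio_pos hk₀ hk₁).ne'
  refine (hasDerivAt_snd (contDiff_pd1 (contDiff_img k N hΨ)) a b).unique ?_
  simp only [pd1_img k N hΨ]
  refine HasDerivAt.fun_sum fun n _ => HasDerivAt.fun_sub ?_ ?_
  · have := (hasDerivAt_comp2 (contDiff_pd1 hΨ) (hasDerivAt_const b (ratio k ^ n * a))
      ((hasDerivAt_id b).const_mul (ratio k ^ (-n)))).const_mul (ratio k ^ n)
    refine this.congr_deriv ?_
    rw [zpow_neg]
    have : ratio k ^ n ≠ 0 := zpow_ne_zero n hr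
    simp only [id]; field_simp; ring
  · have := (hasDerivAt_comp2 (contDiff_pd2 hΨ) ((hasDerivAt_id b).const_mul (ratio k ^ n))
      (hasDerivAt_const b (ratio k ^ (-n) * a))).const_mul (ratio k ^ (-n))
    refine this.congr_deriv ?_
    rw [zpow_neg, pd1_pd2_comm hΨ]
    have : ratio k ^ n ≠ 0 := zpow_ne_zero n hr
    simp only [id]; field_simp; ring

/-- Sorts the images: the original, or those with one coordinate stretched at least once by r and
the other shrunk at least once. -/
theorem zpow_trichotomy {r : ℝ} (hr : 1 < r) (n : ℤ) :
    n = 0 ∨ (0 < n ∧ r ≤ r ^ n ∧ r ^ (-n) * r ≤ 1) ∨ (n < 0 ∧ r ≤ r ^ (-n) ∧ r ^ n * r ≤ 1) := by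
  have hr0 : r ≠ 0 := by positivity
  rcases lt_trichotomy n 0 with h | h | h
  · right; right
    refine ⟨h, ?_, ?_⟩
    · calc r = r ^ (1 : ℤ) := (zpow_one r).symm
        _ ≤ _ := zpow_le_zpow_right₀ hr.le (by omega)
    · rw [← zpow_add_one₀ hr0]; exact zpow_le_one_of_nonpos₀ hr.le (by omega)
  · exact Or.inl h
  · right; left
    refine ⟨h, ?_, ?_⟩
    · calc r = r ^ (1 : ℤ) := (zpow_one r).symm
        _ ≤ _ := zpow_le_zpow_right₀ hr.le (by omega)
    · rw [← zpow_add_one₀ hr0]; exact zpow_le_one_of_nonpos₀ hr.le (by omega)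

/-- In the wedge `b < a < ratio k * b` only one image contributes. -/
theorem pd2_pd1_img_eq {k : ℝ} (hk₀ : 0 < k) (hk₁ : k < 1) (N : ℕ) {Ψ : ℝ × ℝ → ℝ}
    (hΨ : ContDiff ℝ ∞ Ψ)
    (hs : ∀ z : ℝ × ℝ, z.1 ≤ z.2 ∨ ratio k * z.2 ≤ z.1 → pd2 (pd1 Ψ) z = 0) {a b : ℝ} (hb : 0 < b)
    (hba : b < a) (hab : a < ratio k * b) :
    pd2 (pd1 (img k N Ψ)) (a, b) = pd2 (pd1 Ψ) (a, b) := by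
  have hr1 := one_lt_ratio hk₀ hk₁
  have hr0 := ratio_pos hk₀ hk₁
  rw [pd2_pd1_img hk₀ hk₁ N hΨ, Finset.sum_eq_single 0]
  · rw [hs (ratio k ^ (0 : ℤ) * b, _) (Or.inl (by simpa using hba.le))]; simp
  · intro n _ hn
    have hp : 0 < ratio k ^ n := zpow_pos hr0 n
    have hm : 0 < ratio k ^ (-n) := zpow_pos hr0 (-n)
    -- For n > 0 the direct and the reflected point satisfy a ≥ r b, for n < 0 they satisfy a ≤ b;
    -- both regions lie outside the open wedge.
    rcases zpow_trichotomy hr1 n with h | ⟨_, h1, h2⟩ | ⟨_, h1, h2⟩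
    · exact absurd h hn
    · rw [hs _ (Or.inr _), hs _ (Or.inr _), sub_zero]
      · change ratio k * (ratio k ^ (-n) * a) ≤ ratio k ^ n * b
        nlinarith [mul_le_mul_of_nonneg_right h2 (hb.trans hba).le,
          mul_le_mul_of_nonneg_right h1 hb.le]
      · change ratio k * (ratio k ^ (-n) * b) ≤ ratio k ^ n * a
        nlinarith [mul_le_mul_of_nonneg_right h2 hb.le, mul_le_mul_of_nonneg_right h1
          (hb.trans hba).le]
    · rw [hs _ (Or.inl _), hs _ (Or.inl _), sub_zero]
      · change ratio k ^ n * b ≤ ratio k ^ (-n) * a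
        nlinarith [mul_le_mul_of_nonneg_right h2 hb.le, mul_le_mul_of_nonneg_right h1
          (hb.trans hba).le]
      · change ratio k ^ n * a ≤ ratio k ^ (-n) * b
        nlinarith [mul_le_mul_of_nonneg_right h2 hb.le, mul_le_mul_of_nonneg_right h1 hb.le,
          mul_lt_mul_of_pos_left hab hp]
  · intro h; exact absurd (Finset.mem_Icc.2 ⟨by omega, by omega⟩) h

/-! ### Backward and forward potentials and the boundary values of their image sums -/

/-- Potentials vanishing in the future of `Q` with mixed derivative supported in `Q`. -/
structure IsBackward (k T : ℝ) (Ψ : ℝ × ℝ → ℝ) : Prop where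
  smooth : ContDiff ℝ ∞ Ψ
  zero_sum : ∀ z : ℝ × ℝ, 2 * alpha k T ≤ z.1 + z.2 → Ψ z = 0
  zero_snd : ∀ z : ℝ × ℝ, alpha k T ≤ z.2 → Ψ z = 0
  zero_fst : ∀ z : ℝ × ℝ, (1 + k) * alpha k T ≤ z.1 → Ψ z = 0
  support : ∀ z, z ∉ charRegion k T → pd2 (pd1 Ψ) z = 0

/-- Potentials vanishing in the past of `Q`. -/
structure IsForward (k : ℝ) (Ψ : ℝ × ℝ → ℝ) : Prop where
  smooth : ContDiff ℝ ∞ Ψ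
  zero_sum : ∀ z : ℝ × ℝ, z.1 + z.2 ≤ 2 → Ψ z = 0
  zero_snd : ∀ z : ℝ × ℝ, z.2 ≤ 1 - k → Ψ z = 0
  zero_fst : ∀ z : ℝ × ℝ, z.1 ≤ 1 → Ψ z = 0

theorem img_char_one {k : ℝ} (hk₀ : 0 < k) (hk₁ : k < 1) (N : ℕ) (Ψ : ℝ × ℝ → ℝ) (t : ℝ) :
    img k N Ψ (char k (1, t)) =
      Ψ (ratio k ^ (N + 1) * (alpha k t * (1 - k)), (ratio k ^ N)⁻¹ * (alpha k t * (1 - k)))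
      - Ψ ((ratio k ^ N)⁻¹ * (alpha k t * (1 - k)), ratio k ^ (N + 1) * (alpha k t * (1 - k))) := by
  have : char k (1, t) = (ratio k * (alpha k t * (1 - k)), alpha k t * (1 - k)) := by
    simp only [char, mul_one, Prod.mk.injEq, and_true]
    rw [← ratio_mul hk₁]; ring
  rw [this, img_ratio hk₀ hk₁]

theorem img_char_zero (k : ℝ) (N : ℕ) (Ψ : ℝ × ℝ → ℝ) (t : ℝ) : img k N Ψ (char k (0, t)) = 0 := by
  have : char k (0, t) = (alpha k t, alpha k t) := by simp [char]
  rw [this, img_diag]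

/-- In each of the two terms left by `img_ratio` the stretched coordinate, at least (1 + k)α(T), is
past the support of Ψ. -/
theorem IsBackward.img_one {k T : ℝ} (hk₀ : 0 < k) (hk₁ : k < 1) {N : ℕ}
    (hN : alpha k (T + 1) ≤ ratio k ^ N) {Ψ : ℝ × ℝ → ℝ} (hΨ : IsBackward k T Ψ) {t : ℝ}
    (ht : 0 ≤ t) (hT : 0 ≤ T) : img k N Ψ (char k (1, t)) = 0 := by
  have h1 := one_le_alpha hk₀ ht
  have h2 : alpha k T ≤ alpha k (T + 1) := by unfold alpha; nlinarith
  have h3 := alpha_pos hk₀ hT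
  have e : ratio k ^ (N + 1) * (alpha k t * (1 - k)) = ratio k ^ N * ((1 + k) * alpha k t) := by
    rw [pow_succ, ← ratio_mul hk₁]; ring
  have h4 : (1 + k) * alpha k T ≤ ratio k ^ N * ((1 + k) * alpha k t) := by
    have h5 : alpha k T * (1 + k) ≤ ratio k ^ N * (1 + k) :=
      mul_le_mul_of_nonneg_right (h2.trans hN) (by linarith)
    have h6 : ratio k ^ N * (1 + k) * 1 ≤ ratio k ^ N * (1 + k) * alpha k t :=
      mul_le_mul_of_nonneg_left h1 (by have := ratio_pos hk₀ hk₁; positivity)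
    linarith
  rw [img_char_one hk₀ hk₁, e, hΨ.zero_fst _ h4, hΨ.zero_snd _ (by nlinarith), sub_zero]

/-- Now it is the shrunk coordinate, at most 1 - k, that falls before the support. Reaching T + 1
and not only T leaves a neighbourhood of T where the boundary value vanishes, so that its time
derivative vanishes at T too. -/
theorem IsForward.img_one {k T : ℝ} (hk₀ : 0 < k) (hk₁ : k < 1) {N : ℕ}
    (hN : alpha k (T + 1) ≤ ratio k ^ N) {Ψ : ℝ × ℝ → ℝ} (hΨ : IsForward k Ψ) {t : ℝ}
    (ht : t < T + 1) : img k N Ψ (char k (1, t)) = 0 := by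
  have hr : 0 < ratio k ^ N := pow_pos (ratio_pos hk₀ hk₁) N
  have h2 : alpha k t ≤ ratio k ^ N := by
    refine le_trans ?_ hN; unfold alpha; nlinarith
  have h3 : (ratio k ^ N)⁻¹ * (alpha k t * (1 - k)) ≤ 1 - k := by
    rw [inv_mul_le_iff₀ hr]
    exact mul_le_mul_of_nonneg_right h2 (by linarith)
  rw [img_char_one hk₀ hk₁, hΨ.zero_snd _ h3, hΨ.zero_fst _ (h3.trans (by linarith)), sub_zero]

/-- Every term vanishes by itself: for n = 0 because a + b ≥ 2α(T), otherwise because one coordinate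
has been stretched beyond its bound. Later times are included so that the time derivative at T can
be computed from the right. -/
theorem IsBackward.img_final {k T : ℝ} (hk₀ : 0 < k) (hk₁ : k < 1) (N : ℕ) {Ψ : ℝ × ℝ → ℝ}
    (hΨ : IsBackward k T Ψ) {y t : ℝ} (hT : 0 ≤ T) (ht : T ≤ t) (hy : y ∈ Icc (0 : ℝ) 1) :
    img k N Ψ (char k (y, t)) = 0 := by
  have hr1 := one_lt_ratio hk₀ hk₁
  have hrk : 1 + k ≤ ratio k := by rw [ratio, le_div_iff₀ (by linarith)]; nlinarith
  have hα : 0 < alpha k T := alpha_pos hk₀ hT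
  have hαt : alpha k T ≤ alpha k t := by unfold alpha; nlinarith
  obtain ⟨hy0, hy1⟩ := hy
  set a := alpha k t * (1 + k * y) with ha
  set b := alpha k t * (1 - k * y) with hb
  have hab : a + b = 2 * alpha k t := by rw [ha, hb]; ring
  have hky : 0 ≤ k * y := by positivity
  have hky1 : k * y ≤ k := by nlinarith
  have ha1 : alpha k t ≤ a := by rw [ha]; nlinarith
  have hb1 : (1 - k) * alpha k t ≤ b := by rw [hb]; nlinarith
  have hb0 : 0 < b := lt_of_lt_of_le (mul_pos (by linarith) (by linarith)) hb1
  have hrb : (1 + k) * alpha k t ≤ ratio k * b := by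
    rw [← ratio_mul hk₁]; nlinarith
  refine Finset.sum_eq_zero fun n _ => ?_
  have hk2 : (1 + k) * alpha k T ≤ (1 + k) * alpha k t := by nlinarith
  rcases zpow_trichotomy hr1 n with rfl | ⟨_, h1, -⟩ | ⟨_, h1, -⟩
  · rw [hΨ.zero_sum, hΨ.zero_sum, sub_zero] <;> simp [char] <;> linarith
  · have i1 := mul_le_mul_of_nonneg_right h1 hb0.le
    have i2 := mul_le_mul_of_nonneg_right h1 (hα.le.trans (hαt.trans ha1))
    rw [hΨ.zero_fst, hΨ.zero_fst, sub_zero]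
    · change _ ≤ ratio k ^ n * b; linarith
    · change _ ≤ ratio k ^ n * a; nlinarith
  · have i1 := mul_le_mul_of_nonneg_right h1 hb0.le
    have i2 := mul_le_mul_of_nonneg_right h1 (hα.le.trans (hαt.trans ha1))
    rw [hΨ.zero_snd, hΨ.zero_snd, sub_zero]
    · change _ ≤ ratio k ^ (-n) * a; nlinarith
    · change _ ≤ ratio k ^ (-n) * b; nlinarith

/-- The counterpart in the past: now a shrunk coordinate is at most 1 - k. Times before 0 serve for
the time derivative at 0; the condition α(t) ≥ 0 keeps both coordinates nonnegative there. -/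
theorem IsForward.img_initial {k : ℝ} (hk₀ : 0 < k) (hk₁ : k < 1) (N : ℕ) {Ψ : ℝ × ℝ → ℝ}
    (hΨ : IsForward k Ψ) {y t : ℝ} (ht : t ≤ 0) (ht' : 0 ≤ alpha k t) (hy : y ∈ Icc (0 : ℝ) 1) :
    img k N Ψ (char k (y, t)) = 0 := by
  have hr1 := one_lt_ratio hk₀ hk₁
  have hr0 := ratio_pos hk₀ hk₁
  have hrk := ratio_mul hk₁
  have hαt : alpha k t ≤ 1 := by unfold alpha; nlinarith
  obtain ⟨hy0, hy1⟩ := hy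
  set a := alpha k t * (1 + k * y) with ha
  set b := alpha k t * (1 - k * y) with hb
  have hab : a + b = 2 * alpha k t := by rw [ha, hb]; ring
  have hky : 0 ≤ k * y := by positivity
  have hky1 : k * y ≤ k := by nlinarith
  have ha1 : a ≤ 1 + k := by rw [ha]; nlinarith
  have hb1 : b ≤ 1 := by rw [hb]; nlinarith
  have ha0 : 0 ≤ a := by rw [ha]; exact mul_nonneg ht' (by linarith)
  have hb0 : 0 ≤ b := by rw [hb]; exact mul_nonneg ht' (by linarith)
  have key : ∀ s : ℝ, 0 ≤ s → s * ratio k ≤ 1 → s * a ≤ 1 - k ∧ s * b ≤ 1 - k := by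
    intro s hs h
    have h1 : s * (1 + k) ≤ 1 - k := by
      rw [← hrk]; nlinarith
    exact ⟨by nlinarith, by nlinarith⟩
  refine Finset.sum_eq_zero fun n _ => ?_
  rcases zpow_trichotomy hr1 n with rfl | ⟨_, -, h1⟩ | ⟨_, -, h1⟩
  · rw [hΨ.zero_sum, hΨ.zero_sum, sub_zero] <;> simp [char] <;> linarith
  · obtain ⟨i1, i2⟩ := key _ (zpow_pos hr0 (-n)).le h1
    rw [hΨ.zero_snd _ i2, hΨ.zero_snd _ i1, sub_zero]
  · obtain ⟨i1, i2⟩ := key _ (zpow_pos hr0 n).le h1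
    rw [hΨ.zero_fst _ (i1.trans (by linarith)), hΨ.zero_fst _ (i2.trans (by linarith)), sub_zero]

/-- The product of two primitives, a potential with mixed derivative `h₁ ⊗ h₂`. -/
def prodPot (c₁ c₂ : ℝ) (h₁ h₂ : ℝ → ℝ) (z : ℝ × ℝ) : ℝ :=
  (∫ s in c₁..z.1, h₁ s) * ∫ s in c₂..z.2, h₂ s

theorem contDiff_prodPot (c₁ c₂ : ℝ) {h₁ h₂ : ℝ → ℝ} (s₁ : ContDiff ℝ ∞ h₁) (s₂ : ContDiff ℝ ∞ h₂) :
    ContDiff ℝ ∞ (prodPot c₁ c₂ h₁ h₂) :=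
  ((contDiff_primitive s₁ c₁).comp contDiff_fst).mul ((contDiff_primitive s₂ c₂).comp contDiff_snd)

theorem hasDerivAt_primitive {f : ℝ → ℝ} (hf : Continuous f) (c t : ℝ) :
    HasDerivAt (fun t => ∫ s in c..t, f s) (f t) t :=
  intervalIntegral.integral_hasDerivAt_right (hf.intervalIntegrable _ _)
    (hf.stronglyMeasurableAtFilter _ _) hf.continuousAt

theorem pd2_pd1_prodPot (c₁ c₂ : ℝ) {h₁ h₂ : ℝ → ℝ} (s₁ : ContDiff ℝ ∞ h₁) (s₂ : ContDiff ℝ ∞ h₂)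
    (z : ℝ × ℝ) : pd2 (pd1 (prodPot c₁ c₂ h₁ h₂)) z = h₁ z.1 * h₂ z.2 := by
  have hs := contDiff_prodPot c₁ c₂ s₁ s₂
  have h1 : ∀ a b, pd1 (prodPot c₁ c₂ h₁ h₂) (a, b) = h₁ a * ∫ s in c₂..b, h₂ s := fun a b =>
    (hasDerivAt_fst hs a b).unique
      ((hasDerivAt_primitive s₁.continuous c₁ a).mul_const (∫ s in c₂..b, h₂ s))
  refine (hasDerivAt_snd (contDiff_pd1 hs) z.1 z.2).unique ?_
  simp only [h1]
  exact (hasDerivAt_primitive s₂.continuous c₂ z.2).const_mul _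

theorem primitive_eq_zero_right {h : ℝ → ℝ} {a b : ℝ} (hh : ∀ x, x ∉ Icc a b → h x = 0) {x : ℝ}
    (hx : b ≤ x) : ∫ s in b..x, h s = 0 := by
  refine intervalIntegral.integral_zero_ae (ae_of_all _ fun s hs => hh s fun h' => ?_)
  rw [uIoc_of_le hx] at hs
  linarith [hs.1, h'.2]

theorem primitive_eq_zero_left {h : ℝ → ℝ} {a b : ℝ} (hh : ∀ x, x ∉ Icc a b → h x = 0) {x : ℝ}
    (hx : x ≤ a) : ∫ s in a..x, h s = 0 := by
  have h0 : ∀ᵐ s ∂(volume : Measure ℝ), s ≠ a := (compl_mem_ae_iff (s := {a})).2 (by simp)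
  refine intervalIntegral.integral_zero_ae (h0.mono fun s hsa hs => hh s fun h' => ?_)
  rw [uIoc_of_ge hx] at hs
  exact hsa (le_antisymm hs.2 h'.1)

theorem charRegion_corners {k T a₁ a₂ b₁ b₂ : ℝ} (h : Icc a₁ a₂ ×ˢ Icc b₁ b₂ ⊆ charRegion k T)
    (ha : a₁ < a₂) (hb : b₁ < b₂) : b₂ < a₁ ∧ (1 - k) * a₂ < (1 + k) * b₁ ∧ 2 < a₁ + b₁ ∧
      a₂ + b₂ < 2 * alpha k T :=
  ⟨(h (show (a₁, b₂) ∈ _ from ⟨⟨le_rfl, ha.le⟩, hb.le, le_rfl⟩)).1,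
    (h (show (a₂, b₁) ∈ _ from ⟨⟨ha.le, le_rfl⟩, le_rfl, hb.le⟩)).2.1,
    (h (show (a₁, b₁) ∈ _ from ⟨⟨le_rfl, ha.le⟩, le_rfl, hb.le⟩)).2.2.1,
    (h (show (a₂, b₂) ∈ _ from ⟨⟨ha.le, le_rfl⟩, hb.le, le_rfl⟩)).2.2.2⟩

theorem pd2_pd1_prodPot_eq_zero {k T a₁ a₂ b₁ b₂ c₁ c₂ : ℝ} {h₁ h₂ : ℝ → ℝ}
    (h : Icc a₁ a₂ ×ˢ Icc b₁ b₂ ⊆ charRegion k T) (s₁ : ContDiff ℝ ∞ h₁) (s₂ : ContDiff ℝ ∞ h₂)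
    (z₁ : ∀ x, x ∉ Icc a₁ a₂ → h₁ x = 0) (z₂ : ∀ x, x ∉ Icc b₁ b₂ → h₂ x = 0) {z : ℝ × ℝ}
    (hz : z ∉ charRegion k T) : pd2 (pd1 (prodPot c₁ c₂ h₁ h₂)) z = 0 := by
  rw [pd2_pd1_prodPot _ _ s₁ s₂]
  by_cases h1 : z.1 ∈ Icc a₁ a₂
  · rw [z₂ z.2 fun h2 => hz (h ⟨h1, h2⟩), mul_zero]
  · rw [z₁ _ h1, zero_mul]

/-- Primitives based at the upper corner of the box vanish for a ≥ a₂ or b ≥ b₂. As the box lies in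
the characteristic region, each of the three half-planes forces one of these. -/
theorem isBackward_prodPot {k T a₁ a₂ b₁ b₂ : ℝ} {h₁ h₂ : ℝ → ℝ} (hk₀ : 0 < k)
    (h : Icc a₁ a₂ ×ˢ Icc b₁ b₂ ⊆ charRegion k T) (ha : a₁ < a₂) (hb : b₁ < b₂)
    (s₁ : ContDiff ℝ ∞ h₁) (s₂ : ContDiff ℝ ∞ h₂)
    (z₁ : ∀ x, x ∉ Icc a₁ a₂ → h₁ x = 0) (z₂ : ∀ x, x ∉ Icc b₁ b₂ → h₂ x = 0) :
    IsBackward k T (prodPot a₂ b₂ h₁ h₂) := by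
  obtain ⟨c1, c2, c3, c4⟩ := charRegion_corners h ha hb
  have hz : ∀ z : ℝ × ℝ, a₂ ≤ z.1 ∨ b₂ ≤ z.2 → prodPot a₂ b₂ h₁ h₂ z = 0 := by
    rintro z (hz | hz)
    · rw [prodPot, primitive_eq_zero_right z₁ hz, zero_mul]
    · rw [prodPot, primitive_eq_zero_right z₂ hz, mul_zero]
  refine ⟨contDiff_prodPot _ _ s₁ s₂, fun z h' => hz z ?_, fun z h' => hz z (Or.inr (by linarith)),
    fun z h' => hz z (Or.inl ?_), fun z => pd2_pd1_prodPot_eq_zero h s₁ s₂ z₁ z₂⟩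
  · by_contra hc; push Not at hc; linarith
  · nlinarith

/-- The same with the lower corner as base point. -/
theorem isForward_prodPot {k T a₁ a₂ b₁ b₂ : ℝ} {h₁ h₂ : ℝ → ℝ} (hk₀ : 0 < k) (hk₁ : k < 1)
    (h : Icc a₁ a₂ ×ˢ Icc b₁ b₂ ⊆ charRegion k T) (ha : a₁ < a₂) (hb : b₁ < b₂)
    (s₁ : ContDiff ℝ ∞ h₁) (s₂ : ContDiff ℝ ∞ h₂)
    (z₁ : ∀ x, x ∉ Icc a₁ a₂ → h₁ x = 0) (z₂ : ∀ x, x ∉ Icc b₁ b₂ → h₂ x = 0) :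
    IsForward k (prodPot a₁ b₁ h₁ h₂) := by
  obtain ⟨c1, c2, c3, c4⟩ := charRegion_corners h ha hb
  have hz : ∀ z : ℝ × ℝ, z.1 ≤ a₁ ∨ z.2 ≤ b₁ → prodPot a₁ b₁ h₁ h₂ z = 0 := by
    rintro z (hz | hz)
    · rw [prodPot, primitive_eq_zero_left z₁ hz, zero_mul]
    · rw [prodPot, primitive_eq_zero_left z₂ hz, mul_zero]
  refine ⟨contDiff_prodPot _ _ s₁ s₂, fun z h' => hz z ?_, fun z h' => hz z (Or.inr ?_),
    fun z h' => hz z (Or.inl (by linarith))⟩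
  · by_contra hc; push Not at hc; linarith
  · nlinarith

/-- The wedge condition in terms of the region. -/
theorem notMem_charRegion_of_wedge {k T : ℝ} (hk₁ : k < 1) {z : ℝ × ℝ}
    (h : z.1 ≤ z.2 ∨ ratio k * z.2 ≤ z.1) : z ∉ charRegion k T := by
  rintro ⟨h1, h2, -, -⟩
  rcases h with h | h
  · linarith
  · rw [← ratio_mul hk₁] at h2
    have := mul_le_mul_of_nonneg_left h (by linarith : 0 ≤ 1 - k)
    linarith

/-! ### Estimates for the sum over the images -/

/-- Cauchy–Schwarz, as nonnegativity of the variance. -/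
theorem sq_intervalIntegral_le {u : ℝ → ℝ} (hu : Continuous u) {a b : ℝ} (hab : a ≤ b) :
    (∫ x in a..b, u x) ^ 2 ≤ (b - a) * ∫ x in a..b, u x ^ 2 := by
  rcases hab.eq_or_lt with rfl | hlt
  · simp
  set I := ∫ x in a..b, u x with hI
  set m := I / (b - a) with hm
  have hb : 0 < b - a := sub_pos.2 hlt
  have h0 : 0 ≤ ∫ x in a..b, (u x - m) ^ 2 :=
    intervalIntegral.integral_nonneg hab fun x _ => sq_nonneg _
  have e : ∀ x, (u x - m) ^ 2 = u x ^ 2 - 2 * m * u x + m ^ 2 := fun x => by ring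
  have i1 : IntervalIntegrable (fun x => u x ^ 2) volume a b := (hu.pow 2).intervalIntegrable _ _
  have i2 : IntervalIntegrable (fun x => 2 * m * u x) volume a b :=
    (continuous_const.mul hu).intervalIntegrable _ _
  simp only [e] at h0
  rw [intervalIntegral.integral_add (i1.sub i2) (by simp), intervalIntegral.integral_sub i1 i2,
    intervalIntegral.integral_const_mul, ← hI, intervalIntegral.integral_const, smul_eq_mul] at h0
  have hmI : m * (b - a) = I := by rw [hm]; field_simp
  have h1 : 0 ≤ (b - a) * ((∫ x in a..b, u x ^ 2) - 2 * m * I + (b - a) * m ^ 2) :=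
    mul_nonneg hb.le h0
  have h2 : (b - a) * ((∫ x in a..b, u x ^ 2) - 2 * m * I + (b - a) * m ^ 2) =
      (b - a) * (∫ x in a..b, u x ^ 2) - I ^ 2 := by
    rw [← hmI]; ring
  linarith

theorem intervalIntegral_mono_set_of_nonneg {M : ℝ → ℝ} (hM : Continuous M) (h0 : ∀ x, 0 ≤ M x)
    {a b c d : ℝ} (hab : a ≤ b) (hca : c ≤ a) (hbd : b ≤ d) :
    ∫ x in a..b, M x ≤ ∫ x in c..d, M x :=
  intervalIntegral.integral_mono_interval hca hab hbd (ae_of_all _ h0) (hM.intervalIntegrable _ _)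

/-- Affine change of variables for nonnegative functions. -/
theorem integral_comp_affine_le {M : ℝ → ℝ} (hM : Continuous M) (h0 : ∀ x, 0 ≤ M x)
    {L A c d K : ℝ} (hL : 0 ≤ L) (hc : c ≠ 0) (hK : |c|⁻¹ ≤ K) (hd : d ∈ Icc 0 A)
    (hdc : d + c * L ∈ Icc 0 A) : ∫ x in (0 : ℝ)..L, M (d + c * x) ≤ K * ∫ x in (0 : ℝ)..A, M x := by
  have hA : 0 ≤ ∫ x in (0 : ℝ)..A, M x :=
    intervalIntegral.integral_nonneg (hd.1.trans hd.2) fun x _ => h0 x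
  refine le_trans ?_ (mul_le_mul_of_nonneg_right hK hA)
  rw [intervalIntegral.integral_comp_add_mul _ hc, smul_eq_mul, mul_zero, add_zero]
  rcases hc.lt_or_gt with h | h
  · rw [abs_of_neg h, intervalIntegral.integral_symm, inv_neg, mul_neg, neg_mul, neg_le_neg_iff]
    refine mul_le_mul_of_nonpos_left ?_ (inv_nonpos.2 h.le)
    exact intervalIntegral_mono_set_of_nonneg hM h0 (by nlinarith) hdc.1 hd.2
  · rw [abs_of_pos h]
    refine mul_le_mul_of_nonneg_left ?_ (inv_nonneg.2 h.le)
    exact intervalIntegral_mono_set_of_nonneg hM h0 (by nlinarith) hd.1 hdc.2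

theorem charRegion_subset {k T : ℝ} (hk₀ : 0 < k) (hk₁ : k < 1) :
    charRegion k T ⊆ Ioo 0 ((1 + k) * alpha k T) ×ˢ Ioo 0 (alpha k T) := by
  rintro ⟨a, b⟩ ⟨h1, h2, h3, h4⟩
  simp only at h1 h2 h3 h4
  refine ⟨⟨by linarith, by nlinarith⟩, by nlinarith, by linarith⟩

/-! ### Line energies and the majorant of the characteristic derivatives -/

/-- The integral of `(Ψ_ab)²` along the line through `a`. -/
def lineEnergy₁ (k T : ℝ) (Ψ : ℝ × ℝ → ℝ) (a : ℝ) : ℝ :=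
  ∫ b in (0 : ℝ)..alpha k T, pd2 (pd1 Ψ) (a, b) ^ 2

/-- The integral of `(Ψ_ab)²` along the line through `b`. -/
def lineEnergy₂ (k T : ℝ) (Ψ : ℝ × ℝ → ℝ) (b : ℝ) : ℝ :=
  ∫ a in (0 : ℝ)..(1 + k) * alpha k T, pd2 (pd1 Ψ) (a, b) ^ 2

/-- The integral of `(Ψ_ab)²`. -/
def energy (k T : ℝ) (Ψ : ℝ × ℝ → ℝ) : ℝ := ∫ z in charRegion k T, pd2 (pd1 Ψ) z ^ 2

theorem continuous_lineEnergy₁ (k T : ℝ) {Ψ : ℝ × ℝ → ℝ} (hΨ : ContDiff ℝ ∞ Ψ) :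
    Continuous (lineEnergy₁ k T Ψ) := by
  have h := (contDiff_pd2 (contDiff_pd1 hΨ)).continuous
  exact intervalIntegral.continuous_parametric_intervalIntegral_of_continuous'
    (f := fun a b => pd2 (pd1 Ψ) (a, b) ^ 2) (by
      change Continuous fun p : ℝ × ℝ => pd2 (pd1 Ψ) (p.1, p.2) ^ 2; fun_prop) _ _

theorem continuous_lineEnergy₂ (k T : ℝ) {Ψ : ℝ × ℝ → ℝ} (hΨ : ContDiff ℝ ∞ Ψ) :
    Continuous (lineEnergy₂ k T Ψ) := by
  have h := (contDiff_pd2 (contDiff_pd1 hΨ)).continuous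
  exact intervalIntegral.continuous_parametric_intervalIntegral_of_continuous'
    (f := fun b a => pd2 (pd1 Ψ) (a, b) ^ 2) (by
      change Continuous fun p : ℝ × ℝ => pd2 (pd1 Ψ) (p.2, p.1) ^ 2; fun_prop) _ _

theorem lineEnergy₁_nonneg {k T : ℝ} (hk₀ : 0 < k) (hT : 0 ≤ T) (Ψ : ℝ × ℝ → ℝ) (a : ℝ) :
    0 ≤ lineEnergy₁ k T Ψ a :=
  intervalIntegral.integral_nonneg (alpha_pos hk₀ hT).le fun _ _ => sq_nonneg _

theorem lineEnergy₂_nonneg {k T : ℝ} (hk₀ : 0 < k) (hT : 0 ≤ T) (Ψ : ℝ × ℝ → ℝ) (b : ℝ) :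
    0 ≤ lineEnergy₂ k T Ψ b :=
  intervalIntegral.integral_nonneg (by have := alpha_pos hk₀ hT; positivity) fun _ _ => sq_nonneg _

theorem integrable_sq_of_backward {k T : ℝ} (hk₀ : 0 < k) (hk₁ : k < 1) {Ψ : ℝ × ℝ → ℝ}
    (hΨ : IsBackward k T Ψ) : Integrable fun z => pd2 (pd1 Ψ) z ^ 2 := by
  have hc := ((contDiff_pd2 (contDiff_pd1 hΨ.smooth)).continuous).pow 2
  refine hc.integrable_of_hasCompactSupport (HasCompactSupport.intro (K :=
    Icc 0 ((1 + k) * alpha k T) ×ˢ Icc 0 (alpha k T)) (isCompact_Icc.prod isCompact_Icc) ?_)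
  intro z hz
  have : pd2 (pd1 Ψ) z = 0 := hΨ.support z fun h => hz
    (Set.prod_mono Ioo_subset_Icc_self Ioo_subset_Icc_self (charRegion_subset hk₀ hk₁ h))
  rw [Pi.pow_apply, this]; simp

theorem energy_eq {k T : ℝ} {Ψ : ℝ × ℝ → ℝ}
    (hΨ : IsBackward k T Ψ) : energy k T Ψ = ∫ z, pd2 (pd1 Ψ) z ^ 2 :=
  setIntegral_eq_integral_of_forall_compl_eq_zero fun z hz => by rw [hΨ.support z hz]; simp

theorem lineEnergy₁_eq {k T : ℝ} (hk₀ : 0 < k) (hk₁ : k < 1) (hT : 0 ≤ T) {Ψ : ℝ × ℝ → ℝ}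
    (hΨ : IsBackward k T Ψ) (a : ℝ) : lineEnergy₁ k T Ψ a = ∫ b, pd2 (pd1 Ψ) (a, b) ^ 2 := by
  rw [lineEnergy₁, ← setIntegral_Ioo_eq_intervalIntegral (alpha_pos hk₀ hT).le]
  refine setIntegral_eq_integral_of_forall_compl_eq_zero fun b hb => ?_
  rw [hΨ.support (a, b) fun h => hb (charRegion_subset hk₀ hk₁ h).2]; simp

theorem lineEnergy₂_eq {k T : ℝ} (hk₀ : 0 < k) (hk₁ : k < 1) (hT : 0 ≤ T) {Ψ : ℝ × ℝ → ℝ}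
    (hΨ : IsBackward k T Ψ) (b : ℝ) : lineEnergy₂ k T Ψ b = ∫ a, pd2 (pd1 Ψ) (a, b) ^ 2 := by
  have := alpha_pos hk₀ hT
  rw [lineEnergy₂, ← setIntegral_Ioo_eq_intervalIntegral (by positivity)]
  refine setIntegral_eq_integral_of_forall_compl_eq_zero fun a ha => ?_
  rw [hΨ.support (a, b) fun h => ha (charRegion_subset hk₀ hk₁ h).1]; simp

theorem integral_lineEnergy₁_le {k T : ℝ} (hk₀ : 0 < k) (hk₁ : k < 1) (hT : 0 ≤ T)
    {Ψ : ℝ × ℝ → ℝ} (hΨ : IsBackward k T Ψ) {R : ℝ} (hR : 0 ≤ R) :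
    ∫ a in (0 : ℝ)..R, lineEnergy₁ k T Ψ a ≤ energy k T Ψ := by
  have hi := integrable_sq_of_backward hk₀ hk₁ hΨ
  rw [energy_eq hΨ, Measure.volume_eq_prod, integral_prod _ (by rwa [← Measure.volume_eq_prod]),
    intervalIntegral.integral_of_le hR]
  simp only [lineEnergy₁_eq hk₀ hk₁ hT hΨ]
  refine setIntegral_le_integral ?_ (ae_of_all _ fun a => integral_nonneg fun b => sq_nonneg _)
  rw [Measure.volume_eq_prod] at hi
  exact hi.integral_prod_left

theorem integral_lineEnergy₂_le {k T : ℝ} (hk₀ : 0 < k) (hk₁ : k < 1) (hT : 0 ≤ T)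
    {Ψ : ℝ × ℝ → ℝ} (hΨ : IsBackward k T Ψ) {R : ℝ} (hR : 0 ≤ R) :
    ∫ b in (0 : ℝ)..R, lineEnergy₂ k T Ψ b ≤ energy k T Ψ := by
  have hi := integrable_sq_of_backward hk₀ hk₁ hΨ
  rw [energy_eq hΨ, Measure.volume_eq_prod, integral_prod_symm _ (by rwa [← Measure.volume_eq_prod]),
    intervalIntegral.integral_of_le hR]
  simp only [lineEnergy₂_eq hk₀ hk₁ hT hΨ]
  refine setIntegral_le_integral ?_ (ae_of_all _ fun a => integral_nonneg fun b => sq_nonneg _)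
  rw [Measure.volume_eq_prod] at hi
  exact hi.integral_prod_right

/-- Ψ_a vanishes at b = α(T); integrate Ψ_ab from there and apply Cauchy–Schwarz. The bound does not
depend on b, which is what later controls the derivatives on each single line. The factor 1 + k is
only there to match `sq_pd2_le`. -/
theorem sq_pd1_le {k T : ℝ} (hk₀ : 0 < k) (hT : 0 ≤ T) {Ψ : ℝ × ℝ → ℝ} (hΨ : IsBackward k T Ψ)
    (a : ℝ) {b : ℝ} (hb : 0 ≤ b) :
    pd1 Ψ (a, b) ^ 2 ≤ (1 + k) * alpha k T * lineEnergy₁ k T Ψ a := by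
  have hα := alpha_pos hk₀ hT
  have hN := lineEnergy₁_nonneg hk₀ hT Ψ a
  have hz : ∀ b', alpha k T ≤ b' → pd1 Ψ (a, b') = 0 := fun b' hb' =>
    (hasDerivAt_fst hΨ.smooth a b').unique ((hasDerivAt_const a (0 : ℝ)).congr_of_eventuallyEq
      (Eventually.of_forall fun x => hΨ.zero_snd (x, b') hb'))
  rcases le_total (alpha k T) b with h | h
  · rw [hz b h]; simp only [ne_eq, OfNat.ofNat_ne_zero, not_false_eq_true, zero_pow]; positivity
  · have hc : Continuous fun b => pd2 (pd1 Ψ) (a, b) :=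
      (contDiff_pd2 (contDiff_pd1 hΨ.smooth)).continuous.comp (by fun_prop)
    have e : ∫ x in b..alpha k T, pd2 (pd1 Ψ) (a, x) = -pd1 Ψ (a, b) := by
      rw [intervalIntegral.integral_eq_sub_of_hasDerivAt
        (fun x _ => hasDerivAt_snd (contDiff_pd1 hΨ.smooth) a x) (hc.intervalIntegrable _ _),
        hz _ le_rfl, zero_sub]
    have h1 := sq_intervalIntegral_le hc h
    rw [e, neg_sq] at h1
    have h2 : ∫ x in b..alpha k T, pd2 (pd1 Ψ) (a, x) ^ 2 ≤ lineEnergy₁ k T Ψ a :=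
      intervalIntegral_mono_set_of_nonneg (hc.pow 2) (fun x => sq_nonneg _) h hb le_rfl
    calc _ ≤ _ := h1
      _ ≤ (alpha k T - b) * lineEnergy₁ k T Ψ a := mul_le_mul_of_nonneg_left h2 (by linarith)
      _ ≤ _ := mul_le_mul_of_nonneg_right (by nlinarith) hN

theorem sq_pd2_le {k T : ℝ} (hk₀ : 0 < k) (hT : 0 ≤ T) {Ψ : ℝ × ℝ → ℝ} (hΨ : IsBackward k T Ψ)
    {a : ℝ} (ha : 0 ≤ a) (b : ℝ) :
    pd2 Ψ (a, b) ^ 2 ≤ (1 + k) * alpha k T * lineEnergy₂ k T Ψ b := by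
  have hα := alpha_pos hk₀ hT
  have hN := lineEnergy₂_nonneg hk₀ hT Ψ b
  have hz : ∀ a', (1 + k) * alpha k T ≤ a' → pd2 Ψ (a', b) = 0 := fun a' ha' =>
    (hasDerivAt_snd hΨ.smooth a' b).unique ((hasDerivAt_const b (0 : ℝ)).congr_of_eventuallyEq
      (Eventually.of_forall fun x => hΨ.zero_fst (a', x) ha'))
  rcases le_total ((1 + k) * alpha k T) a with h | h
  · rw [hz a h]; simp only [ne_eq, OfNat.ofNat_ne_zero, not_false_eq_true, zero_pow]; positivity
  · have hc : Continuous fun a => pd2 (pd1 Ψ) (a, b) :=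
      (contDiff_pd2 (contDiff_pd1 hΨ.smooth)).continuous.comp (by fun_prop)
    have e : ∫ x in a..(1 + k) * alpha k T, pd2 (pd1 Ψ) (x, b) = -pd2 Ψ (a, b) := by
      rw [intervalIntegral.integral_eq_sub_of_hasDerivAt (f := fun x => pd2 Ψ (x, b))
        (fun x _ => by rw [← pd1_pd2_comm hΨ.smooth]; exact hasDerivAt_fst (contDiff_pd2 hΨ.smooth) x b)
        (hc.intervalIntegrable _ _), hz _ le_rfl, zero_sub]
    have h1 := sq_intervalIntegral_le hc h
    rw [e, neg_sq] at h1
    have h2 : ∫ x in a..(1 + k) * alpha k T, pd2 (pd1 Ψ) (x, b) ^ 2 ≤ lineEnergy₂ k T Ψ b :=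
      intervalIntegral_mono_set_of_nonneg (hc.pow 2) (fun x => sq_nonneg _) h ha le_rfl
    calc _ ≤ _ := h1
      _ ≤ ((1 + k) * alpha k T - a) * lineEnergy₂ k T Ψ b :=
        mul_le_mul_of_nonneg_left h2 (by linarith)
      _ ≤ _ := mul_le_mul_of_nonneg_right (by linarith) hN

/-- A function of one characteristic variable that dominates `|∂_a q|²`, `q` the sum over the images
of `Ψ`. -/
def majorant (k T : ℝ) (N : ℕ) (Ψ : ℝ × ℝ → ℝ) (a : ℝ) : ℝ :=
  (2 * (2 * N + 1) * (ratio k ^ N) ^ 2 * ((1 + k) * alpha k T)) * ∑ n ∈ Finset.Icc (-(N : ℤ)) N,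
    (lineEnergy₁ k T Ψ (ratio k ^ n * a) + lineEnergy₂ k T Ψ (ratio k ^ (-n) * a))

theorem continuous_majorant (k T : ℝ) (N : ℕ) {Ψ : ℝ × ℝ → ℝ} (hΨ : ContDiff ℝ ∞ Ψ) :
    Continuous (majorant k T N Ψ) := by
  have h1 := continuous_lineEnergy₁ k T hΨ
  have h2 := continuous_lineEnergy₂ k T hΨ
  unfold majorant
  fun_prop

theorem majorant_nonneg {k T : ℝ} (hk₀ : 0 < k) (hk₁ : k < 1) (hT : 0 ≤ T) (N : ℕ)
    (Ψ : ℝ × ℝ → ℝ) (a : ℝ) : 0 ≤ majorant k T N Ψ a := by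
  have := alpha_pos hk₀ hT
  have := ratio_pos hk₀ hk₁
  refine mul_nonneg (by positivity) (Finset.sum_nonneg fun n _ => add_nonneg
    (lineEnergy₁_nonneg hk₀ hT _ _) (lineEnergy₂_nonneg hk₀ hT _ _))

/-- In each term b enters only through the coordinate that the line energy integrates out, so the
bound is a function of a alone. The constant collects the 2N + 1 terms, a 2 from (x - y)² and
dilation factors of at most r^N. -/
theorem sq_pd1_img_le {k T : ℝ} (hk₀ : 0 < k) (hk₁ : k < 1) (hT : 0 ≤ T) (N : ℕ)
    {Ψ : ℝ × ℝ → ℝ} (hΨ : IsBackward k T Ψ) {a b : ℝ} (hb : 0 ≤ b) :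
    pd1 (img k N Ψ) (a, b) ^ 2 ≤ majorant k T N Ψ a := by
  have hr1 := one_lt_ratio hk₀ hk₁
  have hr0 := ratio_pos hk₀ hk₁
  have hα := alpha_pos hk₀ hT
  rw [pd1_img k N hΨ.smooth, majorant]
  refine (sq_sum_le_card_mul_sum_sq).trans ?_
  have hcard : ((Finset.Icc (-(N : ℤ)) N).card : ℝ) = 2 * N + 1 := by
    rw [Int.card_Icc]
    have : ((N : ℤ) + 1 - -(N : ℤ)).toNat = 2 * N + 1 := by omega
    rw [this]; push_cast; ring
  rw [hcard, show ∀ S : ℝ, (2 * (2 * (N : ℝ) + 1) * (ratio k ^ N) ^ 2 * ((1 + k) * alpha k T)) * S =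
    (2 * N + 1) * ((2 * (ratio k ^ N) ^ 2 * ((1 + k) * alpha k T)) * S) from fun S => by ring]
  refine mul_le_mul_of_nonneg_left ?_ (by positivity)
  rw [Finset.mul_sum]
  refine Finset.sum_le_sum fun n hn => ?_
  rw [Finset.mem_Icc] at hn
  have hpow : ∀ m : ℤ, m ≤ N → (ratio k ^ m) ^ 2 ≤ (ratio k ^ N) ^ 2 := fun m hm => by
    have : ratio k ^ m ≤ ratio k ^ (N : ℤ) := zpow_le_zpow_right₀ hr1.le hm
    rw [zpow_natCast] at this
    exact pow_le_pow_left₀ (zpow_pos hr0 m).le this 2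
  have e1 := sq_pd1_le hk₀ hT hΨ (ratio k ^ n * a) (b := ratio k ^ (-n) * b)
    (mul_nonneg (zpow_pos hr0 _).le hb)
  have e2 := sq_pd2_le hk₀ hT hΨ (a := ratio k ^ n * b) (mul_nonneg (zpow_pos hr0 _).le hb)
    (ratio k ^ (-n) * a)
  have f1 := mul_le_mul (hpow n hn.2) e1 (sq_nonneg _) (by positivity)
  have f2 := mul_le_mul (hpow (-n) (by omega)) e2 (sq_nonneg _) (by positivity)
  have f3 : ∀ x y : ℝ, (x - y) ^ 2 ≤ 2 * x ^ 2 + 2 * y ^ 2 := fun x y => by nlinarith [sq_nonneg (x + y)]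
  refine (f3 _ _).trans ?_
  rw [mul_pow, mul_pow]
  linarith

/-- The constant in the estimate of the majorant. -/
def majorantConst (k T : ℝ) (N : ℕ) : ℝ :=
  (2 * (2 * N + 1) * (ratio k ^ N) ^ 2 * ((1 + k) * alpha k T)) * ((2 * N + 1) * (2 * ratio k ^ N))

theorem majorantConst_nonneg {k T : ℝ} (hk₀ : 0 < k) (hk₁ : k < 1) (hT : 0 ≤ T) (N : ℕ) :
    0 ≤ majorantConst k T N := by
  have := alpha_pos hk₀ hT
  have := ratio_pos hk₀ hk₁
  unfold majorantConst; positivity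

/-- Rescaling by a power of r costs at most r^N, and by Fubini each line energy integrates to at
most the total energy. -/
theorem integral_majorant_le {k T : ℝ} (hk₀ : 0 < k) (hk₁ : k < 1) (hT : 0 ≤ T) (N : ℕ)
    {Ψ : ℝ × ℝ → ℝ} (hΨ : IsBackward k T Ψ) {R : ℝ} (hR : 0 ≤ R) :
    ∫ a in (0 : ℝ)..R, majorant k T N Ψ a ≤ majorantConst k T N * energy k T Ψ := by
  have hr1 := one_lt_ratio hk₀ hk₁
  have hr0 := ratio_pos hk₀ hk₁
  have hα := alpha_pos hk₀ hT
  have hE : 0 ≤ energy k T Ψ := integral_nonneg fun z => sq_nonneg _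
  have hc1 := continuous_lineEnergy₁ k T hΨ.smooth
  have hc2 := continuous_lineEnergy₂ k T hΨ.smooth
  have hle : ∀ m : ℤ, -(N : ℤ) ≤ m → (ratio k ^ m)⁻¹ ≤ ratio k ^ N := fun m hm => by
    rw [← zpow_neg, ← zpow_natCast]
    exact zpow_le_zpow_right₀ hr1.le (by omega)
  have k1 : ∀ m : ℤ, -(N : ℤ) ≤ m → ∫ a in (0 : ℝ)..R, lineEnergy₁ k T Ψ (ratio k ^ m * a) ≤
      ratio k ^ N * energy k T Ψ := fun m hm => by
    have hp : 0 < ratio k ^ m := zpow_pos hr0 m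
    rw [intervalIntegral.integral_comp_mul_left _ hp.ne', smul_eq_mul, mul_zero]
    exact mul_le_mul (hle m hm) (integral_lineEnergy₁_le hk₀ hk₁ hT hΨ (by positivity))
      (intervalIntegral.integral_nonneg (by positivity) fun _ _ => lineEnergy₁_nonneg hk₀ hT _ _)
      (by positivity)
  have k2 : ∀ m : ℤ, -(N : ℤ) ≤ m → ∫ a in (0 : ℝ)..R, lineEnergy₂ k T Ψ (ratio k ^ m * a) ≤
      ratio k ^ N * energy k T Ψ := fun m hm => by
    have hp : 0 < ratio k ^ m := zpow_pos hr0 m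
    rw [intervalIntegral.integral_comp_mul_left _ hp.ne', smul_eq_mul, mul_zero]
    exact mul_le_mul (hle m hm) (integral_lineEnergy₂_le hk₀ hk₁ hT hΨ (by positivity))
      (intervalIntegral.integral_nonneg (by positivity) fun _ _ => lineEnergy₂_nonneg hk₀ hT _ _)
      (by positivity)
  unfold majorant majorantConst
  rw [intervalIntegral.integral_const_mul, mul_assoc _ ((2 * (N : ℝ) + 1) * (2 * ratio k ^ N))]
  refine mul_le_mul_of_nonneg_left ?_ (by positivity)
  have i1 : ∀ m : ℤ, IntervalIntegrable (fun a => lineEnergy₁ k T Ψ (ratio k ^ m * a)) volume 0 R :=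
    fun m => (hc1.comp (by fun_prop)).intervalIntegrable _ _
  have i2 : ∀ m : ℤ, IntervalIntegrable (fun a => lineEnergy₂ k T Ψ (ratio k ^ m * a)) volume 0 R :=
    fun m => (hc2.comp (by fun_prop)).intervalIntegrable _ _
  rw [intervalIntegral.integral_finsetSum fun n _ => (i1 n).add (i2 (-n))]
  refine (Finset.sum_le_card_nsmul _ _ (2 * ratio k ^ N * energy k T Ψ) fun n hn => ?_).trans
    (le_of_eq ?_)
  · rw [Finset.mem_Icc] at hn
    rw [intervalIntegral.integral_add (i1 n) (i2 (-n))]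
    linarith [k1 n hn.1, k2 (-n) (by omega)]
  · rw [Int.card_Icc, nsmul_eq_mul]
    have : ((N : ℤ) + 1 - -(N : ℤ)).toNat = 2 * N + 1 := by omega
    rw [this]; push_cast; ring

/-! ### Smooth solutions of the adjoint problem -/

/-- The adjoint state generated by the potential `Ψ`. -/
def adj (k : ℝ) (N : ℕ) (Ψ : ℝ × ℝ → ℝ) (z : ℝ × ℝ) : ℝ := alpha k z.2 * img k N Ψ (char k z)

/-- The source term generated by the potential `Ψ`. -/
def source (k : ℝ) (Ψ : ℝ × ℝ → ℝ) (z : ℝ × ℝ) : ℝ :=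
  4 * k ^ 2 * alpha k z.2 * pd2 (pd1 Ψ) (char k z)

theorem contDiff_adj (k : ℝ) (N : ℕ) {Ψ : ℝ × ℝ → ℝ} (hΨ : ContDiff ℝ ∞ Ψ) :
    ContDiff ℝ ∞ (adj k N Ψ) :=
  ((contDiff_alpha k).comp contDiff_snd).mul ((contDiff_img k N hΨ).comp (contDiff_char k))

theorem continuous_source (k : ℝ) {Ψ : ℝ × ℝ → ℝ} (hΨ : ContDiff ℝ ∞ Ψ) :
    Continuous (source k Ψ) := by
  have h1 := ((contDiff_pd2 (contDiff_pd1 hΨ)).comp (contDiff_char k)).continuous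
  have h2 : Continuous fun z : ℝ × ℝ => alpha k z.2 := by unfold alpha; fun_prop
  exact (continuous_const.mul h2).mul h1

theorem pd1_adj (k : ℝ) (N : ℕ) {Ψ : ℝ × ℝ → ℝ} (hΨ : ContDiff ℝ ∞ Ψ) (y t : ℝ) :
    pd1 (adj k N Ψ) (y, t) = k * alpha k t ^ 2 *
      (pd1 (img k N Ψ) (char k (y, t)) - pd2 (img k N Ψ) (char k (y, t))) := by
  refine (hasDerivAt_fst (contDiff_adj k N hΨ) y t).unique ?_
  refine ((hasDerivAt_char_fst (contDiff_img k N hΨ) y t).const_mul (alpha k t)).congr_deriv ?_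
  ring

theorem pd2_adj (k : ℝ) (N : ℕ) {Ψ : ℝ × ℝ → ℝ} (hΨ : ContDiff ℝ ∞ Ψ) (y t : ℝ) :
    pd2 (adj k N Ψ) (y, t) = k * img k N Ψ (char k (y, t)) + alpha k t *
      (k * ((1 + k * y) * pd1 (img k N Ψ) (char k (y, t))
        + (1 - k * y) * pd2 (img k N Ψ) (char k (y, t)))) :=
  (hasDerivAt_snd (contDiff_adj k N hΨ) y t).unique
    ((hasDerivAt_alpha k t).mul (hasDerivAt_char_snd (contDiff_img k N hΨ) y t))

theorem adj_zero (k : ℝ) (N : ℕ) (Ψ : ℝ × ℝ → ℝ) (t : ℝ) : adj k N Ψ (0, t) = 0 := by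
  rw [adj, img_char_zero, mul_zero]

theorem char_fst_mem {k T y t : ℝ} (hk₀ : 0 < k) (hy : y ∈ Icc (0 : ℝ) 1) (ht : t ∈ Icc 0 T) :
    alpha k t * (1 + k * y) ∈ Icc 0 ((1 + k) * alpha k T) := by
  have h1 := alpha_pos hk₀ ht.1
  have h2 : alpha k t ≤ alpha k T := by unfold alpha; nlinarith [ht.2]
  have h3 : 0 ≤ k * y := mul_nonneg hk₀.le hy.1
  have h4 : k * y ≤ k := by nlinarith [hy.2]
  refine ⟨by positivity, ?_⟩
  rw [mul_comm]
  exact mul_le_mul (by linarith) h2 h1.le (by linarith)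

theorem char_snd_mem {k T y t : ℝ} (hk₀ : 0 < k) (hk₁ : k < 1) (hy : y ∈ Icc (0 : ℝ) 1)
    (ht : t ∈ Icc 0 T) : alpha k t * (1 - k * y) ∈ Icc 0 ((1 + k) * alpha k T) := by
  have h1 := alpha_pos hk₀ ht.1
  have h2 : alpha k t ≤ alpha k T := by unfold alpha; nlinarith [ht.2]
  have h3 : 0 ≤ k * y := mul_nonneg hk₀.le hy.1
  have h4 : k * y ≤ k := by nlinarith [hy.2]
  refine ⟨mul_nonneg h1.le (by linarith), ?_⟩
  rw [mul_comm]
  exact mul_le_mul (by linarith) h2 h1.le (by linarith)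

theorem sq_pd2_img_le {k T : ℝ} (hk₀ : 0 < k) (hk₁ : k < 1) (hT : 0 ≤ T) (N : ℕ)
    {Ψ : ℝ × ℝ → ℝ} (hΨ : IsBackward k T Ψ) {a b : ℝ} (ha : 0 ≤ a) :
    pd2 (img k N Ψ) (a, b) ^ 2 ≤ majorant k T N Ψ b := by
  rw [pd2_img k N hΨ.smooth, neg_sq]; exact sq_pd1_img_le hk₀ hk₁ hT N hΨ ha

/-- The majorant summed over the two characteristics through `(y,t)`. -/
def majorantSum (k T : ℝ) (N : ℕ) (Ψ : ℝ × ℝ → ℝ) (y t : ℝ) : ℝ :=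
  majorant k T N Ψ (alpha k t * (1 + k * y)) + majorant k T N Ψ (alpha k t * (1 - k * y))

theorem continuous_majorantSum_fst (k T : ℝ) (N : ℕ) {Ψ : ℝ × ℝ → ℝ} (hΨ : ContDiff ℝ ∞ Ψ)
    (t : ℝ) : Continuous fun y => majorantSum k T N Ψ y t := by
  have h := continuous_majorant k T N hΨ
  unfold majorantSum
  fun_prop

theorem continuous_majorantSum_snd (k T : ℝ) (N : ℕ) {Ψ : ℝ × ℝ → ℝ} (hΨ : ContDiff ℝ ∞ Ψ)
    (y : ℝ) : Continuous fun t => majorantSum k T N Ψ y t := by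
  have h := continuous_majorant k T N hΨ
  unfold majorantSum alpha
  fun_prop

/-- At fixed t both characteristic coordinates are affine in y with slope ±kα(t), and kα(t) ≥ k. -/
theorem integral_majorantSum_fst_le {k T : ℝ} (hk₀ : 0 < k) (hk₁ : k < 1) (hT : 0 ≤ T) (N : ℕ)
    {Ψ : ℝ × ℝ → ℝ} (hΨ : IsBackward k T Ψ) {t : ℝ} (ht : t ∈ Icc 0 T) :
    ∫ y in (0 : ℝ)..1, majorantSum k T N Ψ y t ≤
      2 * k⁻¹ * (majorantConst k T N * energy k T Ψ) := by
  have hM := continuous_majorant k T N hΨ.smooth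
  have h0 := majorant_nonneg hk₀ hk₁ hT N Ψ
  have hα := one_le_alpha hk₀ ht.1
  have hαk : (k * alpha k t)⁻¹ ≤ k⁻¹ := inv_anti₀ hk₀ (by nlinarith)
  have hpos : 0 < k * alpha k t := by positivity
  have hint := integral_majorant_le hk₀ hk₁ hT N hΨ
    (R := (1 + k) * alpha k T) (by have := alpha_pos hk₀ hT; positivity)
  have m0 := char_fst_mem hk₀ (y := 0) (by simp) ht
  have m1 := char_fst_mem hk₀ (y := 1) (by simp) ht
  have m2 := char_snd_mem hk₀ hk₁ (y := 1) (by simp) ht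
  have e1 := integral_comp_affine_le hM h0 (L := 1) (A := (1 + k) * alpha k T) (c := k * alpha k t)
    (d := alpha k t) (K := k⁻¹) zero_le_one hpos.ne' (by rwa [abs_of_pos hpos])
    (by simpa using m0) (by convert m1 using 1; ring)
  have e2 := integral_comp_affine_le hM h0 (L := 1) (A := (1 + k) * alpha k T)
    (c := -(k * alpha k t)) (d := alpha k t) (K := k⁻¹) zero_le_one (neg_ne_zero.2 hpos.ne')
    (by rwa [abs_neg, abs_of_pos hpos]) (by simpa using m0) (by convert m2 using 1; ring)
  unfold majorantSum
  have i1 : IntervalIntegrable (fun y => majorant k T N Ψ (alpha k t * (1 + k * y))) volume 0 1 :=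
    (by fun_prop : Continuous _).intervalIntegrable _ _
  have i2 : IntervalIntegrable (fun y => majorant k T N Ψ (alpha k t * (1 - k * y))) volume 0 1 :=
    (by fun_prop : Continuous _).intervalIntegrable _ _
  rw [intervalIntegral.integral_add i1 i2]
  have g1 : ∀ y, alpha k t * (1 + k * y) = alpha k t + k * alpha k t * y := fun y => by ring
  have g2 : ∀ y, alpha k t * (1 - k * y) = alpha k t + -(k * alpha k t) * y := fun y => by ring
  simp only [g1, g2]
  have := mul_le_mul_of_nonneg_left hint (inv_nonneg.2 hk₀.le)
  linarith

/-- At fixed y the characteristic coordinates are affine in t with slopes k(1 ± ky) ≥ k(1 - k). The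
estimate holds on every line y = const, the boundary included: this is the source of the hidden
regularity. -/
theorem integral_majorantSum_snd_le {k T : ℝ} (hk₀ : 0 < k) (hk₁ : k < 1) (hT : 0 ≤ T) (N : ℕ)
    {Ψ : ℝ × ℝ → ℝ} (hΨ : IsBackward k T Ψ) {y : ℝ} (hy : y ∈ Icc (0 : ℝ) 1) :
    ∫ t in (0 : ℝ)..T, majorantSum k T N Ψ y t ≤
      2 * (k * (1 - k))⁻¹ * (majorantConst k T N * energy k T Ψ) := by
  have hM := continuous_majorant k T N hΨ.smooth
  have h0 := majorant_nonneg hk₀ hk₁ hT N Ψ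
  have hk2 : 0 < 1 - k := by linarith
  have hky : 0 ≤ k * y := mul_nonneg hk₀.le hy.1
  have hky1 : k * y ≤ k := by nlinarith [hy.2]
  have hint := integral_majorant_le hk₀ hk₁ hT N hΨ
    (R := (1 + k) * alpha k T) (by have := alpha_pos hk₀ hT; positivity)
  have hp1 : 0 < k * (1 + k * y) := by positivity
  have hp2 : 0 < k * (1 - k * y) := mul_pos hk₀ (by linarith)
  have m0 := char_fst_mem (T := T) hk₀ hy (t := 0) (by simpa using hT)
  have m1 := char_fst_mem (T := T) hk₀ hy (t := T) (by simpa using hT)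
  have n0 := char_snd_mem (T := T) hk₀ hk₁ hy (t := 0) (by simpa using hT)
  have n1 := char_snd_mem (T := T) hk₀ hk₁ hy (t := T) (by simpa using hT)
  have e1 := integral_comp_affine_le hM h0 (L := T) (A := (1 + k) * alpha k T)
    (c := k * (1 + k * y)) (d := 1 + k * y) (K := (k * (1 - k))⁻¹) hT hp1.ne'
    (by rw [abs_of_pos hp1]; exact inv_anti₀ (by positivity) (by nlinarith))
    (by convert m0 using 1; simp [alpha]) (by convert m1 using 1; unfold alpha; ring)
  have e2 := integral_comp_affine_le hM h0 (L := T) (A := (1 + k) * alpha k T)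
    (c := k * (1 - k * y)) (d := 1 - k * y) (K := (k * (1 - k))⁻¹) hT hp2.ne'
    (by rw [abs_of_pos hp2]; exact inv_anti₀ (by positivity) (by nlinarith))
    (by convert n0 using 1; simp [alpha]) (by convert n1 using 1; unfold alpha; ring)
  have hca : Continuous (alpha k) := (contDiff_alpha k).continuous
  unfold majorantSum
  have i1 : IntervalIntegrable (fun t => majorant k T N Ψ (alpha k t * (1 + k * y))) volume 0 T :=
    (by fun_prop : Continuous _).intervalIntegrable _ _
  have i2 : IntervalIntegrable (fun t => majorant k T N Ψ (alpha k t * (1 - k * y))) volume 0 T :=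
    (by fun_prop : Continuous _).intervalIntegrable _ _
  rw [intervalIntegral.integral_add i1 i2]
  have g1 : ∀ t, alpha k t * (1 + k * y) = 1 + k * y + k * (1 + k * y) * t := fun t => by
    unfold alpha; ring
  have g2 : ∀ t, alpha k t * (1 - k * y) = 1 - k * y + k * (1 - k * y) * t := fun t => by
    unfold alpha; ring
  simp only [g1, g2]
  have := mul_le_mul_of_nonneg_left hint (by positivity : 0 ≤ (k * (1 - k))⁻¹)
  linarith

theorem sq_pd1_adj_le {k T : ℝ} (hk₀ : 0 < k) (hk₁ : k < 1) (hT : 0 ≤ T) (N : ℕ)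
    {Ψ : ℝ × ℝ → ℝ} (hΨ : IsBackward k T Ψ) {y t : ℝ} (hy : y ∈ Icc (0 : ℝ) 1) (ht : t ∈ Icc 0 T) :
    pd1 (adj k N Ψ) (y, t) ^ 2 ≤ 2 * k ^ 2 * alpha k T ^ 4 * majorantSum k T N Ψ y t := by
  have h1 := alpha_pos hk₀ ht.1
  have h2 : alpha k t ≤ alpha k T := by unfold alpha; nlinarith [ht.2]
  have e1 := sq_pd1_img_le hk₀ hk₁ hT N hΨ (a := alpha k t * (1 + k * y))
    (char_snd_mem hk₀ hk₁ hy ht).1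
  have e2 := sq_pd2_img_le hk₀ hk₁ hT N hΨ (b := alpha k t * (1 - k * y))
    (char_fst_mem hk₀ hy ht).1
  have n1 := majorant_nonneg hk₀ hk₁ hT N Ψ (alpha k t * (1 + k * y))
  have n2 := majorant_nonneg hk₀ hk₁ hT N Ψ (alpha k t * (1 - k * y))
  rw [pd1_adj k N hΨ.smooth, mul_pow, mul_pow, ← pow_mul]
  have f3 : ∀ x y : ℝ, (x - y) ^ 2 ≤ 2 * x ^ 2 + 2 * y ^ 2 := fun x y => by nlinarith [sq_nonneg (x + y)]
  have h4 : alpha k t ^ (2 * 2) ≤ alpha k T ^ 4 := pow_le_pow_left₀ h1.le h2 4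
  calc k ^ 2 * alpha k t ^ (2 * 2) * (pd1 (img k N Ψ) (char k (y, t))
        - pd2 (img k N Ψ) (char k (y, t))) ^ 2
      ≤ k ^ 2 * alpha k T ^ 4 * (2 * majorantSum k T N Ψ y t) := by
        refine mul_le_mul (mul_le_mul_of_nonneg_left h4 (by positivity)) ?_ (sq_nonneg _)
          (by positivity)
        refine (f3 _ _).trans ?_
        unfold majorantSum char
        linarith
    _ = _ := by ring

theorem sq_pd2_adj_le {k T : ℝ} (hk₀ : 0 < k) (hk₁ : k < 1) (hT : 0 ≤ T) (N : ℕ)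
    {Ψ : ℝ × ℝ → ℝ} (hΨ : IsBackward k T Ψ) {y t : ℝ} (hy : y ∈ Icc (0 : ℝ) 1) (ht : t ∈ Icc 0 T) :
    pd2 (adj k N Ψ) (y, t) ^ 2 ≤ 2 * adj k N Ψ (y, t) ^ 2
      + 16 * alpha k T ^ 2 * majorantSum k T N Ψ y t := by
  have h1 := alpha_pos hk₀ ht.1
  have h1' := one_le_alpha hk₀ ht.1
  have h2 : alpha k t ≤ alpha k T := by unfold alpha; nlinarith [ht.2]
  have e1 := sq_pd1_img_le hk₀ hk₁ hT N hΨ (a := alpha k t * (1 + k * y))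
    (char_snd_mem hk₀ hk₁ hy ht).1
  have e2 := sq_pd2_img_le hk₀ hk₁ hT N hΨ (b := alpha k t * (1 - k * y))
    (char_fst_mem hk₀ hy ht).1
  have n1 := majorant_nonneg hk₀ hk₁ hT N Ψ (alpha k t * (1 + k * y))
  have n2 := majorant_nonneg hk₀ hk₁ hT N Ψ (alpha k t * (1 - k * y))
  have hky : 0 ≤ k * y := mul_nonneg hk₀.le hy.1
  have hky1 : k * y ≤ 1 := by nlinarith [hy.2]
  have f3 : ∀ x y : ℝ, (x + y) ^ 2 ≤ 2 * x ^ 2 + 2 * y ^ 2 := fun x y => by nlinarith [sq_nonneg (x - y)]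
  have hkk : k ^ 2 ≤ 1 := by nlinarith
  rw [pd2_adj k N hΨ.smooth]
  refine (f3 _ _).trans (add_le_add ?_ ?_)
  · rw [adj, mul_pow, mul_pow]
    have : k ^ 2 ≤ alpha k t ^ 2 := by nlinarith
    have := mul_le_mul_of_nonneg_right this (sq_nonneg (img k N Ψ (char k (y, t))))
    linarith
  · have g : ((1 + k * y) * pd1 (img k N Ψ) (char k (y, t))
        + (1 - k * y) * pd2 (img k N Ψ) (char k (y, t))) ^ 2 ≤ 8 * majorantSum k T N Ψ y t := by
      refine (f3 _ _).trans ?_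
      rw [mul_pow, mul_pow]
      have g1 : (1 + k * y) ^ 2 * pd1 (img k N Ψ) (char k (y, t)) ^ 2 ≤
          4 * majorant k T N Ψ (alpha k t * (1 + k * y)) :=
        mul_le_mul (by nlinarith) e1 (sq_nonneg _) (by norm_num)
      have g2 : (1 - k * y) ^ 2 * pd2 (img k N Ψ) (char k (y, t)) ^ 2 ≤
          4 * majorant k T N Ψ (alpha k t * (1 - k * y)) :=
        mul_le_mul (by nlinarith) e2 (sq_nonneg _) (by norm_num)
      unfold majorantSum
      linarith
    rw [mul_pow, mul_pow]
    have hα2 : alpha k t ^ 2 ≤ alpha k T ^ 2 := pow_le_pow_left₀ h1.le h2 2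
    have g0 : k ^ 2 * ((1 + k * y) * pd1 (img k N Ψ) (char k (y, t))
        + (1 - k * y) * pd2 (img k N Ψ) (char k (y, t))) ^ 2 ≤ 1 * (8 * majorantSum k T N Ψ y t) :=
      mul_le_mul hkk g (sq_nonneg _) zero_le_one
    have := mul_le_mul hα2 g0 (by positivity) (by positivity)
    linarith

theorem norm_bL_pd1_adj_sq_le {k T : ℝ} (hk₀ : 0 < k) (hk₁ : k < 1) (hT : 0 ≤ T) (N : ℕ)
    {Ψ : ℝ × ℝ → ℝ} (hΨ : IsBackward k T Ψ) {t : ℝ} (ht : t ∈ Icc 0 T) :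
    ‖bL 1 fun y => pd1 (adj k N Ψ) (y, t)‖ ^ 2 ≤ 2 * k ^ 2 * alpha k T ^ 4 *
      (2 * k⁻¹ * (majorantConst k T N * energy k T Ψ)) := by
  have hc := (contDiff_pd1 (contDiff_adj k N hΨ.smooth)).continuous
  have hc1 : Continuous fun y => pd1 (adj k N Ψ) (y, t) := by fun_prop
  have hm1 : Continuous fun y => majorantSum k T N Ψ y t :=
    continuous_majorantSum_fst k T N hΨ.smooth t
  rw [norm_bL_sq (memLp_Ioo_of_continuous hc1), setIntegral_Ioo_eq_intervalIntegral zero_le_one]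
  have i1 : IntervalIntegrable (fun y => pd1 (adj k N Ψ) (y, t) ^ 2) volume 0 1 :=
    (hc1.pow 2).intervalIntegrable _ _
  have i2 : IntervalIntegrable (fun y => 2 * k ^ 2 * alpha k T ^ 4 * majorantSum k T N Ψ y t)
      volume 0 1 := (continuous_const.mul hm1).intervalIntegrable _ _
  refine le_trans (intervalIntegral.integral_mono_on zero_le_one i1 i2
    fun y hy => sq_pd1_adj_le hk₀ hk₁ hT N hΨ hy ht) ?_
  rw [intervalIntegral.integral_const_mul]
  exact mul_le_mul_of_nonneg_left (integral_majorantSum_fst_le hk₀ hk₁ hT N hΨ ht) (by positivity)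

theorem norm_bL_adj_le {k : ℝ} (N : ℕ) {Ψ : ℝ × ℝ → ℝ} (hΨ : ContDiff ℝ ∞ Ψ) (t : ℝ) :
    ‖bL 1 fun y => adj k N Ψ (y, t)‖ ≤ ‖bL 1 fun y => pd1 (adj k N Ψ) (y, t)‖ := by
  have hs := contDiff_adj k N hΨ
  have h1 : ContDiff ℝ 1 fun y => adj k N Ψ (y, t) :=
    (hs.comp (contDiff_id.prodMk contDiff_const)).of_le (by simp)
  have e : deriv (fun y => adj k N Ψ (y, t)) = fun y => pd1 (adj k N Ψ) (y, t) :=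
    funext fun y => (hasDerivAt_fst hs y t).deriv
  rw [← prim_deriv h1 (adj_zero k N Ψ t), e]
  exact norm_prim_le _

theorem norm_bL_pd2_adj_sq_le {k T : ℝ} (hk₀ : 0 < k) (hk₁ : k < 1) (hT : 0 ≤ T) (N : ℕ)
    {Ψ : ℝ × ℝ → ℝ} (hΨ : IsBackward k T Ψ) {t : ℝ} (ht : t ∈ Icc 0 T) :
    ‖bL 1 fun y => pd2 (adj k N Ψ) (y, t)‖ ^ 2 ≤
      2 * ‖bL 1 fun y => pd1 (adj k N Ψ) (y, t)‖ ^ 2 + 16 * alpha k T ^ 2 *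
      (2 * k⁻¹ * (majorantConst k T N * energy k T Ψ)) := by
  have hs := (contDiff_adj k N hΨ.smooth).continuous
  have hs1 : Continuous fun y => adj k N Ψ (y, t) := by fun_prop
  have hc := (contDiff_pd2 (contDiff_adj k N hΨ.smooth)).continuous
  have hc1 : Continuous fun y => pd2 (adj k N Ψ) (y, t) := by fun_prop
  have hm1 : Continuous fun y => majorantSum k T N Ψ y t :=
    continuous_majorantSum_fst k T N hΨ.smooth t
  have hle := pow_le_pow_left₀ (norm_nonneg _) (norm_bL_adj_le (k := k) N hΨ.smooth t) 2
  rw [norm_bL_sq (memLp_Ioo_of_continuous hs1), setIntegral_Ioo_eq_intervalIntegral zero_le_one]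
    at hle
  rw [norm_bL_sq (memLp_Ioo_of_continuous hc1), setIntegral_Ioo_eq_intervalIntegral zero_le_one]
  have i1 : IntervalIntegrable (fun y => 2 * adj k N Ψ (y, t) ^ 2) volume 0 1 :=
    (continuous_const.mul (hs1.pow 2)).intervalIntegrable _ _
  have i2 : IntervalIntegrable (fun y => 16 * alpha k T ^ 2 * majorantSum k T N Ψ y t) volume 0 1 :=
    (continuous_const.mul hm1).intervalIntegrable _ _
  have i3 : IntervalIntegrable (fun y => pd2 (adj k N Ψ) (y, t) ^ 2) volume 0 1 :=
    (hc1.pow 2).intervalIntegrable _ _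
  refine le_trans (intervalIntegral.integral_mono_on zero_le_one i3 (i1.add i2)
    fun y hy => sq_pd2_adj_le hk₀ hk₁ hT N hΨ hy ht) ?_
  rw [intervalIntegral.integral_add i1 i2, intervalIntegral.integral_const_mul,
    intervalIntegral.integral_const_mul]
  exact add_le_add (by linarith) (mul_le_mul_of_nonneg_left
    (integral_majorantSum_fst_le hk₀ hk₁ hT N hΨ ht) (by positivity))

/-- The difference quotient at `y = 0` of the adjoint state, `∫_0^1 p_y(hs,t) ds`. -/
def quot (k : ℝ) (N : ℕ) (Ψ : ℝ × ℝ → ℝ) (h t : ℝ) : ℝ :=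
  ∫ s in (0 : ℝ)..1, pd1 (adj k N Ψ) (h * s, t)

theorem continuous_quot (k : ℝ) (N : ℕ) {Ψ : ℝ × ℝ → ℝ} (hΨ : ContDiff ℝ ∞ Ψ) :
    Continuous (Function.uncurry (quot k N Ψ)) := by
  have hc := (contDiff_pd1 (contDiff_adj k N hΨ)).continuous
  exact intervalIntegral.continuous_parametric_intervalIntegral_of_continuous'
    (f := fun (z : ℝ × ℝ) s => pd1 (adj k N Ψ) (z.1 * s, z.2)) (by
      change Continuous fun p : (ℝ × ℝ) × ℝ => pd1 (adj k N Ψ) (p.1.1 * p.2, p.1.2); fun_prop) _ _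

/-- The quotient averages p_y over the lines y = hs, 0 ≤ s ≤ 1. Cauchy–Schwarz and Fubini reduce it
to single lines, where the bound is uniform; h = 0 is not exceptional. -/
theorem norm_bL_quot_sq_le {k T : ℝ} (hk₀ : 0 < k) (hk₁ : k < 1) (hT : 0 ≤ T) (N : ℕ)
    {Ψ : ℝ × ℝ → ℝ} (hΨ : IsBackward k T Ψ) {h : ℝ} (hh : h ∈ Icc (0 : ℝ) 1) :
    ‖bL T (quot k N Ψ h)‖ ^ 2 ≤ 2 * k ^ 2 * alpha k T ^ 4 *
      (2 * (k * (1 - k))⁻¹ * (majorantConst k T N * energy k T Ψ)) := by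
  have hc := (contDiff_pd1 (contDiff_adj k N hΨ.smooth)).continuous
  have hq : Continuous (quot k N Ψ h) :=
    (continuous_quot k N hΨ.smooth).comp (by fun_prop : Continuous fun t : ℝ => (h, t))
  have h2c : Continuous fun z : ℝ × ℝ => pd1 (adj k N Ψ) (h * z.2, z.1) ^ 2 := by fun_prop
  rw [norm_bL_sq (memLp_Ioo_of_continuous hq), setIntegral_Ioo_eq_intervalIntegral hT]
  have e1 : ∫ t in (0 : ℝ)..T, quot k N Ψ h t ^ 2 ≤
      ∫ t in (0 : ℝ)..T, ∫ s in (0 : ℝ)..1, pd1 (adj k N Ψ) (h * s, t) ^ 2 := by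
    refine intervalIntegral.integral_mono_on hT ((hq.pow 2).intervalIntegrable _ _) ?_ fun t _ => ?_
    · exact (intervalIntegral.continuous_parametric_intervalIntegral_of_continuous'
        (f := fun t s => pd1 (adj k N Ψ) (h * s, t) ^ 2) h2c 0 1).intervalIntegrable _ _
    · have := sq_intervalIntegral_le (u := fun s => pd1 (adj k N Ψ) (h * s, t)) (by fun_prop)
        (zero_le_one (α := ℝ))
      simpa [quot] using this
  have e2 : ∫ t in (0 : ℝ)..T, ∫ s in (0 : ℝ)..1, pd1 (adj k N Ψ) (h * s, t) ^ 2 =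
      ∫ s in (0 : ℝ)..1, ∫ t in (0 : ℝ)..T, pd1 (adj k N Ψ) (h * s, t) ^ 2 := by
    refine intervalIntegral_intervalIntegral_swap ?_
    exact (h2c.continuousOn.integrableOn_compact (isCompact_uIcc.prod isCompact_uIcc)).mono_set
      (Set.prod_mono uIoc_subset_uIcc uIoc_subset_uIcc)
  refine e1.trans (e2.le.trans ?_)
  refine (intervalIntegral.integral_mono_on (g := fun _ => 2 * k ^ 2 * alpha k T ^ 4 *
      (2 * (k * (1 - k))⁻¹ * (majorantConst k T N * energy k T Ψ))) zero_le_one ?_ (by simp)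
      fun s hs => ?_).trans (by simp)
  · exact (intervalIntegral.continuous_parametric_intervalIntegral_of_continuous'
        (f := fun s t => pd1 (adj k N Ψ) (h * s, t) ^ 2) (h2c.comp continuous_swap)
        0 T).intervalIntegrable _ _
  · have hy : h * s ∈ Icc (0 : ℝ) 1 :=
      ⟨mul_nonneg hh.1 hs.1, mul_le_one₀ hh.2 hs.1 hs.2⟩
    have hm1 : Continuous fun t => majorantSum k T N Ψ (h * s) t :=
      continuous_majorantSum_snd k T N hΨ.smooth _
    have hc1 : Continuous fun t => pd1 (adj k N Ψ) (h * s, t) := by fun_prop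
    have i1 : IntervalIntegrable (fun t => pd1 (adj k N Ψ) (h * s, t) ^ 2) volume 0 T :=
      (hc1.pow 2).intervalIntegrable _ _
    have i2 : IntervalIntegrable (fun t => 2 * k ^ 2 * alpha k T ^ 4 *
        majorantSum k T N Ψ (h * s) t) volume 0 T :=
      (continuous_const.mul hm1).intervalIntegrable _ _
    refine le_trans (intervalIntegral.integral_mono_on hT i1 i2
      fun t ht => sq_pd1_adj_le hk₀ hk₁ hT N hΨ hy ht) ?_
    rw [intervalIntegral.integral_const_mul]
    exact mul_le_mul_of_nonneg_left (integral_majorantSum_snd_le hk₀ hk₁ hT N hΨ hy) (by positivity)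

/-! ### Linearity in the potential -/

theorem pd1_lin {F G : ℝ × ℝ → ℝ} (hF : ContDiff ℝ ∞ F) (hG : ContDiff ℝ ∞ G) (c : ℝ) (z : ℝ × ℝ) :
    pd1 (fun z => c * F z + G z) z = c * pd1 F z + pd1 G z :=
  (hasDerivAt_fst ((contDiff_const.mul hF).add hG) z.1 z.2).unique
    (((hasDerivAt_fst hF z.1 z.2).const_mul c).add (hasDerivAt_fst hG z.1 z.2))

theorem pd2_lin {F G : ℝ × ℝ → ℝ} (hF : ContDiff ℝ ∞ F) (hG : ContDiff ℝ ∞ G) (c : ℝ) (z : ℝ × ℝ) :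
    pd2 (fun z => c * F z + G z) z = c * pd2 F z + pd2 G z :=
  (hasDerivAt_snd ((contDiff_const.mul hF).add hG) z.1 z.2).unique
    (((hasDerivAt_snd hF z.1 z.2).const_mul c).add (hasDerivAt_snd hG z.1 z.2))

theorem pd2_pd1_lin {F G : ℝ × ℝ → ℝ} (hF : ContDiff ℝ ∞ F) (hG : ContDiff ℝ ∞ G) (c : ℝ)
    (z : ℝ × ℝ) :
    pd2 (pd1 fun z => c * F z + G z) z = c * pd2 (pd1 F) z + pd2 (pd1 G) z := by
  rw [show pd1 (fun z => c * F z + G z) = fun z => c * pd1 F z + pd1 G z from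
    funext fun z => pd1_lin hF hG c z, pd2_lin (contDiff_pd1 hF) (contDiff_pd1 hG)]

theorem adj_lin (k : ℝ) (N : ℕ) (F G : ℝ × ℝ → ℝ) (c : ℝ) :
    adj k N (fun z => c * F z + G z) = fun z => c * adj k N F z + adj k N G z := by
  funext z
  have : ∀ w, img k N (fun z => c * F z + G z) w = c * img k N F w + img k N G w := fun w => by
    simp only [img, Finset.mul_sum, ← Finset.sum_add_distrib]
    exact Finset.sum_congr rfl fun n _ => by ring
  simp only [adj, this]; ring

theorem source_lin (k : ℝ) {F G : ℝ × ℝ → ℝ} (hF : ContDiff ℝ ∞ F) (hG : ContDiff ℝ ∞ G) (c : ℝ)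
    (z : ℝ × ℝ) : source k (fun z => c * F z + G z) z = c * source k F z + source k G z := by
  simp only [source, pd2_pd1_lin hF hG]; ring

theorem quot_lin (k : ℝ) (N : ℕ) {F G : ℝ × ℝ → ℝ} (hF : ContDiff ℝ ∞ F) (hG : ContDiff ℝ ∞ G)
    (c h t : ℝ) :
    quot k N (fun z => c * F z + G z) h t = c * quot k N F h t + quot k N G h t := by
  have hc := (contDiff_pd1 (contDiff_adj k N hF)).continuous
  have hd := (contDiff_pd1 (contDiff_adj k N hG)).continuous
  have i1 : IntervalIntegrable (fun s => c * pd1 (adj k N F) (h * s, t)) volume 0 1 :=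
    (by fun_prop : Continuous _).intervalIntegrable _ _
  have i2 : IntervalIntegrable (fun s => pd1 (adj k N G) (h * s, t)) volume 0 1 :=
    (by fun_prop : Continuous _).intervalIntegrable _ _
  simp only [quot, adj_lin, pd1_lin (contDiff_adj k N hF) (contDiff_adj k N hG)]
  rw [intervalIntegral.integral_add i1 i2, intervalIntegral.integral_const_mul]

theorem IsBackward.lin {k T : ℝ} {F G : ℝ × ℝ → ℝ} (hF : IsBackward k T F) (hG : IsBackward k T G)
    (c : ℝ) : IsBackward k T fun z => c * F z + G z where
  smooth := (contDiff_const.mul hF.smooth).add hG.smooth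
  zero_sum z hz := by rw [hF.zero_sum z hz, hG.zero_sum z hz]; simp
  zero_snd z hz := by rw [hF.zero_snd z hz, hG.zero_snd z hz]; simp
  zero_fst z hz := by rw [hF.zero_fst z hz, hG.zero_fst z hz]; simp
  support z hz := by
    rw [pd2_pd1_lin hF.smooth hG.smooth, hF.support z hz, hG.support z hz]; simp

theorem pd2_pd1_zero (z : ℝ × ℝ) : pd2 (pd1 fun _ => 0) z = 0 := by
  have : pd1 (fun _ => 0) = fun _ => 0 := by funext z; simp [pd1]
  simp [this, pd2]

theorem source_zero (k : ℝ) (z : ℝ × ℝ) : source k (fun _ => 0) z = 0 := by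
  simp [source, pd2_pd1_zero]

theorem isBackward_zero (k T : ℝ) : IsBackward k T fun _ => 0 where
  smooth := contDiff_const
  zero_sum _ _ := rfl
  zero_snd _ _ := rfl
  zero_fst _ _ := rfl
  support z _ := pd2_pd1_zero z

theorem bL_lin {c : ℝ} (s : ℝ) {u v : ℝ → ℝ} (hu : MemLp u 2 (volume.restrict (Ioo (0 : ℝ) c)))
    (hv : MemLp v 2 (volume.restrict (Ioo (0 : ℝ) c))) :
    bL c (fun x => s * u x + v x) = s • bL c u + bL c v := by
  rw [← bL_const_mul s hu]; exact bL_add (hu.const_mul s) hv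

/-! ### The solution operator of the adjoint problem -/

/-- The data `(p, p', h ↦ p(h,·)/h)` of an adjoint state. -/
def AdjData (T : ℝ) : Type := C(Icc (0 : ℝ) T, H10) × C(Icc (0 : ℝ) T, L2) ×
  C(Icc (0 : ℝ) 1, Lp ℝ 2 (volume.restrict (Ioo (0 : ℝ) T)))

instance (T : ℝ) : NormedAddCommGroup (AdjData T) :=
  inferInstanceAs (NormedAddCommGroup (C(Icc (0 : ℝ) T, H10) × C(Icc (0 : ℝ) T, L2) ×
    C(Icc (0 : ℝ) 1, Lp ℝ 2 (volume.restrict (Ioo (0 : ℝ) T)))))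

instance (T : ℝ) : NormedSpace ℝ (AdjData T) :=
  inferInstanceAs (NormedSpace ℝ (C(Icc (0 : ℝ) T, H10) × C(Icc (0 : ℝ) T, L2) ×
    C(Icc (0 : ℝ) 1, Lp ℝ 2 (volume.restrict (Ioo (0 : ℝ) T)))))

instance (T : ℝ) : CompleteSpace (AdjData T) :=
  inferInstanceAs (CompleteSpace (C(Icc (0 : ℝ) T, H10) × C(Icc (0 : ℝ) T, L2) ×
    C(Icc (0 : ℝ) 1, Lp ℝ 2 (volume.restrict (Ioo (0 : ℝ) T)))))

/-- `x` is the data of the smooth adjoint state generated by `Ψ`. -/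
structure IsAdjData (T k : ℝ) (N : ℕ) (Ψ : ℝ × ℝ → ℝ) (x : AdjData T) : Prop where
  space : ∀ t, dy (x.1 t) = bL 1 fun y => pd1 (adj k N Ψ) (y, t)
  time : ∀ t, x.2.1 t = bL 1 fun y => pd2 (adj k N Ψ) (y, t)
  quotient : ∀ h, x.2.2 h = bL T (quot k N Ψ h)

theorem IsAdjData.lin {T k : ℝ} {N : ℕ} {F G : ℝ × ℝ → ℝ} {x z : AdjData T}
    (hF : ContDiff ℝ ∞ F) (hG : ContDiff ℝ ∞ G)
    (hx : IsAdjData T k N F x) (hz : IsAdjData T k N G z) (c : ℝ) :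
    IsAdjData T k N (fun z => c * F z + G z) (c • x + z) := by
  have aF := contDiff_adj k N hF
  have aG := contDiff_adj k N hG
  have f1 := (contDiff_pd1 aF).continuous
  have f2 := (contDiff_pd2 aF).continuous
  have g1 := (contDiff_pd1 aG).continuous
  have g2 := (contDiff_pd2 aG).continuous
  constructor
  · intro t
    simp only [adj_lin, pd1_lin aF aG]
    rw [bL_lin c (memLp_Ioo_of_continuous (by fun_prop)) (memLp_Ioo_of_continuous (by fun_prop)),
      ← hx.space, ← hz.space, ← map_smul, ← map_add]
    rfl
  · intro t
    simp only [adj_lin, pd2_lin aF aG]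
    rw [bL_lin c (memLp_Ioo_of_continuous (by fun_prop)) (memLp_Ioo_of_continuous (by fun_prop)),
      ← hx.time, ← hz.time]
    rfl
  · intro h
    have q1 : Continuous (quot k N F h) :=
      (continuous_quot k N hF).comp (by fun_prop : Continuous fun t : ℝ => ((h : ℝ), t))
    have q2 : Continuous (quot k N G h) :=
      (continuous_quot k N hG).comp (by fun_prop : Continuous fun t : ℝ => ((h : ℝ), t))
    have e : quot k N (fun z => c * F z + G z) h = fun t => c * quot k N F h t + quot k N G h t :=
      funext fun t => quot_lin k N hF hG c h t
    rw [e, bL_lin c (memLp_Ioo_of_continuous q1) (memLp_Ioo_of_continuous q2),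
      ← hx.quotient, ← hz.quotient]
    rfl

theorem isInducing_dy : IsInducing dy :=
  ((ContinuousLinearMap.antilipschitz_of_bound dy (K := 1) fun χ => by
    simpa using norm_H10_le χ).isUniformInducing dy.uniformContinuous).isInducing

theorem isAdjData_zero (T k : ℝ) (N : ℕ) : IsAdjData T k N (fun _ => 0) 0 := by
  have hz : adj k N (fun _ => 0) = fun _ => 0 := by funext z; simp [adj, img]
  have b0 : ∀ c, bL c (fun _ => 0) = 0 := fun c => bL_eq (Lp.coeFn_zero _ _ _)
  have p1 : ∀ z, pd1 (fun _ => 0) z = 0 := fun z => by simp [pd1]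
  have p2 : ∀ z, pd2 (fun _ => 0) z = 0 := fun z => by simp [pd2]
  refine ⟨fun t => ?_, fun t => ?_, fun h => ?_⟩
  · simp only [hz, p1, b0]; exact map_zero dy
  · simp only [hz, p2, b0]; rfl
  · have : quot k N (fun _ => 0) h = fun _ => 0 := by funext t; simp [quot, hz, p1]
    rw [this, b0]; rfl

/-- The graph of the solution operator on smooth sources. -/
def adjGraph (T k : ℝ) (N : ℕ) : Submodule ℝ (LQ T × AdjData T) where
  carrier := {z | ∃ Ψ, IsBackward k T Ψ ∧
    z.1 =ᵐ[volume.restrict (Ioo (0 : ℝ) 1 ×ˢ Ioo (0 : ℝ) T)] source k Ψ ∧ IsAdjData T k N Ψ z.2}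
  zero_mem' := by
    refine ⟨fun _ => 0, isBackward_zero k T, ?_, isAdjData_zero T k N⟩
    refine (Lp.coeFn_zero _ _ _).trans (Eventually.of_forall fun z => ?_)
    exact (source_zero k z).symm
  add_mem' := by
    rintro x z ⟨F, hF, hx, dx⟩ ⟨G, hG, hz, dz⟩
    refine ⟨_, hF.lin hG 1, ?_, by simpa using dx.lin hF.smooth hG.smooth dz 1⟩
    filter_upwards [hx, hz, Lp.coeFn_add x.1 z.1] with w h1 h2 h3
    rw [source_lin k hF.smooth hG.smooth, Prod.fst_add, h3, Pi.add_apply, h1, h2, one_mul]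
  smul_mem' := by
    rintro c x ⟨F, hF, hx, dx⟩
    refine ⟨fun z => c * F z, by simpa using hF.lin (isBackward_zero k T) c, ?_, ?_⟩
    · filter_upwards [hx, Lp.coeFn_smul c x.1] with w h1 h3
      have := source_lin k hF.smooth (contDiff_const (c := (0 : ℝ))) c w
      rw [source_zero] at this
      simp only [add_zero] at this
      rw [this, Prod.smul_fst, h3, Pi.smul_apply, h1, smul_eq_mul]
    · simpa using dx.lin hF.smooth (isBackward_zero k T).smooth (isAdjData_zero T k N) c

/-- The vanishing of the image sum at y = 0 and y = 1 places the state in H¹₀. The quotients form a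
curve continuous up to h = 0, whose value there is the trace; in this form the convergence demanded
by `HasDyTrace` survives the closure of the graph. -/
theorem exists_adjData {T k : ℝ} (hT : 0 ≤ T) (hk₀ : 0 < k) (hk₁ : k < 1) {N : ℕ}
    (hN : alpha k (T + 1) ≤ ratio k ^ N) {Ψ : ℝ × ℝ → ℝ} (hΨ : IsBackward k T Ψ) :
    ∃ x, IsAdjData T k N Ψ x := by
  have hs := contDiff_adj k N hΨ.smooth
  have f1 := (contDiff_pd1 hs).continuous
  have f2 := (contDiff_pd2 hs).continuous
  have hex : ∀ t : Icc (0 : ℝ) T, ∃ χ : H10, dy χ = bL 1 fun y => pd1 (adj k N Ψ) (y, t) := by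
    intro t
    have h1 : ContDiff ℝ 1 fun y => adj k N Ψ (y, t) :=
      (hs.comp (contDiff_id.prodMk contDiff_const)).of_le (by simp)
    have e : deriv (fun y => adj k N Ψ (y, t)) = fun y => pd1 (adj k N Ψ) (y, t) :=
      funext fun y => (hasDerivAt_fst hs y t).deriv
    rw [← e]
    exact ⟨⟨_, mem_H10_of_contDiff h1 (adj_zero k N Ψ t)
      (by rw [adj, hΨ.img_one hk₀ hk₁ hN t.2.1 hT, mul_zero])⟩, rfl⟩
  choose p hp using hex
  have hpc : Continuous p := by
    rw [isInducing_dy.continuous_iff]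
    have : (dy ∘ p) = (fun t : ℝ => bL 1 fun y => pd1 (adj k N Ψ) (y, t)) ∘ Subtype.val :=
      funext hp
    rw [this]
    exact (continuous_bL (by
      change Continuous fun z : ℝ × ℝ => pd1 (adj k N Ψ) (z.2, z.1); fun_prop)).comp
        continuous_subtype_val
  have hqc : Continuous fun t : Icc (0 : ℝ) T => bL 1 fun y => pd2 (adj k N Ψ) (y, t) :=
    (continuous_bL (G := fun (t : ℝ) y => pd2 (adj k N Ψ) (y, t)) (by
      change Continuous fun z : ℝ × ℝ => pd2 (adj k N Ψ) (z.2, z.1); fun_prop)).comp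
        continuous_subtype_val
  have hrc : Continuous fun h : Icc (0 : ℝ) 1 => bL T (quot k N Ψ h) :=
    (continuous_bL (continuous_quot k N hΨ.smooth)).comp continuous_subtype_val
  exact ⟨(⟨p, hpc⟩, ⟨_, hqc⟩, ⟨_, hrc⟩), hp, fun _ => rfl, fun _ => rfl⟩

theorem memLp_Q_of_continuous {G : ℝ × ℝ → ℝ} (hG : Continuous G) (T : ℝ) :
    MemLp G 2 (volume.restrict (Ioo (0 : ℝ) 1 ×ˢ Ioo (0 : ℝ) T)) := by
  obtain ⟨C, hC⟩ := ((isCompact_Icc (a := (0 : ℝ)) (b := 1)).prod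
    (isCompact_Icc (a := (0 : ℝ)) (b := T))).exists_bound_of_continuousOn hG.continuousOn
  have : IsFiniteMeasure ((volume : Measure (ℝ × ℝ)).restrict (Ioo (0 : ℝ) 1 ×ˢ Ioo (0 : ℝ) T)) := by
    rw [restrict_Q]; infer_instance
  exact MemLp.of_bound hG.aestronglyMeasurable C
    ((ae_restrict_iff' (measurableSet_Ioo.prod measurableSet_Ioo)).2 (ae_of_all _ fun z hz =>
      hC z (Set.prod_mono Ioo_subset_Icc_self Ioo_subset_Icc_self hz)))

/-- The source is 4k²αΨ_ab and the Jacobian 2k²α, so the comparison amounts to α ≤ α². -/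
theorem energy_le {k T : ℝ} (hk : 0 < k) {Ψ : ℝ × ℝ → ℝ} (hΨ : ContDiff ℝ ∞ Ψ) {f : LQ T}
    (hf : f =ᵐ[volume.restrict (Ioo (0 : ℝ) 1 ×ˢ Ioo (0 : ℝ) T)] source k Ψ) :
    8 * k ^ 2 * energy k T Ψ ≤ ‖f‖ ^ 2 := by
  have hc := continuous_source k hΨ
  have hd : Continuous fun z => pd2 (pd1 Ψ) (char k z) :=
    ((contDiff_pd2 (contDiff_pd1 hΨ)).comp (contDiff_char k)).continuous
  have ha : Continuous fun z : ℝ × ℝ => alpha k z.2 := by unfold alpha; fun_prop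
  have hfin : ∀ {G : ℝ × ℝ → ℝ}, Continuous G → IntegrableOn G (Ioo (0 : ℝ) 1 ×ˢ Ioo (0 : ℝ) T) :=
    fun hG => (hG.continuousOn.integrableOn_compact ((isCompact_Icc (a := (0 : ℝ)) (b := 1)).prod
      (isCompact_Icc (a := (0 : ℝ)) (b := T)))).mono_set
      (Set.prod_mono Ioo_subset_Icc_self Ioo_subset_Icc_self)
  have e : ‖f‖ ^ 2 = ∫ z in Ioo (0 : ℝ) 1 ×ˢ Ioo (0 : ℝ) T, source k Ψ z ^ 2 := by
    rw [← real_inner_self_eq_norm_sq, L2.inner_def]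
    exact integral_congr_ae (hf.mono fun z hz => by simp [hz, pow_two])
  rw [e, energy, integral_charRegion hk, ← integral_const_mul]
  refine setIntegral_mono_on (hfin ?_) (hfin ?_) (measurableSet_Ioo.prod measurableSet_Ioo)
    fun z hz => ?_
  · fun_prop
  · fun_prop
  · have h1 := one_le_alpha hk hz.2.1.le
    simp only [source]
    have h2 : alpha k z.2 ≤ alpha k z.2 ^ 2 := by nlinarith
    calc _ = 16 * k ^ 4 * pd2 (pd1 Ψ) (char k z) ^ 2 * alpha k z.2 := by ring
      _ ≤ 16 * k ^ 4 * pd2 (pd1 Ψ) (char k z) ^ 2 * alpha k z.2 ^ 2 := by gcongr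
      _ = _ := by ring

theorem exists_adjGraph_bound {T k : ℝ} (hT : 0 ≤ T) (hk₀ : 0 < k) (hk₁ : k < 1) (N : ℕ) :
    ∃ C, ∀ z ∈ adjGraph T k N, ‖z.2‖ ≤ C * ‖z.1‖ := by
  have hM : 0 ≤ majorantConst k T N := majorantConst_nonneg hk₀ hk₁ hT N
  have hα := alpha_pos hk₀ hT
  have hk2 : 0 < 1 - k := by linarith
  obtain ⟨A, hA⟩ : ∃ A, A = 2 * k ^ 2 * alpha k T ^ 4 * (2 * k⁻¹ * majorantConst k T N) := ⟨_, rfl⟩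
  obtain ⟨B, hB⟩ : ∃ B, B = 16 * alpha k T ^ 2 * (2 * k⁻¹ * majorantConst k T N) := ⟨_, rfl⟩
  obtain ⟨D, hD⟩ : ∃ D, D = 2 * k ^ 2 * alpha k T ^ 4 *
    (2 * (k * (1 - k))⁻¹ * majorantConst k T N) := ⟨_, rfl⟩
  have hA0 : 0 ≤ A := by rw [hA]; positivity
  have hB0 : 0 ≤ B := by rw [hB]; positivity
  have hD0 : 0 ≤ D := by rw [hD]; positivity
  -- In units of the energy, A bounds ‖p_y‖², 2A + B bounds ‖p'‖² and D the quotients; 3A + B + D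
  -- dominates all three. The 8k² comes from `energy_le`.
  refine ⟨Real.sqrt ((3 * A + B + D) / (8 * k ^ 2)), ?_⟩
  rintro ⟨f, x⟩ ⟨Ψ, hΨ, hf, hx⟩
  have he : energy k T Ψ ≤ ‖f‖ ^ 2 / (8 * k ^ 2) := by
    rw [le_div_iff₀ (by positivity), mul_comm]; exact energy_le hk₀ hΨ.smooth hf
  have he0 : 0 ≤ energy k T Ψ := integral_nonneg fun _ => sq_nonneg _
  have key : ∀ (s X : ℝ), s ^ 2 ≤ X * energy k T Ψ → X ≤ 3 * A + B + D →
      s ≤ Real.sqrt ((3 * A + B + D) / (8 * k ^ 2)) * ‖f‖ := by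
    intro s X h1 h2
    refine le_trans (Real.le_sqrt_of_sq_le (h1.trans ((mul_le_mul_of_nonneg_right h2 he0).trans
      (mul_le_mul_of_nonneg_left he (by positivity))))) (le_of_eq ?_)
    rw [← mul_div_assoc, mul_div_right_comm, Real.sqrt_mul (by positivity),
      Real.sqrt_sq (norm_nonneg _)]
  have hn : ∀ t ∈ Icc (0 : ℝ) T, ‖bL 1 fun y => pd1 (adj k N Ψ) (y, t)‖ ^ 2 ≤ A * energy k T Ψ :=
    fun t ht => (norm_bL_pd1_adj_sq_le hk₀ hk₁ hT N hΨ ht).trans (le_of_eq (by rw [hA]; ring))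
  have hr : 0 ≤ Real.sqrt ((3 * A + B + D) / (8 * k ^ 2)) * ‖f‖ := by positivity
  refine max_le ((ContinuousMap.norm_le _ hr).2 fun t => ?_)
    (max_le ((ContinuousMap.norm_le _ hr).2 fun t => ?_) ((ContinuousMap.norm_le _ hr).2 fun h => ?_))
  · refine key _ A (le_trans (pow_le_pow_left₀ (norm_nonneg _) (norm_H10_le _) 2) ?_) (by linarith)
    rw [hx.space]; exact hn t t.2
  · refine key _ (2 * A + B) ?_ (by linarith)
    rw [hx.time]
    refine (norm_bL_pd2_adj_sq_le hk₀ hk₁ hT N hΨ t.2).trans ?_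
    have := hn t t.2
    rw [add_mul, hB]
    linarith
  · refine key _ D ?_ (by linarith)
    rw [hx.quotient]
    exact (norm_bL_quot_sq_le hk₀ hk₁ hT N hΨ h.2).trans (le_of_eq (by rw [hD]; ring))

/-- Multiplication by a bounded function on `L²`. -/
theorem exists_mulLp {X : Type*} [MeasurableSpace X] {μ : Measure X} {ρ : X → ℝ}
    (hρ : AEStronglyMeasurable ρ μ) {C : ℝ} (hC : ∀ᵐ x ∂μ, ‖ρ x‖ ≤ C) :
    ∃ M : Lp ℝ 2 μ →L[ℝ] Lp ℝ 2 μ, ∀ F, M F =ᵐ[μ] fun x => ρ x * F x := by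
  have hb : ∀ F : Lp ℝ 2 μ, ∀ᵐ x ∂μ, ‖ρ x * F x‖ ≤ C * ‖F x‖ := fun F => by
    filter_upwards [hC] with x hx
    rw [norm_mul]
    gcongr
  have hm : ∀ F : Lp ℝ 2 μ, MemLp (fun x => ρ x * F x) 2 μ := fun F =>
    (Lp.memLp F).of_le_mul (hρ.mul (Lp.aestronglyMeasurable F)) (hb F)
  let M : Lp ℝ 2 μ →ₗ[ℝ] Lp ℝ 2 μ :=
    { toFun := fun F => (hm F).toLp _
      map_add' := fun F G => by
        apply Lp.ext
        filter_upwards [(hm (F + G)).coeFn_toLp, (hm F).coeFn_toLp, (hm G).coeFn_toLp,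
          Lp.coeFn_add F G, Lp.coeFn_add ((hm F).toLp _) ((hm G).toLp _)] with z h1 h2 h3 h4 h5
        rw [h1, h5, Pi.add_apply, h2, h3, h4, Pi.add_apply, mul_add]
      map_smul' := fun c F => by
        apply Lp.ext
        filter_upwards [(hm (c • F)).coeFn_toLp, (hm F).coeFn_toLp,
          Lp.coeFn_smul c F, Lp.coeFn_smul c ((hm F).toLp _)] with z h1 h2 h4 h5
        rw [RingHom.id_apply, h1, h5, Pi.smul_apply, h2, h4, Pi.smul_apply, smul_eq_mul,
          smul_eq_mul]; ring }
  refine ⟨M.mkContinuous C fun F => ?_, fun F => (hm F).coeFn_toLp⟩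
  refine Lp.norm_le_mul_norm_of_ae_le_mul ?_
  filter_upwards [(hm F).coeFn_toLp, hb F] with z h1 h2
  have : M F z = ρ z * F z := h1
  rw [this]; exact h2

theorem exists_mulTime (T : ℝ) {ρ : ℝ → ℝ} (hρ : Continuous ρ) :
    ∃ M : LQ T →L[ℝ] LQ T, ∀ F,
      M F =ᵐ[volume.restrict (Ioo (0 : ℝ) 1 ×ˢ Ioo (0 : ℝ) T)] fun z => ρ z.2 * F z := by
  obtain ⟨C, hC⟩ := (isCompact_Icc (a := (0 : ℝ)) (b := T)).exists_bound_of_continuousOn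
    hρ.continuousOn
  refine exists_mulLp (hρ.comp continuous_snd).aestronglyMeasurable (C := C) ?_
  filter_upwards [ae_restrict_mem (measurableSet_Ioo.prod measurableSet_Ioo)] with z hz
  exact hC z.2 (Ioo_subset_Icc_self hz.2)

theorem exists_mulSpace {m : ℝ → ℝ} (hm : Continuous m) :
    ∃ M : L2 →L[ℝ] L2, ∀ F, M F =ᵐ[volume.restrict (Ioo (0 : ℝ) 1)] fun y => m y * F y := by
  obtain ⟨C, hC⟩ := (isCompact_Icc (a := (0 : ℝ)) (b := 1)).exists_bound_of_continuousOn
    hm.continuousOn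
  refine exists_mulLp hm.aestronglyMeasurable (C := C) ?_
  filter_upwards [ae_restrict_mem measurableSet_Ioo] with z hz
  exact hC z (Ioo_subset_Icc_self hz)

/-- If F is orthogonal to all sources, then αF is orthogonal to all products h₁(a)h₂(b), hence zero.
-/
theorem dense_fst_adjGraph {T k : ℝ} (hT : 0 ≤ T) (hk₀ : 0 < k) (hk₁ : k < 1) {N : ℕ}
    (hN : alpha k (T + 1) ≤ ratio k ^ N) :
    Dense (Prod.fst '' (adjGraph T k N : Set (LQ T × AdjData T))) := by
  have e : (Prod.fst '' (adjGraph T k N : Set (LQ T × AdjData T))) =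
      ((adjGraph T k N).map (LinearMap.fst ℝ (LQ T) (AdjData T)) : Set (LQ T)) := rfl
  rw [e, Submodule.dense_iff_topologicalClosure_eq_top, Submodule.topologicalClosure_eq_top_iff,
    Submodule.eq_bot_iff]
  intro F hF
  rw [Submodule.mem_orthogonal] at hF
  obtain ⟨M, hM⟩ := exists_mulTime T (contDiff_alpha k).continuous
  have hMF : M F = 0 := by
    refine LQ_eq_zero hk₀ fun a₁ a₂ b₁ b₂ h₁ h₂ hr ha hb s₁ s₂ z₁ z₂ => ?_
    have hΨ := isBackward_prodPot hk₀ hr ha hb s₁ s₂ z₁ z₂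
    obtain ⟨x, hx⟩ := exists_adjData hT hk₀ hk₁ hN hΨ
    have hm := memLp_Q_of_continuous (continuous_source k hΨ.smooth) T
    have h0 := hF (hm.toLp _) ⟨(hm.toLp _, x), ⟨_, hΨ, hm.coeFn_toLp, hx⟩, rfl⟩
    rw [L2.inner_def] at h0
    have h1 : ∫ z in Ioo (0 : ℝ) 1 ×ˢ Ioo 0 T, M F z * (h₁ (char k z).1 * h₂ (char k z).2) =
        (4 * k ^ 2)⁻¹ * ∫ z in Ioo (0 : ℝ) 1 ×ˢ Ioo 0 T, inner ℝ (hm.toLp _ z) (F z) := by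
      rw [← integral_const_mul]
      refine integral_congr_ae ?_
      filter_upwards [hM F, hm.coeFn_toLp] with z h2 h3
      rw [h2, h3, source, pd2_pd1_prodPot _ _ s₁ s₂]
      simp only [RCLike.inner_apply, conj_trivial]
      field_simp
    rw [h1, h0, mul_zero]
  apply Lp.ext
  have h0 := hM F
  rw [hMF] at h0
  filter_upwards [h0, Lp.coeFn_zero ℝ 2 (volume.restrict (Ioo (0 : ℝ) 1 ×ˢ Ioo (0 : ℝ) T)),
    ae_restrict_mem (measurableSet_Ioo.prod measurableSet_Ioo)] with z h1 h2 h3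
  rw [h2, Pi.zero_apply] at h1 ⊢
  exact (mul_eq_zero.1 h1.symm).resolve_left (alpha_pos hk₀ h3.2.1.le).ne'

theorem exists_adjOp {T k : ℝ} (hT : 0 ≤ T) (hk₀ : 0 < k) (hk₁ : k < 1) {N : ℕ}
    (hN : alpha k (T + 1) ≤ ratio k ^ N) :
    ∃ A : LQ T →L[ℝ] AdjData T, ∀ f, (f, A f) ∈ (adjGraph T k N).topologicalClosure := by
  obtain ⟨C, hC⟩ := exists_adjGraph_bound hT hk₀ hk₁ N
  exact exists_clm_of_dense _ C hC (dense_fst_adjGraph hT hk₀ hk₁ hN)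

theorem exists_pow_ratio {k : ℝ} (hk₀ : 0 < k) (hk₁ : k < 1) (T : ℝ) :
    ∃ N : ℕ, alpha k (T + 1) ≤ ratio k ^ N :=
  (pow_unbounded_of_one_lt _ (one_lt_ratio hk₀ hk₁)).imp fun _ h => h.le

/-! ### Auxiliary operators on continuous curves -/

/-- The transfer principle for limits: identities between continuous linear maps need checking only
on smooth solutions. -/
theorem clm_eq_zero_of_mem_closure {E G : Type*} [NormedAddCommGroup E] [NormedSpace ℝ E]
    [NormedAddCommGroup G] [NormedSpace ℝ G] (S : Submodule ℝ E) (l : E →L[ℝ] G)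
    (h : ∀ z ∈ S, l z = 0) {z : E} (hz : z ∈ S.topologicalClosure) : l z = 0 :=
  Submodule.topologicalClosure_minimal (t := l.ker) S h l.isClosed_ker hz

/-- Differentiability in time is not a closed condition for uniform convergence of the state alone.
The integral identity between a curve and its derivative is linear and continuous in the pair, so it
passes to limits, and `hasDerivWithinAt_of_eq_integral` then returns to derivatives. -/
theorem exists_integralCLM {E : Type*} [NormedAddCommGroup E] [NormedSpace ℝ E]
    {T : ℝ} (hT : 0 ≤ T) (t : ℝ) :
    ∃ I : C(Icc (0 : ℝ) T, E) →L[ℝ] E, ∀ g, I g = ∫ s in (0 : ℝ)..t, IccExtend hT g s := by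
  have hi : ∀ g : C(Icc (0 : ℝ) T, E), IntervalIntegrable (IccExtend hT g) volume 0 t := fun g =>
    (g.continuous.Icc_extend').intervalIntegrable _ _
  let I : C(Icc (0 : ℝ) T, E) →ₗ[ℝ] E :=
    { toFun := fun g => ∫ s in (0 : ℝ)..t, IccExtend hT g s
      map_add' := fun f g => intervalIntegral.integral_add (hi f) (hi g)
      map_smul' := fun c g => intervalIntegral.integral_smul c (IccExtend hT g) }
  refine ⟨I.mkContinuous |t| fun g => ?_, fun g => rfl⟩
  have := intervalIntegral.norm_integral_le_of_norm_le_const (a := 0) (b := t)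
    (f := IccExtend hT g) (C := ‖g‖) fun s _ => g.norm_coe_le_norm _
  rw [sub_zero, mul_comm] at this
  exact this

theorem hasDerivWithinAt_of_eq_integral {E : Type*} [NormedAddCommGroup E] [NormedSpace ℝ E]
    [CompleteSpace E] {T : ℝ} (hT : 0 ≤ T) {F : ℝ → E} {e : E} {g : C(Icc (0 : ℝ) T, E)}
    (h : ∀ t ∈ Icc 0 T, F t = e + ∫ s in (0 : ℝ)..t, IccExtend hT g s) {t : ℝ} (ht : t ∈ Icc 0 T) :
    HasDerivWithinAt F (IccExtend hT g t) (Icc 0 T) t := by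
  have hg : Continuous (IccExtend hT g) := g.continuous.Icc_extend'
  have h1 := ((intervalIntegral.integral_hasDerivAt_right (hg.intervalIntegrable 0 t)
    (hg.stronglyMeasurableAtFilter _ _) hg.continuousAt).const_add e).hasDerivWithinAt (s := Icc 0 T)
  exact h1.congr h (h t ht)

theorem exists_curveCLM {E : Type*} [NormedAddCommGroup E] [NormedSpace ℝ E] {T : ℝ} (hT : 0 ≤ T)
    (l : E →L[ℝ] ℝ) :
    ∃ V : C(Icc (0 : ℝ) T, E) →L[ℝ] Lp ℝ 2 (volume.restrict (Ioo (0 : ℝ) T)),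
      ∀ p, V p = bL T fun t => l (IccExtend hT p t) := by
  have hc : ∀ p : C(Icc (0 : ℝ) T, E), MemLp (fun t => l (IccExtend hT p t)) 2
      (volume.restrict (Ioo (0 : ℝ) T)) := fun p =>
    memLp_Ioo_of_continuous (l.continuous.comp (p.continuous.Icc_extend'))
  let V : C(Icc (0 : ℝ) T, E) →ₗ[ℝ] Lp ℝ 2 (volume.restrict (Ioo (0 : ℝ) T)) :=
    { toFun := fun p => bL T fun t => l (IccExtend hT p t)
      map_add' := fun p q => by
        rw [← bL_add (hc p) (hc q)]
        simp only [← map_add]; rfl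
      map_smul' := fun c p => by
        rw [RingHom.id_apply, ← bL_const_mul c (hc p)]
        simp only [← smul_eq_mul, ← map_smul]; rfl }
  refine ⟨V.mkContinuous (Real.sqrt |T| * ‖l‖) fun p => ?_, fun p => rfl⟩
  rw [mul_assoc]
  refine norm_bL_le (hc p) (by positivity) fun t _ => ?_
  exact (l.le_opNorm _).trans (mul_le_mul_of_nonneg_left (p.norm_coe_le_norm (projIcc 0 T hT t))
    (norm_nonneg l))

theorem integral_Q_eq {T : ℝ} {g : ℝ × ℝ → ℝ} (hg : IntegrableOn g (Ioo (0 : ℝ) 1 ×ˢ Ioo (0 : ℝ) T)) :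
    ∫ t in Ioo 0 T, ∫ y in Ioo (0 : ℝ) 1, g (y, t) = ∫ z in Ioo (0 : ℝ) 1 ×ˢ Ioo (0 : ℝ) T, g z := by
  rw [IntegrableOn, restrict_Q] at hg
  rw [restrict_Q, integral_prod_symm g hg]

theorem integrableOn_Q_of_continuous {G : ℝ × ℝ → ℝ} (hG : Continuous G) (T : ℝ) :
    IntegrableOn G (Ioo (0 : ℝ) 1 ×ˢ Ioo (0 : ℝ) T) :=
  (hG.continuousOn.integrableOn_compact ((isCompact_Icc (a := (0 : ℝ)) (b := 1)).prod
    (isCompact_Icc (a := (0 : ℝ)) (b := T)))).mono_set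
    (Set.prod_mono Ioo_subset_Icc_self Ioo_subset_Icc_self)

/-! ### Properties of the smooth adjoint states -/

theorem IsAdjData.toL2_eq {T k : ℝ} {N : ℕ} {Ψ : ℝ × ℝ → ℝ} {x : AdjData T}
    (hΨ : ContDiff ℝ ∞ Ψ) (hx : IsAdjData T k N Ψ x) (t : Icc (0 : ℝ) T) :
    toL2 (x.1 t) = bL 1 fun y => adj k N Ψ (y, t) := by
  have hs := contDiff_adj k N hΨ
  have h1 : ContDiff ℝ 1 fun y => adj k N Ψ (y, t) :=
    (hs.comp (contDiff_id.prodMk contDiff_const)).of_le (by simp)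
  have e : deriv (fun y => adj k N Ψ (y, t)) = fun y => pd1 (adj k N Ψ) (y, t) :=
    funext fun y => (hasDerivAt_fst hs y t).deriv
  rw [toL2_eq_prim, hx.space, ← prim_deriv h1 (adj_zero k N Ψ t), e]

theorem IsAdjData.integral_time {T k : ℝ} (hT : 0 ≤ T) {N : ℕ} {Ψ : ℝ × ℝ → ℝ} {x : AdjData T}
    (hΨ : ContDiff ℝ ∞ Ψ) (hx : IsAdjData T k N Ψ x) {t : ℝ} (ht : t ∈ Icc 0 T) :
    ∫ s in (0 : ℝ)..t, IccExtend hT x.2.1 s = toL2 (x.1 ⟨t, ht⟩) - toL2 (x.1 ⟨0, le_rfl, hT⟩) := by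
  have hs := contDiff_adj k N hΨ
  have c0 := hs.continuous
  have c2 := (contDiff_pd2 hs).continuous
  have f0 : Continuous (Function.uncurry fun s y => adj k N Ψ (y, s)) := by
    change Continuous fun z : ℝ × ℝ => adj k N Ψ (z.2, z.1); fun_prop
  have f2 : Continuous (Function.uncurry fun s y => pd2 (adj k N Ψ) (y, s)) := by
    change Continuous fun z : ℝ × ℝ => pd2 (adj k N Ψ) (z.2, z.1); fun_prop
  have hd : ∀ s, HasDerivAt (fun s => bL 1 fun y => adj k N Ψ (y, s))
      (bL 1 fun y => pd2 (adj k N Ψ) (y, s)) s := fun s =>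
    hasDerivAt_bL f0 f2 (fun s y => hasDerivAt_snd hs y s) s
  rw [hx.toL2_eq hΨ, hx.toL2_eq hΨ, ← intervalIntegral.integral_eq_sub_of_hasDerivAt
    (fun s _ => hd s) ((continuous_bL f2).intervalIntegrable _ _)]
  refine intervalIntegral.integral_congr fun s hs => ?_
  rw [uIcc_of_le ht.1] at hs
  rw [IccExtend_of_mem hT _ ⟨hs.1, hs.2.trans ht.2⟩, hx.time]

theorem IsAdjData.final {T k : ℝ} (hT : 0 ≤ T) (hk₀ : 0 < k) (hk₁ : k < 1) {N : ℕ}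
    {Ψ : ℝ × ℝ → ℝ} {x : AdjData T} (hΨ : IsBackward k T Ψ) (hx : IsAdjData T k N Ψ x) :
    x.1 ⟨T, hT, le_rfl⟩ = 0 ∧ x.2.1 ⟨T, hT, le_rfl⟩ = 0 := by
  have hs := contDiff_adj k N hΨ.smooth
  have h0 : ∀ y ∈ Icc (0 : ℝ) 1, ∀ t, T ≤ t → adj k N Ψ (y, t) = 0 := fun y hy t ht => by
    rw [adj, hΨ.img_final hk₀ hk₁ N hT ht hy, mul_zero]
  have b0 : bL 1 (fun _ => 0) = 0 := bL_eq (Lp.coeFn_zero _ _ _)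
  constructor
  · refine H10_ext ?_
    rw [hx.space, map_zero, ← b0]
    refine bL_congr fun y hy => ?_
    refine (hasDerivAt_fst hs y T).unique ((hasDerivAt_const y (0 : ℝ)).congr_of_eventuallyEq ?_)
    filter_upwards [isOpen_Ioo.mem_nhds hy] with z hz
    exact h0 z (Ioo_subset_Icc_self hz) T le_rfl
  · rw [hx.time, ← b0]
    refine bL_congr fun y hy => ?_
    have h1 := (hasDerivAt_snd hs y T).hasDerivWithinAt (s := Ici T)
    have h2 : HasDerivWithinAt (fun t => adj k N Ψ (y, t)) 0 (Ici T) T :=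
      (hasDerivWithinAt_const T (Ici T) (0 : ℝ)).congr
        (fun t ht => h0 y (Ioo_subset_Icc_self hy) t ht) (h0 y (Ioo_subset_Icc_self hy) T le_rfl)
    exact (uniqueDiffOn_Ici T T self_mem_Ici).eq_deriv _ h1 h2

/-- Multiplying by h, instead of dividing the integral by it, gives an identity that is continuous
in the data and makes sense at h = 0. -/
theorem IsAdjData.quotient_eq {T k : ℝ} (hT : 0 ≤ T) {N : ℕ} {Ψ : ℝ × ℝ → ℝ} {x : AdjData T}
    (hΨ : ContDiff ℝ ∞ Ψ) (hx : IsAdjData T k N Ψ x) (h : Icc (0 : ℝ) 1) :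
    (h : ℝ) • x.2.2 h = bL T fun t => ev h (dy (IccExtend hT x.1 t)) := by
  have hs := contDiff_adj k N hΨ
  have q1 : Continuous (quot k N Ψ h) :=
    (continuous_quot k N hΨ).comp (by fun_prop : Continuous fun t : ℝ => ((h : ℝ), t))
  rw [hx.quotient, ← bL_const_mul _ (memLp_Ioo_of_continuous q1)]
  refine bL_congr fun t ht => ?_
  have h1 : ContDiff ℝ 1 fun y => adj k N Ψ (y, t) :=
    (hs.comp (contDiff_id.prodMk contDiff_const)).of_le (by simp)
  have e : deriv (fun y => adj k N Ψ (y, t)) = fun y => pd1 (adj k N Ψ) (y, t) :=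
    funext fun y => (hasDerivAt_fst hs y t).deriv
  rw [IccExtend_of_mem hT _ (Ioo_subset_Icc_self ht), hx.space]
  simp only
  rw [← e, ev_deriv h1 h.2, quot,
    intervalIntegral.mul_integral_comp_mul_left (f := fun y => pd1 (adj k N Ψ) (y, t)),
    mul_zero, mul_one, ← e, intervalIntegral.integral_deriv_eq_sub' _ rfl
    (fun y _ => (h1.differentiable one_ne_zero) y)
    (h1.continuous_deriv le_rfl).continuousOn]

/-! ### The weak equation -/

theorem tsupport_pd1_subset (F : ℝ × ℝ → ℝ) : tsupport (pd1 F) ⊆ tsupport F :=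
  tsupport_fderiv_apply_subset ℝ (1, 0)

theorem tsupport_pd2_subset (F : ℝ × ℝ → ℝ) : tsupport (pd2 F) ⊆ tsupport F :=
  tsupport_fderiv_apply_subset ℝ (0, 1)

theorem integral_mul_pd2_pd1 {F G : ℝ × ℝ → ℝ} (hF : ContDiff ℝ ∞ F) (hG : ContDiff ℝ ∞ G)
    (hc : HasCompactSupport G) : ∫ z, F z * pd2 (pd1 G) z = ∫ z, pd2 (pd1 F) z * G z := by
  have hc1 : HasCompactSupport (pd1 G) := hc.mono' ((subset_tsupport _).trans (tsupport_pd1_subset G))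
  have hint : ∀ {X Y : ℝ × ℝ → ℝ}, ContDiff ℝ ∞ X → ContDiff ℝ ∞ Y → HasCompactSupport Y →
      Integrable fun z => X z * Y z := fun hX hY hc =>
    (hX.continuous.mul hY.continuous).integrable_of_hasCompactSupport hc.mul_left
  have hcd : ∀ {Y : ℝ × ℝ → ℝ}, HasCompactSupport Y → HasCompactSupport (pd1 Y) ∧
      HasCompactSupport (pd2 Y) := fun {Y} hY =>
    ⟨hY.mono' ((subset_tsupport _).trans (tsupport_pd1_subset Y)),
      hY.mono' ((subset_tsupport _).trans (tsupport_pd2_subset Y))⟩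
  have e1 : ∫ z, F z * pd2 (pd1 G) z = -∫ z, pd2 F z * pd1 G z :=
    integral_mul_fderiv_eq_neg_fderiv_mul_of_integrable
      (hint (contDiff_pd2 hF) (contDiff_pd1 hG) hc1)
      (hint hF (contDiff_pd2 (contDiff_pd1 hG)) (hcd hc1).2) (hint hF (contDiff_pd1 hG) hc1)
      (fun z _ => hF.differentiable (by simp) z)
      (fun z _ => (contDiff_pd1 hG).differentiable (by simp) z)
  have e2 : ∫ z, pd2 F z * pd1 G z = -∫ z, pd1 (pd2 F) z * G z :=
    integral_mul_fderiv_eq_neg_fderiv_mul_of_integrable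
      (hint (contDiff_pd1 (contDiff_pd2 hF)) hG hc)
      (hint (contDiff_pd2 hF) (contDiff_pd1 hG) (hcd hc).1) (hint (contDiff_pd2 hF) hG hc)
      (fun z _ => (contDiff_pd2 hF).differentiable (by simp) z)
      (fun z _ => hG.differentiable (by simp) z)
  rw [e1, e2, neg_neg, pd1_pd2_comm hF]

/-- A test function in characteristic coordinates. -/
theorem exists_test_char {T k : ℝ} (hk : 0 < k) {φ : ℝ → ℝ → ℝ}
    (h1 : ContDiff ℝ ∞ (Function.uncurry φ)) (h2 : HasCompactSupport (Function.uncurry φ))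
    (h3 : tsupport (Function.uncurry φ) ⊆ Ioo 0 1 ×ˢ Ioo 0 T) :
    ∃ ψ : ℝ × ℝ → ℝ, ContDiff ℝ ∞ ψ ∧ HasCompactSupport ψ ∧ tsupport ψ ⊆ charRegion k T ∧
      φ = fun y t => ψ (char k (y, t)) := by
  let ψ : ℝ × ℝ → ℝ := fun z => Function.uncurry φ (charInv k z)
  -- Here a + b ≤ 2 means t ≤ 0, outside the support of φ. In particular ψ vanishes near the line a
  -- + b = 0, where `charInv` is singular.
  have hz : ∀ z : ℝ × ℝ, z.1 + z.2 ≤ 2 → ψ z = 0 := fun z hz => by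
    refine image_eq_zero_of_notMem_tsupport (f := Function.uncurry φ) fun h => ?_
    have := (h3 h).2.1
    simp only [charInv] at this
    have h4 := (div_pos_iff_of_pos_right hk).1 this
    linarith
  have hs : Function.support ψ ⊆ char k '' tsupport (Function.uncurry φ) := by
    intro z hz'
    have h4 : 2 < z.1 + z.2 := by
      by_contra h; exact hz' (hz z (by linarith))
    exact ⟨charInv k z, subset_tsupport _ hz', char_charInv hk (by linarith)⟩
  have hK : IsCompact (char k '' tsupport (Function.uncurry φ)) :=
    h2.isCompact.image (contDiff_char k).continuous
  have hts : tsupport ψ ⊆ char k '' tsupport (Function.uncurry φ) :=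
    closure_minimal hs hK.isClosed
  refine ⟨ψ, ?_, HasCompactSupport.of_support_subset_isCompact hK hs, fun z hz' => ?_, ?_⟩
  · rw [contDiff_iff_contDiffAt]
    intro z
    by_cases h : z.1 + z.2 < 2
    · have ho : IsOpen {z : ℝ × ℝ | z.1 + z.2 < 2} := isOpen_lt (by fun_prop) (by fun_prop)
      exact (contDiffAt_const (c := (0 : ℝ))).congr_of_eventuallyEq
        (by filter_upwards [ho.mem_nhds h] with w hw using hz w (le_of_lt hw))
    · refine h1.contDiffAt.comp z ?_
      unfold charInv
      refine ContDiffAt.prodMk ?_ ?_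
      · refine ContDiffAt.div (by fun_prop) (by fun_prop) (mul_ne_zero hk.ne' (by linarith))
      · fun_prop
  · obtain ⟨w, hw, rfl⟩ := hts hz'
    rw [← char_image hk]
    exact ⟨w, h3 hw, rfl⟩
  · funext y t
    -- For t < 0 both sides vanish, so the inversion of `char` is not needed where α may be zero.
    by_cases ht : 0 ≤ t
    · simp only [ψ]
      rw [charInv_char hk (alpha_pos hk ht).ne']; rfl
    · have e1 : φ y t = 0 := by
        change Function.uncurry φ (y, t) = 0
        exact image_eq_zero_of_notMem_tsupport fun h => ht (h3 h).2.1.le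
      rw [e1, hz]
      simp only [char, alpha]
      nlinarith [mul_pos hk (not_le.1 ht |> neg_pos.2)]

/-- Write the adjoint state as αq. The factor α is absorbed by the Jacobian, leaving 2∫ q ψ_ab; two
integrations by parts move ∂_a∂_b to q, and inside the wedge q_ab = Ψ_ab. -/
theorem integral_adj_waveOp {T k : ℝ} (hk₀ : 0 < k) (hk₁ : k < 1) (N : ℕ)
    {Ψ : ℝ × ℝ → ℝ} (hΨ : IsBackward k T Ψ) {ψ : ℝ × ℝ → ℝ} (h1 : ContDiff ℝ ∞ ψ)
    (h2 : HasCompactSupport ψ) (h3 : tsupport ψ ⊆ charRegion k T) :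
    ∫ z in Ioo (0 : ℝ) 1 ×ˢ Ioo 0 T, adj k N Ψ z * (4 * k ^ 2 * pd2 (pd1 ψ) (char k z)) =
      ∫ z in Ioo (0 : ℝ) 1 ×ˢ Ioo 0 T, source k Ψ z * ψ (char k z) := by
  have e1 : ∫ z in Ioo (0 : ℝ) 1 ×ˢ Ioo 0 T, adj k N Ψ z * (4 * k ^ 2 * pd2 (pd1 ψ) (char k z)) =
      2 * ∫ z in charRegion k T, img k N Ψ z * pd2 (pd1 ψ) z := by
    rw [integral_charRegion hk₀, ← integral_const_mul]
    refine integral_congr_ae (ae_of_all _ fun z => ?_)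
    simp only [adj]; ring
  have e2 : ∫ z in Ioo (0 : ℝ) 1 ×ˢ Ioo 0 T, source k Ψ z * ψ (char k z) =
      2 * ∫ z in charRegion k T, pd2 (pd1 (img k N Ψ)) z * ψ z := by
    rw [integral_charRegion hk₀, ← integral_const_mul]
    refine setIntegral_congr_fun (measurableSet_Ioo.prod measurableSet_Ioo) fun z hz => ?_
    have hz' : char k z ∈ charRegion k T := (char_mem_iff hk₀ (alpha_pos hk₀ hz.2.1.le)).2 hz
    have hb := (charRegion_subset hk₀ hk₁ hz').2.1
    have := pd2_pd1_img_eq hk₀ hk₁ N hΨ.smooth (fun w hw => hΨ.support w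
      (notMem_charRegion_of_wedge hk₁ hw)) hb hz'.1 (by
        have h4 := hz'.2.1
        rw [← ratio_mul hk₁, mul_assoc] at h4
        exact lt_of_mul_lt_mul_left h4 (by linarith))
    simp only [source]
    rw [show pd2 (pd1 (img k N Ψ)) (char k z) = pd2 (pd1 Ψ) (char k z) from this]
    ring
  have hz1 : ∀ z, z ∉ charRegion k T → img k N Ψ z * pd2 (pd1 ψ) z = 0 := fun z hz => by
    rw [image_eq_zero_of_notMem_tsupport fun h =>
      hz (h3 (tsupport_pd1_subset _ (tsupport_pd2_subset _ h))), mul_zero]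
  have hz2 : ∀ z, z ∉ charRegion k T → pd2 (pd1 (img k N Ψ)) z * ψ z = 0 := fun z hz => by
    rw [image_eq_zero_of_notMem_tsupport fun h => hz (h3 h), mul_zero]
  rw [e1, e2, setIntegral_eq_integral_of_forall_compl_eq_zero hz1,
    setIntegral_eq_integral_of_forall_compl_eq_zero hz2,
    integral_mul_pd2_pd1 (contDiff_img k N hΨ.smooth) h1 h2]

/-! ### Solutions of the adjoint problem -/

/-- The closure of the graph of the solution operator on smooth sources. -/
def IsAdjLimit (T k : ℝ) (N : ℕ) (f : LQ T) (x : AdjData T) : Prop :=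
  (f, x) ∈ (adjGraph T k N).topologicalClosure

/-- The adjoint state in `AdjData`. -/
def statePart (T : ℝ) : LQ T × AdjData T →L[ℝ] C(Icc (0 : ℝ) T, H10) :=
  (ContinuousLinearMap.fst ℝ C(Icc (0 : ℝ) T, H10) (C(Icc (0 : ℝ) T, L2) ×
    C(Icc (0 : ℝ) 1, Lp ℝ 2 (volume.restrict (Ioo (0 : ℝ) T))))).comp
    (ContinuousLinearMap.snd ℝ (LQ T) (AdjData T))

/-- The time derivative in `AdjData`. -/
def timePart (T : ℝ) : LQ T × AdjData T →L[ℝ] C(Icc (0 : ℝ) T, L2) :=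
  ((ContinuousLinearMap.fst ℝ C(Icc (0 : ℝ) T, L2)
    C(Icc (0 : ℝ) 1, Lp ℝ 2 (volume.restrict (Ioo (0 : ℝ) T)))).comp
    (ContinuousLinearMap.snd ℝ C(Icc (0 : ℝ) T, H10) (C(Icc (0 : ℝ) T, L2) ×
    C(Icc (0 : ℝ) 1, Lp ℝ 2 (volume.restrict (Ioo (0 : ℝ) T)))))).comp
    (ContinuousLinearMap.snd ℝ (LQ T) (AdjData T))

/-- The difference quotients in `AdjData`. -/
def quotPart (T : ℝ) : LQ T × AdjData T →L[ℝ]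
    C(Icc (0 : ℝ) 1, Lp ℝ 2 (volume.restrict (Ioo (0 : ℝ) T))) :=
  ((ContinuousLinearMap.snd ℝ C(Icc (0 : ℝ) T, L2)
    C(Icc (0 : ℝ) 1, Lp ℝ 2 (volume.restrict (Ioo (0 : ℝ) T)))).comp
    (ContinuousLinearMap.snd ℝ C(Icc (0 : ℝ) T, H10) (C(Icc (0 : ℝ) T, L2) ×
    C(Icc (0 : ℝ) 1, Lp ℝ 2 (volume.restrict (Ioo (0 : ℝ) T)))))).comp
    (ContinuousLinearMap.snd ℝ (LQ T) (AdjData T))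

/-- The curve `t ↦ p(t)` in `L²(Ω)`. -/
def toL2Curve (T : ℝ) : C(Icc (0 : ℝ) T, H10) →L[ℝ] C(Icc (0 : ℝ) T, L2) :=
  toL2.compLeftContinuous ℝ (Icc (0 : ℝ) T)

theorem IsAdjLimit.final {T k : ℝ} (hT : 0 ≤ T) (hk₀ : 0 < k) (hk₁ : k < 1) {N : ℕ} {f : LQ T}
    {x : AdjData T} (h : IsAdjLimit T k N f x) : x.1 ⟨T, hT, le_rfl⟩ = 0 := by
  refine clm_eq_zero_of_mem_closure (adjGraph T k N)
    ((ContinuousMap.evalCLM ℝ ⟨T, hT, le_rfl⟩).comp (statePart T)) ?_ h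
  rintro z ⟨Ψ, hΨ, -, hx⟩
  exact (hx.final hT hk₀ hk₁ hΨ).1

theorem IsAdjLimit.final_deriv {T k : ℝ} (hT : 0 ≤ T) (hk₀ : 0 < k) (hk₁ : k < 1) {N : ℕ} {f : LQ T}
    {x : AdjData T} (h : IsAdjLimit T k N f x) : x.2.1 ⟨T, hT, le_rfl⟩ = 0 := by
  refine clm_eq_zero_of_mem_closure (adjGraph T k N)
    ((ContinuousMap.evalCLM ℝ ⟨T, hT, le_rfl⟩).comp (timePart T)) ?_ h
  rintro z ⟨Ψ, hΨ, -, hx⟩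
  exact (hx.final hT hk₀ hk₁ hΨ).2

theorem IsAdjLimit.integral_time {T k : ℝ} (hT : 0 ≤ T) {N : ℕ} {f : LQ T}
    {x : AdjData T} (h : IsAdjLimit T k N f x) {t : ℝ} (ht : t ∈ Icc 0 T) :
    toL2 (x.1 ⟨t, ht⟩) = toL2 (x.1 ⟨0, le_rfl, hT⟩) + ∫ s in (0 : ℝ)..t, IccExtend hT x.2.1 s := by
  obtain ⟨I, hI⟩ := exists_integralCLM (E := L2) hT t
  have := clm_eq_zero_of_mem_closure (adjGraph T k N)
    (I.comp (timePart T) - (toL2.comp ((ContinuousMap.evalCLM ℝ ⟨t, ht⟩).comp (statePart T))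
      - toL2.comp ((ContinuousMap.evalCLM ℝ ⟨0, le_rfl, hT⟩).comp (statePart T)))) ?_ h
  · rw [← hI]
    have h1 : I x.2.1 - (toL2 (x.1 ⟨t, ht⟩) - toL2 (x.1 ⟨0, le_rfl, hT⟩)) = 0 := this
    rw [sub_eq_zero.1 h1]; abel
  · rintro z ⟨Ψ, hΨ, -, hx⟩
    have h1 : I z.2.2.1 - (toL2 (z.2.1 ⟨t, ht⟩) - toL2 (z.2.1 ⟨0, le_rfl, hT⟩)) = 0 := by
      rw [hI, hx.integral_time hT hΨ.smooth ht, sub_self]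
    exact h1

theorem IsAdjLimit.quotient_eq {T k : ℝ} (hT : 0 ≤ T) {N : ℕ} {f : LQ T}
    {x : AdjData T} (hl : IsAdjLimit T k N f x) (h : Icc (0 : ℝ) 1) :
    (h : ℝ) • x.2.2 h = bL T fun t => ev h (dy (IccExtend hT x.1 t)) := by
  obtain ⟨V, hV⟩ := exists_curveCLM hT ((ev h).comp dy)
  have := clm_eq_zero_of_mem_closure (adjGraph T k N)
    ((h : ℝ) • (ContinuousMap.evalCLM ℝ h).comp (quotPart T) - V.comp (statePart T)) ?_ hl
  · have h1 : (h : ℝ) • x.2.2 h - V x.1 = 0 := this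
    rw [sub_eq_zero.1 h1, hV]; rfl
  · rintro z ⟨Ψ, hΨ, -, hx⟩
    have h1 : (h : ℝ) • z.2.2.2 h - V z.2.1 = 0 := by
      rw [hV, hx.quotient_eq hT hΨ.smooth, sub_eq_zero]; rfl
    exact h1

theorem IsAdjLimit.equation {T k : ℝ} (hT : 0 ≤ T) (hk₀ : 0 < k) (hk₁ : k < 1) {N : ℕ} {f : LQ T}
    {x : AdjData T} (h : IsAdjLimit T k N f x) {ψ : ℝ × ℝ → ℝ} (h1 : ContDiff ℝ ∞ ψ)
    (h2 : HasCompactSupport ψ) (h3 : tsupport ψ ⊆ charRegion k T) :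
    ∫ t in Ioo 0 T, ∫ y in Ioo (0 : ℝ) 1,
        toL2 (IccExtend hT x.1 t) y * (4 * k ^ 2 * pd2 (pd1 ψ) (char k (y, t))) =
      ∫ z in Ioo (0 : ℝ) 1 ×ˢ Ioo 0 T, f z * ψ (char k z) := by
  obtain ⟨ι, hι⟩ := exists_iota hT
  have hd : Continuous fun z => 4 * k ^ 2 * pd2 (pd1 ψ) (char k z) :=
    continuous_const.mul ((contDiff_pd2 (contDiff_pd1 h1)).comp (contDiff_char k)).continuous
  have he : Continuous fun z => ψ (char k z) := (h1.comp (contDiff_char k)).continuous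
  have hd' := memLp_Q_of_continuous hd T
  have he' := memLp_Q_of_continuous he T
  have e1 : ∀ x : AdjData T, ∫ t in Ioo 0 T, ∫ y in Ioo (0 : ℝ) 1,
        toL2 (IccExtend hT x.1 t) y * (4 * k ^ 2 * pd2 (pd1 ψ) (char k (y, t))) =
      inner ℝ (hd'.toLp _) (ι (toL2Curve T x.1)) := fun x => by
    rw [real_inner_comm]
    exact (hι (toL2Curve T x.1)).integral_mul hd'
  have e2 : ∀ f : LQ T, ∫ z in Ioo (0 : ℝ) 1 ×ˢ Ioo 0 T, f z * ψ (char k z) =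
      inner ℝ (he'.toLp _) f := fun f => by
    rw [L2.inner_def]
    exact integral_congr_ae (he'.coeFn_toLp.mono fun z hz => by simp [hz])
  rw [e1, e2, ← sub_eq_zero]
  refine clm_eq_zero_of_mem_closure (adjGraph T k N)
    ((innerSL ℝ (hd'.toLp _)).comp (ι.comp ((toL2Curve T).comp (statePart T)))
      - (innerSL ℝ (he'.toLp _)).comp (ContinuousLinearMap.fst ℝ (LQ T) (AdjData T))) ?_ h
  rintro z ⟨Ψ, hΨ, hf, hx⟩
  have : inner ℝ (hd'.toLp _) (ι (toL2Curve T z.2.1)) - inner ℝ (he'.toLp _) z.1 = 0 := by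
    have hs := (contDiff_adj k N hΨ.smooth).continuous
    rw [← e1, ← e2, sub_eq_zero]
    have e3 : ∫ z' in Ioo (0 : ℝ) 1 ×ˢ Ioo 0 T, z.1 z' * ψ (char k z') =
        ∫ z' in Ioo (0 : ℝ) 1 ×ˢ Ioo 0 T, source k Ψ z' * ψ (char k z') :=
      integral_congr_ae (hf.mono fun w hw => by simp only [hw])
    rw [e3, ← integral_adj_waveOp hk₀ hk₁ N hΨ h1 h2 h3]
    refine Eq.trans ?_ (integral_Q_eq
      (g := fun z => adj k N Ψ z * (4 * k ^ 2 * pd2 (pd1 ψ) (char k z)))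
      (integrableOn_Q_of_continuous (hs.mul hd) T))
    refine setIntegral_congr_fun measurableSet_Ioo fun t ht => ?_
    rw [IccExtend_of_mem hT _ (Ioo_subset_Icc_self ht), hx.toL2_eq hΨ.smooth]
    have hc : Continuous fun y => adj k N Ψ (y, t) := by fun_prop
    exact integral_congr_ae ((bL_coe (memLp_Ioo_of_continuous hc)).mono fun y hy => by
      simp only [hy])
  exact this

theorem IsAdjLimit.isAdjointSolution {T k : ℝ} (hT : 0 ≤ T) (hk₀ : 0 < k) (hk₁ : k < 1) {N : ℕ}
    {f : LQ T} {x : AdjData T} (h : IsAdjLimit T k N f x) {F : ℝ → ℝ → ℝ}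
    (hF : f =ᵐ[volume.restrict (Ioo (0 : ℝ) 1 ×ˢ Ioo (0 : ℝ) T)] Function.uncurry F) :
    IsAdjointSolution T k F (IccExtend hT x.1) where
  continuousOn := (x.1.continuous.Icc_extend').continuousOn
  final := by rw [IccExtend_of_mem hT _ (right_mem_Icc.2 hT)]; exact h.final hT hk₀ hk₁
  final_deriv := by
    refine ⟨IccExtend hT x.2.1, (x.2.1.continuous.Icc_extend').continuousOn, ?_, fun t ht => ?_⟩
    · rw [IccExtend_of_mem hT _ (right_mem_Icc.2 hT)]; exact h.final_deriv hT hk₀ hk₁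
    · refine hasDerivWithinAt_of_eq_integral hT (e := toL2 (x.1 ⟨0, le_rfl, hT⟩)) (fun s hs => ?_) ht
      rw [IccExtend_of_mem hT _ hs]; exact h.integral_time hT hs
  equation := by
    intro φ h1 h2 h3
    obtain ⟨ψ, s1, s2, s3, rfl⟩ := exists_test_char hk₀ h1 h2 h3
    have hc : Continuous fun z => ψ (char k z) := (s1.comp (contDiff_char k)).continuous
    have hm : MemLp (fun z => ψ (char k z)) 2 (volume.restrict (Ioo (0 : ℝ) 1 ×ˢ Ioo (0 : ℝ) T)) :=
      memLp_Q_of_continuous hc T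
    have hi : IntegrableOn (fun z => F z.1 z.2 * ψ (char k z)) (Ioo (0 : ℝ) 1 ×ˢ Ioo (0 : ℝ) T) :=
      MemLp.integrable_mul ((memLp_congr_ae hF).1 (Lp.memLp f)) hm
    rw [integral_Q_eq hi]
    refine Eq.trans (setIntegral_congr_fun measurableSet_Ioo fun t ht => ?_)
      ((h.equation hT hk₀ hk₁ s1 s2 s3).trans
        (integral_congr_ae (hF.mono fun z hz => by simp only [hz]; rfl)))
    simp only [waveOp_comp_char s1 (alpha_pos hk₀ ht.1.le).ne']

/-- The required convergence is the continuity at h = 0 of the curve of quotients, which is part of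
the data. -/
theorem IsAdjLimit.hasDyTrace {T k : ℝ} (hT : 0 ≤ T) {N : ℕ}
    {f : LQ T} {x : AdjData T} (hl : IsAdjLimit T k N f x) :
    HasDyTrace T (IccExtend hT x.1) (x.2.2 ⟨0, by simp⟩) := by
  refine ⟨Lp.memLp _, ?_⟩
  have hz : Icc (0 : ℝ) 1 ∈ 𝓝[>] (0 : ℝ) := Icc_mem_nhdsGT zero_lt_one
  have hz' : Ioi (0 : ℝ) ∈ 𝓝[>] (0 : ℝ) := self_mem_nhdsWithin
  have hc : Continuous (IccExtend (zero_le_one (α := ℝ)) x.2.2) := x.2.2.continuous.Icc_extend'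
  have h0 : Tendsto (fun h : ℝ => ‖IccExtend (zero_le_one (α := ℝ)) x.2.2 h - x.2.2 ⟨0, by simp⟩‖ₑ)
      (𝓝[>] 0) (𝓝 0) := by
    have h1 : Continuous fun h : ℝ => ‖IccExtend (zero_le_one (α := ℝ)) x.2.2 h - x.2.2 ⟨0, by simp⟩‖ₑ :=
      (hc.sub continuous_const).enorm
    have h2 := (h1.tendsto 0).mono_left (nhdsWithin_le_nhds (s := Ioi 0))
    rwa [IccExtend_of_mem _ _ (by simp : (0 : ℝ) ∈ Icc (0 : ℝ) 1), sub_self, enorm_zero] at h2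
  refine h0.congr' ?_
  filter_upwards [hz, hz'] with h hh hpos
  rw [IccExtend_of_mem _ _ hh, Lp.enorm_def]
  have hq := hl.quotient_eq hT ⟨h, hh⟩
  have hp : x.2.2 ⟨h, hh⟩ = h⁻¹ • bL T fun t => ev h (dy (IccExtend hT x.1 t)) := by
    rw [← hq, smul_smul, inv_mul_cancel₀ (ne_of_gt hpos), one_smul]
  rw [hp]
  have hm : MemLp (fun t => ev h (dy (IccExtend hT x.1 t))) 2 (volume.restrict (Ioo (0 : ℝ) T)) :=
    memLp_Ioo_of_continuous
      ((ev h).continuous.comp (dy.continuous.comp (x.1.continuous.Icc_extend')))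
  refine eLpNorm_congr_ae ?_
  filter_upwards [Lp.coeFn_sub (h⁻¹ • bL T fun t => ev h (dy (IccExtend hT x.1 t))) (x.2.2 ⟨0, by simp⟩),
    Lp.coeFn_smul h⁻¹ (bL T fun t => ev h (dy (IccExtend hT x.1 t))), bL_coe hm] with t h1 h2 h3
  rw [h1, Pi.sub_apply, h2, Pi.smul_apply, h3, ev_eq_setIntegral hh, smul_eq_mul]

/-! ### Uniqueness for the adjoint problem -/

/-- Multiplication by `1 - k² y²`. -/
def betaMul (k : ℝ) : L2 →L[ℝ] L2 :=
  Classical.choose (exists_mulSpace (m := fun y => 1 - k ^ 2 * y ^ 2) (by fun_prop))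

/-- Multiplication by `γ_k`. -/
def gammaMul (k : ℝ) : L2 →L[ℝ] L2 :=
  Classical.choose (exists_mulSpace (m := gamma k) (by unfold gamma; fun_prop))

theorem inner_bL_mul {m : ℝ → ℝ} (hm : Continuous m) {M : L2 →L[ℝ] L2}
    (hM : ∀ F, M F =ᵐ[volume.restrict (Ioo (0 : ℝ) 1)] fun y => m y * F y) {u : ℝ → ℝ}
    (hu : Continuous u) (F : L2) : inner ℝ (bL 1 u) (M F) = inner ℝ (bL 1 fun y => m y * u y) F := by
  have h1 : MemLp (fun y => m y * u y) 2 (volume.restrict (Ioo (0 : ℝ) 1)) :=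
    memLp_Ioo_of_continuous (hm.mul hu)
  rw [inner_bL_left (memLp_Ioo_of_continuous hu), inner_bL_left h1]
  exact integral_congr_ae ((hM F).mono fun y hy => by simp only [hy]; ring)

theorem inner_bL_betaMul (k : ℝ) {u : ℝ → ℝ} (hu : Continuous u) (F : L2) :
    inner ℝ (bL 1 u) (betaMul k F) = inner ℝ (bL 1 fun y => (1 - k ^ 2 * y ^ 2) * u y) F :=
  inner_bL_mul (by fun_prop) (Classical.choose_spec
    (exists_mulSpace (m := fun y => 1 - k ^ 2 * y ^ 2) (by fun_prop))) hu F

theorem inner_bL_gammaMul (k : ℝ) {u : ℝ → ℝ} (hu : Continuous u) (F : L2) :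
    inner ℝ (bL 1 u) (gammaMul k F) = inner ℝ (bL 1 fun y => gamma k y * u y) F :=
  inner_bL_mul (by unfold gamma; fun_prop) (Classical.choose_spec
    (exists_mulSpace (m := gamma k) (by unfold gamma; fun_prop))) hu F

/-- One y-derivative is moved from (β φ_y)_y to χ. The equation can then be used at a fixed time,
with p(t) only in H¹₀. -/
theorem inner_waveOp {k t : ℝ} {φ : ℝ → ℝ → ℝ}
    (hφ : ContDiff ℝ ∞ (Function.uncurry φ)) (χ : H10) :
    inner ℝ (bL 1 fun y => waveOp k φ y t) (toL2 χ) =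
      inner ℝ (bL 1 fun y => pd2 (pd2 (Function.uncurry φ)) (y, t)) (toL2 χ)
      + (alpha k t ^ 2)⁻¹ * inner ℝ (bL 1 fun y => pd1 (Function.uncurry φ) (y, t))
          (betaMul k (dy χ))
      + (alpha k t)⁻¹ * inner ℝ (bL 1 fun y => pd1 (pd2 (Function.uncurry φ)) (y, t))
          (gammaMul k (toL2 χ)) := by
  have s1 := contDiff_pd1 hφ
  have c1 := s1.continuous
  have c11 := (contDiff_pd1 s1).continuous
  have c22 := (contDiff_pd2 (contDiff_pd2 hφ)).continuous
  have c12 := (contDiff_pd1 (contDiff_pd2 hφ)).continuous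
  let w : ℝ → ℝ := fun y => (1 - k ^ 2 * y ^ 2) * pd1 (Function.uncurry φ) (y, t)
  have hw : ContDiff ℝ ∞ w := by
    have : ContDiff ℝ ∞ fun y => pd1 (Function.uncurry φ) (y, t) :=
      s1.comp (contDiff_id.prodMk contDiff_const)
    exact ContDiff.mul (by fun_prop) this
  have hdw : deriv w = fun y => (1 - k ^ 2 * y ^ 2) * pd1 (pd1 (Function.uncurry φ)) (y, t)
      - 2 * k ^ 2 * y * pd1 (Function.uncurry φ) (y, t) := by
    funext y
    have h1 : HasDerivAt (fun y : ℝ => 1 - k ^ 2 * y ^ 2) (-(k ^ 2 * (2 * y))) y := by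
      simpa using ((hasDerivAt_pow 2 y).const_mul (k ^ 2)).const_sub 1
    exact ((h1.fun_mul (hasDerivAt_fst s1 y t)).congr_deriv (by ring)).deriv
  have hwd := inner_deriv_toL2 (hw.of_le (by simp)) χ.2
  have hcg : Continuous (gamma k) := by unfold gamma; fun_prop
  have hcw : Continuous (deriv w) := hw.continuous_deriv (by simp)
  have e : (fun y => waveOp k φ y t) = fun y => (-(alpha k t ^ 2)⁻¹) * deriv w y +
      ((alpha k t)⁻¹ * (gamma k y * pd1 (pd2 (Function.uncurry φ)) (y, t))
        + pd2 (pd2 (Function.uncurry φ)) (y, t)) := by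
    funext y
    rw [waveOp_eq k hφ, hdw]
    simp only [gamma, div_eq_mul_inv]
    ring
  have m1 : MemLp (fun y => gamma k y * pd1 (pd2 (Function.uncurry φ)) (y, t)) 2
      (volume.restrict (Ioo (0 : ℝ) 1)) := memLp_Ioo_of_continuous (by fun_prop)
  have m2 : MemLp (fun y => pd2 (pd2 (Function.uncurry φ)) (y, t)) 2
      (volume.restrict (Ioo (0 : ℝ) 1)) := memLp_Ioo_of_continuous (by fun_prop)
  have m3 : MemLp (fun y => (alpha k t)⁻¹ * (gamma k y * pd1 (pd2 (Function.uncurry φ)) (y, t))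
      + pd2 (pd2 (Function.uncurry φ)) (y, t)) 2 (volume.restrict (Ioo (0 : ℝ) 1)) :=
    memLp_Ioo_of_continuous (by fun_prop)
  rw [e, bL_lin _ (memLp_Ioo_of_continuous hcw) m3, bL_lin _ m1 m2,
    inner_bL_gammaMul k (by fun_prop), inner_bL_betaMul k (by fun_prop),
    inner_add_left, inner_add_left, real_inner_smul_left, real_inner_smul_left]
  have hwd' : inner ℝ (bL 1 (deriv w)) (toL2 χ) = - inner ℝ (bL 1 w) (dy χ) := hwd
  rw [hwd']
  simp only [w]
  ring

/-! ### Homogeneous adjoint solutions and their duality with forward solutions -/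

/-- Solutions of the homogeneous adjoint problem. -/
structure IsHomAdj (T k : ℝ) (p : ℝ → H10) (q : ℝ → L2) : Prop where
  continuous_state : Continuous p
  continuous_deriv : Continuous q
  final : p T = 0
  final_deriv : q T = 0
  hasDerivAt : ∀ t ∈ Ioo 0 T, HasDerivAt (fun s => toL2 (p s)) (q t) t
  equation : ∀ φ : ℝ → ℝ → ℝ, ContDiff ℝ ∞ (Function.uncurry φ) →
    HasCompactSupport (Function.uncurry φ) →
    tsupport (Function.uncurry φ) ⊆ Ioo 0 1 ×ˢ Ioo 0 T →
    ∫ t in Ioo 0 T, inner ℝ (bL 1 fun y => waveOp k φ y t) (toL2 (p t)) = 0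

/-- `(β_k/α_k) p_y`, frozen for negative times. -/
def stress (k : ℝ) (p : ℝ → H10) (t : ℝ) : L2 :=
  (alpha k (max t 0) ^ 2)⁻¹ • betaMul k (dy (p t))

theorem alpha_max_ne {k : ℝ} (hk : 0 < k) (t : ℝ) : alpha k (max t 0) ≠ 0 :=
  (alpha_pos hk (le_max_right t 0)).ne'

theorem continuous_alpha_max (k : ℝ) : Continuous fun t => alpha k (max t 0) := by
  unfold alpha; fun_prop

/-- Freezing α for negative times avoids its zero at t = -1/k, so the stress is continuous on the
whole line. -/
theorem continuous_stress {k : ℝ} (hk : 0 < k) {p : ℝ → H10} (hp : Continuous p) :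
    Continuous (stress k p) :=
  (((continuous_alpha_max k).pow 2).inv₀ fun t => pow_ne_zero 2 (alpha_max_ne hk t)).smul
    ((betaMul k).continuous.comp (dy.continuous.comp hp))

/-- The time integral of the stress over `(t,T)`. -/
def stressInt (T k : ℝ) (p : ℝ → H10) (t : ℝ) : L2 := ∫ s in t..T, stress k p s

theorem hasDerivAt_stressInt {T k : ℝ} (hk : 0 < k) {p : ℝ → H10} (hp : Continuous p) (t : ℝ) :
    HasDerivAt (stressInt T k p) (-stress k p t) t :=
  intervalIntegral.integral_hasDerivAt_left ((continuous_stress hk hp).intervalIntegrable _ _)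
    ((continuous_stress hk hp).stronglyMeasurableAtFilter _ _) (continuous_stress hk hp).continuousAt

/-- The equation integrated once in time, so that no second derivative of p appears. With tests
χ(y)η(t) the weak equation says that the left-hand side m satisfies ∫ η' m = 0; hence m is constant
by du Bois-Reymond, and the final data make the constant zero. -/
theorem IsHomAdj.identity_test {T k : ℝ} (hT : 0 < T) (hk : 0 < k) {p : ℝ → H10} {q : ℝ → L2}
    (h : IsHomAdj T k p q) {χ : ℝ → ℝ} (h1 : ContDiff ℝ ∞ χ) (h2 : HasCompactSupport χ)
    (h3 : tsupport χ ⊆ Ioo 0 1) {t : ℝ} (ht : t ∈ Icc 0 T) :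
    inner ℝ (bL 1 (deriv χ)) (stressInt T k p t)
      + (alpha k (max t 0))⁻¹ * inner ℝ (bL 1 (deriv χ)) (gammaMul k (toL2 (p t)))
      - inner ℝ (bL 1 χ) (q t) = 0 := by
  have hU : ∀ t, HasDerivAt (stressInt T k p) (-stress k p t) t :=
    hasDerivAt_stressInt hk h.continuous_state
  have hUc : Continuous (stressInt T k p) := continuous_iff_continuousAt.2 fun t => (hU t).continuousAt
  have hpc : Continuous fun t => toL2 (p t) := toL2.continuous.comp h.continuous_state
  have hqc := h.continuous_deriv
  have hα : Continuous fun t => (alpha k (max t 0))⁻¹ :=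
    (continuous_alpha_max k).inv₀ (alpha_max_ne hk)
  obtain ⟨m, hm⟩ : ∃ m : ℝ → ℝ, m = fun t => inner ℝ (bL 1 (deriv χ)) (stressInt T k p t)
      + (alpha k (max t 0))⁻¹ * inner ℝ (bL 1 (deriv χ)) (gammaMul k (toL2 (p t)))
      - inner ℝ (bL 1 χ) (q t) := ⟨_, rfl⟩
  have hmc : Continuous m := by rw [hm]; fun_prop
  have key : ∀ η : ℝ → ℝ, ContDiff ℝ ∞ η → HasCompactSupport η → tsupport η ⊆ Ioo 0 T →
      ∫ t in Ioo 0 T, deriv η t * m t = 0 := by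
    intro η g1 g2 g3
    have g1' : ContDiff ℝ ∞ (deriv η) := ((contDiff_infty_iff_deriv).1 g1).2
    have h1' : ContDiff ℝ ∞ (deriv χ) := ((contDiff_infty_iff_deriv).1 h1).2
    have dη : ∀ t, HasDerivAt η (deriv η t) t := fun t => (g1.differentiable (by simp) t).hasDerivAt
    have dη' : ∀ t, HasDerivAt (deriv η) (deriv (deriv η) t) t := fun t =>
      (g1'.differentiable (by simp) t).hasDerivAt
    have cη := g1.continuous
    have cη' := g1'.continuous
    have cη2 : Continuous (deriv (deriv η)) := g1'.continuous_deriv (by simp)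
    have z0 : ∀ t, t ∉ Ioo 0 T → η t = 0 ∧ deriv η t = 0 := fun t ht =>
      ⟨image_eq_zero_of_notMem_tsupport fun h => ht (g3 h),
        image_eq_zero_of_notMem_tsupport fun h => ht (g3 (tsupport_deriv_subset h))⟩
    let φ : ℝ → ℝ → ℝ := fun y t => χ y * η t
    have hφ : ContDiff ℝ ∞ (Function.uncurry φ) :=
      (h1.comp contDiff_fst).mul (g1.comp contDiff_snd)
    have hsub : tsupport (Function.uncurry φ) ⊆ tsupport χ ×ˢ tsupport η := by
      refine closure_minimal (fun z hz => ?_)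
        ((isClosed_tsupport χ).prod (isClosed_tsupport η))
      have hz' : χ z.1 * η z.2 ≠ 0 := hz
      exact ⟨subset_tsupport _ (left_ne_zero_of_mul hz'), subset_tsupport _ (right_ne_zero_of_mul hz')⟩
    have hφc : HasCompactSupport (Function.uncurry φ) :=
      (h2.isCompact.prod g2.isCompact).of_isClosed_subset (isClosed_tsupport _) hsub
    have heq := h.equation φ hφ hφc (hsub.trans (Set.prod_mono h3 g3))
    have p2 : ∀ y t, pd2 (Function.uncurry φ) (y, t) = χ y * deriv η t := fun y t =>
      (hasDerivAt_snd hφ y t).unique ((dη t).const_mul (χ y))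
    have p1 : ∀ y t, pd1 (Function.uncurry φ) (y, t) = η t * deriv χ y := fun y t =>
      (hasDerivAt_fst hφ y t).unique
        ((((h1.differentiable (by simp) y).hasDerivAt).mul_const (η t)).congr_deriv (mul_comm _ _))
    have p22 : ∀ y t, pd2 (pd2 (Function.uncurry φ)) (y, t) = deriv (deriv η) t * χ y := fun y t =>
      (hasDerivAt_snd (contDiff_pd2 hφ) y t).unique (by
        simp only [p2]; exact ((dη' t).const_mul (χ y)).congr_deriv (mul_comm _ _))
    have p12 : ∀ y t, pd1 (pd2 (Function.uncurry φ)) (y, t) = deriv η t * deriv χ y := fun y t =>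
      (hasDerivAt_fst (contDiff_pd2 hφ) y t).unique (by
        simp only [p2]
        exact (((h1.differentiable (by simp) y).hasDerivAt).mul_const (deriv η t)).congr_deriv
          (mul_comm _ _))
    have mχ := memLp_Ioo_of_continuous (c := 1) h1.continuous
    have mχ' := memLp_Ioo_of_continuous (c := 1) h1'.continuous
    -- F is chosen so that F' = E - η' m, where E is the integrand of the weak equation; it vanishes
    -- at both ends together with η and η'.
    obtain ⟨F, hF⟩ : ∃ F : ℝ → ℝ, F = fun t => deriv η t * inner ℝ (bL 1 χ) (toL2 (p t))
      - η t * inner ℝ (bL 1 (deriv χ)) (stressInt T k p t) := ⟨_, rfl⟩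
    obtain ⟨E, hE⟩ : ∃ E : ℝ → ℝ, E = fun t => deriv (deriv η) t * inner ℝ (bL 1 χ) (toL2 (p t))
      + η t * inner ℝ (bL 1 (deriv χ)) (stress k p t)
      + deriv η t * ((alpha k (max t 0))⁻¹ * inner ℝ (bL 1 (deriv χ)) (gammaMul k (toL2 (p t)))) :=
        ⟨_, rfl⟩
    have hsc := continuous_stress hk h.continuous_state
    have hEc : Continuous E := by rw [hE]; fun_prop
    have hFc : Continuous F := by rw [hF]; fun_prop
    have hE0 : ∫ t in Ioo 0 T, E t = 0 := by
      refine Eq.trans (setIntegral_congr_fun measurableSet_Ioo fun t ht => ?_) heq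
      simp only [hE]
      rw [inner_waveOp hφ]
      simp only [p22, p1, p12]
      rw [bL_const_mul _ mχ, bL_const_mul _ mχ', bL_const_mul _ mχ', real_inner_smul_left,
        real_inner_smul_left, real_inner_smul_left, stress, max_eq_left (show (0 : ℝ) ≤ t from ht.1.le),
        real_inner_smul_right]
      ring
    have hd : ∀ t ∈ Ioo 0 T, HasDerivAt F (E t - deriv η t * m t) t := by
      intro t ht
      have a1 : HasDerivAt (fun t => inner ℝ (bL 1 χ) (toL2 (p t))) (inner ℝ (bL 1 χ) (q t)) t := by
        simpa using (hasDerivAt_const t (bL 1 χ)).inner ℝ (h.hasDerivAt t ht)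
      have a2 : HasDerivAt (fun t => inner ℝ (bL 1 (deriv χ)) (stressInt T k p t))
          (inner ℝ (bL 1 (deriv χ)) (-stress k p t)) t := by
        simpa using (hasDerivAt_const t (bL 1 (deriv χ))).inner ℝ (hU t)
      rw [hF]
      refine (((dη' t).mul a1).sub ((dη t).mul a2)).congr_deriv ?_
      rw [hE, hm]
      simp only [inner_neg_right]
      ring
    have hi := intervalIntegral.integral_eq_sub_of_hasDerivAt_of_le hT.le hFc.continuousOn hd
      ((hEc.sub (cη'.mul hmc)).intervalIntegrable _ _)
    have hF0 : F T - F 0 = 0 := by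
      simp [hF, z0 T (by simp), z0 0 (by simp)]
    rw [hF0] at hi
    have i1 : IntervalIntegrable E volume 0 T := hEc.intervalIntegrable _ _
    have i2 : IntervalIntegrable (fun t => deriv η t * m t) volume 0 T :=
      (cη'.mul hmc).intervalIntegrable _ _
    rw [intervalIntegral.integral_sub i1 i2] at hi
    rw [setIntegral_Ioo_eq_intervalIntegral hT.le] at hE0 ⊢
    linarith
  obtain ⟨c, hc⟩ := ae_eq_const_of_integral_deriv_mul hT
    (hmc.integrableOn_Icc.mono_set Ioo_subset_Icc_self) key
  rw [restrict_Ioo_eq_restrict_Icc] at hc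
  have hall : EqOn m (fun _ => c) (Icc 0 T) :=
    Measure.eqOn_Icc_of_ae_eq volume hT.ne hc hmc.continuousOn continuousOn_const
  have hmT : m T = 0 := by
    simp [hm, stressInt, h.final, h.final_deriv]
  have : m t = 0 := by rw [hall ht, ← hall (right_mem_Icc.2 hT.le), hmT]
  rw [hm] at this
  exact this

theorem IsHomAdj.identity {T k : ℝ} (hT : 0 < T) (hk : 0 < k) {p : ℝ → H10} {q : ℝ → L2}
    (h : IsHomAdj T k p q) {t : ℝ} (ht : t ∈ Icc 0 T) {z : L2 × L2} (hz : z ∈ H10Submodule) :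
    inner ℝ z.2 (stressInt T k p t)
      + (alpha k t)⁻¹ * inner ℝ z.2 (gammaMul k (toL2 (p t))) - inner ℝ z.1 (q t) = 0 := by
  have := H10_ker (((innerSL ℝ (stressInt T k p t)
      + (alpha k t)⁻¹ • innerSL ℝ (gammaMul k (toL2 (p t)))).comp (ContinuousLinearMap.snd ℝ L2 L2))
      - (innerSL ℝ (q t)).comp (ContinuousLinearMap.fst ℝ L2 L2)) (fun φ h1 h2 h3 => ?_) hz
  · simpa [real_inner_comm] using this
  · have := h.identity_test hT hk h1 h2 h3 ht
    rw [max_eq_left ht.1] at this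
    simpa [real_inner_comm] using this

theorem H10_eq_zero {χ : H10} (h : toL2 χ = 0) : χ = 0 := by
  refine H10_ext ?_
  rw [map_zero]
  have h0 : ∀ᵐ y, y ∈ Ioo (0 : ℝ) 1 → dy χ y = 0 := by
    refine isOpen_Ioo.ae_eq_zero_of_integral_contDiff_smul_eq_zero
      (Lp_integrableOn (dy χ)).locallyIntegrableOn fun g g1 g2 g3 => ?_
    have e1 := inner_deriv_toL2 (g1.of_le (by simp)) χ.2
    have e2 : inner ℝ (bL 1 g) (dy χ) = 0 := by
      have e3 : inner ℝ (bL 1 (deriv g)) (toL2 χ) = - inner ℝ (bL 1 g) (dy χ) := e1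
      rw [h, inner_zero_right] at e3
      linarith
    rw [inner_bL_left (memLp_Ioo_of_continuous g1.continuous)] at e2
    refine Eq.trans ?_ e2
    refine (setIntegral_eq_integral_of_forall_compl_eq_zero fun y hy => ?_).symm
    rw [image_eq_zero_of_notMem_tsupport fun h => hy (g3 h), zero_smul]
  apply Lp.ext
  filter_upwards [(ae_restrict_iff' measurableSet_Ioo).2 h0, Lp.coeFn_zero ℝ 2
    (volume.restrict (Ioo (0 : ℝ) 1))] with y h1 h2
  rw [h1, h2]; rfl

/-- Duality with a forward solution Φ. With U the stress integral, F = (Φ_t, p) - (Φ_y, U) has as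
derivative the pairing of p with the wave operator of Φ; the term in p' is eliminated by
`IsHomAdj.identity` applied to Φ_t. The initial data of Φ annihilate F at 0, the final data of p
annihilate it at T. -/
theorem IsHomAdj.integral_forward {T k : ℝ} (hT : 0 < T) (hk₀ : 0 < k) (hk₁ : k < 1) {N : ℕ}
    (hN : alpha k (T + 1) ≤ ratio k ^ N) {p : ℝ → H10} {q : ℝ → L2}
    (h : IsHomAdj T k p q) {Ψ : ℝ × ℝ → ℝ} (hΨ : IsForward k Ψ) :
    ∫ t in Ioo 0 T, inner ℝ (bL 1 fun y => 4 * k ^ 2 * pd2 (pd1 (img k N Ψ)) (char k (y, t)))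
      (toL2 (p t)) = 0 := by
  have hs := contDiff_img k N hΨ.smooth
  let φ : ℝ → ℝ → ℝ := fun y t => img k N Ψ (char k (y, t))
  have hφ : ContDiff ℝ ∞ (Function.uncurry φ) := hs.comp (contDiff_char k)
  obtain ⟨Φ, hΦ⟩ : ∃ Φ, Φ = Function.uncurry φ := ⟨_, rfl⟩
  rw [← hΦ] at hφ
  have c1 := (contDiff_pd1 hφ).continuous
  have c2 := (contDiff_pd2 hφ).continuous
  have c21 := (contDiff_pd2 (contDiff_pd1 hφ)).continuous
  have c22 := (contDiff_pd2 (contDiff_pd2 hφ)).continuous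
  have sw : ∀ {G : ℝ × ℝ → ℝ}, Continuous G → Continuous (Function.uncurry fun t y => G (y, t)) :=
    fun {G} hG => by
      change Continuous fun z : ℝ × ℝ => G (z.2, z.1); fun_prop
  have hU : ∀ t, HasDerivAt (stressInt T k p) (-stress k p t) t :=
    hasDerivAt_stressInt hk₀ h.continuous_state
  have hUc : Continuous (stressInt T k p) := continuous_iff_continuousAt.2 fun t => (hU t).continuousAt
  have d1 : ∀ t, HasDerivAt (fun t => bL 1 fun y => pd1 Φ (y, t))
      (bL 1 fun y => pd2 (pd1 Φ) (y, t)) t := fun t =>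
    hasDerivAt_bL (sw c1) (sw c21) (fun t y => hasDerivAt_snd (contDiff_pd1 hφ) y t) t
  have d2 : ∀ t, HasDerivAt (fun t => bL 1 fun y => pd2 Φ (y, t))
      (bL 1 fun y => pd2 (pd2 Φ) (y, t)) t := fun t =>
    hasDerivAt_bL (sw c2) (sw c22) (fun t y => hasDerivAt_snd (contDiff_pd2 hφ) y t) t
  have b1 := continuous_bL (c := 1) (sw c1)
  have b2 := continuous_bL (c := 1) (sw c2)
  have hpc : Continuous fun t => toL2 (p t) := toL2.continuous.comp h.continuous_state
  -- Φ_t inherits zero boundary values because Φ vanishes at y = 0 and y = 1 for all times near t,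
  -- also when t = T.
  have hx : ∀ t ∈ Icc 0 T,
      (bL 1 (fun y => pd2 Φ (y, t)), bL 1 (fun y => pd2 (pd1 Φ) (y, t))) ∈ H10Submodule := by
    intro t ht
    have e : deriv (fun y => pd2 Φ (y, t)) = fun y => pd2 (pd1 Φ) (y, t) := funext fun y => by
      rw [(hasDerivAt_fst (contDiff_pd2 hφ) y t).deriv, pd1_pd2_comm hφ]
    rw [← e]
    refine mem_H10_of_contDiff (((contDiff_pd2 hφ).comp
      (contDiff_id.prodMk contDiff_const)).of_le (by simp)) ?_ ?_
    · refine (hasDerivAt_snd hφ 0 t).unique ((hasDerivAt_const t (0 : ℝ)).congr_of_eventuallyEq ?_)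
      exact Eventually.of_forall fun s => by rw [hΦ]; exact img_char_zero k N Ψ s
    · refine (hasDerivAt_snd hφ 1 t).unique ((hasDerivAt_const t (0 : ℝ)).congr_of_eventuallyEq ?_)
      filter_upwards [Iio_mem_nhds (show t < T + 1 by linarith [ht.2])] with s hs
      rw [hΦ]; exact hΨ.img_one hk₀ hk₁ hN hs
  have z0 : ∀ y ∈ Icc (0 : ℝ) 1, ∀ t, t ≤ 0 → 0 ≤ alpha k t → Φ (y, t) = 0 := fun y hy t h1 h2 => by
    rw [hΦ]; exact hΨ.img_initial hk₀ hk₁ N h1 h2 hy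
  have hα0 : 0 ≤ alpha k 0 := by simp [alpha]
  have b0 : bL 1 (fun _ => 0) = 0 := bL_eq (Lp.coeFn_zero _ _ _)
  have i1 : bL 1 (fun y => pd1 Φ (y, 0)) = 0 := by
    rw [← b0]
    refine bL_congr fun y hy => ?_
    refine (hasDerivAt_fst hφ y 0).unique ((hasDerivAt_const y (0 : ℝ)).congr_of_eventuallyEq ?_)
    filter_upwards [isOpen_Ioo.mem_nhds hy] with z hz
    exact z0 z (Ioo_subset_Icc_self hz) 0 le_rfl hα0
  have i2 : bL 1 (fun y => pd2 Φ (y, 0)) = 0 := by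
    rw [← b0]
    refine bL_congr fun y hy => ?_
    have h1 := (hasDerivAt_snd hφ y 0).hasDerivWithinAt (s := Iic 0)
    have h2 : HasDerivWithinAt (fun t => Φ (y, t)) 0 (Iic 0) 0 := by
      refine (hasDerivWithinAt_const (0 : ℝ) (Iic (0 : ℝ)) (0 : ℝ)).congr_of_eventuallyEq ?_
        (z0 y (Ioo_subset_Icc_self hy) 0 le_rfl hα0)
      -- To the left of 0, only the times with α(t) ≥ 0 are covered by `z0`; they fill the one-sided
      -- neighbourhood (-1/k, 0].
      have : Ioi (-k⁻¹) ∈ 𝓝[Iic 0] (0 : ℝ) :=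
        mem_nhdsWithin_of_mem_nhds (Ioi_mem_nhds (by simpa using hk₀))
      filter_upwards [this, self_mem_nhdsWithin] with t h3 h4
      refine z0 y (Ioo_subset_Icc_self hy) t h4 ?_
      have h5 : -k⁻¹ < t := h3
      have := mul_lt_mul_of_pos_left h5 hk₀
      rw [mul_neg, mul_inv_cancel₀ hk₀.ne'] at this
      unfold alpha; linarith
    exact (uniqueDiffOn_Iic 0 0 self_mem_Iic).eq_deriv _ h1 h2
  obtain ⟨F, hF⟩ : ∃ F : ℝ → ℝ, F = fun t =>
      inner ℝ (bL 1 fun y => pd2 Φ (y, t)) (toL2 (p t))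
        - inner ℝ (bL 1 fun y => pd1 Φ (y, t)) (stressInt T k p t) := ⟨_, rfl⟩
  have hFc : Continuous F := by rw [hF]; fun_prop
  have hbox : Continuous fun t => inner ℝ
      (bL 1 fun y => 4 * k ^ 2 * pd2 (pd1 (img k N Ψ)) (char k (y, t))) (toL2 (p t)) := by
    have c3 : Continuous fun z => 4 * k ^ 2 * pd2 (pd1 (img k N Ψ)) (char k z) :=
      continuous_const.mul ((contDiff_pd2 (contDiff_pd1 hs)).comp (contDiff_char k)).continuous
    exact (continuous_bL (sw c3)).inner hpc
  have hd : ∀ t ∈ Ioo 0 T, HasDerivAt F (inner ℝ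
      (bL 1 fun y => 4 * k ^ 2 * pd2 (pd1 (img k N Ψ)) (char k (y, t))) (toL2 (p t))) t := by
    intro t ht
    have hα := alpha_pos hk₀ ht.1.le
    have e : (fun y => 4 * k ^ 2 * pd2 (pd1 (img k N Ψ)) (char k (y, t))) =
        fun y => waveOp k φ y t := funext fun y => (waveOp_comp_char hs hα.ne').symm
    rw [e, inner_waveOp (by rw [← hΦ]; exact hφ), ← hΦ, pd1_pd2_comm hφ]
    have hid := h.identity hT hk₀ (Ioo_subset_Icc_self ht) (hx t (Ioo_subset_Icc_self ht))
    simp only at hid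
    rw [hF]
    refine (((d2 t).inner ℝ (h.hasDerivAt t ht)).sub ((d1 t).inner ℝ (hU t))).congr_deriv ?_
    rw [inner_neg_right, stress, max_eq_left ht.1.le, real_inner_smul_right]
    linarith
  have hi := intervalIntegral.integral_eq_sub_of_hasDerivAt_of_le hT.le hFc.continuousOn hd
    (hbox.intervalIntegrable _ _)
  rw [setIntegral_Ioo_eq_intervalIntegral hT.le, hi, hF]
  simp [h.final, stressInt, i1, i2]

/-- Every product h₁(a)h₂(b) on a small box is, up to a constant, the source of a forward solution,
so p is orthogonal to all of them and vanishes in L²(Q). Continuity in t extends this to every time.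
-/
theorem IsHomAdj.eq_zero {T k : ℝ} (hT : 0 < T) (hk₀ : 0 < k) (hk₁ : k < 1) {p : ℝ → H10} {q : ℝ → L2}
    (h : IsHomAdj T k p q) {t : ℝ} (ht : t ∈ Icc 0 T) : p t = 0 := by
  obtain ⟨N, hN⟩ := exists_pow_ratio hk₀ hk₁ T
  have hpc : Continuous fun t => toL2 (p t) := toL2.continuous.comp h.continuous_state
  obtain ⟨P, hP⟩ := exists_isRep T hpc
  have hP0 : P = 0 := by
    refine LQ_eq_zero hk₀ fun a₁ a₂ b₁ b₂ h₁ h₂ hr ha hb s₁ s₂ z₁ z₂ => ?_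
    have hΨ := isForward_prodPot hk₀ hk₁ hr ha hb s₁ s₂ z₁ z₂
    have h0 := h.integral_forward hT hk₀ hk₁ hN hΨ
    have hc : Continuous fun z => h₁ (char k z).1 * h₂ (char k z).2 := by
      have c := (contDiff_char k).continuous
      exact (s₁.continuous.comp (continuous_fst.comp c)).mul
        (s₂.continuous.comp (continuous_snd.comp c))
    have hm := memLp_Q_of_continuous hc T
    have e1 : ∫ z in Ioo (0 : ℝ) 1 ×ˢ Ioo 0 T, P z * (h₁ (char k z).1 * h₂ (char k z).2) =
        inner ℝ P (hm.toLp _) := by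
      rw [L2.inner_def]
      exact integral_congr_ae (hm.coeFn_toLp.mono fun z hz => by simp [hz, mul_comm])
    rw [e1, ← hP.integral_mul hm]
    have e2 : ∀ t ∈ Ioo 0 T, ∫ y in Ioo (0 : ℝ) 1,
        toL2 (p t) y * (h₁ (char k (y, t)).1 * h₂ (char k (y, t)).2) =
        (4 * k ^ 2)⁻¹ * inner ℝ (bL 1 fun y => 4 * k ^ 2 *
          pd2 (pd1 (img k N (prodPot a₁ b₁ h₁ h₂))) (char k (y, t))) (toL2 (p t)) := by
      intro t ht
      have c3 : Continuous fun z => 4 * k ^ 2 *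
          pd2 (pd1 (img k N (prodPot a₁ b₁ h₁ h₂))) (char k z) :=
        continuous_const.mul ((contDiff_pd2 (contDiff_pd1
          (contDiff_img k N hΨ.smooth))).comp (contDiff_char k)).continuous
      have c4 : Continuous fun y => 4 * k ^ 2 *
          pd2 (pd1 (img k N (prodPot a₁ b₁ h₁ h₂))) (char k (y, t)) :=
        c3.comp (by fun_prop : Continuous fun y : ℝ => (y, t))
      rw [inner_bL_left (memLp_Ioo_of_continuous c4), ← integral_const_mul]
      refine setIntegral_congr_fun measurableSet_Ioo fun y hy => ?_
      have hz : char k (y, t) ∈ charRegion k T :=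
        (char_mem_iff hk₀ (alpha_pos hk₀ ht.1.le)).2 ⟨hy, ht⟩
      have hb' := (charRegion_subset hk₀ hk₁ hz).2.1
      have := pd2_pd1_img_eq hk₀ hk₁ N hΨ.smooth (fun w hw =>
        pd2_pd1_prodPot_eq_zero hr s₁ s₂ z₁ z₂ (notMem_charRegion_of_wedge hk₁ hw)) hb' hz.1 (by
          have h4 := hz.2.1
          rw [← ratio_mul hk₁, mul_assoc] at h4
          exact lt_of_mul_lt_mul_left h4 (by linarith))
      have e3 : pd2 (pd1 (img k N (prodPot a₁ b₁ h₁ h₂))) (char k (y, t)) =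
          h₁ (char k (y, t)).1 * h₂ (char k (y, t)).2 := this.trans (pd2_pd1_prodPot _ _ s₁ s₂ _)
      simp only [e3]
      field_simp
    rw [setIntegral_congr_fun measurableSet_Ioo e2, integral_const_mul, h0, mul_zero]
  have hn := hP.norm_sq
  rw [hP0, norm_zero, setIntegral_Ioo_eq_intervalIntegral hT.le] at hn
  have hzero : ∀ t ∈ Icc 0 T, ‖toL2 (p t)‖ ^ 2 = 0 := by
    by_contra hcon
    push Not at hcon
    obtain ⟨s, hs, hne⟩ := hcon
    have : 0 < ∫ t in (0 : ℝ)..T, ‖toL2 (p t)‖ ^ 2 := intervalIntegral.integral_pos hT (hpc.norm.pow 2).continuousOn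
      (fun _ _ => sq_nonneg _) ⟨s, hs, lt_of_le_of_ne (sq_nonneg _) (Ne.symm hne)⟩
    simp at hn
    linarith
  exact H10_eq_zero (norm_eq_zero.1 (pow_eq_zero_iff two_ne_zero |>.1 (hzero t ht)))

/-- The weak equation in terms of inner products. -/
theorem IsAdjointSolution.integral_waveOp {T k : ℝ} (hk : 0 < k)
    {f : ℝ → ℝ → ℝ} {p : ℝ → H10} (h : IsAdjointSolution T k f p) {φ : ℝ → ℝ → ℝ}
    (h1 : ContDiff ℝ ∞ (Function.uncurry φ)) (h2 : HasCompactSupport (Function.uncurry φ))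
    (h3 : tsupport (Function.uncurry φ) ⊆ Ioo 0 1 ×ˢ Ioo 0 T) :
    IntegrableOn (fun t => inner ℝ (bL 1 fun y => waveOp k φ y t) (toL2 (p t))) (Ioo 0 T) ∧
      ∫ t in Ioo 0 T, inner ℝ (bL 1 fun y => waveOp k φ y t) (toL2 (p t)) =
        ∫ t in Ioo 0 T, ∫ y in Ioo (0 : ℝ) 1, f y t * φ y t := by
  obtain ⟨ψ, s1, s2, s3, e⟩ := exists_test_char hk h1 h2 h3
  obtain ⟨G, hG⟩ : ∃ G : ℝ × ℝ → ℝ, G = fun z => 4 * k ^ 2 * pd2 (pd1 ψ) (char k z) := ⟨_, rfl⟩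
  have hGc : Continuous G := by
    rw [hG]
    exact continuous_const.mul ((contDiff_pd2 (contDiff_pd1 s1)).comp (contDiff_char k)).continuous
  have hw : ∀ t ∈ Ioo 0 T, (fun y => waveOp k φ y t) = fun y => G (y, t) := fun t ht => by
    funext y
    rw [e, waveOp_comp_char s1 (alpha_pos hk ht.1.le).ne', hG]
  have hb : Continuous fun t => bL 1 fun y => G (y, t) := continuous_bL (by
    change Continuous fun z : ℝ × ℝ => G (z.2, z.1); fun_prop)
  have hc : ContinuousOn (fun t => inner ℝ (bL 1 fun y => G (y, t)) (toL2 (p t))) (Icc 0 T) :=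
    hb.continuousOn.inner (toL2.continuous.comp_continuousOn h.continuousOn)
  constructor
  · refine (hc.integrableOn_Icc.mono_set Ioo_subset_Icc_self).congr_fun (fun t ht => ?_)
      measurableSet_Ioo
    simp only [hw t ht]
  · rw [← h.equation φ h1 h2 h3]
    refine setIntegral_congr_fun measurableSet_Ioo fun t ht => ?_
    have hm : MemLp (fun y => waveOp k φ y t) 2 (volume.restrict (Ioo (0 : ℝ) 1)) := by
      rw [hw t ht]; exact memLp_Ioo_of_continuous (by fun_prop)
    rw [inner_bL_left hm]
    simp only [mul_comm]

theorem IsAdjointSolution.unique {T k : ℝ} (hT : 0 < T) (hk₀ : 0 < k) (hk₁ : k < 1)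
    {f : ℝ → ℝ → ℝ} {p₁ p₂ : ℝ → H10} (h₁ : IsAdjointSolution T k f p₁)
    (h₂ : IsAdjointSolution T k f p₂) : EqOn p₁ p₂ (Icc 0 T) := by
  obtain ⟨q₁, c₁, f₁, d₁⟩ := h₁.final_deriv
  obtain ⟨q₂, c₂, f₂, d₂⟩ := h₂.final_deriv
  -- Clamping the time to [0,T] produces the globally continuous curves that `IsHomAdj` asks for.
  let π : ℝ → ℝ := fun t => projIcc 0 T hT.le t
  have hπ : Continuous π := continuous_subtype_val.comp continuous_projIcc
  have hm : ∀ t, π t ∈ Icc 0 T := fun t => (projIcc 0 T hT.le t).2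
  have he : ∀ t ∈ Icc 0 T, π t = t := fun t ht => by simp only [π, projIcc_of_mem hT.le ht]
  have hom : IsHomAdj T k (fun t => p₁ (π t) - p₂ (π t)) (fun t => q₁ (π t) - q₂ (π t)) :=
    { continuous_state := (h₁.continuousOn.comp_continuous hπ hm).sub
        (h₂.continuousOn.comp_continuous hπ hm)
      continuous_deriv := (c₁.comp_continuous hπ hm).sub (c₂.comp_continuous hπ hm)
      final := by rw [he T (right_mem_Icc.2 hT.le), h₁.final, h₂.final, sub_self]
      final_deriv := by rw [he T (right_mem_Icc.2 hT.le), f₁, f₂, sub_self]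
      hasDerivAt := fun t ht => by
        have hn := Icc_mem_nhds ht.1 ht.2
        have ht' := Ioo_subset_Icc_self ht
        rw [he t ht']
        refine (((d₁ t ht').hasDerivAt hn).sub ((d₂ t ht').hasDerivAt hn)).congr_of_eventuallyEq ?_
        filter_upwards [hn] with s hs
        rw [he s hs, map_sub]; rfl
      equation := fun φ g1 g2 g3 => by
        obtain ⟨i₁, e₁⟩ := h₁.integral_waveOp hk₀ g1 g2 g3
        obtain ⟨i₂, e₂⟩ := h₂.integral_waveOp hk₀ g1 g2 g3
        refine Eq.trans ?_ ((integral_sub i₁ i₂).trans (sub_eq_zero.2 (e₁.trans e₂.symm)))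
        refine setIntegral_congr_fun measurableSet_Ioo fun t ht => ?_
        rw [he t (Ioo_subset_Icc_self ht), map_sub, inner_sub_right] }
  intro t ht
  have := hom.eq_zero hT hk₀ hk₁ ht
  rw [he t ht] at this
  exact sub_eq_zero.1 this

theorem HasDyTrace.congr {T : ℝ} {p q : ℝ → H10} {g : ℝ → ℝ} (h : HasDyTrace T p g)
    (hpq : EqOn p q (Icc 0 T)) : HasDyTrace T q g := by
  refine ⟨h.1, h.2.congr fun s => eLpNorm_congr_ae ?_⟩
  filter_upwards [ae_restrict_mem measurableSet_Ioo] with t ht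
  rw [hpq (Ioo_subset_Icc_self ht)]

theorem HasDyTrace.unique {T : ℝ} {p : ℝ → H10} (hp : ContinuousOn p (Icc 0 T)) {g₁ g₂ : ℝ → ℝ}
    (h₁ : HasDyTrace T p g₁) (h₂ : HasDyTrace T p g₂) : g₁ =ᵐ[volume.restrict (Ioo 0 T)] g₂ := by
  have hz : Ioc (0 : ℝ) 1 ∈ 𝓝[>] (0 : ℝ) := Ioc_mem_nhdsGT zero_lt_one
  have hle : ∀ᶠ h in 𝓝[>] (0 : ℝ), eLpNorm (g₁ - g₂) 2 (volume.restrict (Ioo 0 T)) ≤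
      eLpNorm (fun t => h⁻¹ * (∫ y in Ioo 0 h, dy (p t) y) - g₂ t) 2 (volume.restrict (Ioo 0 T))
      + eLpNorm (fun t => h⁻¹ * (∫ y in Ioo 0 h, dy (p t) y) - g₁ t) 2
        (volume.restrict (Ioo 0 T)) := by
    filter_upwards [hz] with h hh
    have hc : ContinuousOn (fun t => h⁻¹ * (∫ y in Ioo 0 h, dy (p t) y)) (Ioo 0 T) := by
      have e : (fun t => h⁻¹ * (∫ y in Ioo 0 h, dy (p t) y)) = fun t => h⁻¹ * ev h (dy (p t)) :=
        funext fun t => by rw [ev_eq_setIntegral ⟨hh.1.le, hh.2⟩]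
      rw [e]
      exact continuousOn_const.mul ((ev h).continuous.comp_continuousOn
        (dy.continuous.comp_continuousOn (hp.mono Ioo_subset_Icc_self)))
    have hm := hc.aestronglyMeasurable (μ := volume) measurableSet_Ioo
    have e : g₁ - g₂ = (fun t => h⁻¹ * (∫ y in Ioo 0 h, dy (p t) y) - g₂ t)
        - fun t => h⁻¹ * (∫ y in Ioo 0 h, dy (p t) y) - g₁ t := by
      funext t; simp
    rw [e]
    exact eLpNorm_sub_le (hm.sub h₂.1.1) (hm.sub h₁.1.1) (by norm_num)
  have hlim := ge_of_tendsto (h₂.2.add h₁.2) hle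
  rw [add_zero] at hlim
  have := (eLpNorm_eq_zero_iff (h₁.1.1.sub h₂.1.1) two_ne_zero).1 (le_antisymm hlim zero_le)
  filter_upwards [this] with t ht
  exact sub_eq_zero.1 ht

/-- The transposition identity quantifies over all adjoint solutions and all their traces. By
uniqueness each such pair is the one delivered by the solution operator. -/
theorem IsAdjLimit.trace_eq {T k : ℝ} (hT : 0 < T) (hk₀ : 0 < k) (hk₁ : k < 1) {N : ℕ}
    {f : LQ T} {x : AdjData T} (h : IsAdjLimit T k N f x) {F : ℝ → ℝ → ℝ}
    (hF : f =ᵐ[volume.restrict (Ioo (0 : ℝ) 1 ×ˢ Ioo (0 : ℝ) T)] Function.uncurry F)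
    {θ : ℝ → H10} {g : ℝ → ℝ} (hθ : IsAdjointSolution T k F θ) (hg : HasDyTrace T θ g) :
    g =ᵐ[volume.restrict (Ioo 0 T)] x.2.2 ⟨0, by simp⟩ :=
  hg.unique hθ.continuousOn ((h.hasDyTrace hT.le).congr
    ((h.isAdjointSolution hT.le hk₀ hk₁ hF).unique hT hk₀ hk₁ hθ))

/-! ### Waves travelling along the characteristics -/

/-- The inclusion `L²(Ω) → H⁻¹(Ω)` as a continuous linear map. -/
def toHneg1L : L2 →L[ℝ] Hneg1 :=
  ((ContinuousLinearMap.compL ℝ H10 L2 ℝ).flip toL2).comp (innerSL ℝ)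

theorem toHneg1_apply (f : L2) (χ : H10) : toHneg1 f χ = inner ℝ f (toL2 χ) := rfl

/-- Test functions on `(0,T)`. -/
structure IsTest (T : ℝ) (w : ℝ → ℝ) : Prop where
  smooth : ContDiff ℝ ∞ w
  compact : HasCompactSupport w
  support : tsupport w ⊆ Ioo 0 T

theorem isTest_zero (T : ℝ) : IsTest T fun _ => 0 :=
  ⟨contDiff_const, HasCompactSupport.zero, by
    simp [tsupport, show Function.support (fun _ : ℝ => (0 : ℝ)) = ∅ from Function.support_zero]⟩

theorem IsTest.lin {T : ℝ} {u v : ℝ → ℝ} (hu : IsTest T u) (hv : IsTest T v) (c : ℝ) :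
    IsTest T fun x => c * u x + v x :=
  ⟨(contDiff_const.mul hu.smooth).add hv.smooth, hu.compact.mul_left.add hv.compact,
    (tsupport_add _ _).trans (union_subset
      ((tsupport_mul_subset_right (f := fun _ => c) (g := u)).trans hu.support) hv.support)⟩

theorem IsTest.eq_zero {T : ℝ} {w : ℝ → ℝ} (hw : IsTest T w) {x : ℝ} (hx : x ∉ Ioo 0 T) : w x = 0 :=
  image_eq_zero_of_notMem_tsupport fun h => hx (hw.support h)

theorem IsTest.deriv_eq_zero {T : ℝ} {w : ℝ → ℝ} (hw : IsTest T w) {x : ℝ} (hx : x ∉ Ioo 0 T) :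
    deriv w x = 0 :=
  image_eq_zero_of_notMem_tsupport fun h => hx (hw.support (tsupport_deriv_subset h))

theorem IsTest.norm_bL_sq {T : ℝ} {w : ℝ → ℝ} (hw : IsTest T w) : ‖bL T w‖ ^ 2 = ∫ x, w x ^ 2 := by
  rw [WaveCylinder.norm_bL_sq (memLp_Ioo_of_continuous hw.smooth.continuous)]
  exact setIntegral_eq_integral_of_forall_compl_eq_zero fun x hx => by rw [hw.eq_zero hx]; simp

/-- A wave with profile `w` travelling along the characteristics `α_k(t)(1 + eky) = const`. -/
def ray (k c e : ℝ) (w : ℝ → ℝ) (z : ℝ × ℝ) : ℝ :=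
  w ((c * (alpha k z.2 * (1 + e * k * z.1)) - 1) / k)

/-- The time derivative of `ray`. -/
def rayDeriv (k c e : ℝ) (w : ℝ → ℝ) (z : ℝ × ℝ) : ℝ :=
  c * (1 + e * k * z.1) * deriv w ((c * (alpha k z.2 * (1 + e * k * z.1)) - 1) / k)

theorem continuous_ray (k c e : ℝ) {w : ℝ → ℝ} (hw : Continuous w) : Continuous (ray k c e w) := by
  unfold ray alpha; fun_prop

theorem continuous_rayDeriv (k c e : ℝ) {w : ℝ → ℝ} (hw : ContDiff ℝ ∞ w) :
    Continuous (rayDeriv k c e w) := by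
  have := hw.continuous_deriv (by simp)
  unfold rayDeriv alpha; fun_prop

theorem hasDerivAt_ray_time {k : ℝ} (hk : k ≠ 0) (c e : ℝ) {w : ℝ → ℝ} (hw : ContDiff ℝ ∞ w) (y t : ℝ) :
    HasDerivAt (fun t => ray k c e w (y, t)) (rayDeriv k c e w (y, t)) t := by
  have h1 : HasDerivAt (fun t => (c * (alpha k t * (1 + e * k * y)) - 1) / k)
      (c * (k * (1 + e * k * y)) / k) t :=
    (((hasDerivAt_alpha k t).mul_const _).const_mul c |>.sub_const 1).div_const k
  have h2 := (hw.differentiable (by simp) ((c * (alpha k t * (1 + e * k * y)) - 1) / k)).hasDerivAt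
  refine (h2.comp t h1).congr_deriv ?_
  simp only [rayDeriv]; field_simp

theorem hasDerivAt_ray_space {k : ℝ} (hk : k ≠ 0) (c e : ℝ) {w : ℝ → ℝ} (hw : ContDiff ℝ ∞ w) (y t : ℝ) :
    HasDerivAt (fun y => ray k c e w (y, t))
      (c * e * alpha k t * deriv w ((c * (alpha k t * (1 + e * k * y)) - 1) / k)) y := by
  have h0 : HasDerivAt (fun y : ℝ => 1 + e * k * y) (e * k) y := by
    simpa using ((hasDerivAt_id y).const_mul (e * k)).const_add 1
  have h1 : HasDerivAt (fun y => (c * (alpha k t * (1 + e * k * y)) - 1) / k)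
      (c * (alpha k t * (e * k)) / k) y := ((h0.const_mul _).const_mul c |>.sub_const 1).div_const k
  have h2 := (hw.differentiable (by simp) ((c * (alpha k t * (1 + e * k * y)) - 1) / k)).hasDerivAt
  refine (h2.comp y h1).congr_deriv ?_
  field_simp

theorem contDiff_ray_space (k c e : ℝ) {w : ℝ → ℝ} (hw : ContDiff ℝ ∞ w) (t : ℝ) :
    ContDiff ℝ 1 fun y => ray k c e w (y, t) := by
  have := hw.of_le (m := 1) (by simp)
  unfold ray alpha; fun_prop

/-- At fixed t the argument of w is affine in y with slope ±cα(t), of modulus at least c. -/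
theorem norm_bL_ray_sq_le {T k c e : ℝ} (hk : 0 < k) (hc : 0 < c) (he : e ^ 2 = 1) {w : ℝ → ℝ}
    (hw : IsTest T w) {t : ℝ} (ht : 0 ≤ t) :
    ‖bL 1 fun y => ray k c e w (y, t)‖ ^ 2 ≤ c⁻¹ * ‖bL T w‖ ^ 2 := by
  have hα := one_le_alpha hk ht
  have hcr := (continuous_ray k c e hw.smooth.continuous)
  have hcr1 : Continuous fun y => ray k c e w (y, t) := by fun_prop
  rw [norm_bL_sq (memLp_Ioo_of_continuous hcr1), hw.norm_bL_sq]
  have habs : |e| = 1 := by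
    have := sq_abs e
    nlinarith [abs_nonneg e]
  have hB : c * alpha k t * e ≠ 0 := by
    refine mul_ne_zero (by positivity) fun h => ?_
    rw [h] at he; norm_num at he
  let W : ℝ → ℝ := fun x => w x ^ 2
  let V : ℝ → ℝ := fun x => W ((c * alpha k t - 1) / k + x)
  have e1 : (fun y => ray k c e w (y, t) ^ 2) = fun y => V (c * alpha k t * e * y) := by
    funext y
    simp only [ray, V, W]; congr 2; field_simp; ring
  have hWc : HasCompactSupport W := hw.compact.comp_left (g := fun x : ℝ => x ^ 2) (by norm_num)
  have hw2 : Integrable W volume :=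
    (hw.smooth.continuous.pow 2).integrable_of_hasCompactSupport hWc
  have hw3 : Integrable V volume := hw2.comp_add_left ((c * alpha k t - 1) / k)
  have hi : Integrable (fun y => ray k c e w (y, t) ^ 2) volume := by
    rw [e1]; exact hw3.comp_mul_left' hB
  have h1 : ∫ y in Ioo (0 : ℝ) 1, ray k c e w (y, t) ^ 2 ≤ ∫ y, ray k c e w (y, t) ^ 2 :=
    setIntegral_le_integral hi (ae_of_all _ fun _ => sq_nonneg _)
  have h2 : ∫ y, ray k c e w (y, t) ^ 2 = |(c * alpha k t * e)⁻¹| * ∫ x, W x := by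
    rw [e1, Measure.integral_comp_mul_left V (c * alpha k t * e), smul_eq_mul]
    congr 1
    exact integral_add_left_eq_self W _
  refine h1.trans (h2.le.trans (mul_le_mul_of_nonneg_right ?_ (integral_nonneg fun _ => sq_nonneg _)))
  rw [abs_inv, abs_mul, abs_mul, habs, mul_one, abs_of_pos hc, abs_of_pos (by linarith)]
  exact inv_anti₀ hc (by nlinarith)

/-- Along its characteristics a wave u satisfies α u_t = e(1 + eky) u_y. One integration by parts
against χ removes the derivative, and u_t is controlled in H⁻¹ by u in L². -/
theorem toHneg1_rayDeriv {k c e : ℝ} (hk : 0 < k) (he : e ^ 2 = 1) {w : ℝ → ℝ}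
    (hw : ContDiff ℝ ∞ w) {t : ℝ} (ht : 0 ≤ t) (χ : H10) :
    toHneg1 (bL 1 fun y => rayDeriv k c e w (y, t)) χ =
      (alpha k t)⁻¹ * (-(e * inner ℝ (bL 1 fun y => (1 + e * k * y) * ray k c e w (y, t)) (dy χ))
        - k * inner ℝ (bL 1 fun y => ray k c e w (y, t)) (toL2 χ)) := by
  have hα := (alpha_pos hk ht).ne'
  have hcr := continuous_ray k c e hw.continuous
  let u : ℝ → ℝ := fun y => (1 + e * k * y) * ray k c e w (y, t)
  have hu : ContDiff ℝ 1 u := ContDiff.mul (by fun_prop) (contDiff_ray_space k c e hw t)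
  have hdu : ∀ y, deriv u y = e * alpha k t * rayDeriv k c e w (y, t) + e * k * ray k c e w (y, t) := by
    intro y
    have h0 : HasDerivAt (fun y : ℝ => 1 + e * k * y) (e * k) y := by
      simpa using ((hasDerivAt_id y).const_mul (e * k)).const_add 1
    rw [(h0.fun_mul (hasDerivAt_ray_space hk.ne' c e hw y t)).deriv]
    simp only [rayDeriv]; ring
  have h1 : inner ℝ (bL 1 (deriv u)) (toL2 χ) = - inner ℝ (bL 1 u) (dy χ) :=
    inner_deriv_toL2 hu χ.2
  have e1 : (fun y => rayDeriv k c e w (y, t)) = fun y => (alpha k t)⁻¹ * e * deriv u y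
      + -((alpha k t)⁻¹ * k) * ray k c e w (y, t) := by
    funext y
    rw [hdu]
    have : e * e = 1 := by rw [← pow_two, he]
    field_simp
    linear_combination (-(alpha k t * rayDeriv k c e w (y, t)) - k * ray k c e w (y, t)) * this
  have m1 : MemLp (fun y => ray k c e w (y, t)) 2 (volume.restrict (Ioo (0 : ℝ) 1)) :=
    memLp_Ioo_of_continuous (by fun_prop)
  rw [toHneg1_apply, e1, bL_lin _ (memLp_Ioo_of_continuous (hu.continuous_deriv le_rfl))
    (m1.const_mul _), bL_const_mul _ m1, inner_add_left, real_inner_smul_left,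
    real_inner_smul_left, h1]
  simp only [u]
  ring

theorem exists_rayDeriv_bound {T k c e : ℝ} (hk₀ : 0 < k) (hc : 0 < c) (he : e ^ 2 = 1) :
    ∃ C, 0 ≤ C ∧ ∀ w, IsTest T w → ∀ t, 0 ≤ t →
      ‖toHneg1 (bL 1 fun y => rayDeriv k c e w (y, t))‖ ≤ C * ‖bL T w‖ := by
  obtain ⟨M, hM⟩ := exists_mulSpace (m := fun y => 1 + e * k * y) (by fun_prop)
  have habs : |e| = 1 := by
    have := sq_abs e
    nlinarith [abs_nonneg e]
  refine ⟨(‖M‖ + k) * Real.sqrt c⁻¹, by positivity, fun w hw t ht => ?_⟩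
  have hcr := continuous_ray k c e hw.smooth.continuous
  have hr : ‖bL 1 fun y => ray k c e w (y, t)‖ ≤ Real.sqrt c⁻¹ * ‖bL T w‖ := by
    have := Real.le_sqrt_of_sq_le (norm_bL_ray_sq_le hk₀ hc he hw ht)
    rwa [Real.sqrt_mul (by positivity), Real.sqrt_sq (norm_nonneg _)] at this
  refine ContinuousLinearMap.opNorm_le_bound _ (by positivity) fun χ => ?_
  have hα1 : (alpha k t)⁻¹ ≤ 1 := inv_le_one_of_one_le₀ (one_le_alpha hk₀ ht)
  have hα0 : 0 ≤ (alpha k t)⁻¹ := (inv_pos.2 (alpha_pos hk₀ ht)).le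
  rw [toHneg1_rayDeriv hk₀ he hw.smooth ht, ← inner_bL_mul (by fun_prop) hM (by fun_prop),
    Real.norm_eq_abs, abs_mul, abs_of_nonneg hα0]
  have b1 : |inner ℝ (bL 1 fun y => ray k c e w (y, t)) (M (dy χ))| ≤
      ‖bL 1 fun y => ray k c e w (y, t)‖ * (‖M‖ * ‖χ‖) :=
    (abs_real_inner_le_norm _ _).trans (mul_le_mul_of_nonneg_left ((M.le_opNorm _).trans
      (mul_le_mul_of_nonneg_left (le_max_right _ _) (norm_nonneg M))) (norm_nonneg _))
  have b2 : |inner ℝ (bL 1 fun y => ray k c e w (y, t)) (toL2 χ)| ≤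
      ‖bL 1 fun y => ray k c e w (y, t)‖ * ‖χ‖ :=
    (abs_real_inner_le_norm _ _).trans (mul_le_mul_of_nonneg_left (le_max_left _ _) (norm_nonneg _))
  refine (mul_le_of_le_one_left (abs_nonneg _) hα1).trans ((abs_sub _ _).trans ?_)
  rw [abs_neg, abs_mul, habs, one_mul, abs_mul, abs_of_pos hk₀]
  have := mul_le_mul_of_nonneg_left b2 hk₀.le
  calc _ ≤ ‖bL 1 fun y => ray k c e w (y, t)‖ * ((‖M‖ + k) * ‖χ‖) := by linarith
    _ ≤ Real.sqrt c⁻¹ * ‖bL T w‖ * ((‖M‖ + k) * ‖χ‖) := by gcongr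
    _ = _ := by ring

/-- `H⁻¹(Ω)` with the norm topology. -/
def Hdual : Type := Hneg1

instance : NormedAddCommGroup Hdual := inferInstanceAs (NormedAddCommGroup Hneg1)

instance : NormedSpace ℝ Hdual := inferInstanceAs (NormedSpace ℝ Hneg1)

instance : CompleteSpace Hdual := inferInstanceAs (CompleteSpace Hneg1)

/-- `toHneg1` with values in `Hdual`. -/
def toHdual : L2 →L[ℝ] Hdual := toHneg1L

/-- The data `(v, v')` of a state. -/
def StateData (T : ℝ) : Type := C(Icc (0 : ℝ) T, L2) × C(Icc (0 : ℝ) T, Hdual)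

instance (T : ℝ) : NormedAddCommGroup (StateData T) :=
  inferInstanceAs (NormedAddCommGroup (C(Icc (0 : ℝ) T, L2) × C(Icc (0 : ℝ) T, Hdual)))

instance (T : ℝ) : NormedSpace ℝ (StateData T) :=
  inferInstanceAs (NormedSpace ℝ (C(Icc (0 : ℝ) T, L2) × C(Icc (0 : ℝ) T, Hdual)))

instance (T : ℝ) : CompleteSpace (StateData T) :=
  inferInstanceAs (CompleteSpace (C(Icc (0 : ℝ) T, L2) × C(Icc (0 : ℝ) T, Hdual)))

/-- `x` is the data of the wave with profile `w`. -/
structure IsRayData (T k c e : ℝ) (w : ℝ → ℝ) (x : StateData T) : Prop where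
  state : ∀ t, x.1 t = bL 1 fun y => ray k c e w (y, t)
  time : ∀ t, x.2 t = toHdual (bL 1 fun y => rayDeriv k c e w (y, t))

theorem IsRayData.lin {T k c e : ℝ} {u v : ℝ → ℝ} {x z : StateData T} (hu : ContDiff ℝ ∞ u)
    (hv : ContDiff ℝ ∞ v) (hx : IsRayData T k c e u x) (hz : IsRayData T k c e v z) (s : ℝ) :
    IsRayData T k c e (fun r => s * u r + v r) (s • x + z) := by
  have f1 := continuous_ray k c e hu.continuous
  have f2 := continuous_rayDeriv k c e hu
  have g1 := continuous_ray k c e hv.continuous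
  have g2 := continuous_rayDeriv k c e hv
  have hd : ∀ r, deriv (fun r => s * u r + v r) r = s * deriv u r + deriv v r := fun r =>
    (((hu.differentiable (by simp) r).hasDerivAt.const_mul s).add
      (hv.differentiable (by simp) r).hasDerivAt).deriv
  constructor
  · intro t
    have e : (fun y => ray k c e (fun r => s * u r + v r) (y, (t : ℝ))) =
        fun y => s * ray k c e u (y, t) + ray k c e v (y, t) := rfl
    rw [e, bL_lin s (memLp_Ioo_of_continuous (by fun_prop)) (memLp_Ioo_of_continuous (by fun_prop)),
      ← hx.state, ← hz.state]
    rfl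
  · intro t
    have e : (fun y => rayDeriv k c e (fun r => s * u r + v r) (y, (t : ℝ))) =
        fun y => s * rayDeriv k c e u (y, t) + rayDeriv k c e v (y, t) := by
      funext y; simp only [rayDeriv, hd]; ring
    rw [e, bL_lin s (memLp_Ioo_of_continuous (by fun_prop)) (memLp_Ioo_of_continuous (by fun_prop)),
      map_add, map_smul, ← hx.time, ← hz.time]
    rfl

theorem bL_zero (c : ℝ) : bL c (fun _ => 0) = 0 := bL_eq (Lp.coeFn_zero _ _ _)

theorem isRayData_zero (T k c e : ℝ) : IsRayData T k c e (fun _ => 0) 0 := by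
  constructor
  · intro t
    exact (bL_zero 1).symm
  · intro t
    have e : (fun y => rayDeriv k c e (fun _ => 0) (y, (t : ℝ))) = fun _ => 0 := by
      funext y; simp [rayDeriv]
    rw [e, bL_zero, map_zero]; rfl

/-- The graph of the map from smooth profiles to waves. -/
def rayGraph (T k c e : ℝ) :
    Submodule ℝ (Lp ℝ 2 (volume.restrict (Ioo (0 : ℝ) T)) × StateData T) where
  carrier := {z | ∃ w, IsTest T w ∧ z.1 = bL T w ∧ IsRayData T k c e w z.2}
  zero_mem' := ⟨fun _ => 0, isTest_zero T, (bL_zero T).symm, isRayData_zero T k c e⟩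
  add_mem' := by
    rintro x z ⟨u, hu, hx, dx⟩ ⟨v, hv, hz, dz⟩
    refine ⟨_, hu.lin hv 1, ?_, by simpa using dx.lin hu.smooth hv.smooth dz 1⟩
    rw [bL_lin 1 (memLp_Ioo_of_continuous hu.smooth.continuous)
      (memLp_Ioo_of_continuous hv.smooth.continuous), one_smul, ← hx, ← hz]; rfl
  smul_mem' := by
    rintro s x ⟨u, hu, hx, dx⟩
    refine ⟨_, hu.lin (isTest_zero T) s, ?_, by
      simpa using dx.lin hu.smooth (isTest_zero T).smooth (isRayData_zero T k c e) s⟩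
    rw [bL_lin s (memLp_Ioo_of_continuous hu.smooth.continuous)
      (memLp_Ioo_of_continuous continuous_const), bL_zero, add_zero, ← hx]; rfl

theorem exists_rayData {T k : ℝ} (c e : ℝ) {w : ℝ → ℝ} (hw : IsTest T w) :
    ∃ x, IsRayData T k c e w x := by
  have f1 := continuous_ray k c e hw.smooth.continuous
  have f2 := continuous_rayDeriv k c e hw.smooth
  have c1 : Continuous fun t : Icc (0 : ℝ) T => bL 1 fun y => ray k c e w (y, t) :=
    (continuous_bL (G := fun (t : ℝ) y => ray k c e w (y, t)) (by
      change Continuous fun z : ℝ × ℝ => ray k c e w (z.2, z.1); fun_prop)).comp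
        continuous_subtype_val
  have c2 : Continuous fun t : Icc (0 : ℝ) T => bL 1 fun y => rayDeriv k c e w (y, t) :=
    (continuous_bL (G := fun (t : ℝ) y => rayDeriv k c e w (y, t)) (by
      change Continuous fun z : ℝ × ℝ => rayDeriv k c e w (z.2, z.1); fun_prop)).comp
        continuous_subtype_val
  exact ⟨(⟨_, c1⟩, ⟨_, toHdual.continuous.comp c2⟩), fun _ => rfl, fun _ => rfl⟩

theorem dense_isTest (T : ℝ) :
    Dense {g : Lp ℝ 2 (volume.restrict (Ioo (0 : ℝ) T)) | ∃ w, IsTest T w ∧ g = bL T w} := by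
  let K : Submodule ℝ (Lp ℝ 2 (volume.restrict (Ioo (0 : ℝ) T))) :=
    { carrier := {g | ∃ w, IsTest T w ∧ g = bL T w}
      zero_mem' := ⟨_, isTest_zero T, (bL_zero T).symm⟩
      add_mem' := by
        rintro _ _ ⟨u, hu, rfl⟩ ⟨v, hv, rfl⟩
        refine ⟨_, hu.lin hv 1, ?_⟩
        rw [bL_lin 1 (memLp_Ioo_of_continuous hu.smooth.continuous)
          (memLp_Ioo_of_continuous hv.smooth.continuous), one_smul]
      smul_mem' := by
        rintro s _ ⟨u, hu, rfl⟩
        refine ⟨_, hu.lin (isTest_zero T) s, ?_⟩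
        rw [bL_lin s (memLp_Ioo_of_continuous hu.smooth.continuous)
          (memLp_Ioo_of_continuous continuous_const), bL_zero, add_zero] }
  have : Dense (K : Set (Lp ℝ 2 (volume.restrict (Ioo (0 : ℝ) T)))) := by
    rw [Submodule.dense_iff_topologicalClosure_eq_top, Submodule.topologicalClosure_eq_top_iff,
      Submodule.eq_bot_iff]
    intro F hF
    rw [Submodule.mem_orthogonal] at hF
    have h0 : ∀ᵐ y, y ∈ Ioo (0 : ℝ) T → F y = 0 := by
      refine isOpen_Ioo.ae_eq_zero_of_integral_contDiff_smul_eq_zero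
        (Lp_integrableOn F).locallyIntegrableOn fun g g1 g2 g3 => ?_
      have e2 := hF (bL T g) ⟨g, ⟨g1, g2, g3⟩, rfl⟩
      rw [inner_bL_left (memLp_Ioo_of_continuous g1.continuous)] at e2
      refine Eq.trans ?_ e2
      refine (setIntegral_eq_integral_of_forall_compl_eq_zero fun y hy => ?_).symm
      rw [image_eq_zero_of_notMem_tsupport fun h => hy (g3 h), zero_smul]
    apply Lp.ext
    filter_upwards [(ae_restrict_iff' measurableSet_Ioo).2 h0, Lp.coeFn_zero ℝ 2
      (volume.restrict (Ioo (0 : ℝ) T))] with y h1 h2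
    rw [h1, h2]; rfl
  exact this

theorem exists_rayOp {T k c e : ℝ} (hk : 0 < k) (hc : 0 < c) (he : e ^ 2 = 1) :
    ∃ X : Lp ℝ 2 (volume.restrict (Ioo (0 : ℝ) T)) →L[ℝ] StateData T,
      ∀ w, (w, X w) ∈ (rayGraph T k c e).topologicalClosure := by
  obtain ⟨C, hC0, hC⟩ := exists_rayDeriv_bound (T := T) hk hc he
  refine exists_clm_of_dense (rayGraph T k c e) (max (Real.sqrt c⁻¹) C) ?_ ?_
  · rintro ⟨g, x⟩ ⟨w, hw, hg, hx⟩
    have hr : 0 ≤ max (Real.sqrt c⁻¹) C * ‖g‖ := by positivity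
    have hg' : ‖g‖ = ‖bL T w‖ := by rw [← hg]
    refine max_le ((ContinuousMap.norm_le _ hr).2 fun t => ?_)
      ((ContinuousMap.norm_le _ hr).2 fun t => ?_)
    · rw [hx.state, hg']
      have := Real.le_sqrt_of_sq_le (norm_bL_ray_sq_le hk hc he hw t.2.1)
      rw [Real.sqrt_mul (by positivity), Real.sqrt_sq (norm_nonneg _)] at this
      exact this.trans (mul_le_mul_of_nonneg_right (le_max_left _ _) (norm_nonneg _))
    · rw [hx.time, hg']
      exact LE.le.trans (hC w hw t t.2.1) (mul_le_mul_of_nonneg_right (le_max_right _ _) (norm_nonneg _))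
  · refine (dense_isTest T).mono ?_
    rintro g ⟨w, hw, rfl⟩
    obtain ⟨x, hx⟩ := exists_rayData c e hw
    exact ⟨(bL T w, x), ⟨w, hw, rfl, hx⟩, rfl⟩

/-- The closure of the graph of the map from smooth profiles to waves. -/
def IsRay (T k c e : ℝ) (w : Lp ℝ 2 (volume.restrict (Ioo (0 : ℝ) T))) (x : StateData T) : Prop :=
  (w, x) ∈ (rayGraph T k c e).topologicalClosure

/-- The wave in `StateData`. -/
def wavePart (T : ℝ) : StateData T →L[ℝ] C(Icc (0 : ℝ) T, L2) :=
  ContinuousLinearMap.fst ℝ C(Icc (0 : ℝ) T, L2) C(Icc (0 : ℝ) T, Hdual)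

/-- The time derivative in `StateData`. -/
def waveTimePart (T : ℝ) : StateData T →L[ℝ] C(Icc (0 : ℝ) T, Hdual) :=
  ContinuousLinearMap.snd ℝ C(Icc (0 : ℝ) T, L2) C(Icc (0 : ℝ) T, Hdual)

/-- The projection to `StateData`. -/
def sndState (T : ℝ) :
    Lp ℝ 2 (volume.restrict (Ioo (0 : ℝ) T)) × StateData T →L[ℝ] StateData T :=
  ContinuousLinearMap.snd ℝ _ (StateData T)

/-- The curve `t ↦ v(t)` in `H⁻¹(Ω)`. -/
def toHdualCurve (T : ℝ) : C(Icc (0 : ℝ) T, L2) →L[ℝ] C(Icc (0 : ℝ) T, Hdual) :=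
  toHdual.compLeftContinuous ℝ (Icc (0 : ℝ) T)

/-- The condition on c and e says that at t = 0 the argument of the profile is at most 0, hence
outside the support of every test profile: the wave has not yet entered Ω. -/
theorem IsRay.initial {T k c e : ℝ} (hT : 0 ≤ T) (hk : 0 < k)
    (hce : ∀ y ∈ Ioo (0 : ℝ) 1, c * (1 + e * k * y) ≤ 1)
    {w : Lp ℝ 2 (volume.restrict (Ioo (0 : ℝ) T))} {x : StateData T} (h : IsRay T k c e w x) :
    x.1 ⟨0, le_rfl, hT⟩ = 0 ∧ x.2 ⟨0, le_rfl, hT⟩ = 0 := by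
  have h0 : ∀ y ∈ Ioo (0 : ℝ) 1, (c * (alpha k 0 * (1 + e * k * y)) - 1) / k ∉ Ioo 0 T := by
    intro y hy hm
    have := hce y hy
    have h2 : (c * (alpha k 0 * (1 + e * k * y)) - 1) / k ≤ 0 :=
      div_nonpos_of_nonpos_of_nonneg (by simp [alpha]; linarith) hk.le
    linarith [hm.1]
  constructor
  · refine clm_eq_zero_of_mem_closure (rayGraph T k c e)
      (((ContinuousMap.evalCLM ℝ ⟨0, le_rfl, hT⟩).comp (wavePart T)).comp (sndState T)) ?_ h
    rintro z ⟨u, hu, -, hx⟩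
    refine (hx.state _).trans (Eq.trans ?_ (bL_zero 1))
    exact bL_congr fun y hy => hu.eq_zero (h0 y hy)
  · refine clm_eq_zero_of_mem_closure (rayGraph T k c e)
      (((ContinuousMap.evalCLM ℝ ⟨0, le_rfl, hT⟩).comp (waveTimePart T)).comp (sndState T)) ?_ h
    rintro z ⟨u, hu, -, hx⟩
    refine (hx.time _).trans (Eq.trans ?_ (map_zero toHdual))
    refine congrArg toHdual (Eq.trans ?_ (bL_zero 1))
    exact bL_congr fun y hy => by
      simp only [rayDeriv]
      rw [hu.deriv_eq_zero (h0 y hy), mul_zero]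

theorem IsRayData.integral_time {T k c e : ℝ} (hT : 0 ≤ T) (hk : 0 < k) {w : ℝ → ℝ}
    (hw : IsTest T w) {x : StateData T} (hx : IsRayData T k c e w x) {t : ℝ} (ht : t ∈ Icc 0 T) :
    toHdual (x.1 ⟨t, ht⟩) =
      toHdual (x.1 ⟨0, le_rfl, hT⟩) + ∫ s in (0 : ℝ)..t, IccExtend hT x.2 s := by
  have c1 := continuous_ray k c e hw.smooth.continuous
  have c2 := continuous_rayDeriv k c e hw.smooth
  have d : ∀ s, HasDerivAt (fun s => toHdual (bL 1 fun y => ray k c e w (y, s)))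
      (toHdual (bL 1 fun y => rayDeriv k c e w (y, s))) s := fun s =>
    toHdual.hasFDerivAt.comp_hasDerivAt s
      (hasDerivAt_bL (G := fun s y => ray k c e w (y, s)) (G' := fun s y => rayDeriv k c e w (y, s))
      (by change Continuous fun z : ℝ × ℝ => ray k c e w (z.2, z.1); fun_prop)
      (by change Continuous fun z : ℝ × ℝ => rayDeriv k c e w (z.2, z.1); fun_prop)
      (fun s y => hasDerivAt_ray_time hk.ne' c e hw.smooth y s) s)
  have cont : Continuous fun s => toHdual (bL 1 fun y => rayDeriv k c e w (y, s)) :=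
    toHdual.continuous.comp (continuous_bL (G := fun s y => rayDeriv k c e w (y, s))
      (by change Continuous fun z : ℝ × ℝ => rayDeriv k c e w (z.2, z.1); fun_prop))
  have e1 : ∫ s in (0 : ℝ)..t, IccExtend hT x.2 s =
      ∫ s in (0 : ℝ)..t, toHdual (bL 1 fun y => rayDeriv k c e w (y, s)) := by
    refine intervalIntegral.integral_congr fun s hs => ?_
    rw [uIcc_of_le ht.1] at hs
    rw [IccExtend_of_mem hT _ ⟨hs.1, hs.2.trans ht.2⟩]
    exact hx.time _
  rw [e1, intervalIntegral.integral_eq_sub_of_hasDerivAt (fun s _ => d s) (cont.intervalIntegrable _ _),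
    hx.state, hx.state]
  abel

theorem IsRay.integral_time {T k c e : ℝ} (hT : 0 ≤ T) (hk : 0 < k)
    {w : Lp ℝ 2 (volume.restrict (Ioo (0 : ℝ) T))} {x : StateData T} (h : IsRay T k c e w x)
    {t : ℝ} (ht : t ∈ Icc 0 T) :
    toHdual (x.1 ⟨t, ht⟩) =
      toHdual (x.1 ⟨0, le_rfl, hT⟩) + ∫ s in (0 : ℝ)..t, IccExtend hT x.2 s := by
  obtain ⟨I, hI⟩ := exists_integralCLM (E := Hdual) hT t
  let D : C(Icc (0 : ℝ) T, Hdual) →L[ℝ] Hdual :=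
    ContinuousMap.evalCLM ℝ ⟨t, ht⟩ - ContinuousMap.evalCLM ℝ ⟨0, le_rfl, hT⟩
  have := clm_eq_zero_of_mem_closure (rayGraph T k c e)
    ((D.comp ((toHdualCurve T).comp (wavePart T))
      - I.comp (waveTimePart T)).comp (sndState T)) ?_ h
  · have e : toHdual (x.1 ⟨t, ht⟩) - toHdual (x.1 ⟨0, le_rfl, hT⟩) - I x.2 = 0 := this
    rw [hI] at e
    rw [sub_eq_zero, sub_eq_iff_eq_add] at e
    rw [e, add_comm]
  · rintro z ⟨u, hu, -, hx⟩
    change toHdual (z.2.1 ⟨t, ht⟩) - toHdual (z.2.1 ⟨0, le_rfl, hT⟩) - I z.2.2 = 0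
    rw [hI, hx.integral_time hT hk hu ht]
    abel

/-! ### Transposition for a single wave -/

theorem IsBackward.pd1_eq_zero {k T : ℝ} {Ψ : ℝ × ℝ → ℝ} (hΨ : IsBackward k T Ψ) (a : ℝ) {b : ℝ}
    (hb : alpha k T ≤ b) : pd1 Ψ (a, b) = 0 :=
  (hasDerivAt_fst hΨ.smooth a b).unique ((hasDerivAt_const a (0 : ℝ)).congr_of_eventuallyEq
    (Eventually.of_forall fun x => hΨ.zero_snd (x, b) hb))

theorem IsBackward.pd2_eq_zero {k T : ℝ} {Ψ : ℝ × ℝ → ℝ} (hΨ : IsBackward k T Ψ) {a : ℝ} (b : ℝ)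
    (ha : (1 + k) * alpha k T ≤ a) : pd2 Ψ (a, b) = 0 :=
  (hasDerivAt_snd hΨ.smooth a b).unique ((hasDerivAt_const b (0 : ℝ)).congr_of_eventuallyEq
    (Eventually.of_forall fun x => hΨ.zero_fst (a, x) ha))

/-- The integral of `Ψ_ab` along a horizontal line. -/
theorem IsBackward.integral_fst {k T : ℝ} (hk₀ : 0 < k) (hk₁ : k < 1) {Ψ : ℝ × ℝ → ℝ}
    (hΨ : IsBackward k T Ψ) {a b : ℝ} (hab : a ≤ b) :
    ∫ x, pd2 (pd1 Ψ) (x, b) = -pd2 Ψ (a, b) := by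
  have hc : Continuous fun a => pd2 (pd1 Ψ) (a, b) :=
    (contDiff_pd2 (contDiff_pd1 hΨ.smooth)).continuous.comp (by fun_prop)
  -- To the right of A the potential vanishes, and to the left of a ≤ b its mixed derivative does,
  -- so the integral over [a, A] is the integral over the whole line.
  set A := max a ((1 + k) * alpha k T)
  have e : ∫ x in a..A, pd2 (pd1 Ψ) (x, b) = -pd2 Ψ (a, b) := by
    rw [intervalIntegral.integral_eq_sub_of_hasDerivAt (f := fun x => pd2 Ψ (x, b))
      (fun x _ => by rw [← pd1_pd2_comm hΨ.smooth]; exact hasDerivAt_fst (contDiff_pd2 hΨ.smooth) x b)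
      (hc.intervalIntegrable _ _), hΨ.pd2_eq_zero _ (le_max_right _ _), zero_sub]
  rw [← e, intervalIntegral.integral_of_le (le_max_left _ _)]
  refine (setIntegral_eq_integral_of_forall_compl_eq_zero fun x hx => hΨ.support _ fun h => hx ?_).symm
  refine ⟨?_, (charRegion_subset hk₀ hk₁ h).1.2.le.trans (le_max_right _ _)⟩
  by_contra! hle
  exact notMem_charRegion_of_wedge hk₁ (Or.inl (show x ≤ b from hle.trans hab)) h

/-- The integral of `Ψ_ab` along a vertical line. -/
theorem IsBackward.integral_snd {k T : ℝ} (hk₀ : 0 < k) (hk₁ : k < 1) {Ψ : ℝ × ℝ → ℝ}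
    (hΨ : IsBackward k T Ψ) {a b : ℝ} (hab : ratio k * b ≤ a) :
    ∫ x, pd2 (pd1 Ψ) (a, x) = -pd1 Ψ (a, b) := by
  have hc : Continuous fun b => pd2 (pd1 Ψ) (a, b) :=
    (contDiff_pd2 (contDiff_pd1 hΨ.smooth)).continuous.comp (by fun_prop)
  set B := max b (alpha k T)
  have e : ∫ x in b..B, pd2 (pd1 Ψ) (a, x) = -pd1 Ψ (a, b) := by
    rw [intervalIntegral.integral_eq_sub_of_hasDerivAt
      (fun x _ => hasDerivAt_snd (contDiff_pd1 hΨ.smooth) a x) (hc.intervalIntegrable _ _),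
      hΨ.pd1_eq_zero _ (le_max_right _ _), zero_sub]
  rw [← e, intervalIntegral.integral_of_le (le_max_left _ _)]
  refine (setIntegral_eq_integral_of_forall_compl_eq_zero fun x hx => hΨ.support _ fun h => hx ?_).symm
  refine ⟨?_, (charRegion_subset hk₀ hk₁ h).2.2.le.trans (le_max_right _ _)⟩
  by_contra! hle
  refine notMem_charRegion_of_wedge hk₁ (Or.inr (show ratio k * x ≤ a from le_trans ?_ hab)) h
  exact mul_le_mul_of_nonneg_left hle (ratio_pos hk₀ hk₁).le

/-- Ψ_a is minus the integral of Ψ_ab over the upward half-line from (a, b), which for a ≤ b stays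
outside the wedge. -/
theorem IsBackward.pd1_wedge {k T : ℝ} {Ψ : ℝ × ℝ → ℝ} (hk₁ : k < 1)
    (hΨ : IsBackward k T Ψ) {a b : ℝ} (hab : a ≤ b) : pd1 Ψ (a, b) = 0 := by
  have hc : Continuous fun b => pd2 (pd1 Ψ) (a, b) :=
    (contDiff_pd2 (contDiff_pd1 hΨ.smooth)).continuous.comp (by fun_prop)
  have e : ∫ x in b..max b (alpha k T), pd2 (pd1 Ψ) (a, x) = -pd1 Ψ (a, b) := by
    rw [intervalIntegral.integral_eq_sub_of_hasDerivAt
      (fun x _ => hasDerivAt_snd (contDiff_pd1 hΨ.smooth) a x) (hc.intervalIntegrable _ _),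
      hΨ.pd1_eq_zero _ (le_max_right _ _), zero_sub]
  have e0 : ∫ x in b..max b (alpha k T), pd2 (pd1 Ψ) (a, x) = 0 := by
    rw [intervalIntegral.integral_of_le (le_max_left _ _)]
    refine setIntegral_eq_zero_of_forall_eq_zero fun x hx => hΨ.support _ ?_
    exact notMem_charRegion_of_wedge hk₁ (Or.inl (show a ≤ x from hab.trans hx.1.le))
  linarith

/-- The same with the half-line to the right of (a, b), which stays in a ≥ r b. -/
theorem IsBackward.pd2_wedge {k T : ℝ} {Ψ : ℝ × ℝ → ℝ} (hk₁ : k < 1)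
    (hΨ : IsBackward k T Ψ) {a b : ℝ} (hab : ratio k * b ≤ a) : pd2 Ψ (a, b) = 0 := by
  have hc : Continuous fun a => pd2 (pd1 Ψ) (a, b) :=
    (contDiff_pd2 (contDiff_pd1 hΨ.smooth)).continuous.comp (by fun_prop)
  have e : ∫ x in a..max a ((1 + k) * alpha k T), pd2 (pd1 Ψ) (x, b) = -pd2 Ψ (a, b) := by
    rw [intervalIntegral.integral_eq_sub_of_hasDerivAt (f := fun x => pd2 Ψ (x, b))
      (fun x _ => by rw [← pd1_pd2_comm hΨ.smooth]; exact hasDerivAt_fst (contDiff_pd2 hΨ.smooth) x b)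
      (hc.intervalIntegrable _ _), hΨ.pd2_eq_zero _ (le_max_right _ _), zero_sub]
  have e0 : ∫ x in a..max a ((1 + k) * alpha k T), pd2 (pd1 Ψ) (x, b) = 0 := by
    rw [intervalIntegral.integral_of_le (le_max_left _ _)]
    refine setIntegral_eq_zero_of_forall_eq_zero fun x hx => hΨ.support _ ?_
    exact notMem_charRegion_of_wedge hk₁ (Or.inr (show ratio k * b ≤ x from hab.trans hx.1.le))
  linarith

theorem IsBackward.integrable_mul {k T : ℝ} (hk₀ : 0 < k) (hk₁ : k < 1) {Ψ : ℝ × ℝ → ℝ}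
    (hΨ : IsBackward k T Ψ) {u : ℝ × ℝ → ℝ} (hu : Continuous u) :
    Integrable fun z => u z * pd2 (pd1 Ψ) z := by
  have hc := hu.mul (contDiff_pd2 (contDiff_pd1 hΨ.smooth)).continuous
  refine hc.integrable_of_hasCompactSupport (HasCompactSupport.intro (K :=
    Icc 0 ((1 + k) * alpha k T) ×ˢ Icc 0 (alpha k T)) (isCompact_Icc.prod isCompact_Icc) ?_)
  intro z hz
  have : pd2 (pd1 Ψ) z = 0 := hΨ.support z fun h => hz
    (Set.prod_mono Ioo_subset_Icc_self Ioo_subset_Icc_self (charRegion_subset hk₀ hk₁ h))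
  rw [Pi.mul_apply, this, mul_zero]

theorem IsBackward.integral_mul_source {k T : ℝ} (hk₀ : 0 < k) {Ψ : ℝ × ℝ → ℝ}
    (hΨ : IsBackward k T Ψ) (u : ℝ × ℝ → ℝ) :
    ∫ z in Ioo (0 : ℝ) 1 ×ˢ Ioo (0 : ℝ) T, u (char k z) * source k Ψ z =
      2 * ∫ z, u z * pd2 (pd1 Ψ) z := by
  have h1 : ∫ z, u z * pd2 (pd1 Ψ) z = ∫ z in charRegion k T, u z * pd2 (pd1 Ψ) z :=
    (setIntegral_eq_integral_of_forall_compl_eq_zero fun z hz => by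
      rw [hΨ.support z hz, mul_zero]).symm
  rw [h1, integral_charRegion hk₀, ← integral_const_mul]
  refine integral_congr_ae (ae_of_all _ fun z => ?_)
  simp only [source]; ring

/-- The profile `w` as a function of `α_k(t)`. -/
def profile (k : ℝ) (w : ℝ → ℝ) (s : ℝ) : ℝ := w ((s - 1) / k)

theorem profile_eq_zero {k T : ℝ} (hk₀ : 0 < k) {w : ℝ → ℝ} (hw : IsTest T w) {s : ℝ} (hs : s ≤ 1) :
    profile k w s = 0 :=
  hw.eq_zero fun h => by
    have := div_nonpos_of_nonpos_of_nonneg (sub_nonpos.2 hs) hk₀.le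
    linarith [h.1]

/-- A ray with e = -1 depends on cb only, so Fubini integrates Ψ_ab over full horizontal lines. That
integral is -Ψ_b at any point with a ≤ b; the point (c²b, b), which is (cs, s/c) for s = cb, is
taken so as to match the terms of `pd1_img`. -/
theorem integral_ray_neg {k T c : ℝ} (hk₀ : 0 < k) (hk₁ : k < 1) (hc : 0 < c) (hc1 : c ≤ 1)
    {Ψ : ℝ × ℝ → ℝ} (hΨ : IsBackward k T Ψ) {w : ℝ → ℝ} (hw : IsTest T w) :
    ∫ z in Ioo (0 : ℝ) 1 ×ˢ Ioo (0 : ℝ) T, ray k c (-1) w z * source k Ψ z =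
      2 * ∫ s, profile k w s * (-(c⁻¹ * pd2 Ψ (c * s, c⁻¹ * s))) := by
  have hw0 : Continuous w := hw.smooth.continuous
  have hu : Continuous fun z : ℝ × ℝ => profile k w (c * z.2) := by unfold profile; fun_prop
  have e1 : ∀ z, ray k c (-1) w z = (fun z : ℝ × ℝ => profile k w (c * z.2)) (char k z) := fun z => by
    simp only [ray, profile, char]; congr 3; ring
  have hi := hΨ.integrable_mul hk₀ hk₁ hu
  simp only [e1]
  rw [hΨ.integral_mul_source hk₀ fun z => profile k w (c * z.2), Measure.volume_eq_prod,
    integral_prod_symm _ (by rwa [← Measure.volume_eq_prod])]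
  congr 1
  have e2 : ∀ b, ∫ a, profile k w (c * b) * pd2 (pd1 Ψ) (a, b) =
      (fun s => profile k w s * -pd2 Ψ (c * s, c⁻¹ * s)) (c * b) := fun b => by
    rw [integral_const_mul]
    simp only
    -- For b ≤ 0 the profile vanishes, and c²b ≤ b would be unavailable.
    rcases le_total b 0 with h | h
    · rw [profile_eq_zero hk₀ hw (by nlinarith), zero_mul, zero_mul]
    · rw [hΨ.integral_fst hk₀ hk₁ (a := c * (c * b)) (by nlinarith [mul_nonneg hc.le h]),
        inv_mul_cancel_left₀ hc.ne']
  simp only [e2]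
  rw [Measure.integral_comp_mul_left (fun s => profile k w s * -pd2 Ψ (c * s, c⁻¹ * s)), smul_eq_mul,
    abs_of_pos (inv_pos.2 hc), ← integral_const_mul]
  refine integral_congr_ae (ae_of_all _ fun s => ?_)
  simp only; ring

/-- The mirror image with vertical lines: the ray depends on ca only, and rc ≤ 1 places the point
(a, c²a) in the region a ≥ r b. -/
theorem integral_ray_pos {k T c : ℝ} (hk₀ : 0 < k) (hk₁ : k < 1) (hc : 0 < c) (hc1 : ratio k * c ≤ 1)
    {Ψ : ℝ × ℝ → ℝ} (hΨ : IsBackward k T Ψ) {w : ℝ → ℝ} (hw : IsTest T w) :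
    ∫ z in Ioo (0 : ℝ) 1 ×ˢ Ioo (0 : ℝ) T, ray k c 1 w z * source k Ψ z =
      2 * ∫ s, profile k w s * (-(c⁻¹ * pd1 Ψ (c⁻¹ * s, c * s))) := by
  have hr := one_lt_ratio hk₀ hk₁
  have hc1' : c ≤ 1 := by nlinarith
  have hw0 : Continuous w := hw.smooth.continuous
  have hu : Continuous fun z : ℝ × ℝ => profile k w (c * z.1) := by unfold profile; fun_prop
  have e1 : ∀ z, ray k c 1 w z = (fun z : ℝ × ℝ => profile k w (c * z.1)) (char k z) := fun z => by
    simp only [ray, profile, char]; congr 3; ring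
  have hi := hΨ.integrable_mul hk₀ hk₁ hu
  simp only [e1]
  rw [hΨ.integral_mul_source hk₀ fun z => profile k w (c * z.1), Measure.volume_eq_prod,
    integral_prod _ (by rwa [← Measure.volume_eq_prod])]
  congr 1
  have e2 : ∀ a, ∫ b, profile k w (c * a) * pd2 (pd1 Ψ) (a, b) =
      (fun s => profile k w s * -pd1 Ψ (c⁻¹ * s, c * s)) (c * a) := fun a => by
    rw [integral_const_mul]
    simp only
    rcases le_total a 0 with h | h
    · rw [profile_eq_zero hk₀ hw (by nlinarith), zero_mul, zero_mul]
    · rw [hΨ.integral_snd hk₀ hk₁ (b := c * (c * a)) (by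
        have h1 : 0 ≤ c * a := mul_nonneg hc.le h
        calc ratio k * (c * (c * a)) = (ratio k * c) * (c * a) := by ring
          _ ≤ 1 * (c * a) := mul_le_mul_of_nonneg_right hc1 h1
          _ ≤ a := by nlinarith), inv_mul_cancel_left₀ hc.ne']
  simp only [e2]
  rw [Measure.integral_comp_mul_left (fun s => profile k w s * -pd1 Ψ (c⁻¹ * s, c * s)), smul_eq_mul,
    abs_of_pos (inv_pos.2 hc), ← integral_const_mul]
  refine integral_congr_ae (ae_of_all _ fun s => ?_)
  simp only; ring

/-- The substitution s = α(t), ds = k dt. -/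
theorem integral_profile {k T : ℝ} (hk : 0 < k) {w : ℝ → ℝ} (hw : IsTest T w) (G : ℝ → ℝ) :
    ∫ s, profile k w s * G s = k * ∫ t in Ioo 0 T, w t * G (alpha k t) := by
  have h1 : ∫ t in Ioo 0 T, w t * G (alpha k t) = ∫ t, w t * G (alpha k t) :=
    setIntegral_eq_integral_of_forall_compl_eq_zero fun t ht => by rw [hw.eq_zero ht, zero_mul]
  let h : ℝ → ℝ := fun u => profile k w (1 + u) * G (1 + u)
  have h2 : (fun t => w t * G (alpha k t)) = fun t => h (k * t) := by
    funext t
    simp only [h, profile, alpha, add_sub_cancel_left, mul_div_cancel_left₀ t hk.ne']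
  rw [h1, h2, Measure.integral_comp_mul_left h, smul_eq_mul, abs_of_pos (inv_pos.2 hk),
    mul_inv_cancel_left₀ hk.ne']
  exact (integral_add_left_eq_self (fun s => profile k w s * G s) 1).symm

theorem IsRayData.inner_source {T k c e : ℝ} (hT : 0 ≤ T) (hk : 0 < k) {w : ℝ → ℝ}
    (hw : IsTest T w) {x : StateData T} (hx : IsRayData T k c e w x) {Ψ : ℝ × ℝ → ℝ}
    (hΨ : ContDiff ℝ ∞ Ψ) {G : ℝ → ℝ}
    (hG : ∫ z in Ioo (0 : ℝ) 1 ×ˢ Ioo (0 : ℝ) T, ray k c e w z * source k Ψ z =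
      2 * ∫ s, profile k w s * G s) {V : LQ T} (hV : IsRep T (IccExtend hT x.1) V) :
    inner ℝ V ((memLp_Q_of_continuous (continuous_source k hΨ) T).toLp _) =
      ∫ t in Ioo 0 T, (2 * k * G (alpha k t)) * w t := by
  have cr := continuous_ray k c e hw.smooth.continuous
  rw [← hV.integral_mul (memLp_Q_of_continuous (continuous_source k hΨ) T)]
  have e1 : ∫ t in Ioo 0 T, ∫ y in Ioo (0 : ℝ) 1, (IccExtend hT x.1 t) y * source k Ψ (y, t) =
      ∫ t in Ioo 0 T, ∫ y in Ioo (0 : ℝ) 1, ray k c e w (y, t) * source k Ψ (y, t) := by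
    refine setIntegral_congr_fun measurableSet_Ioo fun t ht => ?_
    refine integral_congr_ae ?_
    rw [IccExtend_of_mem hT _ (Ioo_subset_Icc_self ht), hx.state]
    filter_upwards [bL_coe (c := 1) (u := fun y => ray k c e w (y, t))
      (memLp_Ioo_of_continuous (by fun_prop))] with y hy
    rw [hy]
  rw [e1, integral_Q_eq (g := fun z => ray k c e w z * source k Ψ z)
    (integrableOn_Q_of_continuous (cr.mul (continuous_source k hΨ)) T), hG, integral_profile hk hw,
    ← integral_const_mul, ← integral_const_mul]
  exact integral_congr_ae (ae_of_all _ fun t => by simp only; ring)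

theorem IsRay.inner_source {T k c e : ℝ} (hT : 0 ≤ T) (hk : 0 < k)
    {w : Lp ℝ 2 (volume.restrict (Ioo (0 : ℝ) T))} {x : StateData T} (h : IsRay T k c e w x)
    {Ψ : ℝ × ℝ → ℝ} (hΨ : ContDiff ℝ ∞ Ψ) {G : ℝ → ℝ} (hGc : Continuous G)
    (hG : ∀ w, IsTest T w → ∫ z in Ioo (0 : ℝ) 1 ×ˢ Ioo (0 : ℝ) T, ray k c e w z * source k Ψ z =
      2 * ∫ s, profile k w s * G s) {ι : C(Icc (0 : ℝ) T, L2) →L[ℝ] LQ T}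
    (hι : ∀ f : C(Icc (0 : ℝ) T, L2), IsRep T (IccExtend hT f) (ι f)) :
    inner ℝ ((memLp_Q_of_continuous (continuous_source k hΨ) T).toLp _) (ι x.1) =
      inner ℝ (bL T fun t => 2 * k * G (alpha k t)) w := by
  let f : LQ T := (memLp_Q_of_continuous (continuous_source k hΨ) T).toLp _
  let l : Lp ℝ 2 (volume.restrict (Ioo (0 : ℝ) T)) × StateData T →L[ℝ] ℝ :=
    ((innerSL ℝ f).comp (ι.comp (wavePart T))).comp (sndState T)
      - (innerSL ℝ (bL T fun t => 2 * k * G (alpha k t))).comp (ContinuousLinearMap.fst ℝ _ _)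
  have hz : l (w, x) = 0 := by
    refine clm_eq_zero_of_mem_closure (rayGraph T k c e) l ?_ h
    rintro ⟨v, z⟩ ⟨u, hu, hv, hx⟩
    have hc : Continuous fun t => 2 * k * G (alpha k t) := by unfold alpha; fun_prop
    have e1 := hx.inner_source hT hk hu hΨ (hG u hu) (hι z.1)
    have e2 : inner ℝ (bL T fun t => 2 * k * G (alpha k t)) (bL T u) =
        ∫ t in Ioo 0 T, (2 * k * G (alpha k t)) * u t := by
      rw [inner_bL_left (memLp_Ioo_of_continuous hc)]
      refine integral_congr_ae ?_
      filter_upwards [bL_coe (c := T) (memLp_Ioo_of_continuous hu.smooth.continuous)] with t ht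
      rw [ht]
    change inner ℝ f (ι z.1) - inner ℝ (bL T fun t => 2 * k * G (alpha k t)) v = 0
    rw [real_inner_comm, e1, show v = bL T u from hv, e2, sub_self]
  exact sub_eq_zero.1 hz

/-! ### The family of reflected waves and the sum of its weights -/

/-- The dilation factor of the `n`-th reflected wave. -/
def rayScale (k : ℝ) (n : ℤ) : ℝ := if n ≤ 0 then ratio k ^ n else ratio k ^ (-n)

/-- The direction of the `n`-th reflected wave. -/
def raySign (n : ℤ) : ℝ := if n ≤ 0 then -1 else 1

/-- The density that represents the pairing of the `n`-th reflected wave with a source. -/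
def rayWeight (k : ℝ) (Ψ : ℝ × ℝ → ℝ) (n : ℤ) (s : ℝ) : ℝ :=
  if n ≤ 0 then -(ratio k ^ (-n) * pd2 Ψ (ratio k ^ n * s, ratio k ^ (-n) * s))
  else -(ratio k ^ n * pd1 Ψ (ratio k ^ n * s, ratio k ^ (-n) * s))

theorem rayScale_pos {k : ℝ} (hk₀ : 0 < k) (hk₁ : k < 1) (n : ℤ) : 0 < rayScale k n := by
  have := ratio_pos hk₀ hk₁
  unfold rayScale; split_ifs <;> positivity

theorem raySign_sq (n : ℤ) : raySign n ^ 2 = 1 := by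
  unfold raySign; split_ifs <;> norm_num

theorem continuous_rayWeight (k : ℝ) {Ψ : ℝ × ℝ → ℝ} (hΨ : ContDiff ℝ ∞ Ψ) (n : ℤ) :
    Continuous (rayWeight k Ψ n) := by
  have c1 := (contDiff_pd1 hΨ).continuous
  have c2 := (contDiff_pd2 hΨ).continuous
  unfold rayWeight
  split_ifs <;> fun_prop

theorem rayScale_le {k : ℝ} (hk₀ : 0 < k) (hk₁ : k < 1) {n : ℤ} (hn : n ≤ 0) :
    rayScale k n ≤ 1 := by
  rw [rayScale, if_pos hn]
  exact zpow_le_one_of_nonpos₀ (one_lt_ratio hk₀ hk₁).le hn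

theorem ratio_mul_rayScale_le {k : ℝ} (hk₀ : 0 < k) (hk₁ : k < 1) {n : ℤ} (hn : ¬ n ≤ 0) :
    ratio k * rayScale k n ≤ 1 := by
  rw [rayScale, if_neg hn]
  rcases zpow_trichotomy (one_lt_ratio hk₀ hk₁) n with h | ⟨-, -, h⟩ | ⟨h, -⟩
  · omega
  · linarith
  · omega

/-- This is the condition of `IsRay.initial`. For n ≤ 0 both factors are at most 1; for n > 0 the
scale is at most 1/r, and (1 + k)/r = 1 - k. -/
theorem rayScale_mul_le {k : ℝ} (hk₀ : 0 < k) (hk₁ : k < 1) (n : ℤ) {y : ℝ} (hy : y ∈ Ioo (0 : ℝ) 1) :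
    rayScale k n * (1 + raySign n * k * y) ≤ 1 := by
  have hc := rayScale_pos hk₀ hk₁ n
  have hky := mul_pos hk₀ hy.1
  by_cases hn : n ≤ 0
  · have := rayScale_le hk₀ hk₁ hn
    rw [raySign, if_pos hn]
    nlinarith
  · have h := ratio_mul_rayScale_le hk₀ hk₁ hn
    have h2 := ratio_mul hk₁
    rw [raySign, if_neg hn]
    have h3 : k * y ≤ k := by nlinarith [hy.2]
    calc rayScale k n * (1 + 1 * k * y) ≤ rayScale k n * (1 + k) :=
          mul_le_mul_of_nonneg_left (by linarith) hc.le
      _ = (1 - k) * (ratio k * rayScale k n) := by rw [← h2]; ring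
      _ ≤ (1 - k) * 1 := mul_le_mul_of_nonneg_left h (by linarith)
      _ ≤ 1 := by linarith

theorem integral_ray {k T : ℝ} (hk₀ : 0 < k) (hk₁ : k < 1) (n : ℤ) {Ψ : ℝ × ℝ → ℝ}
    (hΨ : IsBackward k T Ψ) {w : ℝ → ℝ} (hw : IsTest T w) :
    ∫ z in Ioo (0 : ℝ) 1 ×ˢ Ioo (0 : ℝ) T, ray k (rayScale k n) (raySign n) w z * source k Ψ z =
      2 * ∫ s, profile k w s * rayWeight k Ψ n s := by
  by_cases hn : n ≤ 0
  · have := integral_ray_neg hk₀ hk₁ (rayScale_pos hk₀ hk₁ n) (rayScale_le hk₀ hk₁ hn) hΨ hw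
    simp only [raySign, rayWeight, if_pos hn]
    rw [this]
    simp only [rayScale, if_pos hn, zpow_neg]
  · have := integral_ray_pos hk₀ hk₁ (rayScale_pos hk₀ hk₁ n) (ratio_mul_rayScale_le hk₀ hk₁ hn) hΨ hw
    simp only [raySign, rayWeight, if_neg hn]
    rw [this]
    simp only [rayScale, if_neg hn, zpow_neg, inv_inv]

/-- On the diagonal the n-th term of `pd1_img` involves Ψ_a and Ψ_b at the same point (rⁿs, r⁻ⁿs).
For n ≤ 0 this point has a ≤ b, where Ψ_a vanishes; for n > 0 it has a ≥ r b, where Ψ_b vanishes.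
The survivor is the weight of the n-th wave. -/
theorem sum_rayWeight {k T : ℝ} (hk₀ : 0 < k) (hk₁ : k < 1) (N : ℕ) {Ψ : ℝ × ℝ → ℝ}
    (hΨ : IsBackward k T Ψ) {s : ℝ} (hs : 0 ≤ s) :
    ∑ n ∈ Finset.Icc (-(N : ℤ)) N, -raySign n * rayWeight k Ψ n s = pd1 (img k N Ψ) (s, s) := by
  have hr := one_lt_ratio hk₀ hk₁
  have hr0 := ratio_pos hk₀ hk₁
  rw [pd1_img k N hΨ.smooth]
  refine Finset.sum_congr rfl fun n _ => ?_
  by_cases hn : n ≤ 0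
  · have h1 : ratio k ^ n * s ≤ ratio k ^ (-n) * s :=
      mul_le_mul_of_nonneg_right (zpow_le_zpow_right₀ hr.le (by omega)) hs
    rw [hΨ.pd1_wedge hk₁ h1]
    simp only [raySign, rayWeight, if_pos hn]
    ring
  · have h1 : ratio k * (ratio k ^ (-n) * s) ≤ ratio k ^ n * s := by
      rw [← mul_assoc]
      refine mul_le_mul_of_nonneg_right ?_ hs
      rw [← zpow_one_add₀ hr0.ne']
      exact zpow_le_zpow_right₀ hr.le (by omega)
    rw [hΨ.pd2_wedge hk₁ h1]
    simp only [raySign, rayWeight, if_neg hn]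
    ring

/-- At y = 0 the antisymmetry of the image sum makes its two derivatives opposite, which doubles the
trace. -/
theorem quot_zero (k : ℝ) (N : ℕ) {Ψ : ℝ × ℝ → ℝ} (hΨ : ContDiff ℝ ∞ Ψ) (t : ℝ) :
    quot k N Ψ 0 t = 2 * k * alpha k t ^ 2 * pd1 (img k N Ψ) (alpha k t, alpha k t) := by
  simp only [quot, zero_mul]
  rw [intervalIntegral.integral_const, sub_zero, one_smul, pd1_adj k N hΨ]
  simp only [char, mul_zero, add_zero, sub_zero, mul_one]
  rw [pd2_img k N hΨ]
  ring

/-! ### The state equation -/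

/-- The superposition of the reflected waves. -/
theorem exists_stateOp {T k : ℝ} (hT : 0 ≤ T) (hk₀ : 0 < k) (hk₁ : k < 1) (N : ℕ) :
    ∃ V : Lp ℝ 2 (volume.restrict (Ioo (0 : ℝ) T)) →L[ℝ] StateData T,
      (∀ l : StateData T →L[ℝ] Hdual, (∀ n w x, IsRay T k (rayScale k n) (raySign n) w x → l x = 0) →
        ∀ w, l (V w) = 0) ∧
      (∀ l : StateData T →L[ℝ] L2, (∀ n w x, IsRay T k (rayScale k n) (raySign n) w x → l x = 0) →
        ∀ w, l (V w) = 0) ∧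
      ∀ (ι : C(Icc (0 : ℝ) T, L2) →L[ℝ] LQ T),
        (∀ f : C(Icc (0 : ℝ) T, L2), IsRep T (IccExtend hT f) (ι f)) →
        ∀ w Ψ (hΨ : IsBackward k T Ψ),
          inner ℝ ((memLp_Q_of_continuous (continuous_source k hΨ.smooth) T).toLp _) (ι (V w).1) =
            inner ℝ (bL T fun t => 2 * k * pd1 (img k N Ψ) (alpha k t, alpha k t)) w := by
  have hX := fun n : ℤ => exists_rayOp (T := T) hk₀ (rayScale_pos hk₀ hk₁ n) (raySign_sq n)
  choose X hX using hX
  have sumE : ∀ w, (∑ n ∈ Finset.Icc (-(N : ℤ)) N, (-raySign n) • X n) w =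
      ∑ n ∈ Finset.Icc (-(N : ℤ)) N, (-raySign n) • X n w := fun w => by
    rw [sum_apply]; rfl
  -- With these signs the waves n and -n cancel at y = 0 for n ≠ 0 and leave w, while at y = 1 the
  -- wave n > 0 cancels the wave 1 - n. The first two clauses let the sum inherit every closed
  -- linear property of single waves.
  refine ⟨∑ n ∈ Finset.Icc (-(N : ℤ)) N, (-raySign n) • X n, fun l hl w => ?_, fun l hl w => ?_,
    fun ι hι w Ψ hΨ => ?_⟩
  · rw [sumE, map_sum]
    exact Finset.sum_eq_zero fun n _ => by rw [map_smul, hl n w _ (hX n w), smul_zero]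
  · rw [sumE, map_sum]
    exact Finset.sum_eq_zero fun n _ => by rw [map_smul, hl n w _ (hX n w), smul_zero]
  · let f : LQ T := (memLp_Q_of_continuous (continuous_source k hΨ.smooth) T).toLp _
    let l : StateData T →L[ℝ] ℝ := (innerSL ℝ f).comp (ι.comp (wavePart T))
    have hα : Continuous (alpha k) := (contDiff_alpha k).continuous
    have hw : ∀ n, Continuous fun t => 2 * k * rayWeight k Ψ n (alpha k t) := fun n => by
      have := continuous_rayWeight k hΨ.smooth n
      fun_prop
    have hp := (contDiff_pd1 (contDiff_img k N hΨ.smooth)).continuous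
    have e1 : ∀ n, l (X n w) = ∫ t in Ioo 0 T, (2 * k * rayWeight k Ψ n (alpha k t)) * w t :=
      fun n => by
      rw [← inner_bL_left (memLp_Ioo_of_continuous (hw n))]
      have hr : IsRay T k (rayScale k n) (raySign n) w (X n w) := hX n w
      exact hr.inner_source hT hk₀ hΨ.smooth (continuous_rayWeight k hΨ.smooth n)
        (fun u hu => integral_ray hk₀ hk₁ n hΨ hu) hι
    change l _ = _
    rw [sumE, map_sum, inner_bL_left (memLp_Ioo_of_continuous (by fun_prop))]
    simp only [map_smul, e1, smul_eq_mul]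
    simp only [← integral_const_mul]
    rw [← integral_finsetSum]
    · refine setIntegral_congr_fun measurableSet_Ioo fun t ht => ?_
      have ha := one_le_alpha hk₀ ht.1.le
      rw [← sum_rayWeight hk₀ hk₁ N hΨ (by linarith), Finset.mul_sum, Finset.sum_mul]
      exact Finset.sum_congr rfl fun n _ => by ring
    · intro n _
      refine Integrable.const_mul ?_ _
      exact MemLp.integrable_mul (memLp_Ioo_of_continuous (hw n)) (Lp.memLp w)

/-- The state operator has the properties of a solution by transposition. -/
theorem exists_isState {T k : ℝ} (hT : 0 < T) (hk₀ : 0 < k) (hk₁ : k < 1) :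
    ∃ V : Lp ℝ 2 (volume.restrict (Ioo (0 : ℝ) T)) →L[ℝ] C(Icc (0 : ℝ) T, L2),
      ∀ (w : Lp ℝ 2 (volume.restrict (Ioo (0 : ℝ) T))) (u : ℝ → ℝ),
        w =ᵐ[volume.restrict (Ioo 0 T)] u → IsState T k u (IccExtend hT.le (V w)) := by
  obtain ⟨N, hN⟩ := exists_pow_ratio hk₀ hk₁ T
  obtain ⟨V, hV1, hV2, hV3⟩ := exists_stateOp hT.le hk₀ hk₁ N
  obtain ⟨A, hA⟩ := exists_adjOp hT.le hk₀ hk₁ hN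
  obtain ⟨ι, hι⟩ := exists_iota hT.le
  obtain ⟨M, hM⟩ : ∃ M : Lp ℝ 2 (volume.restrict (Ioo (0 : ℝ) T)) →L[ℝ]
      Lp ℝ 2 (volume.restrict (Ioo (0 : ℝ) T)),
      ∀ F, M F =ᵐ[volume.restrict (Ioo (0 : ℝ) T)] fun t => (1 / alpha k t ^ 2) * F t := by
    have hm : Measurable fun t => 1 / alpha k t ^ 2 := by unfold alpha; fun_prop
    refine exists_mulLp hm.aestronglyMeasurable (C := 1) ?_
    filter_upwards [ae_restrict_mem measurableSet_Ioo] with t ht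
    have := one_le_alpha hk₀ ht.1.le
    rw [Real.norm_eq_abs, abs_of_nonneg (by positivity), div_le_one (by positivity)]
    exact one_le_pow₀ this
  -- the transposition identity on the level of classes
  have key : ∀ w f x, IsAdjLimit T k N f x →
      inner ℝ (ι (V w).1) f = inner ℝ w (M (x.2.2 ⟨0, by simp⟩)) := by
    intro w f x hx
    let l : LQ T × AdjData T →L[ℝ] ℝ :=
      (innerSL ℝ (ι (V w).1)).comp (ContinuousLinearMap.fst ℝ _ _) -
      (innerSL ℝ w).comp (M.comp ((ContinuousMap.evalCLM ℝ ⟨0, by simp⟩).comp (quotPart T)))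
    have hz : l (f, x) = 0 := by
      refine clm_eq_zero_of_mem_closure (adjGraph T k N) l ?_ hx
      rintro ⟨g, z⟩ ⟨Ψ, hΨ, hg, hz⟩
      have e1 : g = (memLp_Q_of_continuous (continuous_source k hΨ.smooth) T).toLp _ :=
        Lp.ext (hg.trans (MemLp.coeFn_toLp _).symm)
      -- By `quot_zero` the weight α⁻² turns the trace into the density 2k q_a, q the image sum,
      -- that `exists_stateOp` produces.
      have e2 : M (z.2.2 ⟨0, by simp⟩) = bL T fun t => 2 * k * pd1 (img k N Ψ) (alpha k t, alpha k t) := by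
        refine (bL_eq ?_).symm
        have hq : Continuous (quot k N Ψ 0) :=
          (continuous_quot k N hΨ.smooth).comp (Continuous.prodMk_right 0)
        rw [hz.quotient]
        refine (hM _).trans ?_
        filter_upwards [bL_coe (c := T) (memLp_Ioo_of_continuous hq),
          ae_restrict_mem measurableSet_Ioo] with t h1 ht
        have := alpha_pos hk₀ ht.1.le
        rw [h1, quot_zero k N hΨ.smooth]
        field_simp
      change inner ℝ (ι (V w).1) g - inner ℝ w (M (z.2.2 ⟨0, by simp⟩)) = 0
      rw [e2, e1, real_inner_comm, hV3 ι hι w Ψ hΨ, real_inner_comm, sub_self]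
    exact sub_eq_zero.1 hz
  refine ⟨(wavePart T).comp V, fun w u hu => ⟨((V w).1.continuous.Icc_extend').continuousOn, ?_, ?_, ?_⟩⟩
  · rw [IccExtend_of_mem hT.le _ ⟨le_rfl, hT.le⟩]
    exact hV2 ((ContinuousMap.evalCLM ℝ (⟨0, le_rfl, hT.le⟩ : Icc (0 : ℝ) T)).comp (wavePart T)) (fun n w x h =>
      (h.initial hT.le hk₀ fun y hy => rayScale_mul_le hk₀ hk₁ n hy).1) w
  · let v' : ℝ → Hdual := IccExtend hT.le (V w).2
    refine ⟨v', ((V w).2.continuous.Icc_extend').continuousOn, ?_, fun t ht => ?_⟩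
    · refine (IccExtend_of_mem hT.le _ ⟨le_rfl, hT.le⟩).trans ?_
      exact hV1 ((ContinuousMap.evalCLM ℝ (⟨0, le_rfl, hT.le⟩ : Icc (0 : ℝ) T)).comp (waveTimePart T)) (fun n w x h =>
        (h.initial hT.le hk₀ fun y hy => rayScale_mul_le hk₀ hk₁ n hy).2) w
    · refine hasDerivWithinAt_of_eq_integral (E := Hdual) hT.le
        (F := fun s => toHdual (IccExtend hT.le (V w).1 s))
        (e := toHdual ((V w).1 ⟨0, le_rfl, hT.le⟩)) (fun t ht => ?_) ht
      obtain ⟨I, hI⟩ := exists_integralCLM (E := Hdual) hT.le t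
      let D : C(Icc (0 : ℝ) T, Hdual) →L[ℝ] Hdual :=
        ContinuousMap.evalCLM ℝ ⟨t, ht⟩ - ContinuousMap.evalCLM ℝ ⟨0, le_rfl, hT.le⟩
      have := hV1 (D.comp ((toHdualCurve T).comp (wavePart T)) - I.comp (waveTimePart T))
        (fun n w x h => ?_) w
      · have e : toHdual ((V w).1 ⟨t, ht⟩) - toHdual ((V w).1 ⟨0, le_rfl, hT.le⟩) - I (V w).2 = 0 := this
        rw [hI, sub_eq_zero, sub_eq_iff_eq_add] at e
        rw [IccExtend_of_mem hT.le _ ht, e, add_comm]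
      · change toHdual (x.1 ⟨t, ht⟩) - toHdual (x.1 ⟨0, le_rfl, hT.le⟩) - I x.2 = 0
        rw [hI, h.integral_time hT.le hk₀ ht]
        abel
  · intro f hf θ g hθ hg
    have hl : IsAdjLimit T k N (hf.toLp _) (A (hf.toLp _)) := hA _
    have h1 := hl.trace_eq hT hk₀ hk₁ hf.coeFn_toLp hθ hg
    refine ((hι (V w).1).integral_mul hf).trans ?_
    refine (key w _ _ hl).trans ?_
    rw [L2.inner_def]
    refine integral_congr_ae ?_
    filter_upwards [h1, hu, hM ((A (hf.toLp _)).2.2 ⟨0, by simp⟩)] with t e1 e2 e3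
    rw [e3, e2, e1, real_inner_comm]
    simp only [RCLike.inner_apply, conj_trivial]
    ring

/-! ### Extension by zero, changes on null sets, solvability of the adjoint problem and uniqueness
of the state -/

theorem inner_Lp_eq_integral {X : Type*} [MeasurableSpace X] {μ : Measure X} (f g : Lp ℝ 2 μ) :
    inner ℝ f g = ∫ x, f x * g x ∂μ := by
  rw [L2.inner_def]
  refine integral_congr_ae (ae_of_all _ fun x => ?_)
  simp only [RCLike.inner_apply, conj_trivial]
  ring

theorem norm_sq_Lp_eq_integral {X : Type*} [MeasurableSpace X] {μ : Measure X} (f : Lp ℝ 2 μ) :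
    ‖f‖ ^ 2 = ∫ x, f x ^ 2 ∂μ := by
  rw [← real_inner_self_eq_norm_sq, inner_Lp_eq_integral]
  simp only [pow_two]

/-- Extension by zero. -/
theorem exists_extend {T : ℝ} {S : Set ℝ} (hS : MeasurableSet S) (hST : S ⊆ Ioo 0 T) :
    ∃ E : Lp ℝ 2 (volume.restrict S) →L[ℝ] Lp ℝ 2 (volume.restrict (Ioo (0 : ℝ) T)),
      ∀ w, E w =ᵐ[volume.restrict (Ioo 0 T)] S.indicator w := by
  have hr : (volume.restrict (Ioo (0 : ℝ) T)).restrict S = volume.restrict S := by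
    rw [Measure.restrict_restrict hS, inter_eq_left.2 hST]
  have hm : ∀ w : Lp ℝ 2 (volume.restrict S),
      MemLp (S.indicator w) 2 (volume.restrict (Ioo (0 : ℝ) T)) := fun w => by
    rw [memLp_indicator_iff_restrict hS, hr]; exact Lp.memLp w
  have hae : ∀ {f g : ℝ → ℝ}, f =ᵐ[volume.restrict S] g →
      S.indicator f =ᵐ[volume.restrict (Ioo 0 T)] S.indicator g := fun h => by
    rw [← hr] at h
    filter_upwards [(ae_restrict_iff' hS).1 h] with x hx
    by_cases hxS : x ∈ S
    · rw [indicator_of_mem hxS, indicator_of_mem hxS, hx hxS]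
    · rw [indicator_of_notMem hxS, indicator_of_notMem hxS]
  let L : Lp ℝ 2 (volume.restrict S) →ₗ[ℝ] Lp ℝ 2 (volume.restrict (Ioo (0 : ℝ) T)) :=
    { toFun := fun w => (hm w).toLp _
      map_add' := fun u v => by
        rw [← MemLp.toLp_add, MemLp.toLp_eq_toLp_iff]
        rw [← indicator_add']
        exact hae (Lp.coeFn_add u v)
      map_smul' := fun c u => by
        rw [RingHom.id_apply, ← MemLp.toLp_const_smul, MemLp.toLp_eq_toLp_iff]
        have : c • S.indicator u = S.indicator (c • (u : ℝ → ℝ)) :=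
          (indicator_const_smul S c (u : ℝ → ℝ)).symm
        rw [this]
        exact hae (Lp.coeFn_smul c u) }
  refine ⟨L.mkContinuous 1 fun w => ?_, fun w => (hm w).coeFn_toLp⟩
  rw [one_mul]
  change ‖(hm w).toLp _‖ ≤ ‖w‖
  rw [Lp.norm_toLp, eLpNorm_indicator_eq_eLpNorm_restrict hS, hr, Lp.norm_def]

theorem IsAdjointSolution.congr_source {T k : ℝ} {F G : ℝ → ℝ → ℝ} {p : ℝ → H10}
    (h : IsAdjointSolution T k F p)
    (hFG : ∀ᵐ t ∂volume.restrict (Ioo 0 T), ∀ᵐ y ∂volume.restrict (Ioo (0 : ℝ) 1), F y t = G y t) :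
    IsAdjointSolution T k G p := by
  refine ⟨h.continuousOn, h.final, h.final_deriv, fun φ h1 h2 h3 => (h.equation φ h1 h2 h3).trans ?_⟩
  refine integral_congr_ae ?_
  filter_upwards [hFG] with t ht
  refine integral_congr_ae ?_
  filter_upwards [ht] with y hy
  rw [hy]

theorem IsState.congr {T k : ℝ} {u u' : ℝ → ℝ} {v : ℝ → L2} (h : IsState T k u v)
    (hu : u =ᵐ[volume.restrict (Ioo 0 T)] u') : IsState T k u' v := by
  refine ⟨h.continuousOn, h.initial, h.initial_deriv, fun f hf θ g hθ hg =>
    (h.transposition f hf θ g hθ hg).trans (integral_congr_ae ?_)⟩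
  filter_upwards [hu] with t ht
  rw [ht]

theorem exists_adjointSolution {T k : ℝ} (hT : 0 < T) (hk₀ : 0 < k) (hk₁ : k < 1) {F : ℝ → ℝ → ℝ}
    (hF : MemLp (Function.uncurry F) 2 (volume.restrict (Ioo (0 : ℝ) 1 ×ˢ Ioo (0 : ℝ) T))) :
    ∃ p g, IsAdjointSolution T k F p ∧ HasDyTrace T p g := by
  obtain ⟨N, hN⟩ := exists_pow_ratio hk₀ hk₁ T
  obtain ⟨A, hA⟩ := exists_adjOp hT.le hk₀ hk₁ hN
  have hl : IsAdjLimit T k N (hF.toLp _) (A (hF.toLp _)) := hA _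
  exact ⟨_, _, hl.isAdjointSolution hT.le hk₀ hk₁ hF.coeFn_toLp, hl.hasDyTrace hT.le⟩

/-- The transposition identity determines the pairing of the state with every f for which the
adjoint problem has a solution with a trace, and this is all of L²(Q). Continuity in t gives
equality at each time. -/
theorem IsState.unique {T k : ℝ} (hT : 0 < T) (hk₀ : 0 < k) (hk₁ : k < 1) {u : ℝ → ℝ}
    {v₁ v₂ : ℝ → L2} (h₁ : IsState T k u v₁) (h₂ : IsState T k u v₂) : EqOn v₁ v₂ (Icc 0 T) := by
  obtain ⟨ι, hι⟩ := exists_iota hT.le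
  let D₁ : C(Icc (0 : ℝ) T, L2) := ⟨(Icc (0 : ℝ) T).domRestrict v₁, h₁.continuousOn.domRestrict⟩
  let D₂ : C(Icc (0 : ℝ) T, L2) := ⟨(Icc (0 : ℝ) T).domRestrict v₂, h₂.continuousOn.domRestrict⟩
  have r : ∀ (v : ℝ → L2) (D : C(Icc (0 : ℝ) T, L2)), (∀ t : Icc (0 : ℝ) T, D t = v t) →
      ∀ f : LQ T, inner ℝ (ι D) f = ∫ t in Ioo 0 T, ∫ y in Ioo (0 : ℝ) 1, v t y * f (y, t) := by
    intro v D hD f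
    rw [(hι D).inner_eq]
    refine setIntegral_congr_fun measurableSet_Ioo fun t ht => ?_
    simp only [IccExtend_of_mem hT.le _ (Ioo_subset_Icc_self ht), hD]
  have e : ι D₁ = ι D₂ := by
    refine ext_inner_right ℝ fun f => ?_
    have hf : MemLp (Function.uncurry fun y t => f (y, t)) 2
        (volume.restrict (Ioo (0 : ℝ) 1 ×ˢ Ioo (0 : ℝ) T)) := Lp.memLp f
    obtain ⟨p, g, hp, hg⟩ := exists_adjointSolution hT hk₀ hk₁ hf
    rw [r v₁ D₁ (fun _ => rfl), r v₂ D₂ (fun _ => rfl), h₁.transposition _ hf p g hp hg,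
      h₂.transposition _ hf p g hp hg]
  have h0 : ∫ t in Ioo 0 T, ‖IccExtend hT.le (D₁ - D₂) t‖ ^ 2 = 0 := by
    rw [← (hι (D₁ - D₂)).norm_sq, map_sub, e, sub_self, norm_zero]; norm_num
  have hc : Continuous (IccExtend hT.le (D₁ - D₂)) := (D₁ - D₂).continuous.Icc_extend'
  have hae : IccExtend hT.le (D₁ - D₂) =ᵐ[volume.restrict (Ioo 0 T)] fun _ => 0 := by
    rw [integral_eq_zero_iff_of_nonneg (fun t => sq_nonneg _)
      ((hc.norm.pow 2).continuousOn.integrableOn_Icc.mono_set Ioo_subset_Icc_self)] at h0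
    filter_upwards [h0] with t ht
    simpa using ht
  have hE := Measure.eqOn_Icc_of_ae_eq volume hT.ne
    (hae.filter_mono (by rw [← restrict_Ioo_eq_restrict_Icc])) hc.continuousOn continuousOn_const
  intro t ht
  have := hE ht
  rw [IccExtend_of_mem hT.le _ ht] at this
  exact sub_eq_zero.1 this

/-! ### The optimality system -/

theorem IsState.inner_rep {T k : ℝ} {u : ℝ → ℝ} {v : ℝ → L2} (h : IsState T k u v) {X : LQ T}
    (hX : IsRep T v X) {Y : LQ T} {p : ℝ → H10} {g : ℝ → ℝ}
    (hp : IsAdjointSolution T k (fun y t => Y (y, t)) p) (hg : HasDyTrace T p g) :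
    inner ℝ X Y = ∫ t in Ioo 0 T, 1 / alpha k t ^ 2 * g t * u t :=
  (hX.inner_eq Y).trans (h.transposition (fun y t => Y (y, t)) (Lp.memLp Y) p g hp hg)

theorem IsRep.source_eq {T k : ℝ} {v : ℝ → L2} {X : LQ T} (hX : IsRep T v X) {v₂ : ℝ → ℝ → ℝ}
    (hv₂ : MemLp (Function.uncurry v₂) 2 (volume.restrict (Ioo (0 : ℝ) 1 ×ˢ Ioo (0 : ℝ) T)))
    {M : LQ T →L[ℝ] LQ T}
    (hM : ∀ F, M F =ᵐ[volume.restrict (Ioo (0 : ℝ) 1 ×ˢ Ioo (0 : ℝ) T)] fun z => alpha k z.2 * F z) :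
    ∀ᵐ t ∂volume.restrict (Ioo 0 T), ∀ᵐ y ∂volume.restrict (Ioo (0 : ℝ) 1),
      alpha k t * (v t y - v₂ y t) = M (X - hv₂.toLp _) (y, t) := by
  have h1 : ∀ᵐ z ∂(volume.restrict (Ioo (0 : ℝ) 1 ×ˢ Ioo (0 : ℝ) T)),
      M (X - hv₂.toLp _) z = alpha k z.2 * (X z - v₂ z.1 z.2) := by
    filter_upwards [hM (X - hv₂.toLp _), Lp.coeFn_sub X (hv₂.toLp _), hv₂.coeFn_toLp] with z e1 e2 e3
    rw [e1, e2, Pi.sub_apply, e3]; rfl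
  filter_upwards [ae_ae_of_ae_Q h1, hX] with t e1 e2
  filter_upwards [e1, e2] with y f1 f2
  rw [f1, f2]

/-- Multiplication by √α absorbs the weight and turns the tracking term into the square of a Hilbert
norm. -/
theorem IsRep.integral_cost {T k : ℝ} (hk : 0 < k) {v : ℝ → L2} {X : LQ T} (hX : IsRep T v X)
    {v₂ : ℝ → ℝ → ℝ}
    (hv₂ : MemLp (Function.uncurry v₂) 2 (volume.restrict (Ioo (0 : ℝ) 1 ×ˢ Ioo (0 : ℝ) T)))
    {P : LQ T →L[ℝ] LQ T}
    (hP : ∀ F, P F =ᵐ[volume.restrict (Ioo (0 : ℝ) 1 ×ˢ Ioo (0 : ℝ) T)]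
      fun z => Real.sqrt (alpha k z.2) * F z) :
    ∫ t in Ioo 0 T, ∫ y in Ioo (0 : ℝ) 1, alpha k t * (v t y - v₂ y t) ^ 2 =
      ‖P (X - hv₂.toLp _)‖ ^ 2 := by
  rw [norm_sq_Lp_eq_integral, ← integral_Q_eq (g := fun z => P (X - hv₂.toLp _) z ^ 2)
    (Lp.memLp (P (X - hv₂.toLp _))).integrable_sq]
  have h1 : ∀ᵐ z ∂(volume.restrict (Ioo (0 : ℝ) 1 ×ˢ Ioo (0 : ℝ) T)),
      P (X - hv₂.toLp _) z = Real.sqrt (alpha k z.2) * (X z - v₂ z.1 z.2) := by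
    filter_upwards [hP (X - hv₂.toLp _), Lp.coeFn_sub X (hv₂.toLp _), hv₂.coeFn_toLp] with z e1 e2 e3
    rw [e1, e2, Pi.sub_apply, e3]; rfl
  refine integral_congr_ae ?_
  filter_upwards [ae_ae_of_ae_Q h1, hX, ae_restrict_mem measurableSet_Ioo] with t e1 e2 ht
  refine integral_congr_ae ?_
  filter_upwards [e1, e2] with y f1 f2
  rw [f1, f2, mul_pow, Real.sq_sqrt (alpha_pos hk ht.1.le).le]

/-- Moves both factors √α to one side, where they form the source α(v - v₂) of the adjoint problem.
-/
theorem inner_sqrt_mul {T k : ℝ} (hk : 0 < k) {P M : LQ T →L[ℝ] LQ T}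
    (hP : ∀ F, P F =ᵐ[volume.restrict (Ioo (0 : ℝ) 1 ×ˢ Ioo (0 : ℝ) T)]
      fun z => Real.sqrt (alpha k z.2) * F z)
    (hM : ∀ F, M F =ᵐ[volume.restrict (Ioo (0 : ℝ) 1 ×ˢ Ioo (0 : ℝ) T)] fun z => alpha k z.2 * F z)
    (X Y : LQ T) : inner ℝ (P X) (P Y) = inner ℝ Y (M X) := by
  rw [inner_Lp_eq_integral, inner_Lp_eq_integral]
  refine integral_congr_ae ?_
  filter_upwards [hP X, hP Y, hM X,
    ae_restrict_mem (measurableSet_Ioo.prod measurableSet_Ioo)] with z e1 e2 e3 hz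
  rw [e1, e2, e3]
  have := Real.mul_self_sqrt (alpha_pos hk hz.2.1.le).le
  linear_combination (X z * Y z) * this

theorem memLp_follower {T k σ : ℝ} (hk : 0 < k) {S : Set ℝ} (hST : S ⊆ Ioo 0 T)
    {g : ℝ → ℝ} (hg : MemLp g 2 (volume.restrict (Ioo 0 T))) (hσ : 0 < σ) :
    MemLp (followerOfTrace k σ g) 2 (volume.restrict S) := by
  have hgS : MemLp g 2 (volume.restrict S) := hg.mono_measure (Measure.restrict_mono hST le_rfl)
  have hm : Measurable fun t => 1 / (σ * alpha k t ^ 2) := by unfold alpha; fun_prop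
  have h2 : ∀ᵐ t ∂volume.restrict S, ‖followerOfTrace k σ g t‖ ≤ σ⁻¹ * ‖g t‖ := by
    refine ae_mono (Measure.restrict_mono hST le_rfl) ?_
    filter_upwards [ae_restrict_mem measurableSet_Ioo] with t ht
    have := one_le_alpha hk ht.1.le
    rw [followerOfTrace, norm_mul, norm_neg]
    refine mul_le_mul_of_nonneg_right ?_ (norm_nonneg _)
    rw [Real.norm_eq_abs, abs_of_nonneg (by positivity), one_div]
    exact inv_anti₀ hσ (le_mul_of_one_le_right hσ.le (one_le_pow₀ this))
  exact MemLp.of_le_mul hgS (hm.aestronglyMeasurable.mul hgS.1.neg) h2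

/-- The Euler-Lagrange equation expresses the follower by the trace of the adjoint state. -/
theorem critical_iff {T k σ : ℝ} (hk : 0 < k) (hσ : 0 < σ) {S : Set ℝ}
    (hST : S ⊆ Ioo 0 T) {g : ℝ → ℝ} (hg : MemLp g 2 (volume.restrict (Ioo 0 T)))
    (w : Lp ℝ 2 (volume.restrict S)) :
    (∀ d : Lp ℝ 2 (volume.restrict S),
      (∫ t in S, 1 / alpha k t ^ 2 * g t * d t) + σ * inner ℝ w d = 0) ↔
      w =ᵐ[volume.restrict S] followerOfTrace k σ g := by
  have hf := memLp_follower hk hST hg hσ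
  have hpos : ∀ᵐ t ∂volume.restrict S, 0 < alpha k t := by
    refine ae_mono (Measure.restrict_mono hST le_rfl) ?_
    filter_upwards [ae_restrict_mem measurableSet_Ioo] with t ht using alpha_pos hk ht.1.le
  have e : ∀ d : Lp ℝ 2 (volume.restrict S), ∫ t in S, 1 / alpha k t ^ 2 * g t * d t =
      -(σ * inner ℝ (hf.toLp _) d) := fun d => by
    rw [inner_Lp_eq_integral, ← integral_const_mul, ← integral_neg]
    refine integral_congr_ae ?_
    filter_upwards [hf.coeFn_toLp, hpos] with t h1 h2
    rw [h1, followerOfTrace]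
    field_simp
  simp only [e]
  constructor
  · intro h
    have : w = hf.toLp _ := ext_inner_right ℝ fun d => by
      have := h d
      have h3 : σ * (inner ℝ w d - inner ℝ (hf.toLp _) d) = 0 := by linarith
      exact sub_eq_zero.1 ((mul_eq_zero.1 h3).resolve_left hσ.ne')
    rw [this]; exact hf.coeFn_toLp
  · intro h d
    have : w = hf.toLp _ := Lp.ext (h.trans hf.coeFn_toLp.symm)
    rw [this]; ring

theorem setIntegral_extend {T : ℝ} {S : Set ℝ} (hS : MeasurableSet S) (hST : S ⊆ Ioo 0 T)
    (h d : ℝ → ℝ) : ∫ t in Ioo 0 T, h t * S.indicator d t = ∫ t in S, h t * d t := by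
  have : (fun t => h t * S.indicator d t) = S.indicator fun t => h t * d t := by
    funext t; by_cases ht : t ∈ S <;> simp [ht]
  rw [this, setIntegral_indicator hS, inter_eq_right.2 hST]

theorem boundaryDatum_ae {T : ℝ} {S₁ S₂ : Set ℝ} (hS₂ : MeasurableSet S₂) (hS₂T : S₂ ⊆ Ioo 0 T)
    (w₁ : ℝ → ℝ) {f g : ℝ → ℝ} (h : f =ᵐ[volume.restrict S₂] g) :
    boundaryDatum S₁ S₂ w₁ f =ᵐ[volume.restrict (Ioo 0 T)] boundaryDatum S₁ S₂ w₁ g := by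
  rw [← inter_eq_left.2 hS₂T, ← Measure.restrict_restrict hS₂] at h
  filter_upwards [(ae_restrict_iff' hS₂).1 h] with t ht
  by_cases hm : t ∈ S₂
  · simp only [boundaryDatum, indicator_of_mem hm, ht hm]
  · simp only [boundaryDatum, indicator_of_notMem hm]

end WaveCylinder

end

/-! ### The main theorem -/

theorem mainTheorem1 (T k σ : ℝ) (hT : 0 < T) (hk₀ : 0 < k) (hk₁ : k < 1) (hσ : 0 < σ)
    (S₁ S₂ : Set ℝ) (hS₁ : MeasurableSet S₁) (hS₂ : MeasurableSet S₂)
    (hS : S₁ ∪ S₂ = Ioo 0 T)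
    (v₂ : ℝ → ℝ → ℝ)
    (hv₂ : MemLp (Function.uncurry v₂) 2 (volume.restrict (Ioo 0 1 ×ˢ Ioo 0 T))) :
    -- the state equation is well posed, so that `J₂` is well defined
    (∀ (w₁ : Lp ℝ 2 (volume.restrict S₁)) (w₂ : Lp ℝ 2 (volume.restrict S₂)),
      ∃ v, WaveCylinder.IsState T k (WaveCylinder.boundaryDatum S₁ S₂ w₁ w₂) v ∧
        ∀ v', WaveCylinder.IsState T k (WaveCylinder.boundaryDatum S₁ S₂ w₁ w₂) v' →
          EqOn v' v (Icc 0 T)) ∧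
    -- for each leader there is a unique Nash equilibrium, given by the optimality system
    ∀ w₁ : Lp ℝ 2 (volume.restrict S₁),
      ∃ w₂ : Lp ℝ 2 (volume.restrict S₂),
        WaveCylinder.IsNashEquilibrium T k σ S₁ S₂ v₂ w₁ w₂ ∧
        (∀ w₂', WaveCylinder.IsNashEquilibrium T k σ S₁ S₂ v₂ w₁ w₂' → w₂' = w₂) ∧
        ∃ v p g,
          WaveCylinder.IsOptimalitySolution T k σ S₁ S₂ v₂ w₁ v p g ∧
          (∀ v' p' g', WaveCylinder.IsOptimalitySolution T k σ S₁ S₂ v₂ w₁ v' p' g' →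
            EqOn v' v (Icc 0 T) ∧ EqOn p' p (Icc 0 T)) ∧
          w₂ =ᵐ[volume.restrict S₂] WaveCylinder.followerOfTrace k σ g := by
  have hS₁T : S₁ ⊆ Ioo 0 T := hS ▸ subset_union_left
  have hS₂T : S₂ ⊆ Ioo 0 T := hS ▸ subset_union_right
  obtain ⟨V, hV⟩ := WaveCylinder.exists_isState hT hk₀ hk₁
  obtain ⟨ι, hι⟩ := WaveCylinder.exists_iota hT.le
  obtain ⟨E₁, hE₁⟩ := WaveCylinder.exists_extend hS₁ hS₁T
  obtain ⟨E₂, hE₂⟩ := WaveCylinder.exists_extend hS₂ hS₂T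
  have hst : ∀ (w₁ : Lp ℝ 2 (volume.restrict S₁)) (w₂ : Lp ℝ 2 (volume.restrict S₂)),
      WaveCylinder.IsState T k (WaveCylinder.boundaryDatum S₁ S₂ w₁ w₂)
        (IccExtend hT.le (V (E₁ w₁ + E₂ w₂))) := fun w₁ w₂ => by
    refine hV _ _ ?_
    filter_upwards [Lp.coeFn_add (E₁ w₁) (E₂ w₂), hE₁ w₁, hE₂ w₂] with t e1 e2 e3
    rw [e1, Pi.add_apply, e2, e3, WaveCylinder.boundaryDatum]
  refine ⟨fun w₁ w₂ => ⟨_, hst w₁ w₂, fun v' h => h.unique hT hk₀ hk₁ (hst w₁ w₂)⟩, fun w₁ => ?_⟩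
  have hα : Continuous (WaveCylinder.alpha k) := (WaveCylinder.contDiff_alpha k).continuous
  obtain ⟨P, hP⟩ := WaveCylinder.exists_mulTime T (ρ := fun t => Real.sqrt (WaveCylinder.alpha k t))
    (by fun_prop)
  obtain ⟨M, hM⟩ := WaveCylinder.exists_mulTime T hα
  -- B is the linear response to the follower and c the response to the leader minus the target,
  -- both carrying the weight √α.
  let B : Lp ℝ 2 (volume.restrict S₂) →L[ℝ] WaveCylinder.LQ T := P.comp (ι.comp (V.comp E₂))
  let c : WaveCylinder.LQ T := P (ι (V (E₁ w₁)) - hv₂.toLp _)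
  have hB : ∀ w₂, B w₂ + c = P (ι (V (E₁ w₁ + E₂ w₂)) - hv₂.toLp _) := fun w₂ => by
    change P (ι (V (E₂ w₂))) + P (ι (V (E₁ w₁)) - hv₂.toLp _) = _
    rw [← map_add, map_add V, map_add ι]
    congr 1; abel
  have hcost : ∀ w₂, WaveCylinder.costJ₂ T k σ S₁ S₂ v₂ w₁ w₂ =
      1 / 2 * ‖B w₂ + c‖ ^ 2 + σ / 2 * ‖w₂‖ ^ 2 := fun w₂ => by
    -- The solution in `costJ₂` is an arbitrary choice; uniqueness identifies it on [0,T] with the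
    -- one given by V.
    have h1 : WaveCylinder.IsState T k (WaveCylinder.boundaryDatum S₁ S₂ w₁ w₂)
        (WaveCylinder.state T k (WaveCylinder.boundaryDatum S₁ S₂ w₁ w₂)) :=
      Classical.epsilon_spec (p := WaveCylinder.IsState T k (WaveCylinder.boundaryDatum S₁ S₂ w₁ w₂))
        ⟨_, hst w₁ w₂⟩
    have h2 := ((hι (V (E₁ w₁ + E₂ w₂))).congr fun t ht =>
      (hst w₁ w₂).unique hT hk₀ hk₁ h1 (Ioo_subset_Icc_self ht)).integral_cost hk₀ hv₂ hP
    rw [WaveCylinder.costJ₂, h2, hB, WaveCylinder.norm_sq_Lp_eq_integral w₂]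
  -- the adjoint state attached to a follower characterizes criticality
  have hcrit : ∀ (w₂ : Lp ℝ 2 (volume.restrict S₂)) (v : ℝ → WaveCylinder.L2)
      (p : ℝ → WaveCylinder.H10) (g : ℝ → ℝ),
      WaveCylinder.IsRep T v (ι (V (E₁ w₁ + E₂ w₂))) →
      WaveCylinder.IsAdjointSolution T k
        (fun y t => WaveCylinder.alpha k t * (v t y - v₂ y t)) p →
      WaveCylinder.HasDyTrace T p g →
      ((∀ d, inner ℝ (B w₂ + c) (B d) + σ * inner ℝ w₂ d = 0) ↔
        w₂ =ᵐ[volume.restrict S₂] WaveCylinder.followerOfTrace k σ g) := fun w₂ v p g hv hp hg => by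
    rw [← WaveCylinder.critical_iff hk₀ hσ hS₂T hg.1]
    refine forall_congr' fun d => ?_
    -- Transposition for the state with datum d on Σ₂, tested with the source α(v - v₂), turns the
    -- derivative of the tracking term into an integral over Σ₂ of the trace of p.
    have e : inner ℝ (B w₂ + c) (B d) = ∫ t in S₂, 1 / WaveCylinder.alpha k t ^ 2 * g t * d t := by
      rw [hB]
      refine (WaveCylinder.inner_sqrt_mul hk₀ hP hM _ (ι (V (E₂ d)))).trans ?_
      rw [(hV (E₂ d) _ (hE₂ d)).inner_rep (hι _) (hp.congr_source (hv.source_eq hv₂ hM)) hg]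
      exact WaveCylinder.setIntegral_extend hS₂ hS₂T _ _
    rw [e]
  obtain ⟨w₂, hw₂⟩ := WaveCylinder.exists_tikhonov_critical B c hσ
  have hexp := WaveCylinder.tikhonov_expand B c hw₂
  have hpos : ∀ u : Lp ℝ 2 (volume.restrict S₂),
      0 ≤ 1 / 2 * ‖B (u - w₂)‖ ^ 2 + σ / 2 * ‖u - w₂‖ ^ 2 := fun u => by positivity
  have hle : ∀ u, WaveCylinder.costJ₂ T k σ S₁ S₂ v₂ w₁ w₂ ≤ WaveCylinder.costJ₂ T k σ S₁ S₂ v₂ w₁ u :=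
    fun u => by
      rw [hcost, hcost, hexp u]
      linarith [hpos u]
  have hinf : WaveCylinder.costJ₂ T k σ S₁ S₂ v₂ w₁ w₂ = ⨅ u, WaveCylinder.costJ₂ T k σ S₁ S₂ v₂ w₁ u :=
    le_antisymm (le_ciInf hle) (ciInf_le ⟨_, by rintro _ ⟨u, rfl⟩; exact hle u⟩ w₂)
  have huniq : ∀ u, 1 / 2 * ‖B u + c‖ ^ 2 + σ / 2 * ‖u‖ ^ 2 ≤
      1 / 2 * ‖B w₂ + c‖ ^ 2 + σ / 2 * ‖w₂‖ ^ 2 → u = w₂ := fun u hu => by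
    rw [hexp u] at hu
    have h1 : 0 ≤ 1 / 2 * ‖B (u - w₂)‖ ^ 2 := by positivity
    have h2 : σ / 2 * ‖u - w₂‖ ^ 2 ≤ 0 := by linarith
    have h3 : ‖u - w₂‖ ^ 2 ≤ 0 := nonpos_of_mul_nonpos_right h2 (by positivity)
    have h4 : ‖u - w₂‖ = 0 := by
      have := le_antisymm h3 (sq_nonneg _)
      exact pow_eq_zero_iff (two_ne_zero) |>.1 this
    exact sub_eq_zero.1 (norm_eq_zero.1 h4)
  -- the adjoint state of the equilibrium
  let X := ι (V (E₁ w₁ + E₂ w₂))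
  obtain ⟨p, g, hp', hg⟩ := WaveCylinder.exists_adjointSolution hT hk₀ hk₁
    (F := fun y t => M (X - hv₂.toLp _) (y, t)) (Lp.memLp (M (X - hv₂.toLp _)))
  have hrep : WaveCylinder.IsRep T (IccExtend hT.le (V (E₁ w₁ + E₂ w₂))) X := hι _
  have hp := hp'.congr_source (G := fun y t => WaveCylinder.alpha k t *
    (IccExtend hT.le (V (E₁ w₁ + E₂ w₂)) t y - v₂ y t)) (by
      filter_upwards [hrep.source_eq hv₂ hM] with t ht
      filter_upwards [ht] with y hy using hy.symm)
  have hfol := (hcrit w₂ _ p g hrep hp hg).1 hw₂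
  refine ⟨w₂, hinf, fun u hu => huniq u ?_, IccExtend hT.le (V (E₁ w₁ + E₂ w₂)), p, g,
    ⟨hp, hg, (hst w₁ w₂).congr (WaveCylinder.boundaryDatum_ae hS₂ hS₂T _ hfol)⟩, ?_, hfol⟩
  · rw [← hcost, ← hcost, hinf]
    exact le_of_eq hu
  · intro v' p' g' h
    -- The follower read off from a solution of the optimality system is critical, hence a
    -- minimizer, hence equal to w₂; after that v' and p' are determined by uniqueness for each
    -- equation.
    have hf := WaveCylinder.memLp_follower hk₀ hS₂T h.trace.1 hσ
    have hv' : EqOn v' (IccExtend hT.le (V (E₁ w₁ + E₂ (hf.toLp _)))) (Icc 0 T) :=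
      (h.state.congr (WaveCylinder.boundaryDatum_ae hS₂ hS₂T _ hf.coeFn_toLp.symm)).unique
        hT hk₀ hk₁ (hst w₁ _)
    have hr' : WaveCylinder.IsRep T v' (ι (V (E₁ w₁ + E₂ (hf.toLp _)))) :=
      (hι _).congr fun t ht => (hv' (Ioo_subset_Icc_self ht)).symm
    have hc' := (hcrit (hf.toLp _) v' p' g' hr' h.adjoint h.trace).2 hf.coeFn_toLp
    have hw : hf.toLp _ = w₂ := huniq _ (by
      have := WaveCylinder.tikhonov_expand B c hc' w₂
      have h2 : 0 ≤ 1 / 2 * ‖B (w₂ - hf.toLp _)‖ ^ 2 + σ / 2 * ‖w₂ - hf.toLp _‖ ^ 2 := by positivity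
      linarith)
    rw [hw] at hv' hr'
    refine ⟨hv', WaveCylinder.IsAdjointSolution.unique hT hk₀ hk₁
      (h.adjoint.congr_source (hr'.source_eq hv₂ hM)) hp'⟩
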